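/- **Setting.** Let $d\in\{2,3\}$, and let $\Omega\subset\mathbb R^d$ be a polyhedral domain divided into two disjoint polyhedral domains $\Omega_1,\Omega_2$ by the interface $\Gamma=\partial\Omega_1\cap\partial\Omega_2$, i.e. $\Omega\setminus\Gamma=\Omega_1\cup\Omega_2$, with $\partial\Omega\cap\Gamma\neq\emptyset$ (a polyhedral domain is a bounded domain which is the interior of its closure, the closure being a finite union of simplices). Let $A=A(x)$ be a symmetric $d\times d$ matrix function on $\Omega$ with $\lambda_{\min}|\xi|^2\le \xi\cdot A(x)\xi\le\lambda_{\max}|\xi|^2$, where $0<\lambda_{\min}$ and $0<\lambda_{\max}$, such that each $A|_{\Omega_i}$ is $C^1$ in $\Omega_i$ and continuous up to the boundary. Let $f\in L^2(\Omega)$, $g_D,g_N\in L^2(\Gamma)$. Let $V$ be the set of $v\in L^2(\Omega)$ with $v_i:=v|_{\Omega_i}\in H^1(\Omega_i)$ and zero trace on $\partial\Omega\cap\partial\Omega_i$ ($i=1,2$), and let $u\in V$ be a solution of the interface problem $$u_1-u_2=g_D\ \text{ on }\Gamma,\qquad \sum_{i=1}^2\int_{\Omega_i}A\nabla u_i\cdot\nabla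 v_i\,dx=\int_\Omega fv\,dx+\int_\Gamma g_Nv\,dS\quad(\forall v\in H^1_0(\Omega)),$$ with $u_i\in H^{1+s}(\Omega_i)$, $i=1,2$, for some $s\in(1/2,1]$. Let $\mathcal T_h$ be a conforming simplicial triangulation of $\Omega$, $\mathcal E_h$ its set of edges ($d=2$) or faces ($d=3$), such that $\Gamma$ is the union of some members of $\mathcal E_h$, and $$\max\{h_e/\rho_K,\ h_K/h_e\}\le\nu_1\qquad(e\subset\partial K,\ K\in\mathcal T_h),$$ where $h_K,h_e$ are diameters and $\rho_K$ is the diameter of the inscribed ball of $K$. Let $\mathcal E_{h,\Gamma}=\{e\in\mathcal E_h: e\subset\Gamma\}$, let $\eta_e$ ($e\in\mathcal E_h$) be penalty parameters with $\eta_e\ge\eta_{\min}>0$, and let $k,l\ge1$ be integers. Let $\boldsymbol V_h$ be the space of pairs $\boldsymbol v_h=(v_h,\hat v_h)$ where $v_h|_K$ is a polynomial of degree $\le k$ on each $K\in\mathcal T_h$, and $\hat v_h$ is a function on $\bigcup_{e\in\mathcal E_h}e$ with $\hat v_h|_e$ a polynomial of degree $\le l$ for each $e\in\mathcal E_h$ and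 $\hat v_h|_e=0$ for $e\subset\partial\Omega$. With $n_K$ the outer unit normal of $K$ and $n_1$ that of $\Omega_1$, put $$B_h(\boldsymbol w,\boldsymbol v)=\sum_K\int_K A\nabla w\cdot\nabla v\,dx-\sum_K\int_{\partial K}(A\nabla w\cdot n_K)(v-\hat v)\,dS-\sum_K\int_{\partial K}(A\nabla v\cdot n_K)(w-\hat w)\,dS+\sum_K\sum_{e\subset\partial K}\int_e\frac{\eta_e}{h_e}(w-\hat w)(v-\hat v)\,dS,$$ $$L_h(\boldsymbol v)=\sum_K\int_K fv\,dx+\int_\Gamma g_N\hat v\,dS-\int_\Gamma g_D\,\{A\nabla v\}\cdot n_1\,dS+\sum_{e\in\mathcal E_{h,\Gamma}}\ \sum_{K:\,e\subset\partial K}\int_e\frac{\sigma_K}{2}\frac{\eta_e}{h_e}\,g_D\,(v|_K-\hat v)\,dS,$$ where $\{\cdot\}$ is the mean of the values from the two sides of $\Gamma$, $\sigma_K=1$ if $K\subset\overline{\Omega_1}$ and $\sigma_K=-1$ if $K\subset\overline{\Omega_2}$; on $\partial K$ the functions $v$, $w$ and the fluxes are traces from within $K$. Further let $$\|\boldsymbol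 v\|_{1+s,h}^2=\sum_K|v|_{H^1(K)}^2+\sum_Kh_K^{2s}|v|_{H^{1+s}(K)}^2+\sum_K\sum_{e\subset\partial K}\frac{\eta_e}{h_e}\|\hat v-v\|_{L^2(e)}^2,$$ where for $s<1$ $|v|_{H^{1+s}(K)}^2=\sum_{i}\iint_{K\times K}|\partial_iv(x)-\partial_iv(y)|^2|x-y|^{-d-2s}\,dx\,dy$, and $|v|_{H^2(K)}^2=\sum_{i,j}\|\partial_i\partial_jv\|_{L^2(K)}^2$. Set $\boldsymbol u=(u,\hat u)$, where $\hat u$ on $e$ is the mean of the traces of $u$ from the two elements adjacent to $e$ if $e\not\subset\partial\Omega$, and the trace of $u$ if $e\subset\partial\Omega$. Finally, let $\boldsymbol u_h\in\boldsymbol V_h$ be a solution of the HDG scheme $B_h(\boldsymbol u_h,\boldsymbol v_h)=L_h(\boldsymbol v_h)$ for all $\boldsymbol v_h\in\boldsymbol V_h$. **Theorem 1.** In this setting, the Galerkin orthogonality $$B_h(\boldsymbol u-\boldsymbol u_h,\boldsymbol v_h)=0\qquad(\forall\boldsymbol v_h\in\boldsymbol V_h)$$ holds. Moreover, there is $\eta^*>0$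 depending only on $d,k,\nu_1,\lambda_{\min},\lambda_{\max}$ such that, if $\eta_{\min}\ge\eta^*$, then $\|\boldsymbol u-\boldsymbol u_h\|_{1+s,h}$ is finite and $$\|\boldsymbol u-\boldsymbol u_h\|_{1+s,h}\le C\inf_{\boldsymbol v_h\in\boldsymbol V_h}\|\boldsymbol u-\boldsymbol v_h\|_{1+s,h},$$ where the constant $C>0$ depends only on $d,k,\nu_1,\lambda_{\min},\lambda_{\max},\eta_{\min}$ and $s$; in particular it does not depend on the mesh size $h$. -/

import Mathlib

open MeasureTheory Set Filter Topology
open scoped ENNReal ContDiff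

noncomputable section

namespace HDG

/-- The space `ℝᵈ` with its Euclidean norm. -/
abbrev Pt (d : ℕ) : Type := EuclideanSpace ℝ (Fin d)

variable {d : ℕ}

/-- The `(d-1)`-dimensional surface measure (arc length for `d = 2`, area for `d = 3`), normalised
so that it agrees with Lebesgue measure on hyperplanes. -/
def surf (d : ℕ) : Measure (Pt d) := Measure.euclideanHausdorffMeasure (d - 1)

/-! ### Sobolev spaces and traces -/

/-- `φ ∈ C_c^∞(U)`. -/
def IsTestFun (U : Set (Pt d)) (φ : Pt d → ℝ) : Prop :=
  ContDiff ℝ ∞ φ ∧ HasCompactSupport φ ∧ tsupport φ ⊆ U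

/-- `G ∈ L²(U)ᵈ` is the weak gradient of `v` on the open set `U`. -/
def HasWeakGrad (U : Set (Pt d)) (v : Pt d → ℝ) (G : Pt d → Pt d) : Prop :=
  MemLp G 2 (volume.restrict U) ∧
    ∀ φ : Pt d → ℝ, IsTestFun U φ →
      ∫ x in U, v x • gradient φ x = - ∫ x in U, φ x • G x

/-- `v|_U ∈ H¹(U)`. -/
def MemH1 (U : Set (Pt d)) (v : Pt d → ℝ) : Prop :=
  MemLp v 2 (volume.restrict U) ∧ ∃ G, HasWeakGrad U v G

open Classical in
/-- The weak gradient of `v ∈ H¹(U)`, unique up to null sets (zero if `v` has none in `L²`). -/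
def weakGrad (U : Set (Pt d)) (v : Pt d → ℝ) : Pt d → Pt d :=
  if h : ∃ G, HasWeakGrad U v G then h.choose else 0

/-- The weak partial derivative `∂ᵢ v` on `U`. -/
def weakPartial (U : Set (Pt d)) (i : Fin d) (v : Pt d → ℝ) : Pt d → ℝ :=
  fun x => weakGrad U v x i

/-- `|v|²_{H¹(U)}`. -/
def h1SemiSq (U : Set (Pt d)) (v : Pt d → ℝ) : ℝ≥0∞ :=
  ∫⁻ x in U, ENNReal.ofReal (‖weakGrad U v x‖ ^ 2)

open Classical in
/-- `|v|²_{H^{1+s}(U)}` for `0 < s ≤ 1`: the Sobolev-Slobodeckij seminorm of the first derivatives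
if `s < 1`, and the `L²` norm of the second derivatives if `s = 1`. -/
def fracSemiSq (U : Set (Pt d)) (s : ℝ) (v : Pt d → ℝ) : ℝ≥0∞ :=
  if s = 1 then ∑ i : Fin d, h1SemiSq U (weakPartial U i v)
  else ∑ i : Fin d, ∫⁻ x in U, ∫⁻ y in U,
    ENNReal.ofReal (|weakPartial U i v x - weakPartial U i v y| ^ 2
      / ‖x - y‖ ^ ((d : ℝ) + 2 * s))

/-- `v|_U ∈ H^{1+s}(U)` for `0 < s ≤ 1`. -/
def MemHfrac (U : Set (Pt d)) (s : ℝ) (v : Pt d → ℝ) : Prop :=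
  MemH1 U v ∧ (s = 1 → ∀ i, MemH1 U (weakPartial U i v)) ∧ fracSemiSq U s v < ⊤

/-- `v ∈ H¹₀(U)`, the closure of `C_c^∞(U)` in `H¹(U)`. -/
def MemH10 (U : Set (Pt d)) (v : Pt d → ℝ) : Prop :=
  MemH1 U v ∧ ∃ φ : ℕ → Pt d → ℝ, (∀ n, IsTestFun U (φ n)) ∧
    Tendsto (fun n => eLpNorm (v - φ n) 2 (volume.restrict U)) atTop (𝓝 0) ∧
    Tendsto (fun n => eLpNorm (weakGrad U v - gradient (φ n)) 2 (volume.restrict U)) atTop (𝓝 0)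

/-- The boundary trace from within `U`, in its pointwise form
`(γ v)(x) = lim_{r → 0} |B(x,r) ∩ U|⁻¹ ∫_{B(x,r) ∩ U} v`. It is the boundary value if `v` is
continuous up to the boundary; for `v ∈ H^t(U)`, `1/2 < t ≤ 1`, `U` polyhedral, the limit exists
at almost every boundary point and gives the usual trace operator into `L²(∂U)`. -/
def trace (U : Set (Pt d)) (v : Pt d → ℝ) (x : Pt d) : ℝ :=
  limUnder (𝓝[>] (0 : ℝ)) fun r => ⨍ y in Metric.ball x r ∩ U, v y

/-! ### The interface problem -/

/-- A bounded domain which is the interior of a finite union of (closed) polytopes. -/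
structure IsPolyhedralDomain (Ω : Set (Pt d)) : Prop where
  isOpen : IsOpen Ω
  isConnected : IsConnected Ω
  interior_closure : interior (closure Ω) = Ω
  polyhedral : ∃ F : Finset (Finset (Pt d)),
    closure Ω = ⋃ s ∈ F, convexHull ℝ (s : Set (Pt d))

/-- The interface `Γ = ∂Ω₁ ∩ ∂Ω₂`. -/
def interface (Ω₁ Ω₂ : Set (Pt d)) : Set (Pt d) := frontier Ω₁ ∩ frontier Ω₂

/-- `Ω` is a polyhedral domain divided by the interface `Γ` into the disjoint polyhedral subdomains
`Ω₁` and `Ω₂`, and `Γ` meets `∂Ω`. -/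
structure IsInterfaceGeometry (Ω Ω₁ Ω₂ : Set (Pt d)) : Prop where
  whole : IsPolyhedralDomain Ω
  left : IsPolyhedralDomain Ω₁
  right : IsPolyhedralDomain Ω₂
  disjoint : Disjoint Ω₁ Ω₂
  union : Ω₁ ∪ Ω₂ = Ω \ interface Ω₁ Ω₂
  meets : (frontier Ω ∩ interface Ω₁ Ω₂).Nonempty

/-- The coefficient matrix on a subdomain: `C¹` inside and continuous up to the boundary. -/
def IsRegularOn (U : Set (Pt d)) (A : Pt d → Pt d →L[ℝ] Pt d) : Prop :=
  ContDiffOn ℝ 1 A U ∧ ∃ A' : Pt d → Pt d →L[ℝ] Pt d, ContinuousOn A' (closure U) ∧ EqOn A' A U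

/-- The assumptions on the diffusion coefficient: piecewise smooth, symmetric, elliptic. -/
structure IsCoefficient (Ω Ω₁ Ω₂ : Set (Pt d)) (lmin lmax : ℝ) (A : Pt d → Pt d →L[ℝ] Pt d) :
    Prop where
  left : IsRegularOn Ω₁ A
  right : IsRegularOn Ω₂ A
  symm : ∀ x ∈ Ω, ∀ ξ ζ : Pt d, inner ℝ ξ (A x ζ) = inner ℝ (A x ξ) ζ
  lower : ∀ x ∈ Ω, ∀ ξ : Pt d, lmin * ‖ξ‖ ^ 2 ≤ inner ℝ ξ (A x ξ)
  upper : ∀ x ∈ Ω, ∀ ξ : Pt d, inner ℝ ξ (A x ξ) ≤ lmax * ‖ξ‖ ^ 2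

/-- `u ∈ V`: `u ∈ L²(Ω)`, and on `Ωᵢ` it is in `H¹(Ωᵢ)` with zero trace on `∂Ω ∩ ∂Ωᵢ`. -/
structure MemV (Ω Ω₁ Ω₂ : Set (Pt d)) (u : Pt d → ℝ) : Prop where
  memLp : MemLp u 2 (volume.restrict Ω)
  left : MemH1 Ω₁ u
  right : MemH1 Ω₂ u
  bdry_left : ∀ᵐ x ∂(surf d).restrict (frontier Ω ∩ frontier Ω₁), trace Ω₁ u x = 0
  bdry_right : ∀ᵐ x ∂(surf d).restrict (frontier Ω ∩ frontier Ω₂), trace Ω₂ u x = 0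

/-- `a(u,v) = ∫_{Ω₁} A∇u₁·∇v₁ + ∫_{Ω₂} A∇u₂·∇v₂`. -/
def aForm (Ω₁ Ω₂ : Set (Pt d)) (A : Pt d → Pt d →L[ℝ] Pt d) (u v : Pt d → ℝ) : ℝ :=
  (∫ x in Ω₁, inner ℝ (A x (weakGrad Ω₁ u x)) (weakGrad Ω₁ v x)) +
    ∫ x in Ω₂, inner ℝ (A x (weakGrad Ω₂ u x)) (weakGrad Ω₂ v x)

/-- `u` solves the variational formulation of the interface problem with data `f, g_D, g_N`. -/
structure IsWeakSolution (Ω Ω₁ Ω₂ : Set (Pt d)) (A : Pt d → Pt d →L[ℝ] Pt d)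
    (f gD gN u : Pt d → ℝ) : Prop where
  memV : MemV Ω Ω₁ Ω₂ u
  jump : ∀ᵐ x ∂(surf d).restrict (interface Ω₁ Ω₂), trace Ω₁ u x - trace Ω₂ u x = gD x
  weak : ∀ v : Pt d → ℝ, MemH10 Ω v →
    aForm Ω₁ Ω₂ A u v = (∫ x in Ω, f x * v x) +
      ∫ x in interface Ω₁ Ω₂, gN x * trace Ω v x ∂(surf d)

/-! ### Triangulations -/

/-- A (conforming, simplicial) triangulation of `Ω`. -/
structure Triangulation (Ω : Set (Pt d)) extends Geometry.SimplicialComplex ℝ (Pt d) where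
  finite : faces.Finite
  pure : ∀ s ∈ faces, ∃ K ∈ faces, s ⊆ K ∧ K.card = d + 1
  covers : toSimplicialComplex.space = closure Ω

open Classical in
/-- The elements `K ∈ 𝒯_h`, given by their `d + 1` vertices. -/
def Triangulation.elements {Ω : Set (Pt d)} (T : Triangulation Ω) : Finset (Finset (Pt d)) :=
  T.finite.toFinset.filter fun s => s.card = d + 1

open Classical in
/-- The set `ℰ_h` of all edges (`d = 2`) or faces (`d = 3`), given by their `d` vertices. -/
def Triangulation.edges {Ω : Set (Pt d)} (T : Triangulation Ω) : Finset (Finset (Pt d)) :=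
  T.finite.toFinset.filter fun s => s.card = d

/-- The edges `e ⊂ ∂K` of an element `K`. -/
def edgesOf (K : Finset (Pt d)) : Finset (Finset (Pt d)) := K.powersetCard d

open Classical in
/-- The elements `K` with `e ⊂ ∂K`. -/
def Triangulation.adjacent {Ω : Set (Pt d)} (T : Triangulation Ω) (e : Finset (Pt d)) :
    Finset (Finset (Pt d)) :=
  T.elements.filter fun K => e ⊆ K

/-- The closed simplex with given vertices. -/
def hull (K : Finset (Pt d)) : Set (Pt d) := convexHull ℝ (K : Set (Pt d))

/-- The open element. -/
def elt (K : Finset (Pt d)) : Set (Pt d) := interior (hull K)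

open Classical in
/-- `ℰ_{h,Γ}`, the edges contained in the interface. -/
def Triangulation.interfaceEdges {Ω : Set (Pt d)} (T : Triangulation Ω) (Ω₁ Ω₂ : Set (Pt d)) :
    Finset (Finset (Pt d)) :=
  T.edges.filter fun e => hull e ⊆ interface Ω₁ Ω₂

/-- The triangulation resolves the interface: `Γ` is the union of a set of edges. -/
def Triangulation.FitsInterface {Ω : Set (Pt d)} (T : Triangulation Ω) (Ω₁ Ω₂ : Set (Pt d)) :
    Prop :=
  ∃ S ⊆ T.edges, interface Ω₁ Ω₂ = ⋃ e ∈ S, hull e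

/-- `h_K` or `h_e`, the diameter of a simplex. -/
def size (K : Finset (Pt d)) : ℝ := Metric.diam (hull K)

/-- `ρ_K`, the diameter of the inscribed (largest) ball. -/
def inDiam (K : Finset (Pt d)) : ℝ :=
  sSup {t : ℝ | ∃ (c : Pt d) (r : ℝ), 0 ≤ r ∧ t = 2 * r ∧ Metric.closedBall c r ⊆ hull K}

/-- `max {h_e / ρ_K, h_K / h_e} ≤ ν₁` for all `e ⊂ ∂K`. -/
def Triangulation.ShapeRegular {Ω : Set (Pt d)} (T : Triangulation Ω) (ν₁ : ℝ) : Prop :=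
  ∀ K ∈ T.elements, ∀ e ∈ edgesOf K, max (size e / inDiam K) (size K / size e) ≤ ν₁

/-- `n` is the outer unit normal vector of the simplex `K` on its edge `e`. -/
def IsOuterNormal (K e : Finset (Pt d)) (n : Pt d) : Prop :=
  ‖n‖ = 1 ∧ (∀ x ∈ e, ∀ y ∈ e, inner ℝ n (x - y) = 0) ∧
    ∀ p ∈ K, p ∉ e → ∀ x ∈ e, inner ℝ n (p - x) < 0

/-- `n_K` on `e ⊂ ∂K`. -/
def outerNormal (K e : Finset (Pt d)) : Pt d := Classical.epsilon (IsOuterNormal K e)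

/-- The trace on `e ⊂ ∂K` of the flux `A∇v·n_K`, taken from within `K`. -/
def flux (A : Pt d → Pt d →L[ℝ] Pt d) (v : Pt d → ℝ) (K e : Finset (Pt d)) (x : Pt d) : ℝ :=
  trace (elt K) (fun y => inner ℝ (A y (weakGrad (elt K) v y)) (outerNormal K e)) x

/-! ### The HDG method -/

/-- Pairs `(v, v̂)`: `v` is a function on the elements, and `v̂` a function on `S_h = ⋃ e`, given by
its restrictions `v̂|_e` to the edges. -/
abbrev HPair (d : ℕ) : Type := (Pt d → ℝ) × (Finset (Pt d) → Pt d → ℝ)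

/-- `w` is almost everywhere equal to a polynomial of degree `≤ k`. -/
def IsPolyAE (μ : Measure (Pt d)) (k : ℕ) (w : Pt d → ℝ) : Prop :=
  ∃ p : MvPolynomial (Fin d) ℝ, p.totalDegree ≤ k ∧ w =ᵐ[μ] fun x => MvPolynomial.eval (⇑x) p

/-- `𝑽_h = V_{h,k} × V̂_{h,l}`: piecewise polynomials of degree `≤ k` on the elements, and of
degree `≤ l` on the edges, the latter vanishing on the edges in `∂Ω`. -/
def discreteSpace {Ω : Set (Pt d)} (T : Triangulation Ω) (k l : ℕ) : Set (HPair d) :=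
  {v | (∀ K ∈ T.elements, IsPolyAE (volume.restrict (elt K)) k v.1) ∧
    (∀ e ∈ T.edges, IsPolyAE ((surf d).restrict (hull e)) l (v.2 e)) ∧
    ∀ e ∈ T.edges, hull e ⊆ frontier Ω → v.2 e =ᵐ[(surf d).restrict (hull e)] 0}

/-- The function `û` on the edges: the mean of the traces of `u` from the adjacent elements
(two for an interior edge, one for an edge in `∂Ω`). -/
def hatTrace {Ω : Set (Pt d)} (T : Triangulation Ω) (u : Pt d → ℝ) :
    Finset (Pt d) → Pt d → ℝ :=
  fun e x => ((T.adjacent e).card : ℝ)⁻¹ * ∑ K ∈ T.adjacent e, trace (elt K) u x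

/-- `v|_K - v̂` on `e ⊂ ∂K`. -/
def hjump (v : HPair d) (K e : Finset (Pt d)) (x : Pt d) : ℝ := trace (elt K) v.1 x - v.2 e x

/-- The bilinear form `B_h`, with penalty parameters `η_e`. -/
def Bh {Ω : Set (Pt d)} (T : Triangulation Ω) (A : Pt d → Pt d →L[ℝ] Pt d)
    (η : Finset (Pt d) → ℝ) (w v : HPair d) : ℝ :=
  (∑ K ∈ T.elements,
      ∫ x in elt K, inner ℝ (A x (weakGrad (elt K) w.1 x)) (weakGrad (elt K) v.1 x))
    - (∑ K ∈ T.elements, ∑ e ∈ edgesOf K, ∫ x in hull e, flux A w.1 K e x * hjump v K e x ∂(surf d))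
    - (∑ K ∈ T.elements, ∑ e ∈ edgesOf K, ∫ x in hull e, flux A v.1 K e x * hjump w K e x ∂(surf d))
    + ∑ K ∈ T.elements, ∑ e ∈ edgesOf K,
        ∫ x in hull e, η e / size e * hjump w K e x * hjump v K e x ∂(surf d)

open Classical in
/-- `σ_K = 1` for elements in `Ω₁`, and `-1` for elements in `Ω₂`. -/
def sigma (Ω₁ : Set (Pt d)) (K : Finset (Pt d)) : ℝ := if hull K ⊆ closure Ω₁ then 1 else -1

/-- The linear form `L_h`. On `Γ` the flux `A∇v_h·n₁` of the discontinuous function `v_h` stands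
for the mean of its values from both sides; note `n₁ = σ_K n_K` on `∂K ∩ Γ`. -/
def Lh {Ω : Set (Pt d)} (T : Triangulation Ω) (Ω₁ Ω₂ : Set (Pt d))
    (A : Pt d → Pt d →L[ℝ] Pt d) (f gD gN : Pt d → ℝ) (η : Finset (Pt d) → ℝ) (v : HPair d) : ℝ :=
  (∑ K ∈ T.elements, ∫ x in elt K, f x * v.1 x)
    + (∑ e ∈ T.interfaceEdges Ω₁ Ω₂, ∫ x in hull e, gN x * v.2 e x ∂(surf d))
    - (∑ e ∈ T.interfaceEdges Ω₁ Ω₂, ∑ K ∈ T.adjacent e,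
        ∫ x in hull e, gD x * (1 / 2 * (sigma Ω₁ K * flux A v.1 K e x)) ∂(surf d))
    + ∑ e ∈ T.interfaceEdges Ω₁ Ω₂, ∑ K ∈ T.adjacent e,
        ∫ x in hull e, sigma Ω₁ K / 2 * (η e / size e) * gD x * hjump v K e x ∂(surf d)

/-- `𝒖_h ∈ 𝑽_h` solves the HDG scheme. -/
def IsHDGSolution {Ω : Set (Pt d)} (T : Triangulation Ω) (Ω₁ Ω₂ : Set (Pt d)) (k l : ℕ)
    (A : Pt d → Pt d →L[ℝ] Pt d) (f gD gN : Pt d → ℝ) (η : Finset (Pt d) → ℝ) (uh : HPair d) :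
    Prop :=
  uh ∈ discreteSpace T k l ∧
    ∀ vh ∈ discreteSpace T k l, Bh T A η uh vh = Lh T Ω₁ Ω₂ A f gD gN η vh

/-- The HDG norm `‖𝒗‖_{1+s,h}`, as an extended real. -/
def hdgNorm {Ω : Set (Pt d)} (T : Triangulation Ω) (η : Finset (Pt d) → ℝ) (s : ℝ) (v : HPair d) :
    ℝ≥0∞ :=
  ((∑ K ∈ T.elements, h1SemiSq (elt K) v.1)
    + (∑ K ∈ T.elements, ENNReal.ofReal (size K ^ (2 * s)) * fracSemiSq (elt K) s v.1)
    + ∑ K ∈ T.elements, ∑ e ∈ edgesOf K, ENNReal.ofReal (η e / size e) *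
        ∫⁻ x in hull e, ENNReal.ofReal (hjump v K e x ^ 2) ∂(surf d)) ^ (1 / 2 : ℝ)

end HDG

end

noncomputable section

namespace HDG

section

variable {d : ℕ}

/-! ### Geometry of a simplex -/

/-! Quasi-optimality follows from two facts: the exact solution satisfies the discrete equations,
and the form `Bh` is coercive on the discrete space and continuous against it. The analytic
difficulty is shared by both: traces of functions and fluxes on element faces, with constants that
depend only on the shape of the element.

Consistency. Testing the weak formulation inside one element shows that the distributional
divergence of `A∇u` is `-f` there (`IsSetting.div_eq`). As `u` has `1 + s > 3/2` derivatives, its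
flux has a square integrable trace on each face, and Green's formula holds on the element
(`IsSimplex.green`). Summing Green's formula against smooth functions and comparing with the weak
formulation leaves only edge integrals (`IsSetting.sum_flux`). Test functions supported near one
interior face then show that the fluxes from the two sides add up to `gN` on the interface and to
`0` elsewhere (`IsSetting.flux_jump`). A similar localisation gives the jump of `u`
(`IsSetting.hjump_eq`). Inserting both into `Bh` yields `IsSetting.bh_solution` and hence
`IsSetting.galerkin`.

Stability. For a polynomial on `K`, trace and inverse inequalities bound `size K` times the squared
flux norm on a face by `C₁` times the squared gradient norm. Young's inequality absorbs the flux
terms of the form into the gradient and penalty terms once the penalty is at least `4 (d + 1) C₁ /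
lmin` (`IsSetting.localForm_ge`). Continuity needs the fractional seminorm only for the first,
nonpolynomial argument (`IsSetting.localForm_le`). With `w = uh - vh` and `z = u - vh`,
orthogonality gives `Bh w w = Bh z w`. So the gradient and jumps of `w` are controlled by the norm
of `z`; the inverse inequality adds the fractional part of `w`, and the triangle inequality finishes
(`IsSetting.energy_le`).

Traces. They are pointwise limits of averages over `B(x, r) ∩ K`, and a Campanato argument produces
them (`exists_value`): averages at comparable radii differ by a power of `r` if the oscillation
decays. The oscillation at `x` is controlled by the Slobodeckij integrand of order `t` weighted with
`|x - y|^(-(d - 1 - (t - 1/2)))` (`oscillation_le`). For `t > 1/2` this weight is integrable over a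
`(d - 1)`-dimensional face, which gives almost everywhere convergence and a scaled `L²` bound
(`trace_theorem`). The same rate shows that `w` is close to its trace, in mean square, in thin
layers along the face. This last property, kept in `HasFaceTrace`, is what Green's formula uses:
multiplying a test function by a cutoff that vanishes near the boundary produces integrals over such
layers, and they converge to face integrals. Derivatives in `H¹`, the case `s = 1`, are first
embedded into the space of order `3/4` (`slobSq_le_of_hasWeakGrad`). -/

/-- The vertices of a nondegenerate `d`-simplex in `ℝᵈ`. -/
structure IsSimplex (K : Finset (Pt d)) : Prop where
  indep : AffineIndependent ℝ ((↑) : K → Pt d)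
  card : K.card = d + 1

variable {K : Finset (Pt d)}

/-- The affine basis formed by the vertices of a simplex. -/
def IsSimplex.basis (h : IsSimplex K) : AffineBasis K ℝ (Pt d) :=
  ⟨(↑), h.indep, by
    rw [h.indep.affineSpan_eq_top_iff_card_eq_finrank_add_one]
    simp [h.card]⟩

open Classical in
/-- The barycentric coordinate of the vertex `p` of the simplex `K`. -/
def bary (K : Finset (Pt d)) (p : Pt d) : Pt d →ᵃ[ℝ] ℝ :=
  if h : IsSimplex K ∧ p ∈ K then h.1.basis.coord ⟨p, h.2⟩ else 0

lemma IsSimplex.bary_eq (h : IsSimplex K) (p : K) : bary K p = h.basis.coord p := by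
  simp [bary, h]

lemma IsSimplex.range_basis (h : IsSimplex K) : range h.basis = (K : Set (Pt d)) := by
  have : (h.basis : K → Pt d) = (↑) := rfl
  rw [this]; simp

lemma IsSimplex.bary_self (h : IsSimplex K) {p : Pt d} (hp : p ∈ K) : bary K p p = 1 := by
  rw [h.bary_eq ⟨p, hp⟩]
  exact h.basis.coord_apply_eq ⟨p, hp⟩

lemma IsSimplex.bary_ne (h : IsSimplex K) {p q : Pt d} (hp : p ∈ K) (hq : q ∈ K) (hpq : p ≠ q) :
    bary K p q = 0 := by
  rw [h.bary_eq ⟨p, hp⟩]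
  exact h.basis.coord_apply_ne (i := ⟨p, hp⟩) (j := ⟨q, hq⟩) (by simpa using hpq)

lemma IsSimplex.sum_bary (h : IsSimplex K) (x : Pt d) : ∑ p ∈ K, bary K p x = 1 := by
  rw [← h.basis.sum_coord_apply_eq_one x, ← Finset.sum_coe_sort]
  exact Finset.sum_congr rfl fun p _ => by rw [h.bary_eq]

lemma IsSimplex.sum_bary_smul (h : IsSimplex K) (x : Pt d) : ∑ p ∈ K, bary K p x • p = x := by
  rw [← Finset.sum_coe_sort]
  conv_rhs => rw [← h.basis.linear_combination_coord_eq_self x]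
  exact Finset.sum_congr rfl fun p _ => by rw [h.bary_eq]; rfl

lemma IsSimplex.hull_eq (h : IsSimplex K) : hull K = {x | ∀ p ∈ K, 0 ≤ bary K p x} := by
  rw [hull, ← h.range_basis, h.basis.convexHull_eq_nonneg_coord]
  ext x
  constructor
  · intro hx p hp
    rw [h.bary_eq ⟨p, hp⟩]; exact hx _
  · intro hx p
    rw [← h.bary_eq]; exact hx p p.2

lemma IsSimplex.elt_eq (h : IsSimplex K) : elt K = {x | ∀ p ∈ K, 0 < bary K p x} := by
  rw [elt, hull, ← h.range_basis, h.basis.interior_convexHull]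
  ext x
  constructor
  · intro hx p hp
    rw [h.bary_eq ⟨p, hp⟩]; exact hx _
  · intro hx p
    rw [← h.bary_eq]; exact hx p p.2

/-- Affine maps commute with affine combinations. This is how the barycentric coordinates of two
simplices with a common face, and the functional given by a normal vector, are compared. -/
lemma IsSimplex.affine_eq (h : IsSimplex K) (g : Pt d →ᵃ[ℝ] ℝ) (x : Pt d) :
    g x = ∑ p ∈ K, bary K p x * g p := by
  have h1 := h.basis.affineCombination_coord_eq_self x
  conv_lhs => rw [← h1]
  rw [Finset.map_affineCombination _ _ _ (h.basis.sum_coord_apply_eq_one x),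
    Finset.affineCombination_eq_linear_combination _ _ _ (h.basis.sum_coord_apply_eq_one x),
    ← Finset.sum_coe_sort K]
  exact Finset.sum_congr rfl fun p _ => by rw [h.bary_eq]; rfl

lemma continuous_bary (p : Pt d) : Continuous (bary K p) :=
  AffineMap.continuous_of_finiteDimensional _

lemma isCompact_hull (K : Finset (Pt d)) : IsCompact (hull K) :=
  K.finite_toSet.isCompact_convexHull (𝕜 := ℝ)

lemma isOpen_elt (K : Finset (Pt d)) : IsOpen (elt K) := isOpen_interior

lemma convex_hull (K : Finset (Pt d)) : Convex ℝ (hull K) := convex_convexHull ℝ _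

lemma convex_elt (K : Finset (Pt d)) : Convex ℝ (elt K) := (convex_hull K).interior

lemma elt_subset_hull (K : Finset (Pt d)) : elt K ⊆ hull K := interior_subset

lemma isBounded_elt (K : Finset (Pt d)) : Bornology.IsBounded (elt K) :=
  (isCompact_hull K).isBounded.subset (elt_subset_hull K)

lemma volume_elt_lt_top (K : Finset (Pt d)) : volume (elt K) < ⊤ :=
  (isBounded_elt K).measure_lt_top

instance (K : Finset (Pt d)) : IsFiniteMeasure (volume.restrict (elt K)) :=
  ⟨by simpa using volume_elt_lt_top K⟩

lemma volume_hull_diff_elt (K : Finset (Pt d)) : volume (hull K \ elt K) = 0 := by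
  have := (convex_hull K).addHaar_frontier volume
  rwa [frontier, (isCompact_hull K).isClosed.closure_eq] at this

lemma IsSimplex.nonempty_elt (h : IsSimplex K) : (elt K).Nonempty := by
  have := h.basis.centroid_mem_interior_convexHull
  rw [h.range_basis] at this
  exact ⟨_, this⟩

lemma IsSimplex.closure_elt (h : IsSimplex K) : closure (elt K) = hull K := by
  rw [elt, (convex_hull K).closure_interior_eq_closure_of_nonempty_interior h.nonempty_elt,
    (isCompact_hull K).isClosed.closure_eq]

/-- The gradient of the barycentric coordinate `bary K p`. -/
def baryGrad (K : Finset (Pt d)) (p : Pt d) : Pt d :=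
  (InnerProductSpace.toDual ℝ (Pt d)).symm (LinearMap.toContinuousLinearMap (bary K p).linear)

lemma inner_baryGrad (K : Finset (Pt d)) (p v : Pt d) :
    inner ℝ (baryGrad K p) v = (bary K p).linear v := by
  simp [baryGrad]

lemma bary_sub (K : Finset (Pt d)) (p x y : Pt d) :
    bary K p x - bary K p y = inner ℝ (baryGrad K p) (x - y) := by
  rw [inner_baryGrad]
  exact ((bary K p).linearMap_vsub x y).symm

lemma bary_add (K : Finset (Pt d)) (p x v : Pt d) :
    bary K p (x + v) = bary K p x + inner ℝ (baryGrad K p) v := by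
  have := bary_sub K p (x + v) x
  simp at this; linarith

variable [DecidableEq (Pt d)]

/-- The zero set of an affine function is convex, which gives one inclusion. Conversely, if one
coordinate vanishes, the remaining ones are the weights of a convex combination. -/
lemma IsSimplex.hull_erase (h : IsSimplex K) {p : Pt d} (hp : p ∈ K) :
    hull (K.erase p) = {x ∈ hull K | bary K p x = 0} := by
  ext x
  constructor
  · intro hx
    refine ⟨convexHull_mono (by exact_mod_cast K.erase_subset p) hx, ?_⟩
    have h1 : hull (K.erase p) ⊆ (bary K p) ⁻¹' {0} := by
      refine convexHull_min ?_ ?_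
      · intro q hq
        have hq' := Finset.mem_erase.1 (Finset.mem_coe.1 hq)
        exact h.bary_ne hp hq'.2 hq'.1.symm
      · exact (convex_singleton (0 : ℝ)).affine_preimage (bary K p)
    exact h1 hx
  · rintro ⟨hx, h0⟩
    rw [h.hull_eq] at hx
    rw [hull, Finset.mem_convexHull']
    refine ⟨fun q => bary K q x, fun q hq => hx q (Finset.mem_of_mem_erase hq), ?_, ?_⟩
    · rw [← h.sum_bary x, ← Finset.add_sum_erase K _ hp, h0, zero_add]
    · conv_rhs => rw [← h.sum_bary_smul x, ← Finset.add_sum_erase K _ hp, h0, zero_smul, zero_add]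

lemma IsSimplex.mem_edgesOf (h : IsSimplex K) {e : Finset (Pt d)} :
    e ∈ edgesOf K ↔ ∃ p ∈ K, K.erase p = e := by
  rw [edgesOf, Finset.mem_powersetCard]
  constructor
  · rintro ⟨h1, h2⟩
    have h3 : (K \ e).card = 1 := by
      rw [Finset.card_sdiff_of_subset h1, h.card, h2]; simp
    obtain ⟨p, hp⟩ := Finset.card_eq_one.1 h3
    have hpK : p ∈ K \ e := by rw [hp]; simp
    refine ⟨p, (Finset.mem_sdiff.1 hpK).1, ?_⟩
    rw [← Finset.sdiff_singleton_eq_erase, ← hp, Finset.sdiff_sdiff_eq_self h1]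
  · rintro ⟨p, hp, rfl⟩
    exact ⟨K.erase_subset p, by rw [Finset.card_erase_of_mem hp, h.card]; simp⟩

lemma IsSimplex.sum_edgesOf {M : Type*} [AddCommMonoid M] (h : IsSimplex K)
    (g : Finset (Pt d) → M) : ∑ e ∈ edgesOf K, g e = ∑ p ∈ K, g (K.erase p) := by
  have : edgesOf K = K.image K.erase := by
    ext e
    rw [h.mem_edgesOf]; simp
  rw [this, Finset.sum_image]
  exact Finset.erase_injOn K

omit [DecidableEq (Pt d)] in
lemma IsSimplex.card_edgesOf (h : IsSimplex K) : (edgesOf K).card = d + 1 := by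
  rw [edgesOf, Finset.card_powersetCard, h.card]; simp

omit [DecidableEq (Pt d)] in
lemma IsSimplex.baryGrad_ne_zero (h : IsSimplex K) (hd : 1 ≤ d) {p : Pt d} (hp : p ∈ K) :
    baryGrad K p ≠ 0 := by
  intro h0
  have h1 : 1 < K.card := by rw [h.card]; omega
  obtain ⟨q, hq, hqp⟩ := Finset.exists_mem_ne h1 p
  have := bary_sub K p p q
  rw [h.bary_self hp, h.bary_ne hp hq hqp.symm, h0] at this
  simp at this

/-- `outerNormal` is defined by choice, so a witness has to be supplied: the normalised negative
gradient of the opposite coordinate. -/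
lemma IsSimplex.isOuterNormal (h : IsSimplex K) (hd : 1 ≤ d) {p : Pt d} (hp : p ∈ K) :
    IsOuterNormal K (K.erase p) (outerNormal K (K.erase p)) := by
  refine Classical.epsilon_spec (p := IsOuterNormal K (K.erase p))
    ⟨-(‖baryGrad K p‖⁻¹ • baryGrad K p), ?_, ?_, ?_⟩
  · rw [norm_neg, norm_smul, norm_inv, norm_norm,
      inv_mul_cancel₀ (norm_ne_zero_iff.2 (h.baryGrad_ne_zero hd hp))]
  · intro x hx y hy
    rw [Finset.mem_erase] at hx hy
    rw [inner_neg_left, inner_smul_left, ← bary_sub, h.bary_ne hp hx.2 hx.1.symm,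
      h.bary_ne hp hy.2 hy.1.symm]
    simp
  · intro q hq hqe x hx
    have : q = p := by
      by_contra hne
      exact hqe (Finset.mem_erase.2 ⟨hne, hq⟩)
    subst this
    rw [Finset.mem_erase] at hx
    rw [inner_neg_left, inner_smul_left, ← bary_sub, h.bary_ne hp hx.2 hx.1.symm, h.bary_self hp]
    have := norm_pos_iff.2 (h.baryGrad_ne_zero hd hp)
    simp only [conj_trivial, sub_zero, mul_one, Left.neg_neg_iff]
    positivity

/-- The height of the simplex over the face opposite to a vertex is `‖∇λ_p‖⁻¹`, and `∇λ_p` points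
into the direction of the inner normal. -/
lemma IsSimplex.baryGrad_eq (h : IsSimplex K) (hd : 1 ≤ d) {p : Pt d} (hp : p ∈ K) :
    baryGrad K p = -(‖baryGrad K p‖ • outerNormal K (K.erase p)) := by
  obtain ⟨hn1, hn2, hn3⟩ := h.isOuterNormal hd hp
  set n := outerNormal K (K.erase p)
  have h1 : 1 < K.card := by rw [h.card]; omega
  obtain ⟨q, hq, hqp⟩ := Finset.exists_mem_ne h1 p
  have hqe : q ∈ K.erase p := Finset.mem_erase.2 ⟨hqp, hq⟩
  have hc := hn3 p hp (by simp) q hqe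
  set c : ℝ := inner ℝ n (p - q)
  -- Both functionals are constant on the face, so their linear parts are proportional; the factor
  -- `c` is fixed by the edge from `q` to `p`. Hence the defining conditions determine the normal.
  have key : ∀ v : Pt d, inner ℝ n v = c * inner ℝ (baryGrad K p) v := by
    intro v
    let g : Pt d →ᵃ[ℝ] ℝ := (innerₛₗ ℝ n).toAffineMap
    have e1 := h.affine_eq g (q + v)
    have e2 := h.affine_eq g q
    have e3 : ∀ y : Pt d, ∑ r ∈ K, bary K r y * g r = bary K p y * c + inner ℝ n q := by
      intro y
      have : ∀ r ∈ K, bary K r y * g r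
          = bary K r y * (if r = p then c else 0) + bary K r y * inner ℝ n q := by
        intro r hr
        have hgr : g r = inner ℝ n r := rfl
        rw [hgr, ← mul_add]
        congr 1
        split_ifs with hrp
        · subst hrp; simp [c, inner_sub_right]
        · have := hn2 r (Finset.mem_erase.2 ⟨hrp, hr⟩) q hqe
          rw [inner_sub_right] at this; linarith
      rw [Finset.sum_congr rfl this, Finset.sum_add_distrib, ← Finset.sum_mul, h.sum_bary, one_mul]
      simp [hp]
    rw [e3] at e1 e2
    have hg1 : g (q + v) = inner ℝ n q + inner ℝ n v := inner_add_right n q v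
    have hg2 : g q = inner ℝ n q := rfl
    rw [bary_add] at e1
    rw [hg1] at e1
    rw [hg2] at e2
    linarith
  have e : n = c • baryGrad K p := by
    refine ext_inner_right ℝ fun v => ?_
    rw [key, inner_smul_left]; simp
  have hnn : 1 = -c * ‖baryGrad K p‖ := by
    rw [← hn1, e, norm_smul, Real.norm_of_nonpos hc.le]
  have : ‖baryGrad K p‖ • n = -baryGrad K p := by
    rw [e, smul_smul]
    have : ‖baryGrad K p‖ * c = -1 := by linarith
    rw [this]; simp
  rw [this, neg_neg]

end

section

variable {d : ℕ}

/-! ### Surface measure on hyperplanes -/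

/-- The hyperplane through `x₀` with normal `n`. -/
def hyper (n x₀ : Pt d) : Set (Pt d) := {x | inner ℝ n (x - x₀) = 0}

lemma isClosed_hyper (n x₀ : Pt d) : IsClosed (hyper n x₀) :=
  isClosed_eq (by fun_prop) continuous_const

/-- Slicing by parallel hyperplanes; since `n` is a unit vector, the factor in the general formula
is one. This identity is the link between `surf` and Lebesgue measure. -/
lemma volume_eq_lintegral_surf {n : Pt d} (hn : ‖n‖ = 1) (x₀ : Pt d) {S : Set (Pt d)}
    (hS : MeasurableSet S) :
    volume S = ∫⁻ s : ℝ, surf d (S ∩ hyper n (x₀ + s • n)) := by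
  have hn0 : n ≠ 0 := by
    rintro rfl; simp at hn
  have h := EuclideanGeometry.euclideanHausdorffMeasure_eq_lintegral x₀ hn0 hS
  rw [InnerProductSpace.euclideanHausdorffMeasure_eq_volume] at h
  rw [h]
  have h1 : ‖n‖ₑ = 1 := by
    rw [← ofReal_norm, hn]; simp
  rw [h1, one_mul]
  refine lintegral_congr fun s => ?_
  rw [surf]
  have hd : Module.finrank ℝ (Pt d) = d := by simp
  rw [hd]
  congr 2
  ext x
  simp only [AffineSubspace.mem_coe, AffineSubspace.mem_mk', hyper,
    Submodule.mem_orthogonal_singleton_iff_inner_right, vsub_eq_sub, vadd_eq_add, mem_ofPred_eq]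
  rw [add_comm]

instance : (surf d).IsAddLeftInvariant := by unfold surf; infer_instance

lemma surf_preimage_add (S : Set (Pt d)) (v : Pt d) :
    surf d ((fun x => x + v) ⁻¹' S) = surf d S := by
  have := measure_preimage_add (surf d) v S
  rw [← this]
  congr 1; ext x; simp [add_comm]

/-- Only the normal component of a translation changes the hyperplane; `surf` is translation
invariant. -/
lemma surf_inter_hyper_add (S : Set (Pt d)) {n : Pt d} (hn : ‖n‖ = 1) (x₀ b : Pt d) (t : ℝ) :
    surf d ({x | x + t • b ∈ S} ∩ hyper n x₀)
      = surf d (S ∩ hyper n (x₀ + (t * inner ℝ n b) • n)) := by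
  rw [← surf_preimage_add (S ∩ _) (t • b)]
  congr 1
  ext x
  simp only [mem_inter_iff, mem_ofPred_eq, mem_preimage, hyper, and_congr_right_iff]
  intro _
  have : inner ℝ n (x + t • b - (x₀ + (t * inner ℝ n b) • n)) = inner ℝ n (x - x₀) := by
    simp only [inner_sub_right, inner_add_right, inner_smul_right, real_inner_self_eq_norm_sq, hn]
    ring
  rw [this]

/-- A constant in the bound for the surface measure of the intersection of a ball with a
hyperplane. -/
def surfBallConst (d : ℕ) : ℝ := 2 ^ d * (volume (Metric.ball (0 : Pt d) 1)).toReal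

lemma surfBallConst_nonneg (d : ℕ) : 0 ≤ surfBallConst d := by unfold surfBallConst; positivity

/-- The translates of the slice by `s • n` with `0 < s < r` stay in the ball of radius `2 * r`. So
`r` times the area of the slice is at most the volume of that ball, whence the factor `2 ^ d`. -/
lemma surf_hyper_ball_le (hd : 1 ≤ d) {n : Pt d} (hn : ‖n‖ = 1) (x₀ y : Pt d) {r : ℝ}
    (hr : 0 < r) :
    surf d (Metric.ball y r ∩ hyper n x₀) ≤ ENNReal.ofReal (surfBallConst d * r ^ (d - 1)) := by
  have h1 : ENNReal.ofReal r * surf d (Metric.ball y r ∩ hyper n x₀)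
      ≤ volume (Metric.ball y (2 * r)) := by
    rw [volume_eq_lintegral_surf hn x₀ Metric.isOpen_ball.measurableSet]
    calc ENNReal.ofReal r * surf d (Metric.ball y r ∩ hyper n x₀)
        = ∫⁻ s in Ioo 0 r, surf d (Metric.ball y r ∩ hyper n x₀) := by
          rw [setLIntegral_const, mul_comm]; simp
      _ ≤ ∫⁻ s in Ioo 0 r, surf d (Metric.ball y (2 * r) ∩ hyper n (x₀ + s • n)) := by
          refine setLIntegral_mono' measurableSet_Ioo fun s hs => ?_
          have := surf_inter_hyper_add (Metric.ball y (2 * r)) hn x₀ n s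
          rw [real_inner_self_eq_norm_sq, hn, one_pow, mul_one] at this
          rw [← this]
          refine measure_mono (inter_subset_inter_left _ fun x hx => ?_)
          rw [Metric.mem_ball, dist_eq_norm] at hx
          rw [mem_ofPred_eq, Metric.mem_ball, dist_eq_norm]
          have e1 : x + s • n - y = (x - y) + s • n := by abel
          rw [e1]
          refine (norm_add_le _ _).trans_lt ?_
          rw [norm_smul, hn, Real.norm_of_nonneg hs.1.le]
          linarith [hs.2]
      _ ≤ _ := setLIntegral_le_lintegral _ _
  have : Nonempty (Fin d) := ⟨⟨0, hd⟩⟩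
  rw [Measure.addHaar_ball volume y (by positivity)] at h1
  have hfin : volume (Metric.ball (0 : Pt d) 1) ≠ ⊤ := Metric.isBounded_ball.measure_lt_top.ne
  have h2 : ENNReal.ofReal ((2 * r) ^ Module.finrank ℝ (Pt d)) * volume (Metric.ball (0 : Pt d) 1)
      = ENNReal.ofReal r * ENNReal.ofReal (surfBallConst d * r ^ (d - 1)) := by
    rw [← ENNReal.ofReal_toReal hfin, ← ENNReal.ofReal_mul (by positivity),
      ← ENNReal.ofReal_mul hr.le]
    congr 1
    rw [surfBallConst]
    obtain ⟨m, rfl⟩ : ∃ m, d = m + 1 := ⟨d - 1, by omega⟩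
    simp only [finrank_euclideanSpace, Fintype.card_fin, add_tsub_cancel_right]
    ring
  rw [h2] at h1
  exact (ENNReal.mul_le_mul_iff_right (by simpa using hr) ENNReal.ofReal_ne_top).1 h1

lemma isLocallyFiniteMeasure_surf_hyper (hd : 1 ≤ d) {n : Pt d} (hn : ‖n‖ = 1) (x₀ : Pt d) :
    IsLocallyFiniteMeasure ((surf d).restrict (hyper n x₀)) :=
  ⟨fun y => ⟨Metric.ball y 1, Metric.ball_mem_nhds y one_pos, by
    rw [Measure.restrict_apply Metric.isOpen_ball.measurableSet]
    exact (surf_hyper_ball_le hd hn x₀ y one_pos).trans_lt ENNReal.ofReal_lt_top⟩⟩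

/-- Fubini's theorem along a direction `b` that need not be normal: at time `t` the cross-section
has moved by `t * ⟪n, b⟫` along `n`, which is the Jacobian. -/
lemma measurePreserving_skew (hd : 1 ≤ d) {n : Pt d} (hn : ‖n‖ = 1) (x₀ b : Pt d)
    (hb : inner ℝ n b ≠ 0) :
    MeasurePreserving (fun q : ℝ × Pt d => q.2 + q.1 • b)
      (ENNReal.ofReal |inner ℝ n b| • (volume.prod ((surf d).restrict (hyper n x₀)))) volume := by
  have := isLocallyFiniteMeasure_surf_hyper hd hn x₀
  have hm : Measurable (fun q : ℝ × Pt d => q.2 + q.1 • b) := by fun_prop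
  refine ⟨hm, ?_⟩
  ext S hS
  rw [Measure.map_apply hm hS, Measure.smul_apply, Measure.prod_apply (hm hS),
    volume_eq_lintegral_surf hn x₀ hS, smul_eq_mul]
  have h1 : ∀ t : ℝ, (surf d).restrict (hyper n x₀)
      (Prod.mk t ⁻¹' ((fun q : ℝ × Pt d => q.2 + q.1 • b) ⁻¹' S))
      = surf d (S ∩ hyper n (x₀ + (t * inner ℝ n b) • n)) := by
    intro t
    rw [Measure.restrict_apply (measurable_prodMk_left (hm hS)), ← surf_inter_hyper_add S hn]
    rfl
  simp_rw [h1]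
  have h2 := Real.smul_map_volume_mul_right hb
  conv_rhs => rw [← h2]
  have h3 := (Homeomorph.mulRight₀ _ hb).measurableEmbedding.lintegral_map (μ := volume)
    (fun s : ℝ => surf d (S ∩ hyper n (x₀ + s • n)))
  rw [lintegral_smul_measure, smul_eq_mul]
  exact congrArg _ h3.symm

lemma volume_hyper {n : Pt d} (hn : ‖n‖ = 1) (x₀ : Pt d) : volume (hyper n x₀) = 0 := by
  rw [volume_eq_lintegral_surf hn x₀ (isClosed_hyper n x₀).measurableSet, lintegral_eq_zero_iff']
  · have : ∀ᵐ s : ℝ, s ≠ 0 := by simp [ae_iff]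
    filter_upwards [this] with s hs
    have : hyper n x₀ ∩ hyper n (x₀ + s • n) = ∅ := by
      ext x
      simp only [hyper, mem_inter_iff, mem_ofPred_eq, mem_empty_iff_false, iff_false, not_and]
      intro h1 h2
      rw [← sub_sub, inner_sub_right, h1, inner_smul_right, real_inner_self_eq_norm_sq, hn] at h2
      simp at h2; exact hs h2
    rw [this]; simp
  · refine AEMeasurable.congr (f := indicator {0} fun _ => surf d (hyper n x₀)) ?_ ?_
    · exact (measurable_const.indicator (measurableSet_singleton 0)).aemeasurable
    · refine Eventually.of_forall fun s => ?_
      by_cases hs : s = 0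
      · simp [hs]
      · have : hyper n x₀ ∩ hyper n (x₀ + s • n) = ∅ := by
          ext x
          simp only [hyper, mem_inter_iff, mem_ofPred_eq, mem_empty_iff_false, iff_false, not_and]
          intro h1 h2
          rw [← sub_sub, inner_sub_right, h1, inner_smul_right, real_inner_self_eq_norm_sq, hn] at h2
          simp at h2; exact hs h2
        simp [this, hs]

/-! ### Singular kernels -/

/-- If the balls around `y` have measure at most `A r ^ m`, then the kernel `dist x y ^ (-(m - β))`
is integrable near `y`. -/
lemma lintegral_kernel_le {X : Type*} [MetricSpace X] [MeasurableSpace X] [BorelSpace X]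
    (μ : Measure X) (y : X) {A m β R : ℝ} (hA : 0 ≤ A) (hβ : 0 < β) (hm : β ≤ m) (hR : 0 < R)
    (hμ : ∀ r, 0 < r → μ (Metric.ball y r) ≤ ENNReal.ofReal (A * r ^ m)) :
    ∫⁻ x in Metric.ball y R \ {y}, ENNReal.ofReal (dist x y ^ (-(m - β))) ∂μ
      ≤ ENNReal.ofReal (2 ^ (m - β) * (1 - 2 ^ (-β))⁻¹ * A * R ^ β) := by
  set q : ℝ := 2 ^ (-β) with hq
  have hq0 : 0 < q := by positivity
  have hq1 : q < 1 := Real.rpow_lt_one_of_one_lt_of_neg one_lt_two (by linarith)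
  -- Dyadic shells around `y`. On the `j`-th one the kernel is comparable to its value at radius `R
  -- * 2⁻¹ ^ j`, and the product with the measure of the ball is a geometric sequence with ratio
  -- `q`.
  let S : ℕ → Set X := fun j => {x | R * 2⁻¹ ^ (j + 1) ≤ dist x y ∧ dist x y < R * 2⁻¹ ^ j}
  have hS : ∀ j, MeasurableSet (S j) := fun j =>
    (measurableSet_le (g := fun x => dist x y) measurable_const (by fun_prop)).inter
      (measurableSet_lt (f := fun x => dist x y) (by fun_prop) measurable_const)
  have hcov : Metric.ball y R \ {y} ⊆ ⋃ j, S j := by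
    rintro x ⟨hx, hxy⟩
    rw [Metric.mem_ball] at hx
    have hpos : 0 < dist x y := dist_pos.2 hxy
    obtain ⟨j, hj1, hj2⟩ := exists_nat_pow_near_of_lt_one (x := dist x y / R) (y := (2⁻¹ : ℝ))
      (by positivity) (by rw [div_le_one hR]; exact hx.le) (by norm_num) (by norm_num)
    -- The shells exclude their outer sphere, so a point at distance exactly `R * 2⁻¹ ^ j` goes to
    -- the preceding shell; for `j = 0` it is outside the open ball.
    rcases hj2.lt_or_eq with h | h
    · refine mem_iUnion.2 ⟨j, ?_, ?_⟩
      · rw [lt_div_iff₀ hR] at hj1; rw [mul_comm]; exact hj1.le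
      · rw [div_lt_iff₀ hR] at h; rw [mul_comm]; exact h
    · rcases j with _ | j
      · rw [pow_zero, div_eq_one_iff_eq hR.ne'] at h; linarith
      · refine mem_iUnion.2 ⟨j, ?_, ?_⟩
        · rw [div_eq_iff hR.ne'] at h; rw [h, mul_comm]
        · rw [div_eq_iff hR.ne'] at h; rw [h, mul_comm, pow_succ]
          have : (0 : ℝ) < 2⁻¹ ^ j := by positivity
          nlinarith
  have hterm : ∀ j, ∫⁻ x in S j, ENNReal.ofReal (dist x y ^ (-(m - β))) ∂μ
      ≤ ENNReal.ofReal (2 ^ (m - β) * A * R ^ β * q ^ j) := by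
    intro j
    have hrj : 0 < R * 2⁻¹ ^ j := by positivity
    calc ∫⁻ x in S j, ENNReal.ofReal (dist x y ^ (-(m - β))) ∂μ
        ≤ ∫⁻ x in S j, ENNReal.ofReal ((R * 2⁻¹ ^ (j + 1)) ^ (-(m - β))) ∂μ := by
          refine setLIntegral_mono' (hS j) fun x hx => ENNReal.ofReal_le_ofReal ?_
          exact Real.rpow_le_rpow_of_nonpos (by positivity) hx.1 (by linarith)
      _ ≤ ENNReal.ofReal ((R * 2⁻¹ ^ (j + 1)) ^ (-(m - β)))
            * ENNReal.ofReal (A * (R * 2⁻¹ ^ j) ^ m) := by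
          rw [setLIntegral_const]
          gcongr
          exact (measure_mono fun x hx => hx.2).trans (hμ _ hrj)
      _ = _ := by
          rw [← ENNReal.ofReal_mul (by positivity)]
          congr 1
          have e1 : R * 2⁻¹ ^ (j + 1) = (R * 2⁻¹ ^ j) * 2⁻¹ := by rw [pow_succ]; ring
          have e2 : q ^ j = (2⁻¹ ^ j : ℝ) ^ β := by
            rw [hq, Real.rpow_neg (by norm_num), ← Real.inv_rpow (by norm_num),
              ← Real.rpow_natCast, ← Real.rpow_natCast, ← Real.rpow_mul (by norm_num),
              ← Real.rpow_mul (by norm_num), mul_comm]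
          have e3 : (2⁻¹ : ℝ) ^ (-(m - β)) = 2 ^ (m - β) := by
            rw [Real.inv_rpow (by norm_num), ← Real.rpow_neg (by norm_num), neg_neg]
          rw [e1, Real.mul_rpow hrj.le (by norm_num), e3, e2]
          have e4 : (R * 2⁻¹ ^ j) ^ (-(m - β)) * (R * 2⁻¹ ^ j) ^ m = (R * 2⁻¹ ^ j) ^ β := by
            rw [← Real.rpow_add hrj]; congr 1; ring
          have e5 : (R * 2⁻¹ ^ j) ^ β = R ^ β * (2⁻¹ ^ j : ℝ) ^ β :=
            Real.mul_rpow hR.le (by positivity)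
          calc _ = 2 ^ (m - β) * A * ((R * 2⁻¹ ^ j) ^ (-(m - β)) * (R * 2⁻¹ ^ j) ^ m) := by ring
            _ = _ := by rw [e4, e5]; ring
  calc ∫⁻ x in Metric.ball y R \ {y}, ENNReal.ofReal (dist x y ^ (-(m - β))) ∂μ
      ≤ ∫⁻ x in ⋃ j, S j, ENNReal.ofReal (dist x y ^ (-(m - β))) ∂μ := lintegral_mono_set hcov
    _ ≤ ∑' j, ∫⁻ x in S j, ENNReal.ofReal (dist x y ^ (-(m - β))) ∂μ := lintegral_iUnion_le _ _
    _ ≤ ∑' j, ENNReal.ofReal (2 ^ (m - β) * A * R ^ β * q ^ j) := ENNReal.tsum_le_tsum hterm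
    _ = _ := by
        rw [← ENNReal.ofReal_tsum_of_nonneg (fun j => by positivity)
          ((summable_geometric_of_lt_one hq0.le hq1).mul_left _), tsum_mul_left,
          tsum_geometric_of_lt_one hq0.le hq1]
        congr 1; ring

end

section

variable {d : ℕ}

/-! ### Size and shape of a simplex -/

variable {K : Finset (Pt d)}

lemma dist_le_size {K : Finset (Pt d)} {x y : Pt d} (hx : x ∈ hull K) (hy : y ∈ hull K) :
    dist x y ≤ size K :=
  Metric.dist_le_diam_of_mem (isCompact_hull K).isBounded hx hy

lemma subset_hull (K : Finset (Pt d)) : (K : Set (Pt d)) ⊆ hull K := subset_convexHull ℝ _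

lemma hull_mono {e K : Finset (Pt d)} (h : e ⊆ K) : hull e ⊆ hull K :=
  convexHull_mono (by exact_mod_cast h)

lemma size_mono {e K : Finset (Pt d)} (h : e ⊆ K) : size e ≤ size K :=
  Metric.diam_mono (hull_mono h) (isCompact_hull K).isBounded

lemma size_pos_of_one_lt_card {e : Finset (Pt d)} (h : 1 < e.card) : 0 < size e := by
  obtain ⟨x, hx, y, hy, hxy⟩ := Finset.one_lt_card.1 h
  exact (dist_pos.2 hxy).trans_le (dist_le_size (subset_hull e hx) (subset_hull e hy))

lemma IsSimplex.size_pos (h : IsSimplex K) (hd : 1 ≤ d) : 0 < size K :=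
  size_pos_of_one_lt_card (by rw [h.card]; omega)

lemma diam_closedBall_eq (hd : 1 ≤ d) (c : Pt d) {r : ℝ} (hr : 0 ≤ r) :
    2 * r ≤ Metric.diam (Metric.closedBall c r) := by
  have : Nonempty (Fin d) := ⟨⟨0, hd⟩⟩
  obtain ⟨v, hv⟩ := exists_norm_eq (Pt d) hr
  have h1 : c + v ∈ Metric.closedBall c r := by simp [hv]
  have h2 : c - v ∈ Metric.closedBall c r := by simp [hv]
  have h3 := Metric.dist_le_diam_of_mem Metric.isBounded_closedBall h1 h2
  have h4 : dist (c + v) (c - v) = 2 * r := by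
    rw [dist_eq_norm]
    have : c + v - (c - v) = (2 : ℝ) • v := by rw [two_smul]; abel
    rw [this, norm_smul, hv]; norm_num
  linarith

/-- A shape regular simplex contains a ball whose radius is comparable to its diameter. -/
lemma IsSimplex.exists_closedBall_subset (h : IsSimplex K) (hd : 2 ≤ d) {ν : ℝ}
    (hν : ∀ e ∈ edgesOf K, max (size e / inDiam K) (size K / size e) ≤ ν) :
    0 < ν ∧ ∃ c, Metric.closedBall c ((4 * ν ^ 2)⁻¹ * size K) ⊆ hull K := by
  classical
  obtain ⟨p, hp⟩ : K.Nonempty := Finset.card_pos.1 (by rw [h.card]; omega)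
  have he : K.erase p ∈ edgesOf K := h.mem_edgesOf.2 ⟨p, hp, rfl⟩
  set e := K.erase p
  have hcard : e.card = d := by simp [e, Finset.card_erase_of_mem hp, h.card]
  have hse : 0 < size e := size_pos_of_one_lt_card (by omega)
  have hsK : 0 < size K := h.size_pos (by omega)
  have h1 := (le_max_left _ _).trans (hν e he)
  have h2 := (le_max_right _ _).trans (hν e he)
  have hν0 : 0 < ν := (div_pos hsK hse).trans_le h2
  let S := {t : ℝ | ∃ (c : Pt d) (r : ℝ), 0 ≤ r ∧ t = 2 * r ∧ Metric.closedBall c r ⊆ hull K}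
  have hbdd : BddAbove S := by
    refine ⟨size K, ?_⟩
    rintro t ⟨c, r, hr, rfl, hc⟩
    exact (diam_closedBall_eq (by omega) c hr).trans
      (Metric.diam_mono hc (isCompact_hull K).isBounded)
  have hpos : 0 < inDiam K := by
    obtain ⟨c, hc⟩ := h.nonempty_elt
    obtain ⟨r, hr, hrK⟩ := Metric.nhds_basis_closedBall.mem_iff.1 ((isOpen_elt K).mem_nhds hc)
    exact (by positivity : (0 : ℝ) < 2 * r).trans_le
      (le_csSup hbdd ⟨c, r, hr.le, rfl, hrK.trans (elt_subset_hull K)⟩)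
  have hne : S.Nonempty := by
    by_contra hS
    rw [Set.not_nonempty_iff_eq_empty] at hS
    have : inDiam K = 0 := by change sSup S = 0; rw [hS]; exact Real.sSup_empty
    linarith
  -- The chain `h_K ≤ ν h_e ≤ ν² ρ_K`.
  have h3 : size K ≤ ν ^ 2 * inDiam K := by
    rw [div_le_iff₀ hpos] at h1
    rw [div_le_iff₀ hse] at h2
    nlinarith
  -- Half of the supremum is enough and avoids showing that it is attained; a diameter above `ρ_K /
  -- 2` means a radius above `ρ_K / 4`, which explains the `4`.
  obtain ⟨t, ⟨c, r, hr, rfl, hc⟩, hlt⟩ := exists_lt_of_lt_csSup hne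
    (show inDiam K / 2 < sSup S from half_lt_self hpos)
  refine ⟨hν0, c, (Metric.closedBall_subset_closedBall ?_).trans hc⟩
  rw [inv_mul_le_iff₀ (by positivity)]
  nlinarith [sq_pos_of_pos hν0]

/-- The volume of the unit ball. -/
def unitBallVol (d : ℕ) : ℝ := (volume (Metric.ball (0 : Pt d) 1)).toReal

lemma unitBallVol_pos (d : ℕ) : 0 < unitBallVol d :=
  ENNReal.toReal_pos (Metric.measure_ball_pos volume _ one_pos).ne'
    Metric.isBounded_ball.measure_lt_top.ne

lemma volume_ball_eq (hd : 1 ≤ d) (x : Pt d) {r : ℝ} (hr : 0 ≤ r) :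
    volume (Metric.ball x r) = ENNReal.ofReal (unitBallVol d * r ^ d) := by
  have : Nonempty (Fin d) := ⟨⟨0, hd⟩⟩
  rw [Measure.addHaar_ball volume x hr, unitBallVol, mul_comm,
    ENNReal.ofReal_mul ENNReal.toReal_nonneg,
    ENNReal.ofReal_toReal Metric.isBounded_ball.measure_lt_top.ne]
  simp

/-- Contract the interior ball towards `x` with ratio `r / (2 * size K)`. By convexity its image
stays in the open element, and by the choice of the ratio it stays in `B(x, r)`. -/
lemma IsSimplex.volume_ball_inter_ge (h : IsSimplex K) (hd : 1 ≤ d) {c : Pt d} {κ : ℝ}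
    (hκ : 0 < κ) (hc : Metric.closedBall c (κ * size K) ⊆ hull K) {x : Pt d} (hx : x ∈ hull K)
    {r : ℝ} (hr : 0 < r) (hrK : r ≤ size K) :
    ENNReal.ofReal (unitBallVol d * (κ / 2) ^ d * r ^ d) ≤ volume (Metric.ball x r ∩ elt K) := by
  have hK := h.size_pos hd
  set t := r / (2 * size K) with ht
  have ht0 : 0 < t := by positivity
  have ht1 : t ≤ 1 := by rw [ht, div_le_one (by positivity)]; linarith
  have hrad : t * (κ * size K) = κ / 2 * r := by rw [ht]; field_simp
  have hsub : Metric.ball (x + t • (c - x)) (κ / 2 * r) ⊆ Metric.ball x r ∩ elt K := by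
    intro z hz
    set y := x + t⁻¹ • (z - x) with hy
    have hzy : z = x + t • (y - x) := by
      rw [hy, add_sub_cancel_left, smul_smul, mul_inv_cancel₀ ht0.ne', one_smul]; abel
    have hyc : y ∈ Metric.ball c (κ * size K) := by
      rw [Metric.mem_ball, dist_eq_norm] at hz ⊢
      have : z - (x + t • (c - x)) = t • (y - c) := by
        rw [hzy]; simp only [smul_sub]; abel
      rw [this, norm_smul, Real.norm_of_nonneg ht0.le, ← hrad] at hz
      exact lt_of_mul_lt_mul_left hz ht0.le
    have hye : y ∈ elt K :=
      interior_mono hc (Metric.isOpen_ball.subset_interior_iff.2 Metric.ball_subset_closedBall hyc)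
    constructor
    · rw [Metric.mem_ball, dist_eq_norm, hzy, add_sub_cancel_left, norm_smul,
        Real.norm_of_nonneg ht0.le, ← dist_eq_norm]
      have := dist_le_size (elt_subset_hull K hye) hx
      calc t * dist y x ≤ t * size K := by gcongr
        _ = r / 2 := by rw [ht]; field_simp
        _ < r := by linarith
    · rw [hzy]
      have h1 := (convex_hull K).add_smul_sub_mem_interior hx hye ⟨ht0, ht1⟩
      exact h1
  calc _ = volume (Metric.ball (x + t • (c - x)) (κ / 2 * r)) := by
        rw [volume_ball_eq hd _ (by positivity)]; congr 1; ring
    _ ≤ _ := measure_mono hsub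

/-! ### The faces of a simplex -/

variable [DecidableEq (Pt d)]

lemma IsSimplex.setOf_bary_eq_zero (h : IsSimplex K) (hd : 1 ≤ d) {p : Pt d} (hp : p ∈ K)
    {x₀ : Pt d} (hx₀ : bary K p x₀ = 0) :
    {x | bary K p x = 0} = hyper (outerNormal K (K.erase p)) x₀ := by
  ext x
  have h1 := bary_sub K p x x₀
  rw [hx₀, sub_zero, h.baryGrad_eq hd hp, inner_neg_left, inner_smul_left] at h1
  have := norm_pos_iff.2 (h.baryGrad_ne_zero hd hp)
  simp only [mem_ofPred_eq, hyper, h1]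
  simp [this.ne']

lemma IsSimplex.exists_mem_erase (h : IsSimplex K) (hd : 1 ≤ d) (p : Pt d) :
    ∃ q, q ∈ K.erase p := by
  have : (K.erase p).Nonempty := by
    apply Finset.card_pos.1
    have := Finset.pred_card_le_card_erase (s := K) (a := p)
    rw [h.card] at this; omega
  exact this

/-- The hyperplane of the face opposite to `p` in the form used for `surf`. -/
lemma IsSimplex.exists_hyper (h : IsSimplex K) (hd : 1 ≤ d) {p : Pt d} (hp : p ∈ K) :
    ∃ x₀, {x | bary K p x = 0} = hyper (outerNormal K (K.erase p)) x₀ := by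
  obtain ⟨q, hq⟩ := h.exists_mem_erase hd p
  rw [Finset.mem_erase] at hq
  exact ⟨q, h.setOf_bary_eq_zero hd hp (h.bary_ne hp hq.2 hq.1.symm)⟩

lemma IsSimplex.hull_erase_subset (h : IsSimplex K) {p : Pt d} (hp : p ∈ K) :
    hull (K.erase p) ⊆ {x | bary K p x = 0} := by
  rw [h.hull_erase hp]; exact fun x hx => hx.2

lemma IsSimplex.surf_ball_inter_hull_le (h : IsSimplex K) (hd : 1 ≤ d) {p : Pt d} (hp : p ∈ K)
    (y : Pt d) {r : ℝ} (hr : 0 < r) :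
    surf d (Metric.ball y r ∩ hull (K.erase p)) ≤
      ENNReal.ofReal (surfBallConst d * r ^ (d - 1)) := by
  obtain ⟨x₀, hx₀⟩ := h.exists_hyper hd hp
  refine (measure_mono (inter_subset_inter_right _ (h.hull_erase_subset hp))).trans ?_
  rw [hx₀]
  exact surf_hyper_ball_le hd (h.isOuterNormal hd hp).1 x₀ y hr

lemma IsSimplex.hull_erase_subset_ball (h : IsSimplex K) (hd : 1 ≤ d) (p : Pt d) {y : Pt d}
    (hy : y ∈ hull K) : hull (K.erase p) ⊆ Metric.ball y (2 * size K) := by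
  intro x hx
  have := dist_le_size (hull_mono (K.erase_subset p) hx) hy
  rw [Metric.mem_ball]; linarith [h.size_pos hd]

lemma IsSimplex.surf_hull_le (h : IsSimplex K) (hd : 1 ≤ d) {p : Pt d} (hp : p ∈ K) :
    surf d (hull (K.erase p)) ≤ ENNReal.ofReal (surfBallConst d * (2 * size K) ^ (d - 1)) := by
  have hK := h.size_pos hd
  have h1 := h.surf_ball_inter_hull_le hd hp p (r := 2 * size K) (by positivity)
  rwa [inter_eq_right.2 (h.hull_erase_subset_ball hd p (subset_hull K hp))] at h1

lemma IsSimplex.surf_hull_lt_top (h : IsSimplex K) (hd : 1 ≤ d) {p : Pt d} (hp : p ∈ K) :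
    surf d (hull (K.erase p)) < ⊤ := (h.surf_hull_le hd hp).trans_lt ENNReal.ofReal_lt_top

lemma IsSimplex.isFiniteMeasure_surf (h : IsSimplex K) (hd : 1 ≤ d) {p : Pt d} (hp : p ∈ K) :
    IsFiniteMeasure ((surf d).restrict (hull (K.erase p))) :=
  ⟨by simpa using h.surf_hull_lt_top hd hp⟩

lemma IsSimplex.notMem_elt_of_mem_hull_erase (h : IsSimplex K) {p : Pt d} (hp : p ∈ K) {x : Pt d}
    (hx : x ∈ hull (K.erase p)) : x ∉ elt K := by
  intro hx'
  rw [h.elt_eq] at hx'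
  have := hx' p hp
  rw [h.hull_erase_subset hp hx] at this
  exact lt_irrefl _ this

/-- On a face, balls have measure of order `r ^ (d - 1)`, so the exponent may be as low as `-(d - 1
- β)`. The point `y` lies in the open element, hence not on the face, and the excluded singleton
does not matter. -/
lemma IsSimplex.lintegral_kernel_face_le (h : IsSimplex K) (hd : 2 ≤ d) {p : Pt d} (hp : p ∈ K)
    {y : Pt d} (hy : y ∈ elt K) {β : ℝ} (hβ : 0 < β) (hβ1 : β ≤ 1) :
    ∫⁻ x in hull (K.erase p), ENNReal.ofReal (dist x y ^ (-((d : ℝ) - 1 - β))) ∂(surf d) ≤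
      ENNReal.ofReal (2 ^ ((d : ℝ) - 1 - β) * (1 - 2 ^ (-β))⁻¹ * surfBallConst d *
        (2 * size K) ^ β) := by
  have hK := h.size_pos (by omega)
  have hd' : (2 : ℝ) ≤ d := by exact_mod_cast hd
  have h1 := lintegral_kernel_le ((surf d).restrict (hull (K.erase p))) y (m := (d : ℝ) - 1)
    (A := surfBallConst d) (β := β) (R := 2 * size K) (surfBallConst_nonneg d) hβ (by linarith)
    (by positivity) (fun r hr => by
      rw [Measure.restrict_apply Metric.isOpen_ball.measurableSet]
      refine (h.surf_ball_inter_hull_le (by omega) hp y hr).trans (le_of_eq ?_)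
      rw [← Real.rpow_natCast r (d - 1), Nat.cast_sub (by omega)]; simp)
  rw [Measure.restrict_restrict (Metric.isOpen_ball.measurableSet.diff (measurableSet_singleton y)),
    inter_eq_right.2] at h1
  · exact h1
  · intro x hx
    refine ⟨h.hull_erase_subset_ball (by omega) p (elt_subset_hull K hy) hx, ?_⟩
    rintro rfl
    exact h.notMem_elt_of_mem_hull_erase hp hx hy

/-- The vector from the centroid of the face opposite to `p` to the vertex `p`. -/
def apexDir (K : Finset (Pt d)) (p : Pt d) : Pt d := p - (d : ℝ)⁻¹ • ∑ v ∈ K.erase p, v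

omit [DecidableEq (Pt d)] in
lemma linear_bary_sub (K : Finset (Pt d)) (q x y : Pt d) :
    inner ℝ (baryGrad K q) (x - y) = bary K q x - bary K q y := (bary_sub K q x y).symm

/-- Along the line from the centroid of the face to the apex, the coordinate of `p` grows from `0`
to `1` while each of the others drops from `1 / d` to `0`. Consequently projecting back onto the
face can only increase the other coordinates. -/
lemma IsSimplex.inner_baryGrad_apexDir (h : IsSimplex K) (hd : 1 ≤ d) {p q : Pt d} (hp : p ∈ K)
    (hq : q ∈ K) : inner ℝ (baryGrad K q) (apexDir K p) = if q = p then 1 else -(d : ℝ)⁻¹ := by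
  have hd' : (d : ℝ) ≠ 0 := by exact_mod_cast (by omega : d ≠ 0)
  have hc : (K.erase p).card = d := by simp [Finset.card_erase_of_mem hp, h.card]
  have e1 : apexDir K p = (d : ℝ)⁻¹ • ∑ v ∈ K.erase p, (p - v) := by
    rw [Finset.sum_sub_distrib, Finset.sum_const, hc, smul_sub, ← Nat.cast_smul_eq_nsmul ℝ,
      smul_smul, inv_mul_cancel₀ hd', one_smul, apexDir]
  rw [e1, inner_smul_right, inner_sum]
  simp_rw [linear_bary_sub]
  split_ifs with hqp
  · subst hqp
    have : ∀ v ∈ K.erase q, bary K q q - bary K q v = 1 := by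
      intro v hv
      rw [Finset.mem_erase] at hv
      rw [h.bary_self hq, h.bary_ne hq hv.2 hv.1.symm, sub_zero]
    rw [Finset.sum_congr rfl this]; simp [hc, hd']
  · have : ∀ v ∈ K.erase p, bary K q p - bary K q v = if q = v then -1 else 0 := by
      intro v hv
      rw [Finset.mem_erase] at hv
      rw [h.bary_ne hq hp hqp]
      split_ifs with hqv
      · subst hqv; rw [h.bary_self hq]; ring
      · rw [h.bary_ne hq hv.2 hqv]; ring
    rw [Finset.sum_congr rfl this]
    simp [hqp, hq]

/-- The projection onto the face opposite to `p` in direction `apexDir K p`. -/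
def faceProj (K : Finset (Pt d)) (p y : Pt d) : Pt d := y - bary K p y • apexDir K p

lemma IsSimplex.bary_faceProj (h : IsSimplex K) (hd : 1 ≤ d) {p q : Pt d} (hp : p ∈ K)
    (hq : q ∈ K) (y : Pt d) : bary K q (faceProj K p y)
      = if q = p then 0 else bary K q y + bary K p y * (d : ℝ)⁻¹ := by
  rw [faceProj, sub_eq_add_neg, bary_add, ← neg_smul, inner_smul_right,
    h.inner_baryGrad_apexDir hd hp hq]
  split_ifs with hqp
  · subst hqp; ring
  · ring

lemma IsSimplex.bary_add_apexDir (h : IsSimplex K) (hd : 1 ≤ d) {p q : Pt d} (hp : p ∈ K)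
    (hq : q ∈ K) (x : Pt d) (t : ℝ) : bary K q (x + t • apexDir K p)
      = bary K q x + t * if q = p then 1 else -(d : ℝ)⁻¹ := by
  rw [bary_add, inner_smul_right, h.inner_baryGrad_apexDir hd hp hq]

lemma IsSimplex.faceProj_mem (h : IsSimplex K) (hd : 1 ≤ d) {p : Pt d} (hp : p ∈ K) {y : Pt d}
    (hy : y ∈ hull K) : faceProj K p y ∈ hull (K.erase p) := by
  rw [h.hull_erase hp, h.hull_eq]
  rw [h.hull_eq] at hy
  refine ⟨fun q hq => ?_, ?_⟩
  · rw [h.bary_faceProj hd hp hq]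
    have h1 := hy q hq
    have h2 := hy p hp
    split_ifs
    · exact le_rfl
    · positivity
  · rw [h.bary_faceProj hd hp hp, if_pos rfl]

lemma measurable_faceProj (K : Finset (Pt d)) (p : Pt d) : Measurable (faceProj K p) := by
  have := (continuous_bary (K := K) p).measurable
  unfold faceProj
  fun_prop

/-- Points above a face: `(t, x) ↦ x + t • apexDir K p`. -/
def liftFace (K : Finset (Pt d)) (p : Pt d) (q : ℝ × Pt d) : Pt d := q.2 + q.1 • apexDir K p

lemma measurable_liftFace (K : Finset (Pt d)) (p : Pt d) : Measurable (liftFace K p) := by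
  unfold liftFace; fun_prop

lemma IsSimplex.bary_liftFace (h : IsSimplex K) (hd : 1 ≤ d) {p : Pt d} (hp : p ∈ K)
    {x : Pt d} (hx : bary K p x = 0) (t : ℝ) : bary K p (liftFace K p (t, x)) = t := by
  rw [liftFace, h.bary_add_apexDir hd hp hp, hx]; simp

lemma IsSimplex.faceProj_liftFace (h : IsSimplex K) (hd : 1 ≤ d) {p : Pt d} (hp : p ∈ K)
    {x : Pt d} (hx : bary K p x = 0) (t : ℝ) : faceProj K p (liftFace K p (t, x)) = x := by
  rw [faceProj, h.bary_liftFace hd hp hx, liftFace]; simp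

/-- Fubini's theorem on a simplex, with respect to a face and the direction to the opposite
vertex. -/
lemma IsSimplex.measurePreserving_liftFace (h : IsSimplex K) (hd : 1 ≤ d) {p : Pt d}
    (hp : p ∈ K) :
    MeasurePreserving (liftFace K p)
      ((ENNReal.ofReal ‖baryGrad K p‖⁻¹ •
        (volume.prod ((surf d).restrict (hull (K.erase p))))).restrict
          (liftFace K p ⁻¹' elt K)) (volume.restrict (elt K)) := by
  obtain ⟨x₀, hx₀⟩ := h.exists_hyper hd hp
  have hn := (h.isOuterNormal hd hp).1
  have hg := norm_pos_iff.2 (h.baryGrad_ne_zero hd hp)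
  -- The height of the simplex is `‖∇λ_p‖⁻¹`; it becomes the Jacobian of the skew Fubini formula.
  have hb : inner ℝ (outerNormal K (K.erase p)) (apexDir K p) = -‖baryGrad K p‖⁻¹ := by
    have h1 := h.inner_baryGrad_apexDir hd hp hp
    rw [if_pos rfl] at h1
    conv_lhs at h1 => rw [h.baryGrad_eq hd hp, inner_neg_left, inner_smul_left]
    have h2 : ‖baryGrad K p‖ * inner ℝ (outerNormal K (K.erase p)) (apexDir K p) = -1 := by
      simp at h1; linarith
    field_simp; linarith
  have h1 := measurePreserving_skew hd hn x₀ (apexDir K p) (by rw [hb]; simp [hg.ne'])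
  rw [hb, abs_neg, abs_of_pos (by positivity)] at h1
  have h2 : MeasurePreserving (liftFace K p)
      ((ENNReal.ofReal ‖baryGrad K p‖⁻¹ • (volume.prod ((surf d).restrict
        (hyper (outerNormal K (K.erase p)) x₀)))).restrict (liftFace K p ⁻¹' elt K))
      (volume.restrict (elt K)) := h1.restrict_preimage (isOpen_elt K).measurableSet
  convert h2 using 1
  have hm := measurable_liftFace K p (isOpen_elt K).measurableSet
  have := h.isFiniteMeasure_surf hd hp
  have := isLocallyFiniteMeasure_surf_hyper hd hn x₀
  have hmE : MeasurableSet (hull (K.erase p)) := (isCompact_hull _).isClosed.measurableSet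
  rw [Measure.restrict_smul, Measure.restrict_smul]
  congr 1
  ext S hS
  rw [Measure.restrict_apply hS, Measure.restrict_apply hS, Measure.prod_apply (hS.inter hm),
    Measure.prod_apply (hS.inter hm)]
  refine lintegral_congr fun t => ?_
  rw [Measure.restrict_apply (measurable_prodMk_left (hS.inter hm)),
    Measure.restrict_apply (measurable_prodMk_left (hS.inter hm)), ← hx₀]
  congr 1
  ext x
  simp only [mem_inter_iff, mem_preimage, mem_ofPred_eq, and_congr_right_iff]
  rintro ⟨-, hx⟩
  -- A point of the hyperplane below a point of the element is its projection and so belongs to the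
  -- face. Thus the hyperplane and the face give the same measure on the preimage of the element.
  refine ⟨fun hx' => h.hull_erase_subset hp hx', fun hx' => ?_⟩
  have := h.faceProj_mem hd hp (elt_subset_hull K hx)
  rwa [h.faceProj_liftFace hd hp hx'] at this

/-- Almost every point of a face lies in its relative interior. -/
lemma IsSimplex.ae_bary_pos (h : IsSimplex K) (hd : 2 ≤ d) {p : Pt d} (hp : p ∈ K) :
    ∀ᵐ x ∂(surf d).restrict (hull (K.erase p)), ∀ j ∈ K.erase p, 0 < bary K j x := by
  have hmE : MeasurableSet (hull (K.erase p)) := (isCompact_hull _).isClosed.measurableSet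
  refine (ae_ball_iff (K.erase p).countable_toSet).2 fun j hj => ?_
  have hj' := Finset.mem_erase.1 (Finset.mem_coe.1 hj)
  obtain ⟨r, hr⟩ : ∃ r, r ∈ (K.erase p).erase j := by
    apply Finset.card_pos.1
    rw [Finset.card_erase_of_mem hj, Finset.card_erase_of_mem hp, h.card]; omega
  simp only [Finset.mem_erase] at hr
  obtain ⟨x₀, hx₀⟩ := h.exists_hyper (by omega) hp
  obtain ⟨x₁, hx₁⟩ := h.exists_hyper (by omega) hj'.2
  have hn := (h.isOuterNormal (by omega) hp).1
  have hg := norm_pos_iff.2 (h.baryGrad_ne_zero (by omega) hp)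
  set n := outerNormal K (K.erase p)
  -- The direction `p - r` is transversal to the face but parallel to the hyperplane `bary K j = 0`,
  -- since the coordinate `j` vanishes at both points. Slicing this Lebesgue null hyperplane along
  -- `p - r` gives the same cross-section at every time, so that cross-section is null. A vertex `r`
  -- other than `p` and `j` exists because `d ≥ 2`.
  have hb : inner ℝ n (p - r) ≠ 0 := by
    intro h0
    have h1 := linear_bary_sub K p p r
    rw [h.bary_self hp, h.bary_ne hp hr.2.2 hr.2.1.symm, h.baryGrad_eq (by omega) hp,
      inner_neg_left, inner_smul_left, h0] at h1
    simp at h1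
  have h1 := measurePreserving_skew (by omega) hn x₀ (p - r) hb
  have := isLocallyFiniteMeasure_surf_hyper (by omega) hn x₀
  have hS : MeasurableSet {x | bary K j x = 0} := by
    rw [hx₁]; exact (isClosed_hyper _ _).measurableSet
  have h0 : volume {x | bary K j x = 0} = 0 := by
    rw [hx₁]; exact volume_hyper (h.isOuterNormal (by omega) hj'.2).1 _
  rw [← h1.measure_preimage hS.nullMeasurableSet, Measure.smul_apply, smul_eq_mul, mul_eq_zero] at h0
  have h0' := h0.resolve_left (by simpa using hb)
  rw [Measure.prod_apply (h1.measurable hS)] at h0'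
  have e1 : ∀ t : ℝ, (surf d).restrict (hyper n x₀)
      (Prod.mk t ⁻¹' ((fun q : ℝ × Pt d => q.2 + q.1 • (p - r)) ⁻¹' {x | bary K j x = 0}))
      = (surf d).restrict (hyper n x₀) {x | bary K j x = 0} := by
    intro t
    congr 1
    ext x
    simp only [mem_preimage, mem_ofPred_eq]
    rw [bary_add, inner_smul_right, linear_bary_sub, h.bary_ne hj'.2 hp hj'.1,
      h.bary_ne hj'.2 hr.2.2 hr.1.symm]
    simp
  simp_rw [e1] at h0'
  rw [lintegral_const] at h0'
  have h2 : (surf d).restrict (hyper n x₀) {x | bary K j x = 0} = 0 := by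
    simpa using h0'
  rw [← hx₀] at h2
  have h3 : (surf d).restrict (hull (K.erase p)) {x | bary K j x = 0} = 0 :=
    le_antisymm ((Measure.restrict_mono_set _ (h.hull_erase_subset hp) _).trans h2.le) bot_le
  have h4 : ∀ᵐ x ∂(surf d).restrict (hull (K.erase p)), ¬ bary K j x = 0 := by
    rw [ae_iff]; simpa using h3
  filter_upwards [h4, ae_restrict_mem hmE] with x hx hxe
  rw [h.hull_erase hp, h.hull_eq] at hxe
  exact lt_of_le_of_ne (hxe.1 j hj'.2) (Ne.symm hx)

end

section

variable {d : ℕ}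

/-! ### Weak derivatives -/

variable {U : Set (Pt d)} {φ v w : Pt d → ℝ} {G H : Pt d → Pt d}

lemma IsTestFun.contDiff (h : IsTestFun U φ) : ContDiff ℝ ∞ φ := h.1

lemma IsTestFun.hasCompactSupport (h : IsTestFun U φ) : HasCompactSupport φ := h.2.1

lemma IsTestFun.mono {U' : Set (Pt d)} (h : IsTestFun U φ) (hU : U ⊆ U') : IsTestFun U' φ :=
  ⟨h.1, h.2.1, h.2.2.trans hU⟩

lemma continuous_gradient (h : ContDiff ℝ ∞ φ) : Continuous (gradient φ) :=
  (InnerProductSpace.toDual ℝ (Pt d)).symm.continuous.comp (h.continuous_fderiv (by simp))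

lemma tsupport_gradient_subset (φ : Pt d → ℝ) : tsupport (gradient φ) ⊆ tsupport φ :=
  (tsupport_comp_subset (g := (InnerProductSpace.toDual ℝ (Pt d)).symm) (map_zero _) _).trans
    (tsupport_fderiv_subset ℝ)

lemma IsTestFun.hasCompactSupport_gradient (h : IsTestFun U φ) :
    HasCompactSupport (gradient φ) :=
  h.2.1.mono' ((subset_tsupport _).trans (tsupport_gradient_subset φ))

lemma IsTestFun.eq_zero (h : IsTestFun U φ) {x : Pt d} (hx : x ∉ U) : φ x = 0 :=
  image_eq_zero_of_notMem_tsupport fun h' => hx (h.2.2 h')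

lemma IsTestFun.gradient_eq_zero (h : IsTestFun U φ) {x : Pt d} (hx : x ∉ U) :
    gradient φ x = 0 :=
  image_eq_zero_of_notMem_tsupport fun h' => hx (h.2.2 (tsupport_gradient_subset φ h'))

lemma IsTestFun.memLp (h : IsTestFun U φ) (p : ℝ≥0∞) (μ : Measure (Pt d))
    [IsFiniteMeasureOnCompacts μ] : MemLp φ p μ :=
  h.1.continuous.memLp_of_hasCompactSupport h.2.1

lemma IsTestFun.memLp_gradient (h : IsTestFun U φ) (p : ℝ≥0∞) (μ : Measure (Pt d))
    [IsFiniteMeasureOnCompacts μ] : MemLp (gradient φ) p μ :=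
  (continuous_gradient h.1).memLp_of_hasCompactSupport h.hasCompactSupport_gradient

lemma inner_gradient_eq (φ : Pt d → ℝ) (x a : Pt d) : inner ℝ (gradient φ x) a = fderiv ℝ φ x a := by
  simp [gradient]

lemma integrable_smul_of_memLp {μ : Measure (Pt d)} {E : Type*} [NormedAddCommGroup E]
    [NormedSpace ℝ E] {f : Pt d → ℝ} {g : Pt d → E} (hf : MemLp f 2 μ) (hg : MemLp g 2 μ) :
    Integrable (fun x => f x • g x) μ :=
  memLp_one_iff_integrable.1 (hg.smul hf)

/-- A vector identity may be tested against constant vectors; the resulting scalar form is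
integration by parts in a single direction. -/
lemma hasWeakGrad_iff (hv : MemLp v 2 (volume.restrict U)) (hG : MemLp G 2 (volume.restrict U)) :
    HasWeakGrad U v G ↔ ∀ φ, IsTestFun U φ → ∀ a : Pt d,
      ∫ x in U, v x * inner ℝ (gradient φ x) a = -∫ x in U, φ x * inner ℝ (G x) a := by
  have key : ∀ φ, IsTestFun U φ → ∀ a : Pt d,
      inner ℝ a (∫ x in U, v x • gradient φ x) = ∫ x in U, v x * inner ℝ (gradient φ x) a ∧
      inner ℝ a (∫ x in U, φ x • G x) = ∫ x in U, φ x * inner ℝ (G x) a := by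
    intro φ hφ a
    constructor
    · rw [← integral_inner (integrable_smul_of_memLp hv (hφ.memLp_gradient 2 _))]
      simp_rw [inner_smul_right, real_inner_comm]
    · rw [← integral_inner (integrable_smul_of_memLp (hφ.memLp 2 _) hG)]
      simp_rw [inner_smul_right, real_inner_comm]
  constructor
  · rintro ⟨-, h⟩ φ hφ a
    rw [← (key φ hφ a).1, ← (key φ hφ a).2, h φ hφ, inner_neg_right]
  · refine fun h => ⟨hG, fun φ hφ => ?_⟩
    refine ext_inner_left ℝ fun a => ?_
    rw [inner_neg_right, (key φ hφ a).1, (key φ hφ a).2, h φ hφ a]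

/-- This is the fundamental lemma of the calculus of variations. `weakGrad` is a choice, so every
computation with it passes through this uniqueness. -/
lemma HasWeakGrad.unique (hU : IsOpen U) (hG : HasWeakGrad U v G) (hH : HasWeakGrad U v H) :
    G =ᵐ[volume.restrict U] H := by
  have h := hU.ae_eq_zero_of_integral_contDiff_smul_eq_zero (μ := volume)
    (f := fun x => G x - H x) ?_ ?_
  · rw [EventuallyEq, ae_restrict_iff' hU.measurableSet]
    filter_upwards [h] with x hx hxU
    exact sub_eq_zero.1 (hx hxU)
  · exact locallyIntegrableOn_of_locallyIntegrable_restrict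
      ((hG.1.locallyIntegrable (by norm_num)).sub (hH.1.locallyIntegrable (by norm_num)))
  · intro g hg1 hg2 hg3
    have hg : IsTestFun U g := ⟨hg1, hg2, hg3⟩
    have e := (hG.2 g hg).symm.trans (hH.2 g hg)
    have i1 := integrable_smul_of_memLp (hg.memLp 2 _) hG.1
    have i2 := integrable_smul_of_memLp (hg.memLp 2 _) hH.1
    rw [← setIntegral_eq_integral_of_forall_compl_eq_zero (s := U)
      (fun x hx => by rw [hg.eq_zero hx, zero_smul])]
    simp_rw [smul_sub]
    rw [integral_sub i1 i2, sub_eq_zero]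
    exact neg_inj.1 e

lemma weakGrad_spec (h : ∃ G, HasWeakGrad U v G) : HasWeakGrad U v (weakGrad U v) := by
  rw [weakGrad, dif_pos h]; exact h.choose_spec

lemma HasWeakGrad.ae_eq (hU : IsOpen U) (h : HasWeakGrad U v G) :
    weakGrad U v =ᵐ[volume.restrict U] G :=
  (weakGrad_spec ⟨G, h⟩).unique hU h

lemma MemH1.hasWeakGrad (h : MemH1 U v) : HasWeakGrad U v (weakGrad U v) := weakGrad_spec h.2

lemma HasWeakGrad.memH1 (h : HasWeakGrad U v G) (hv : MemLp v 2 (volume.restrict U)) :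
    MemH1 U v := ⟨hv, G, h⟩

lemma MemH1.memLp_weakGrad (h : MemH1 U v) : MemLp (weakGrad U v) 2 (volume.restrict U) :=
  h.hasWeakGrad.1

lemma HasWeakGrad.congr (h : HasWeakGrad U v G) (hv : v =ᵐ[volume.restrict U] w)
    (hG : G =ᵐ[volume.restrict U] H) : HasWeakGrad U w H := by
  refine ⟨(memLp_congr_ae hG).1 h.1, fun φ hφ => ?_⟩
  have := h.2 φ hφ
  have e1 : (fun x => v x • gradient φ x) =ᵐ[volume.restrict U] fun x => w x • gradient φ x :=
    hv.mono fun x hx => by simp only [hx]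
  have e2 : (fun x => φ x • G x) =ᵐ[volume.restrict U] fun x => φ x • H x :=
    hG.mono fun x hx => by simp only [hx]
  rwa [integral_congr_ae e1, integral_congr_ae e2] at this

lemma HasWeakGrad.mono {U' : Set (Pt d)} (h : HasWeakGrad U v G) (hUU : U' ⊆ U) :
    HasWeakGrad U' v G := by
  refine ⟨h.1.mono_measure (Measure.restrict_mono_set _ hUU), fun φ hφ => ?_⟩
  have := h.2 φ (hφ.mono hUU)
  rw [setIntegral_eq_integral_of_forall_compl_eq_zero
      (fun x hx => by rw [(hφ.mono hUU).gradient_eq_zero hx, smul_zero]),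
    setIntegral_eq_integral_of_forall_compl_eq_zero
      (fun x hx => by rw [(hφ.mono hUU).eq_zero hx, zero_smul])] at this
  rwa [setIntegral_eq_integral_of_forall_compl_eq_zero
      (fun x hx => by rw [hφ.gradient_eq_zero hx, smul_zero]),
    setIntegral_eq_integral_of_forall_compl_eq_zero
      (fun x hx => by rw [hφ.eq_zero hx, zero_smul])]

lemma HasWeakGrad.sub (hv : MemLp v 2 (volume.restrict U)) (hw : MemLp w 2 (volume.restrict U))
    (hG : HasWeakGrad U v G) (hH : HasWeakGrad U w H) :
    HasWeakGrad U (v - w) (G - H) := by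
  refine ⟨hG.1.sub hH.1, fun φ hφ => ?_⟩
  simp only [Pi.sub_apply, sub_smul, smul_sub]
  rw [integral_sub (integrable_smul_of_memLp hv (hφ.memLp_gradient 2 _))
      (integrable_smul_of_memLp hw (hφ.memLp_gradient 2 _)),
    integral_sub (integrable_smul_of_memLp (hφ.memLp 2 _) hG.1)
      (integrable_smul_of_memLp (hφ.memLp 2 _) hH.1), hG.2 φ hφ, hH.2 φ hφ]
  abel

lemma MemH1.sub (hv : MemH1 U v) (hw : MemH1 U w) : MemH1 U (v - w) :=
  (hv.hasWeakGrad.sub hv.1 hw.1 hw.hasWeakGrad).memH1 (hv.1.sub hw.1)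

lemma weakGrad_sub (hU : IsOpen U) (hv : MemH1 U v) (hw : MemH1 U w) :
    weakGrad U (v - w) =ᵐ[volume.restrict U] weakGrad U v - weakGrad U w :=
  (hv.hasWeakGrad.sub hv.1 hw.1 hw.hasWeakGrad).ae_eq hU

lemma MemH1.mono {U' : Set (Pt d)} (h : MemH1 U v) (hUU : U' ⊆ U) : MemH1 U' v :=
  ((h.hasWeakGrad.mono hUU)).memH1 (h.1.mono_measure (Measure.restrict_mono_set _ hUU))

lemma weakGrad_mono {U' : Set (Pt d)} (h : MemH1 U v) (hU' : IsOpen U') (hUU : U' ⊆ U) :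
    weakGrad U' v =ᵐ[volume.restrict U'] weakGrad U v :=
  (h.hasWeakGrad.mono hUU).ae_eq hU'

lemma memLp_of_continuous {E : Type*} [NormedAddCommGroup E] {f : Pt d → E} (hf : Continuous f)
    (hU : Bornology.IsBounded U) (p : ℝ≥0∞) : MemLp f p (volume.restrict U) := by
  have hc : IsCompact (closure U) := hU.isCompact_closure
  obtain ⟨C, hC⟩ := hc.exists_bound_of_continuousOn hf.continuousOn
  have : IsFiniteMeasure (volume.restrict (closure U)) :=
    ⟨by simpa using hc.measure_lt_top⟩
  refine MemLp.mono_measure (Measure.restrict_mono_set _ subset_closure)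
    (MemLp.of_bound (μ := volume.restrict (closure U)) hf.aestronglyMeasurable C ?_)
  exact (ae_restrict_iff' isClosed_closure.measurableSet).2 (Eventually.of_forall hC)

/-- The classical gradient of a smooth function is its weak gradient. -/
lemma hasWeakGrad_of_contDiff (hv : ContDiff ℝ ∞ v) (hU : Bornology.IsBounded U) :
    HasWeakGrad U v (gradient v) := by
  rw [hasWeakGrad_iff (memLp_of_continuous hv.continuous hU 2)
    (memLp_of_continuous (continuous_gradient hv) hU 2)]
  intro φ hφ a
  rw [setIntegral_eq_integral_of_forall_compl_eq_zero
      (fun x hx => by rw [hφ.gradient_eq_zero hx, inner_zero_left, mul_zero]),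
    setIntegral_eq_integral_of_forall_compl_eq_zero
      (fun x hx => by rw [hφ.eq_zero hx, zero_mul])]
  simp_rw [inner_gradient_eq, mul_comm (φ _)]
  have c1 : Continuous fun x => fderiv ℝ v x a :=
    (hv.continuous_fderiv (by simp)).clm_apply continuous_const
  have c2 : Continuous fun x => fderiv ℝ φ x a :=
    (hφ.1.continuous_fderiv (by simp)).clm_apply continuous_const
  refine integral_mul_fderiv_eq_neg_fderiv_mul_of_integrable ?_ ?_ ?_ ?_ ?_
  · exact (c1.mul hφ.1.continuous).integrable_of_hasCompactSupport hφ.2.1.mul_left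
  · exact (hv.continuous.mul c2).integrable_of_hasCompactSupport
      ((hφ.2.1.fderiv_apply ℝ a).mul_left)
  · exact (hv.continuous.mul hφ.1.continuous).integrable_of_hasCompactSupport hφ.2.1.mul_left
  · exact fun x _ => hv.differentiable (by simp) x
  · exact fun x _ => hφ.1.differentiable (by simp) x

lemma memH1_of_contDiff (hv : ContDiff ℝ ∞ v) (hU : Bornology.IsBounded U) : MemH1 U v :=
  (hasWeakGrad_of_contDiff hv hU).memH1 (memLp_of_continuous hv.continuous hU 2)

lemma weakGrad_of_contDiff (hv : ContDiff ℝ ∞ v) (hU : Bornology.IsBounded U) (hU' : IsOpen U) :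
    weakGrad U v =ᵐ[volume.restrict U] gradient v :=
  (hasWeakGrad_of_contDiff hv hU).ae_eq hU'

lemma MemH1.congr (h : MemH1 U v) (hvw : v =ᵐ[volume.restrict U] w) : MemH1 U w :=
  (h.hasWeakGrad.congr hvw EventuallyEq.rfl).memH1 ((memLp_congr_ae hvw).1 h.1)

lemma weakGrad_congr (hU : IsOpen U) (h : MemH1 U v) (hvw : v =ᵐ[volume.restrict U] w) :
    weakGrad U w =ᵐ[volume.restrict U] weakGrad U v :=
  (h.hasWeakGrad.congr hvw EventuallyEq.rfl).ae_eq hU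

/-! ### `H¹` is contained in the fractional spaces -/

lemma sq_lintegral_le {α : Type*} [MeasurableSpace α] (μ : Measure α) {f : α → ℝ≥0∞}
    (hf : AEMeasurable f μ) : (∫⁻ x, f x ∂μ) ^ 2 ≤ μ univ * ∫⁻ x, f x ^ 2 ∂μ := by
  have h := ENNReal.lintegral_mul_le_Lp_mul_Lq μ (Real.HolderConjugate.two_two) hf
    (aemeasurable_const (b := (1 : ℝ≥0∞)))
  simp only [Pi.mul_apply, mul_one, ENNReal.one_rpow, lintegral_const, one_mul] at h
  calc (∫⁻ x, f x ∂μ) ^ 2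
      ≤ ((∫⁻ x, f x ^ (2 : ℝ) ∂μ) ^ (1 / (2 : ℝ)) * μ univ ^ (1 / (2 : ℝ))) ^ 2 := by gcongr
    _ = _ := by
      rw [mul_pow, ← ENNReal.rpow_natCast, ← ENNReal.rpow_natCast, ← ENNReal.rpow_mul,
        ← ENNReal.rpow_mul]
      norm_num
      rw [mul_comm]

/-- For `v ∈ H¹(U)`, `U` convex, the difference `v(y + h) - v(y)` is the integral of the weak
gradient along the segment. -/
lemma HasWeakGrad.sub_eq_integral (hU : IsOpen U) (hUc : Convex ℝ U)
    (hUb : Bornology.IsBounded U) (hv : MemLp v 2 (volume.restrict U)) (hG : HasWeakGrad U v G)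
    (h : Pt d) : ∀ᵐ y, y ∈ U → y + h ∈ U →
      v (y + h) - v y = ∫ τ in (0 : ℝ)..1, inner ℝ (U.indicator G (y + τ • h)) h := by
  have hfin : IsFiniteMeasure (volume.restrict U) := ⟨by simpa using hUb.measure_lt_top⟩
  set G' : Pt d → ℝ := fun y => inner ℝ (U.indicator G y) h with hG'
  set v' : Pt d → ℝ := U.indicator v with hv'
  have hGi : Integrable (U.indicator G) volume :=
    (integrable_indicator_iff hU.measurableSet).2 (hG.1.integrable (by norm_num))
  have hG'i : Integrable G' volume := hGi.inner_const h
  have hv'i : Integrable v' volume :=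
    (integrable_indicator_iff hU.measurableSet).2 (hv.integrable (by norm_num))
  let ν : Measure ℝ := volume.restrict (Ioc 0 1)
  -- The shear along `h` preserves the product measure, so the gradient on the moving point is
  -- jointly integrable and Fubini's theorem applies to the segment integral.
  have hmp : MeasurePreserving (fun q : ℝ × Pt d => (q.1, q.2 + q.1 • h)) (ν.prod volume)
      (ν.prod volume) :=
    (MeasurePreserving.id ν).skew_product (g := fun t y => y + t • h) (by fun_prop)
      (Eventually.of_forall fun t => (measurePreserving_add_right volume (t • h)).map_eq)
  have hGp : Integrable (fun q : ℝ × Pt d => G' (q.2 + q.1 • h)) (ν.prod volume) :=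
    hmp.integrable_comp_of_integrable (hG'i.comp_snd ν)
  set P : Pt d → ℝ := fun y => ∫ τ in (0 : ℝ)..1, G' (y + τ • h) with hP
  have hPi : Integrable P volume := by
    have := hGp.integral_prod_right
    simpa only [hP, intervalIntegral.integral_of_le zero_le_one] using this
  set W : Set (Pt d) := U ∩ (fun y => y + h) ⁻¹' U with hW
  have hWo : IsOpen W := hU.inter (hU.preimage (by fun_prop))
  have hv'h : Integrable (fun y => v' (y + h)) volume := hv'i.comp_add_right h
  have hseg : ∀ y, y ∈ W → ∀ τ ∈ Icc (0 : ℝ) 1, y + τ • h ∈ U := by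
    intro y hy τ hτ
    have := hUc.add_smul_sub_mem hy.1 hy.2 hτ
    simpa using this
  -- The identity is tested on the open set `W` of points `y` with `y` and `y + h` in `U`. By
  -- convexity, translates by `τ • h` of a test function on `W` are test functions on `U`, so the
  -- definition of the weak gradient applies at each `τ`.
  have main := hWo.ae_eq_zero_of_integral_contDiff_smul_eq_zero (μ := volume)
    (f := fun y => v' (y + h) - v' y - P y)
    (((hv'h.sub hv'i).sub hPi).locallyIntegrable.locallyIntegrableOn W) ?_
  · filter_upwards [main] with y hy hyU hyh
    have := hy ⟨hyU, hyh⟩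
    simp only [hv', indicator_of_mem hyU, indicator_of_mem hyh] at this
    linarith
  · intro φ hφ1 hφ2 hφ3
    have hφc := hφ1.continuous
    obtain ⟨C, hC⟩ := hφ2.exists_bound_of_continuous hφc
    have hφb : ∀ {f : Pt d → ℝ}, Integrable f volume → Integrable (fun x => φ x * f x) volume :=
      fun hf => hf.bdd_mul hφc.aestronglyMeasurable (Eventually.of_forall hC)
    -- the translated test functions
    have htest : ∀ τ ∈ Icc (0 : ℝ) 1, IsTestFun U (fun y => φ (y - τ • h)) := by
      intro τ hτ
      refine ⟨hφ1.comp (by fun_prop), ?_, ?_⟩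
      · exact hφ2.comp_homeomorph (Homeomorph.subRight (τ • h))
      · have e : tsupport (fun y => φ (y - τ • h)) = (fun y => y - τ • h) ⁻¹' tsupport φ :=
          tsupport_comp_eq_preimage φ (Homeomorph.subRight (τ • h))
        rw [e]
        intro y hy
        have := hseg _ (hφ3 hy) τ hτ
        simpa using this
    have e1 : ∫ y, φ y * P y = ∫ τ in Ioc (0 : ℝ) 1, ∫ y, φ y * G' (y + τ • h) := by
      simp only [hP, intervalIntegral.integral_of_le zero_le_one, ← integral_const_mul]
      refine (integral_integral_swap (f := fun τ y => φ y * G' (y + τ • h)) (μ := ν) ?_).symm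
      exact hGp.bdd_mul (c := C) (hφc.comp continuous_snd).aestronglyMeasurable
        (Eventually.of_forall fun q => hC q.2)
    have e2 : ∀ τ ∈ Ioc (0 : ℝ) 1, ∫ y, φ y * G' (y + τ • h)
        = -∫ y, v' y * fderiv ℝ φ (y - τ • h) h := by
      intro τ hτ
      have ht := htest τ ⟨hτ.1.le, hτ.2⟩
      have k := (hasWeakGrad_iff hv hG.1).1 hG _ ht h
      have k1 : ∫ y, φ y * G' (y + τ • h) = ∫ y, φ (y - τ • h) * G' y := by
        rw [← integral_add_right_eq_self (fun y => φ (y - τ • h) * G' y) (τ • h)]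
        simp only [add_sub_cancel_right]
      have k2 : ∫ y, φ (y - τ • h) * G' y = ∫ x in U, φ (x - τ • h) * inner ℝ (G x) h := by
        rw [← integral_indicator hU.measurableSet]
        refine integral_congr_ae (Eventually.of_forall fun y => ?_)
        by_cases hy : y ∈ U <;> simp [hG', hy]
      have k3 : ∫ y, v' y * fderiv ℝ φ (y - τ • h) h
          = ∫ x in U, v x * inner ℝ (gradient (fun y => φ (y - τ • h)) x) h := by
        rw [← integral_indicator hU.measurableSet]
        refine integral_congr_ae (Eventually.of_forall fun y => ?_)
        by_cases hy : y ∈ U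
        · simp only [hv', hy, indicator_of_mem, inner_gradient_eq]
          rw [fderiv_comp_sub]
        · simp [hv', hy]
      rw [k1, k2, k3, k]; simp
    have hdc : Continuous fun y => fderiv ℝ φ y h :=
      (hφ1.continuous_fderiv (by simp)).clm_apply continuous_const
    obtain ⟨C', hC'⟩ := (hφ2.fderiv_apply ℝ h).exists_bound_of_continuous hdc
    -- After moving the derivative to the smooth function, the integral over `τ` is the fundamental
    -- theorem of calculus for `τ ↦ -φ (y - τ • h)`.
    have e3 : ∫ τ in Ioc (0 : ℝ) 1, ∫ y, v' y * fderiv ℝ φ (y - τ • h) h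
        = ∫ y, v' y * (φ y - φ (y - h)) := by
      rw [integral_integral_swap (f := fun τ y => v' y * fderiv ℝ φ (y - τ • h) h) (μ := ν)]
      · refine integral_congr_ae (Eventually.of_forall fun y => ?_)
        simp only [integral_const_mul]
        congr 1
        rw [← intervalIntegral.integral_of_le zero_le_one]
        have hd : ∀ τ ∈ uIcc (0 : ℝ) 1,
            HasDerivAt (fun τ : ℝ => -φ (y - τ • h)) (fderiv ℝ φ (y - τ • h) h) τ := by
          intro τ _
          have a1 : HasDerivAt (fun τ : ℝ => y - τ • h) (-h) τ := by
            simpa using ((hasDerivAt_id τ).smul_const h).const_sub y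
          have a2 := ((hφ1.differentiable (by simp)) (y - τ • h)).hasFDerivAt.comp_hasDerivAt τ a1
          have a3 := a2.neg
          simp only [map_neg, neg_neg] at a3
          exact a3
        rw [intervalIntegral.integral_eq_sub_of_hasDerivAt hd
          ((hdc.comp (by fun_prop)).intervalIntegrable _ _)]
        simp; ring
      · have := ((hv'i.comp_snd ν).bdd_mul (c := C')
          (f := fun q : ℝ × Pt d => fderiv ℝ φ (q.2 - q.1 • h) h)
          (hdc.comp (by fun_prop)).aestronglyMeasurable (Eventually.of_forall fun q => hC' _))
        refine this.congr (Eventually.of_forall fun q => ?_)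
        simp only [Function.uncurry]; ring
    have e4 : ∫ y, φ y * P y = -∫ y, v' y * (φ y - φ (y - h)) := by
      rw [e1, setIntegral_congr_fun measurableSet_Ioc e2, integral_neg, e3]
    have e5 : ∫ y, φ y * v' (y + h) = ∫ y, φ (y - h) * v' y := by
      rw [← integral_add_right_eq_self (fun y => φ (y - h) * v' y) h]
      simp only [add_sub_cancel_right]
    have hφh : Integrable (fun x => φ (x - h) * v' x) volume :=
      hv'i.bdd_mul (hφc.comp (by fun_prop)).aestronglyMeasurable
        (Eventually.of_forall fun x => hC (x - h))
    have e6 : ∫ y, v' y * (φ y - φ (y - h)) = (∫ y, φ y * v' y) - ∫ y, φ (y - h) * v' y := by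
      rw [← integral_sub (hφb hv'i) hφh]
      congr 1; ext y; ring
    simp only [smul_eq_mul, mul_sub]
    rw [integral_sub, integral_sub (hφb hv'h) (hφb hv'i), e4, e5, e6]
    · ring
    · exact (hφb hv'h).sub (hφb hv'i)
    · exact hφb hPi

end

section

variable {d : ℕ}

/-! ### Sobolev-Slobodeckij seminorms -/

variable {U : Set (Pt d)} {v w : Pt d → ℝ} {G : Pt d → Pt d} {t : ℝ}

/-- The square of the Sobolev-Slobodeckij seminorm of order `t`. -/
def slobSq (U : Set (Pt d)) (t : ℝ) (w : Pt d → ℝ) : ℝ≥0∞ :=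
  ∫⁻ x in U, ∫⁻ y in U, ENNReal.ofReal (|w x - w y| ^ 2 / ‖x - y‖ ^ ((d : ℝ) + 2 * t))

lemma slobSq_congr (h : v =ᵐ[volume.restrict U] w) : slobSq U t v = slobSq U t w := by
  refine lintegral_congr_ae (h.mono fun x hx => ?_)
  refine lintegral_congr_ae (h.mono fun y hy => ?_)
  simp only [hx, hy]

lemma slobSq_mono {U' : Set (Pt d)} (hU : U' ⊆ U) : slobSq U' t v ≤ slobSq U t v :=
  (lintegral_mono_set hU).trans (lintegral_mono fun _ => lintegral_mono_set hU)

lemma measurable_slob_kernel (hw : Measurable w) : Measurable fun q : Pt d × Pt d =>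
    ENNReal.ofReal (|w q.1 - w q.2| ^ 2 / ‖q.1 - q.2‖ ^ ((d : ℝ) + 2 * t)) := by
  refine ENNReal.measurable_ofReal.comp (Measurable.div ?_ ?_)
  · have : Measurable fun q : Pt d × Pt d => w q.1 - w q.2 :=
      (hw.comp measurable_fst).sub (hw.comp measurable_snd)
    exact (continuous_abs.measurable.comp this).pow_const 2
  · exact Measurable.pow_const (by fun_prop) _

lemma lintegral_lintegral_le_two_mul_add {α : Type*} [MeasurableSpace α] (μ : Measure α)
    [SFinite μ] {F G H : α → α → ℝ≥0∞} (hG : Measurable (Function.uncurry G))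
    (hH : Measurable (Function.uncurry H)) (hle : ∀ x y, F x y ≤ 2 * G x y + 2 * H x y) :
    ∫⁻ x, ∫⁻ y, F x y ∂μ ∂μ ≤ 2 * ∫⁻ x, ∫⁻ y, G x y ∂μ ∂μ + 2 * ∫⁻ x, ∫⁻ y, H x y ∂μ ∂μ := by
  have g1 : ∀ x, Measurable (G x) := fun x => hG.comp measurable_prodMk_left
  have h1 : ∀ x, Measurable (H x) := fun x => hH.comp measurable_prodMk_left
  have g2 : Measurable fun x => ∫⁻ y, G x y ∂μ := hG.lintegral_prod_right
  have h2 : Measurable fun x => ∫⁻ y, H x y ∂μ := hH.lintegral_prod_right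
  rw [← lintegral_const_mul _ g2, ← lintegral_const_mul _ h2,
    ← lintegral_add_left (g2.const_mul 2)]
  refine lintegral_mono fun x => ?_
  rw [← lintegral_const_mul _ (g1 x), ← lintegral_const_mul _ (h1 x),
    ← lintegral_add_left ((g1 x).const_mul 2)]
  exact lintegral_mono fun y => hle x y

lemma two_mul_ofReal_add {a b : ℝ} (ha : 0 ≤ a) (hb : 0 ≤ b) :
    2 * ENNReal.ofReal a + 2 * ENNReal.ofReal b = ENNReal.ofReal (2 * a + 2 * b) := by
  rw [ENNReal.ofReal_add (by positivity) (by positivity), ENNReal.ofReal_mul (by norm_num),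
    ENNReal.ofReal_mul (by norm_num)]
  simp

lemma slobSq_sub_le (hv : AEStronglyMeasurable v (volume.restrict U))
    (hw : AEStronglyMeasurable w (volume.restrict U)) :
    slobSq U t (v - w) ≤ 2 * slobSq U t v + 2 * slobSq U t w := by
  have hv' := hv.ae_eq_mk
  have hw' := hw.ae_eq_mk
  rw [slobSq_congr (hv'.sub hw'), slobSq_congr hv', slobSq_congr hw']
  refine lintegral_lintegral_le_two_mul_add _
    (measurable_slob_kernel hv.stronglyMeasurable_mk.measurable)
    (measurable_slob_kernel hw.stronglyMeasurable_mk.measurable) fun x y => ?_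
  generalize hv.mk v = v'
  generalize hw.mk w = w'
  rw [two_mul_ofReal_add (by positivity) (by positivity)]
  refine ENNReal.ofReal_le_ofReal ?_
  rw [mul_div_assoc', mul_div_assoc', ← add_div]
  gcongr
  simp only [sq_abs, Pi.sub_apply]
  nlinarith [sq_nonneg (v' x - v' y + (w' x - w' y))]

lemma ofReal_norm_sq {E : Type*} [SeminormedAddCommGroup E] (a : E) :
    ENNReal.ofReal (‖a‖ ^ 2) = ‖a‖ₑ ^ 2 := by
  rw [ENNReal.ofReal_pow (norm_nonneg _), ofReal_norm]

lemma ofReal_sq_eq_enorm (a : ℝ) : ENNReal.ofReal (a ^ 2) = ‖a‖ₑ ^ 2 := by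
  rw [← ofReal_norm_sq, Real.norm_eq_abs, sq_abs]

/-- A constant in the embedding of `H¹` into fractional spaces. -/
def slobConst (d : ℕ) (t : ℝ) : ℝ :=
  2 ^ ((d : ℝ) - (2 - 2 * t)) * (1 - 2 ^ (-(2 - 2 * t)))⁻¹ * unitBallVol d * 2 ^ (2 - 2 * t)

lemma one_sub_two_rpow_pos {β : ℝ} (hβ : 0 < β) : (0 : ℝ) < 1 - 2 ^ (-β) := by
  have : (2 : ℝ) ^ (-β) < 1 := Real.rpow_lt_one_of_one_lt_of_neg one_lt_two (by linarith)
  linarith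

lemma slobConst_pos (d : ℕ) {t : ℝ} (ht : t < 1) : 0 < slobConst d t := by
  have := one_sub_two_rpow_pos (β := 2 - 2 * t) (by linarith)
  have := unitBallVol_pos d
  unfold slobConst; positivity

/-- The classical difference estimate: represent the difference along the segment, apply the
Cauchy-Schwarz inequality in `τ`, exchange the integrals and use translation invariance in `y`. -/
lemma lintegral_translate_le (hU : IsOpen U) (hUc : Convex ℝ U)
    (hUb : Bornology.IsBounded U) (hv : MemLp v 2 (volume.restrict U)) (hG : HasWeakGrad U v G)
    (hGm : Measurable G) (h : Pt d) :
    ∫⁻ y in U ∩ (fun y => y + h) ⁻¹' U, ‖v (y + h) - v y‖ₑ ^ 2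
      ≤ ‖h‖ₑ ^ 2 * ∫⁻ y in U, ‖G y‖ₑ ^ 2 := by
  have hW : MeasurableSet (U ∩ (fun y => y + h) ⁻¹' U) :=
    (hU.inter (hU.preimage (by fun_prop))).measurableSet
  have hGm' : Measurable (U.indicator G) := hGm.indicator hU.measurableSet
  have key := hG.sub_eq_integral hU hUc hUb hv h
  calc ∫⁻ y in U ∩ (fun y => y + h) ⁻¹' U, ‖v (y + h) - v y‖ₑ ^ 2
      ≤ ∫⁻ y in U ∩ (fun y => y + h) ⁻¹' U,
          ∫⁻ τ in Ioc (0 : ℝ) 1, ‖h‖ₑ ^ 2 * ‖U.indicator G (y + τ • h)‖ₑ ^ 2 := by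
        refine lintegral_mono_ae ?_
        rw [ae_restrict_iff' hW]
        filter_upwards [key] with y hy hyW
        rw [hy hyW.1 hyW.2, intervalIntegral.integral_of_le zero_le_one]
        have hm : Measurable fun τ : ℝ => inner ℝ (U.indicator G (y + τ • h)) h :=
          Measurable.inner (hGm'.comp (by fun_prop)) measurable_const
        calc ‖∫ τ in Ioc (0 : ℝ) 1, inner ℝ (U.indicator G (y + τ • h)) h‖ₑ ^ 2
            ≤ (∫⁻ τ in Ioc (0 : ℝ) 1, ‖inner ℝ (U.indicator G (y + τ • h)) h‖ₑ) ^ 2 := by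
              gcongr; exact enorm_integral_le_lintegral_enorm _
          _ ≤ ∫⁻ τ in Ioc (0 : ℝ) 1, ‖inner ℝ (U.indicator G (y + τ • h)) h‖ₑ ^ 2 := by
              refine (sq_lintegral_le _ hm.enorm.aemeasurable).trans ?_
              simp
          _ ≤ _ := by
              refine lintegral_mono fun τ => ?_
              rw [← mul_pow, ← ofReal_norm, ← ofReal_norm, ← ofReal_norm,
                ← ENNReal.ofReal_mul (norm_nonneg _)]
              gcongr
              exact (norm_inner_le_norm _ _).trans_eq (mul_comm _ _)
    _ ≤ ∫⁻ y, ∫⁻ τ in Ioc (0 : ℝ) 1, ‖h‖ₑ ^ 2 * ‖U.indicator G (y + τ • h)‖ₑ ^ 2 :=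
        setLIntegral_le_lintegral _ _
    _ = ∫⁻ τ in Ioc (0 : ℝ) 1, ∫⁻ y, ‖h‖ₑ ^ 2 * ‖U.indicator G (y + τ • h)‖ₑ ^ 2 := by
        refine lintegral_lintegral_swap ?_
        have : Measurable fun q : Pt d × ℝ => U.indicator G (q.1 + q.2 • h) :=
          hGm'.comp (by fun_prop)
        exact ((this.enorm.pow_const 2).const_mul _).aemeasurable
    _ = ∫⁻ τ in Ioc (0 : ℝ) 1, ‖h‖ₑ ^ 2 * ∫⁻ y in U, ‖G y‖ₑ ^ 2 := by
        refine lintegral_congr fun τ => ?_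
        rw [lintegral_add_right_eq_self (fun y => ‖h‖ₑ ^ 2 * ‖U.indicator G y‖ₑ ^ 2) (τ • h),
          lintegral_const_mul _ (hGm'.enorm.pow_const 2), ← lintegral_indicator hU.measurableSet]
        congr 2; ext y
        by_cases hy : y ∈ U <;> simp [hy]
    _ = _ := by rw [setLIntegral_const]; simp

/-- Substituting `y = x + h` turns the seminorm into an integral over `h` of squared `L²`
differences against `‖h‖ ^ (-(d + 2t))`. The difference estimate contributes `‖h‖ ^ 2`, and what
remains is integrable at the origin exactly because `t < 1`. -/
lemma slobSq_le_of_measurable (hd : 2 ≤ d) (hU : IsOpen U) (hUc : Convex ℝ U) {R : ℝ} (hR : 0 < R)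
    (hUR : ∀ x ∈ U, ∀ y ∈ U, dist x y ≤ R) (ht0 : 0 < t) (ht1 : t < 1)
    (hv : MemLp v 2 (volume.restrict U)) (hvm : Measurable v) (hG : HasWeakGrad U v G)
    (hGm : Measurable G) :
    slobSq U t v ≤ ENNReal.ofReal (slobConst d t * R ^ (2 - 2 * t)) * ∫⁻ y in U, ‖G y‖ₑ ^ 2 := by
  have hUb : Bornology.IsBounded U := Metric.isBounded_iff.2 ⟨R, fun x hx y hy => hUR x hx y hy⟩
  have hd' : (2 : ℝ) ≤ d := by exact_mod_cast hd
  set I := ∫⁻ y in U, ‖G y‖ₑ ^ 2 with hI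
  let F : Pt d → Pt d → ℝ≥0∞ := fun x y =>
    ENNReal.ofReal (|v x - v y| ^ 2 / ‖x - y‖ ^ ((d : ℝ) + 2 * t))
  have hF : Measurable (Function.uncurry F) := measurable_slob_kernel hvm
  have e1 : slobSq U t v = ∫⁻ h, ∫⁻ x in U, U.indicator (F x) (x + h) := by
    rw [← lintegral_lintegral_swap]
    · refine lintegral_congr fun x => ?_
      rw [lintegral_add_left_eq_self (U.indicator (F x)) x, lintegral_indicator hU.measurableSet]
    · have : Measurable fun q : Pt d × Pt d =>
          (univ ×ˢ U).indicator (Function.uncurry F) (q.1, q.1 + q.2) :=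
        (hF.indicator (MeasurableSet.univ.prod hU.measurableSet)).comp (by fun_prop)
      convert this.aemeasurable using 1
      ext q
      by_cases hq : q.1 + q.2 ∈ U <;> simp [hq, Function.uncurry]
  have e2 : ∀ h, ∫⁻ x in U, U.indicator (F x) (x + h) ≤
      (Metric.ball (0 : Pt d) (2 * R) \ {0}).indicator
        (fun h => ENNReal.ofReal (dist h 0 ^ (-((d : ℝ) - (2 - 2 * t)))) * I) h := by
    intro h
    -- For `‖h‖ ≥ 2 * R` no pair `x`, `x + h` fits into `U`, and for `h = 0` the numerator vanishes.
    by_cases hh : h ∈ Metric.ball (0 : Pt d) (2 * R) \ {0}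
    · rw [indicator_of_mem hh]
      have hpos : 0 < ‖h‖ := norm_pos_iff.2 hh.2
      have f1 : ∀ x, U.indicator (F x) (x + h) = ENNReal.ofReal (‖h‖ ^ (-((d : ℝ) + 2 * t))) *
          ((fun y => y + h) ⁻¹' U).indicator (fun x => ‖v (x + h) - v x‖ₑ ^ 2) x := by
        intro x
        by_cases hx : x + h ∈ U
        · have hx' : x ∈ (fun y => y + h) ⁻¹' U := hx
          rw [indicator_of_mem hx, indicator_of_mem hx', ← ofReal_norm_sq,
            ← ENNReal.ofReal_mul (by positivity)]
          simp only [F]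
          congr 1
          rw [Real.rpow_neg hpos.le, sub_add_cancel_left, norm_neg, div_eq_inv_mul, abs_sub_comm,
            Real.norm_eq_abs]
        · have hx' : x ∉ (fun y => y + h) ⁻¹' U := hx
          rw [indicator_of_notMem hx, indicator_of_notMem hx', mul_zero]
      simp_rw [f1]
      have hpre : MeasurableSet ((fun y => y + h) ⁻¹' U) :=
        (hU.preimage (by fun_prop)).measurableSet
      have hm : Measurable fun x => ‖v (x + h) - v x‖ₑ ^ 2 :=
        (((hvm.comp (by fun_prop)).sub hvm).enorm).pow_const 2
      rw [lintegral_const_mul _ (hm.indicator hpre), lintegral_indicator hpre,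
        Measure.restrict_restrict hpre, inter_comm]
      calc _ ≤ ENNReal.ofReal (‖h‖ ^ (-((d : ℝ) + 2 * t))) * (‖h‖ₑ ^ 2 * I) := by
            gcongr; exact lintegral_translate_le hU hUc hUb hv hG hGm h
        _ = _ := by
            rw [← mul_assoc, ← ofReal_norm_sq, ← ENNReal.ofReal_mul (by positivity),
              dist_zero_right]
            congr 2
            rw [← Real.rpow_natCast, ← Real.rpow_add hpos]
            congr 1; push_cast; ring
    · rw [indicator_of_notMem hh]
      refine le_of_eq ?_
      rw [lintegral_eq_zero_iff' ]
      · rw [EventuallyEq, ae_restrict_iff' hU.measurableSet]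
        refine Eventually.of_forall fun x hx => ?_
        by_cases hxh : x + h ∈ U
        · have h1 := hUR x hx _ hxh
          rw [dist_self_add_right] at h1
          have h2 : h = 0 := by
            by_contra h0
            refine hh ⟨?_, h0⟩
            rw [mem_ball_zero_iff]; linarith
          rw [indicator_of_mem hxh]
          simp [F, h2]
        · rw [indicator_of_notMem hxh]; rfl
      · have : Measurable fun x : Pt d =>
          (univ ×ˢ U).indicator (Function.uncurry F) (x, x + h) :=
          (hF.indicator (MeasurableSet.univ.prod hU.measurableSet)).comp (by fun_prop)
        have hfe : (fun x => U.indicator (F x) (x + h)) = fun x =>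
            (univ ×ˢ U).indicator (Function.uncurry F) (x, x + h) := by
          funext x
          by_cases hq : x + h ∈ U <;> simp [hq, Function.uncurry]
        rw [hfe]
        exact this.aemeasurable
  have hball : MeasurableSet (Metric.ball (0 : Pt d) (2 * R) \ {0}) :=
    Metric.isOpen_ball.measurableSet.diff (measurableSet_singleton 0)
  rw [e1]
  refine (lintegral_mono e2).trans ?_
  have hkm : Measurable fun x : Pt d =>
      ENNReal.ofReal (dist x 0 ^ (-((d : ℝ) - (2 - 2 * t)))) :=
    ENNReal.measurable_ofReal.comp (Measurable.pow_const (by fun_prop) _)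
  rw [lintegral_indicator hball, lintegral_mul_const _ hkm]
  gcongr
  refine (lintegral_kernel_le volume (0 : Pt d) (A := unitBallVol d) (m := d) (β := 2 - 2 * t)
    (unitBallVol_pos d).le (by linarith) (by linarith) (by positivity) (fun r hr => ?_)).trans
    (le_of_eq ?_)
  · rw [volume_ball_eq (by omega) _ hr.le, Real.rpow_natCast]
  · congr 1
    rw [slobConst, Real.mul_rpow (by norm_num) hR.le]; ring

/-- On a bounded convex open set, `H¹` is contained in the fractional space of order `t < 1`. -/
lemma slobSq_le_of_hasWeakGrad (hd : 2 ≤ d) (hU : IsOpen U) (hUc : Convex ℝ U) {R : ℝ} (hR : 0 < R)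
    (hUR : ∀ x ∈ U, ∀ y ∈ U, dist x y ≤ R) (ht0 : 0 < t) (ht1 : t < 1)
    (hv : MemLp v 2 (volume.restrict U)) (hG : HasWeakGrad U v G) :
    slobSq U t v ≤ ENNReal.ofReal (slobConst d t * R ^ (2 - 2 * t)) * ∫⁻ y in U, ‖G y‖ₑ ^ 2 := by
  have h1 := hv.1.ae_eq_mk
  have h2 := hG.1.1.ae_eq_mk
  have h3 : (fun x => ‖G x‖ₑ ^ 2) =ᵐ[volume.restrict U] fun x => ‖hG.1.1.mk G x‖ₑ ^ 2 :=
    h2.mono fun x hx => by simp only [← hx]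
  rw [slobSq_congr h1, lintegral_congr_ae h3]
  exact slobSq_le_of_measurable hd hU hUc hR hUR ht0 ht1 ((memLp_congr_ae h1).1 hv)
    hv.1.stronglyMeasurable_mk.measurable (hG.congr h1 h2) hG.1.1.stronglyMeasurable_mk.measurable

end

section

variable {d : ℕ}

/-! ### Pointwise values at the boundary -/

variable {U : Set (Pt d)} {v w : Pt d → ℝ} {x : Pt d} {a b : ℝ}

/-- `a` is the limit of the averages of `w` over `B(x, r) ∩ U`, in the mean square sense. -/
def HasStrongValue (U : Set (Pt d)) (w : Pt d → ℝ) (x : Pt d) (a : ℝ) : Prop :=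
  Tendsto (fun r => (volume (Metric.ball x r ∩ U))⁻¹ *
    ∫⁻ y in Metric.ball x r ∩ U, ‖w y - a‖ₑ ^ 2) (𝓝[>] 0) (𝓝 0)

lemma enorm_add_sq_le (a b : ℝ) : ‖a + b‖ₑ ^ 2 ≤ 2 * ‖a‖ₑ ^ 2 + 2 * ‖b‖ₑ ^ 2 := by
  rw [← ofReal_norm_sq, ← ofReal_norm_sq, ← ofReal_norm_sq,
    two_mul_ofReal_add (by positivity) (by positivity)]
  refine ENNReal.ofReal_le_ofReal ?_
  simp only [Real.norm_eq_abs, sq_abs]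
  nlinarith [sq_nonneg (a - b)]

lemma lintegral_enorm_add_sq_le {α : Type*} [MeasurableSpace α] {μ : Measure α} {f g : α → ℝ}
    (hf : AEStronglyMeasurable f μ) :
    ∫⁻ y, ‖f y + g y‖ₑ ^ 2 ∂μ ≤ 2 * (∫⁻ y, ‖f y‖ₑ ^ 2 ∂μ) + 2 * ∫⁻ y, ‖g y‖ₑ ^ 2 ∂μ := by
  have h1 : AEMeasurable (fun y => ‖f y‖ₑ ^ 2) μ := hf.enorm.pow_const 2
  rw [← lintegral_const_mul'' _ h1, ← lintegral_const_mul' _ _ (by simp),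
    ← lintegral_add_left' (h1.const_mul 2)]
  exact lintegral_mono fun y => enorm_add_sq_le _ _

lemma enorm_average_sub_sq_le {α : Type*} [MeasurableSpace α] {μ : Measure α} [IsFiniteMeasure μ]
    (hμ : μ ≠ 0) {f : α → ℝ} (hf : Integrable f μ) (c : ℝ) :
    ‖(⨍ y, f y ∂μ) - c‖ₑ ^ 2 ≤ (μ univ)⁻¹ * ∫⁻ y, ‖f y - c‖ₑ ^ 2 ∂μ := by
  have hμ0 : μ univ ≠ 0 := by simpa using hμ
  have hμt : μ univ ≠ ⊤ := measure_ne_top μ univ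
  have hfc : Integrable (fun y => f y - c) μ := hf.sub (integrable_const c)
  have : NeZero μ := ⟨hμ⟩
  have e : (⨍ y, f y ∂μ) - c = ⨍ y, (f y - c) ∂μ := by
    have hr : μ.real univ ≠ 0 := by
      rw [Measure.real, ENNReal.toReal_ne_zero]; exact ⟨hμ0, hμt⟩
    rw [average_eq, average_eq, integral_sub hf (integrable_const c), integral_const]
    simp only [smul_eq_mul]
    field_simp
  rw [e, average_eq, enorm_smul, mul_pow]
  have e2 : ‖(μ.real univ)⁻¹‖ₑ = (μ univ)⁻¹ := by
    rw [enorm_inv (by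
      rw [Measure.real, ENNReal.toReal_ne_zero]; exact ⟨hμ0, hμt⟩), Measure.real,
      Real.enorm_eq_ofReal ENNReal.toReal_nonneg, ENNReal.ofReal_toReal hμt]
  rw [e2]
  calc (μ univ)⁻¹ ^ 2 * ‖∫ y, (f y - c) ∂μ‖ₑ ^ 2
      ≤ (μ univ)⁻¹ ^ 2 * (μ univ * ∫⁻ y, ‖f y - c‖ₑ ^ 2 ∂μ) := by
        gcongr
        exact (pow_le_pow_left' (enorm_integral_le_lintegral_enorm _) 2).trans
          (sq_lintegral_le μ hfc.1.enorm)
    _ = _ := by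
        rw [← mul_assoc, sq, mul_assoc (μ univ)⁻¹, ENNReal.inv_mul_cancel hμ0 hμt, mul_one]

/-- The set `U` has positive finite measure near `x`. -/
def Fat (U : Set (Pt d)) (x : Pt d) : Prop :=
  ∀ r, 0 < r → volume (Metric.ball x r ∩ U) ≠ 0

lemma volume_ball_inter_ne_top (x : Pt d) (r : ℝ) : volume (Metric.ball x r ∩ U) ≠ ⊤ :=
  ((measure_mono inter_subset_left).trans_lt Metric.isBounded_ball.measure_lt_top).ne

lemma HasStrongValue.tendsto_average (hU : Fat U x) (hw : IntegrableOn w U)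
    (h : HasStrongValue U w x a) :
    Tendsto (fun r => ⨍ y in Metric.ball x r ∩ U, w y) (𝓝[>] (0 : ℝ)) (𝓝 a) := by
  rw [EMetric.tendsto_nhds]
  intro ε hε
  have hε2 : (0 : ℝ≥0∞) < ε ^ 2 := by positivity
  filter_upwards [(tendsto_order.1 h).2 _ hε2, self_mem_nhdsWithin] with r hr hr0
  have hfin : IsFiniteMeasure (volume.restrict (Metric.ball x r ∩ U)) :=
    ⟨by simpa using (volume_ball_inter_ne_top x r).lt_top⟩
  have h1 := enorm_average_sub_sq_le (μ := volume.restrict (Metric.ball x r ∩ U))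
    (by simpa using hU r hr0) (hw.mono_set inter_subset_right) a
  rw [Measure.restrict_apply_univ] at h1
  rw [edist_eq_enorm_sub]
  exact lt_of_pow_lt_pow_left' 2 (h1.trans_lt hr)

/-- `limUnder` returns an arbitrary value when there is no limit, so information about `trace` is
obtained by first exhibiting a strong value. -/
lemma HasStrongValue.trace_eq (hU : Fat U x) (hw : IntegrableOn w U)
    (h : HasStrongValue U w x a) : trace U w x = a :=
  (h.tendsto_average hU hw).limUnder_eq

/-- Averages only see the class of the function, so the equality holds at every point, not merely at
almost every one. -/
lemma trace_congr (hvw : v =ᵐ[volume.restrict U] w) (x : Pt d) : trace U v x = trace U w x := by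
  unfold trace
  congr 1
  funext r
  exact average_congr (ae_restrict_of_ae_restrict_of_subset inter_subset_right hvw)

lemma HasStrongValue.congr (h : HasStrongValue U v x a) (hvw : v =ᵐ[volume.restrict U] w) :
    HasStrongValue U w x a := by
  refine Tendsto.congr (fun r => ?_) h
  congr 1
  refine lintegral_congr_ae ?_
  filter_upwards [ae_restrict_of_ae_restrict_of_subset inter_subset_right hvw] with y hy
  rw [hy]

lemma HasStrongValue.add (hv : AEStronglyMeasurable v (volume.restrict U))
    (h1 : HasStrongValue U v x a) (h2 : HasStrongValue U w x b) :
    HasStrongValue U (v + w) x (a + b) := by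
  have h3 := (ENNReal.Tendsto.const_mul (a := 2) h1 (by simp)).add
    (ENNReal.Tendsto.const_mul (a := 2) h2 (by simp))
  simp only [mul_zero, add_zero] at h3
  refine tendsto_of_tendsto_of_tendsto_of_le_of_le tendsto_const_nhds h3 (fun _ => bot_le)
    fun r => ?_
  have h4 := lintegral_enorm_add_sq_le (μ := volume.restrict (Metric.ball x r ∩ U))
    (f := fun y => v y - a) (g := fun y => w y - b)
    ((hv.mono_set inter_subset_right).sub aestronglyMeasurable_const)
  have e : ∀ y, (v + w) y - (a + b) = (v y - a) + (w y - b) := fun y => by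
    simp only [Pi.add_apply]; ring
  simp_rw [e]
  exact (mul_le_mul' le_rfl h4).trans_eq (by ring)

/-- Multiplication by a bounded function with a limit. -/
lemma HasStrongValue.mul_continuous (hU : MeasurableSet U) (hx : Fat U x) {θ : Pt d → ℝ} {C : ℝ}
    (hθ : ContinuousWithinAt θ (insert x U) x) (hC : ∀ y ∈ U, |θ y| ≤ C)
    (hw : AEStronglyMeasurable w (volume.restrict U))
    (h : HasStrongValue U w x a) : HasStrongValue U (fun y => θ y * w y) x (θ x * a) := by
  have hC0 : 0 ≤ C := by
    by_contra hC0
    have : U = ∅ := by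
      ext y
      simp only [mem_empty_iff_false, iff_false]
      intro hy
      linarith [hC y hy, abs_nonneg (θ y)]
    have := hx 1 one_pos
    simp_all
  -- the variation of `θ`
  have key : Tendsto (fun r => (volume (Metric.ball x r ∩ U))⁻¹ *
      ∫⁻ y in Metric.ball x r ∩ U, ‖(θ y - θ x) * a‖ₑ ^ 2) (𝓝[>] 0) (𝓝 0) := by
    rw [ENNReal.tendsto_nhds_zero]
    intro ε hε
    have h1 : Tendsto (fun y => ‖(θ y - θ x) * a‖ₑ ^ 2) (𝓝[insert x U] x) (𝓝 0) := by
      have h2 : ContinuousWithinAt (fun y => (θ y - θ x) * a) (insert x U) x :=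
        (hθ.sub continuousWithinAt_const).mul continuousWithinAt_const
      have h3 := (ENNReal.continuous_pow 2).continuousAt.tendsto.comp
        (continuous_enorm.continuousAt.tendsto.comp h2.tendsto)
      simpa [Function.comp_def] using h3
    have h2 := (ENNReal.tendsto_nhds_zero.1 h1) ε hε
    rw [Metric.nhdsWithin_basis_ball.eventually_iff] at h2
    obtain ⟨δ, hδ, hball⟩ := h2
    filter_upwards [Ioo_mem_nhdsGT hδ] with r hr
    have h0 := hx r hr.1
    have ht := volume_ball_inter_ne_top (U := U) x r
    calc _ ≤ (volume (Metric.ball x r ∩ U))⁻¹ * ∫⁻ y in Metric.ball x r ∩ U, ε := by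
          refine mul_le_mul' le_rfl ?_
          refine setLIntegral_mono' (Metric.isOpen_ball.measurableSet.inter hU) fun y hy => ?_
          exact hball ⟨Metric.ball_subset_ball hr.2.le hy.1, mem_insert_of_mem _ hy.2⟩
      _ = ε := by
          rw [setLIntegral_const, mul_comm ε, ← mul_assoc, ENNReal.inv_mul_cancel h0 ht, one_mul]
  have h3 := (ENNReal.Tendsto.const_mul (a := 2 * ENNReal.ofReal (C ^ 2)) h
    (Or.inr (ENNReal.mul_ne_top (by simp) ENNReal.ofReal_ne_top))).add
    (ENNReal.Tendsto.const_mul (a := 2) key (by simp))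
  simp only [mul_zero, add_zero] at h3
  refine tendsto_of_tendsto_of_tendsto_of_le_of_le tendsto_const_nhds h3 (fun _ => bot_le)
    fun r => ?_
  have hm : AEMeasurable (fun y => ‖w y - a‖ₑ ^ 2) (volume.restrict (Metric.ball x r ∩ U)) :=
    ((hw.mono_set inter_subset_right).sub aestronglyMeasurable_const).enorm.pow_const 2
  have h4 : ∫⁻ y in Metric.ball x r ∩ U, ‖θ y * w y - θ x * a‖ₑ ^ 2 ≤
      2 * ENNReal.ofReal (C ^ 2) * (∫⁻ y in Metric.ball x r ∩ U, ‖w y - a‖ₑ ^ 2) +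
        2 * ∫⁻ y in Metric.ball x r ∩ U, ‖(θ y - θ x) * a‖ₑ ^ 2 := by
    rw [← lintegral_const_mul'' _ hm, ← lintegral_const_mul' _ _ (by simp),
      ← lintegral_add_left' (hm.const_mul _)]
    refine setLIntegral_mono' (Metric.isOpen_ball.measurableSet.inter hU) fun y hy => ?_
    have e : θ y * w y - θ x * a = θ y * (w y - a) + (θ y - θ x) * a := by ring
    rw [e]
    refine (enorm_add_sq_le _ _).trans ?_
    gcongr ?_ + _
    rw [mul_assoc, enorm_mul, mul_pow]
    gcongr
    rw [← ofReal_norm_sq]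
    gcongr
    exact hC y hy.2
  exact (mul_le_mul' le_rfl h4).trans_eq (by ring)

/-- A Campanato type estimate: if the mean oscillation over `B(x, r) ∩ U` decays like a power of
`r`, then the averages converge, with a rate. -/
lemma exists_value (hd : 1 ≤ d) {c β : ℝ} (hc : 0 < c) (hβ : 0 < β) : ∃ C : ℝ, 0 < C ∧
    ∀ (U : Set (Pt d)) (x : Pt d) (h M : ℝ) (w : Pt d → ℝ), MeasurableSet U → 0 < h → 0 ≤ M →
      (∀ r, 0 < r → r ≤ h → ENNReal.ofReal (c * r ^ d) ≤ volume (Metric.ball x r ∩ U)) →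
      volume U ≠ ⊤ → MemLp w 2 (volume.restrict U) →
      (∀ r, 0 < r → r ≤ h → ∫⁻ y in Metric.ball x r ∩ U, ∫⁻ z in Metric.ball x r ∩ U,
        ‖w y - w z‖ₑ ^ 2 ≤ ENNReal.ofReal (M * r ^ d * r ^ d * r ^ β)) →
      ∃ a, ∀ r, 0 < r → r ≤ h →
        ∫⁻ y in Metric.ball x r ∩ U, ‖w y - a‖ₑ ^ 2 ≤ ENNReal.ofReal (C * M * (r ^ d * r ^ β)) := by
  set D : ℝ := Real.sqrt (4 * c⁻¹ ^ 2 * 2 ^ d) with hD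
  set q : ℝ := 2 ^ (-(β / 2)) with hq
  have hq0 : 0 < q := by positivity
  have hq1 : q < 1 := Real.rpow_lt_one_of_one_lt_of_neg one_lt_two (by linarith)
  set E : ℝ := 2 ^ (β / 2) * (1 + (1 - q)⁻¹) with hE
  have hE0 : 0 < E := by
    have : 0 < 1 - q := by linarith
    positivity
  have hω := unitBallVol_pos d
  refine ⟨2 * c⁻¹ + 2 * (D ^ 2 * E ^ 2 * unitBallVol d), by positivity, ?_⟩
  intro U x h M w hU hh hM hvol hfin hw hQ
  have : IsFiniteMeasure (volume.restrict U) := ⟨by simpa using hfin.lt_top⟩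
  have hwi : IntegrableOn w U := hw.integrable (by norm_num)
  set m : ℝ → ℝ := fun r => ⨍ y in Metric.ball x r ∩ U, w y with hm
  have hcr : ∀ r, 0 < r → 0 < c * r ^ d := fun r hr => by positivity
  have hwm : ∀ r, AEStronglyMeasurable w (volume.restrict (Metric.ball x r ∩ U)) := fun r =>
    hw.1.mono_set inter_subset_right
  -- the mean square oscillation
  have s1 : ∀ r, 0 < r → r ≤ h → ∫⁻ y in Metric.ball x r ∩ U, ‖w y - m r‖ₑ ^ 2
      ≤ ENNReal.ofReal (c⁻¹ * M * (r ^ d * r ^ β)) := by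
    intro r hr hrh
    have hV := hvol r hr hrh
    have hV0 : volume (Metric.ball x r ∩ U) ≠ 0 := fun h0 => by
      rw [h0] at hV
      exact absurd (ENNReal.ofReal_eq_zero.1 (le_antisymm hV bot_le)) (not_le.2 (hcr r hr))
    have hfinr : IsFiniteMeasure (volume.restrict (Metric.ball x r ∩ U)) :=
      ⟨by simpa using (volume_ball_inter_ne_top x r).lt_top⟩
    calc ∫⁻ y in Metric.ball x r ∩ U, ‖w y - m r‖ₑ ^ 2
        ≤ ∫⁻ y in Metric.ball x r ∩ U, (volume (Metric.ball x r ∩ U))⁻¹ *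
            ∫⁻ z in Metric.ball x r ∩ U, ‖w y - w z‖ₑ ^ 2 := by
          refine lintegral_mono fun y => ?_
          have := enorm_average_sub_sq_le (μ := volume.restrict (Metric.ball x r ∩ U))
            (by simpa using hV0) (hwi.mono_set inter_subset_right) (w y)
          rw [Measure.restrict_apply_univ] at this
          dsimp only
          rw [← enorm_neg, neg_sub]
          refine this.trans_eq ?_
          congr 1
          refine lintegral_congr fun z => ?_
          rw [← enorm_neg, neg_sub]
      _ = (volume (Metric.ball x r ∩ U))⁻¹ * ∫⁻ y in Metric.ball x r ∩ U,
            ∫⁻ z in Metric.ball x r ∩ U, ‖w y - w z‖ₑ ^ 2 :=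
          lintegral_const_mul' _ _ (ENNReal.inv_ne_top.2 hV0)
      _ ≤ (ENNReal.ofReal (c * r ^ d))⁻¹ * ENNReal.ofReal (M * r ^ d * r ^ d * r ^ β) :=
          mul_le_mul' (ENNReal.inv_le_inv.2 hV) (hQ r hr hrh)
      _ = _ := by
          rw [← ENNReal.ofReal_inv_of_pos (hcr r hr), ← ENNReal.ofReal_mul (by positivity)]
          congr 1
          field_simp
  -- comparison of two averages
  have s2 : ∀ r r', 0 < r → r ≤ h → r / 2 ≤ r' → r' ≤ r →
      |m r - m r'| ≤ D * Real.sqrt M * r ^ (β / 2) := by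
    intro r r' hr hrh hr1 hr2
    have hr' : 0 < r' := by linarith
    have k1 : ENNReal.ofReal ((m r - m r') ^ 2 * (c * r' ^ d)) ≤
        ENNReal.ofReal (4 * (c⁻¹ * M * (r ^ d * r ^ β))) := by
      calc ENNReal.ofReal ((m r - m r') ^ 2 * (c * r' ^ d))
          ≤ ‖m r - m r'‖ₑ ^ 2 * volume (Metric.ball x r' ∩ U) := by
            rw [ENNReal.ofReal_mul (sq_nonneg _), ofReal_sq_eq_enorm]
            gcongr
            exact hvol r' hr' (hr2.trans hrh)
        _ = ∫⁻ y in Metric.ball x r' ∩ U, ‖(w y - m r') + (m r - w y)‖ₑ ^ 2 := by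
            have : ∀ y, (w y - m r') + (m r - w y) = m r - m r' := fun y => by ring
            simp_rw [this]
            rw [setLIntegral_const]
        _ ≤ 2 * (∫⁻ y in Metric.ball x r' ∩ U, ‖w y - m r'‖ₑ ^ 2) +
              2 * ∫⁻ y in Metric.ball x r' ∩ U, ‖m r - w y‖ₑ ^ 2 :=
            lintegral_enorm_add_sq_le ((hwm r').sub aestronglyMeasurable_const)
        _ ≤ 2 * ENNReal.ofReal (c⁻¹ * M * (r ^ d * r ^ β)) +
              2 * ENNReal.ofReal (c⁻¹ * M * (r ^ d * r ^ β)) := by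
            gcongr ?_ + ?_
            · refine mul_le_mul' le_rfl ((s1 r' hr' (hr2.trans hrh)).trans ?_)
              gcongr
            · refine mul_le_mul' le_rfl (le_trans ?_ (s1 r hr hrh))
              refine (lintegral_mono_set
                (inter_subset_inter_left _ (Metric.ball_subset_ball hr2))).trans_eq ?_
              refine lintegral_congr fun y => ?_
              rw [← enorm_neg, neg_sub]
        _ = _ := by
            rw [two_mul_ofReal_add (by positivity) (by positivity)]; congr 1; ring
    rw [ENNReal.ofReal_le_ofReal_iff (by positivity)] at k1
    have k2 : (m r - m r') ^ 2 ≤ (D * Real.sqrt M * r ^ (β / 2)) ^ 2 := by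
      have e1 : (D * Real.sqrt M * r ^ (β / 2)) ^ 2 = 4 * c⁻¹ ^ 2 * 2 ^ d * M * r ^ β := by
        rw [mul_pow, mul_pow, hD, Real.sq_sqrt (by positivity), Real.sq_sqrt hM,
          ← Real.rpow_natCast (r ^ (β / 2)), ← Real.rpow_mul hr.le]
        norm_num
      rw [e1]
      have hpow : r ^ d ≤ 2 ^ d * r' ^ d := by
        rw [← mul_pow]; exact pow_le_pow_left₀ hr.le (by linarith) d
      have hrb : 0 ≤ r ^ β := by positivity
      have hr'd : 0 < r' ^ d := by positivity
      have k3 : (m r - m r') ^ 2 * (c * r' ^ d) ≤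
          (4 * c⁻¹ ^ 2 * 2 ^ d * M * r ^ β) * (c * r' ^ d) := by
        refine k1.trans ?_
        have : 4 * c⁻¹ ^ 2 * 2 ^ d * M * r ^ β * (c * r' ^ d)
            = 4 * (c⁻¹ * M * ((2 ^ d * r' ^ d) * r ^ β)) := by field_simp
        rw [this]
        gcongr
      exact le_of_mul_le_mul_right k3 (by positivity)
    exact abs_le_of_sq_le_sq' k2 (by positivity) |> abs_le.2
  -- the dyadic averages converge
  let s : ℕ → ℝ := fun j => m (h * 2⁻¹ ^ j)
  have hsr : ∀ j : ℕ, 0 < h * 2⁻¹ ^ j ∧ h * 2⁻¹ ^ j ≤ h := fun j =>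
    ⟨by positivity, mul_le_of_le_one_right hh.le (pow_le_one₀ (by norm_num) (by norm_num))⟩
  set B : ℝ := D * Real.sqrt M * h ^ (β / 2) with hB
  have hpowj : ∀ j : ℕ, (h * 2⁻¹ ^ j) ^ (β / 2) = h ^ (β / 2) * q ^ j := by
    intro j
    rw [Real.mul_rpow hh.le (by positivity), hq, Real.rpow_neg (by norm_num),
      ← Real.inv_rpow (by norm_num), ← Real.rpow_natCast, ← Real.rpow_natCast,
      ← Real.rpow_mul (by norm_num), ← Real.rpow_mul (by norm_num), mul_comm (j : ℝ)]
  have s3 : ∀ j, dist (s j) (s (j + 1)) ≤ B * q ^ j := by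
    intro j
    rw [Real.dist_eq]
    have := s2 (h * 2⁻¹ ^ j) (h * 2⁻¹ ^ (j + 1)) (hsr j).1 (hsr j).2
      (by rw [pow_succ]; linarith) (by
        rw [pow_succ]; nlinarith [(hsr j).1])
    rw [hpowj] at this
    refine this.trans_eq ?_
    rw [hB]; ring
  obtain ⟨a, ha⟩ := cauchySeq_tendsto_of_complete (cauchySeq_of_le_geometric q B hq1 s3)
  have s4 : ∀ j, |s j - a| ≤ B * q ^ j / (1 - q) := fun j => by
    rw [← Real.dist_eq]
    exact dist_le_of_le_geometric_of_tendsto q B hq1 s3 ha j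
  -- An arbitrary radius is compared with the nearest larger dyadic one, at the cost of one more
  -- term of the geometric series; both contributions are collected in `E`.
  have s5 : ∀ r, 0 < r → r ≤ h → |m r - a| ≤ D * Real.sqrt M * E * r ^ (β / 2) := by
    intro r hr hrh
    obtain ⟨j, hj1, hj2⟩ := exists_nat_pow_near_of_lt_one (x := r / h) (y := (2⁻¹ : ℝ))
      (by positivity) (by rw [div_le_one hh]; exact hrh) (by norm_num) (by norm_num)
    rw [div_le_iff₀ hh] at hj2
    rw [lt_div_iff₀ hh] at hj1
    have k1 := s2 (h * 2⁻¹ ^ j) r (hsr j).1 (hsr j).2 (by rw [pow_succ] at hj1; linarith)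
      (by linarith)
    have k2 := s4 j
    have k3 : (h * 2⁻¹ ^ j) ^ (β / 2) ≤ 2 ^ (β / 2) * r ^ (β / 2) := by
      rw [← Real.mul_rpow (by norm_num) hr.le]
      exact Real.rpow_le_rpow (hsr j).1.le (by rw [pow_succ] at hj1; linarith) (by positivity)
    have k4 : B * q ^ j = D * Real.sqrt M * (h * 2⁻¹ ^ j) ^ (β / 2) := by
      rw [hpowj, hB]; ring
    have hDM : 0 ≤ D * Real.sqrt M := by positivity
    have h1q : 0 < 1 - q := by linarith
    rw [k4, div_eq_mul_inv] at k2
    have k5 : |m r - a| ≤ |s j - m r| + |s j - a| := by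
      have := abs_sub_le (m r) (s j) a
      rwa [abs_sub_comm (m r) (s j)] at this
    calc |m r - a| ≤ D * Real.sqrt M * (h * 2⁻¹ ^ j) ^ (β / 2) * (1 + (1 - q)⁻¹) := by
          rw [mul_add, mul_one]; exact k5.trans (add_le_add k1 k2)
      _ ≤ D * Real.sqrt M * (2 ^ (β / 2) * r ^ (β / 2)) * (1 + (1 - q)⁻¹) := by gcongr
      _ = _ := by rw [hE]; ring
  refine ⟨a, fun r hr hrh => ?_⟩
  calc ∫⁻ y in Metric.ball x r ∩ U, ‖w y - a‖ₑ ^ 2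
      = ∫⁻ y in Metric.ball x r ∩ U, ‖(w y - m r) + (m r - a)‖ₑ ^ 2 := by
        refine lintegral_congr fun y => ?_
        rw [sub_add_sub_cancel]
    _ ≤ 2 * (∫⁻ y in Metric.ball x r ∩ U, ‖w y - m r‖ₑ ^ 2) +
          2 * ∫⁻ y in Metric.ball x r ∩ U, ‖m r - a‖ₑ ^ 2 :=
        lintegral_enorm_add_sq_le ((hwm r).sub aestronglyMeasurable_const)
    _ ≤ 2 * ENNReal.ofReal (c⁻¹ * M * (r ^ d * r ^ β)) +
          2 * ENNReal.ofReal ((D * Real.sqrt M * E * r ^ (β / 2)) ^ 2 * (unitBallVol d * r ^ d)) := by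
        refine add_le_add (mul_le_mul' le_rfl (s1 r hr hrh)) (mul_le_mul' le_rfl ?_)
        rw [setLIntegral_const, ENNReal.ofReal_mul (by positivity), ← volume_ball_eq hd x hr.le,
          ← ofReal_sq_eq_enorm]
        refine mul_le_mul' (ENNReal.ofReal_le_ofReal ?_) (measure_mono inter_subset_left)
        rw [← sq_abs]
        exact pow_le_pow_left₀ (abs_nonneg _) (s5 r hr hrh) 2
    _ = _ := by
        rw [two_mul_ofReal_add (by positivity) (by positivity)]
        congr 1
        have e1 : (D * Real.sqrt M * E * r ^ (β / 2)) ^ 2 = D ^ 2 * M * E ^ 2 * r ^ β := by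
          rw [mul_pow, mul_pow, mul_pow, Real.sq_sqrt hM, ← Real.rpow_natCast (r ^ (β / 2)),
            ← Real.rpow_mul hr.le]
          norm_num
        rw [e1]; ring

end

section

variable {d : ℕ}

/-! ### Traces on the faces of a simplex -/

variable {K : Finset (Pt d)} {p : Pt d} {v w a b : Pt d → ℝ} {t : ℝ}

lemma IsSimplex.fat (h : IsSimplex K) {x : Pt d} (hx : x ∈ hull K) : Fat (elt K) x := by
  intro r hr h0
  rw [← h.closure_elt, Metric.mem_closure_iff] at hx
  obtain ⟨y, hy, hxy⟩ := hx r hr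
  have h1 : (Metric.ball x r ∩ elt K).Nonempty := ⟨y, by rwa [Metric.mem_ball, dist_comm], hy⟩
  exact ((Metric.isOpen_ball.inter (isOpen_elt K)).measure_pos volume h1).ne' h0

/-- Measurability in the centre comes from Fubini's theorem, applied to the indicator of the set of
pairs `(x, y)` with `dist y x < r` and `y ∈ U`. -/
lemma stronglyMeasurable_average_ball (hw : Measurable w) {U : Set (Pt d)} (hU : MeasurableSet U)
    (r : ℝ) : StronglyMeasurable fun x => ⨍ y in Metric.ball x r ∩ U, w y := by
  have hS : MeasurableSet {q : Pt d × Pt d | dist q.2 q.1 < r ∧ q.2 ∈ U} :=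
    (measurableSet_lt (f := fun q : Pt d × Pt d => dist q.2 q.1) (by fun_prop)
      measurable_const).inter (hU.preimage measurable_snd)
  have key : ∀ f : Pt d → ℝ, Measurable f →
      StronglyMeasurable fun x => ∫ y in Metric.ball x r ∩ U, f y := by
    intro f hf
    have h1 : StronglyMeasurable ({q : Pt d × Pt d | dist q.2 q.1 < r ∧ q.2 ∈ U}.indicator
        fun q => f q.2) := ((hf.comp measurable_snd).indicator hS).stronglyMeasurable
    have h2 := h1.integral_prod_right' (ν := volume)
    convert h2 using 2 with x
    rw [← integral_indicator (Metric.isOpen_ball.measurableSet.inter hU)]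
    rfl
  have h1 := key w hw
  have h2 := key (fun _ => 1) measurable_const
  have : (fun x => ⨍ y in Metric.ball x r ∩ U, w y) = fun x =>
      (∫ y in Metric.ball x r ∩ U, (1 : ℝ))⁻¹ * ∫ y in Metric.ball x r ∩ U, w y := by
    funext x
    rw [setAverage_eq]; simp
  rw [this]
  exact (h2.measurable.inv.mul h1.measurable).stronglyMeasurable

/-- At almost every point the trace is the limit of the averages with radius `1 / (n + 1)`, each of
which is measurable after passing to a measurable representative. -/
lemma aestronglyMeasurable_trace {U : Set (Pt d)} (hU : MeasurableSet U)
    (hwm : AEStronglyMeasurable w (volume.restrict U)) (hw : IntegrableOn w U) {μ : Measure (Pt d)}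
    (hfat : ∀ᵐ x ∂μ, Fat U x) (h : ∀ᵐ x ∂μ, ∃ a, HasStrongValue U w x a) :
    AEStronglyMeasurable (trace U w) μ := by
  have hc := hwm.ae_eq_mk
  have hm := hwm.stronglyMeasurable_mk.measurable
  refine aestronglyMeasurable_of_tendsto_ae (atTop : Filter ℕ)
    (f := fun n x => ⨍ y in Metric.ball x (1 / ((n : ℝ) + 1)) ∩ U, hwm.mk w y)
    (fun n => (stronglyMeasurable_average_ball hm hU _).aestronglyMeasurable) ?_
  filter_upwards [hfat, h] with x hx ⟨a, ha⟩
  rw [ha.trace_eq hx hw]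
  have h1 := (ha.congr hc).tendsto_average hx (hw.congr hc)
  refine h1.comp ?_
  rw [tendsto_nhdsWithin_iff]
  exact ⟨tendsto_one_div_add_atTop_nhds_zero_nat, Eventually.of_forall fun n => by
    simp only [mem_Ioi]; positivity⟩

/-- The layer of a simplex near the face opposite to `p`. -/
def strip (K : Finset (Pt d)) (p : Pt d) (ε : ℝ) : Set (Pt d) := {y | y ∈ elt K ∧ bary K p y < ε}

lemma measurableSet_strip (K : Finset (Pt d)) (p : Pt d) (ε : ℝ) : MeasurableSet (strip K p ε) :=
  (isOpen_elt K).measurableSet.inter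
    (measurableSet_lt (continuous_bary (K := K) p).measurable measurable_const)

lemma strip_subset (K : Finset (Pt d)) (p : Pt d) (ε : ℝ) : strip K p ε ⊆ elt K := fun _ h => h.1

variable [DecidableEq (Pt d)]

/-- The function `a` is the trace of `w` on the face of `K` opposite to `p`: pointwise, as a limit
of mean values, and as a limit of the values of `w` near the face. -/
structure HasFaceTrace (K : Finset (Pt d)) (p : Pt d) (w a : Pt d → ℝ) : Prop where
  memLp_elt : MemLp w 2 (volume.restrict (elt K))
  memLp : MemLp a 2 ((surf d).restrict (hull (K.erase p)))
  value : ∀ᵐ x ∂(surf d).restrict (hull (K.erase p)), HasStrongValue (elt K) w x (a x)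
  strip : Tendsto (fun ε : ℝ => ENNReal.ofReal ε⁻¹ *
    ∫⁻ y in strip K p ε, ‖w y - a (faceProj K p y)‖ₑ ^ 2) (𝓝[>] 0) (𝓝 0)

omit [DecidableEq (Pt d)] in
lemma measurableSet_hull (e : Finset (Pt d)) : MeasurableSet (hull e) :=
  (isCompact_hull e).isClosed.measurableSet

/-- In the coordinates of `liftFace` the projection is `(t, x) ↦ x`, so by Fubini preimages of null
sets are null. Hence composing a function on the face with the projection respects almost everywhere
equality. -/
lemma IsSimplex.quasiMeasurePreserving_faceProj (h : IsSimplex K) (hd : 1 ≤ d) (hp : p ∈ K) :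
    Measure.QuasiMeasurePreserving (faceProj K p) (volume.restrict (elt K))
      ((surf d).restrict (hull (K.erase p))) := by
  have := h.isFiniteMeasure_surf hd hp
  refine ⟨measurable_faceProj K p, ?_⟩
  refine Measure.AbsolutelyContinuous.mk fun S hS h0 => ?_
  have hmp := h.measurePreserving_liftFace hd hp
  rw [Measure.map_apply (measurable_faceProj K p) hS,
    ← hmp.measure_preimage (measurable_faceProj K p hS).nullMeasurableSet]
  refine le_antisymm ((Measure.restrict_apply_le _ _).trans ?_) bot_le
  rw [Measure.smul_apply, Measure.prod_apply
    (measurable_liftFace K p (measurable_faceProj K p hS))]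
  refine le_of_eq ?_
  rw [lintegral_congr (g := fun _ => 0) fun t => ?_]
  · simp
  · rw [← h0]
    refine measure_congr ?_
    filter_upwards [ae_restrict_mem (measurableSet_hull (K.erase p))] with x hx
    have := h.faceProj_liftFace hd hp (h.hull_erase_subset hp hx) t
    exact propext (by change faceProj K p (liftFace K p (t, x)) ∈ S ↔ x ∈ S; rw [this])

lemma HasFaceTrace.trace_eq (h : IsSimplex K) (ht : HasFaceTrace K p w a) :
    trace (elt K) w =ᵐ[(surf d).restrict (hull (K.erase p))] a := by
  filter_upwards [ht.value, ae_restrict_mem (measurableSet_hull (K.erase p))] with x hx hxe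
  exact hx.trace_eq (h.fat (hull_mono (K.erase_subset p) hxe))
    (ht.memLp_elt.integrable (by norm_num))

lemma HasFaceTrace.congr (ht : HasFaceTrace K p v a) (hvw : v =ᵐ[volume.restrict (elt K)] w) :
    HasFaceTrace K p w a := by
  refine ⟨(memLp_congr_ae hvw).1 ht.memLp_elt, ht.memLp, ht.value.mono fun x hx => hx.congr hvw, ?_⟩
  refine ht.strip.congr fun ε => ?_
  congr 1
  refine lintegral_congr_ae ?_
  filter_upwards [ae_restrict_of_ae_restrict_of_subset (strip_subset K p ε) hvw] with y hy
  rw [hy]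

lemma HasFaceTrace.congr_trace (h : IsSimplex K) (hd : 1 ≤ d) (hp : p ∈ K)
    (ht : HasFaceTrace K p v a) (hab : a =ᵐ[(surf d).restrict (hull (K.erase p))] b) :
    HasFaceTrace K p v b := by
  refine ⟨ht.memLp_elt, (memLp_congr_ae hab).1 ht.memLp, ?_, ?_⟩
  · filter_upwards [ht.value, hab] with x hx hx'
    rwa [← hx']
  · refine ht.strip.congr fun ε => ?_
    congr 1
    refine lintegral_congr_ae ?_
    have := (h.quasiMeasurePreserving_faceProj hd hp).ae_eq_comp hab
    filter_upwards [ae_restrict_of_ae_restrict_of_subset (strip_subset K p ε) this] with y hy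
    simp only [Function.comp] at hy
    rw [hy]

lemma HasFaceTrace.aestronglyMeasurable_comp (h : IsSimplex K) (hd : 1 ≤ d) (hp : p ∈ K)
    (ht : HasFaceTrace K p w a) :
    AEStronglyMeasurable (fun y => a (faceProj K p y)) (volume.restrict (elt K)) :=
  ht.memLp.1.comp_quasiMeasurePreserving (h.quasiMeasurePreserving_faceProj hd hp)

lemma HasFaceTrace.add (h : IsSimplex K) (hd : 1 ≤ d) (hp : p ∈ K)
    (h1 : HasFaceTrace K p v a) (h2 : HasFaceTrace K p w b) :
    HasFaceTrace K p (v + w) (a + b) := by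
  refine ⟨h1.memLp_elt.add h2.memLp_elt, h1.memLp.add h2.memLp, ?_, ?_⟩
  · filter_upwards [h1.value, h2.value] with x hx1 hx2
    exact hx1.add h1.memLp_elt.1 hx2
  · have h3 := (ENNReal.Tendsto.const_mul (a := 2) h1.strip (by simp)).add
      (ENNReal.Tendsto.const_mul (a := 2) h2.strip (by simp))
    simp only [mul_zero, add_zero] at h3
    refine tendsto_of_tendsto_of_tendsto_of_le_of_le tendsto_const_nhds h3 (fun _ => bot_le)
      fun ε => ?_
    have h4 := lintegral_enorm_add_sq_le (μ := volume.restrict (HDG.strip K p ε))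
      (f := fun y => v y - a (faceProj K p y)) (g := fun y => w y - b (faceProj K p y))
      ((h1.memLp_elt.1.sub (h1.aestronglyMeasurable_comp h hd hp)).mono_set (strip_subset K p ε))
    have e : ∀ y, (v + w) y - (a + b) (faceProj K p y)
        = (v y - a (faceProj K p y)) + (w y - b (faceProj K p y)) := fun y => by
      simp only [Pi.add_apply]; ring
    simp_rw [e]
    exact (mul_le_mul' le_rfl h4).trans_eq (by ring)

omit [DecidableEq (Pt d)] in
/-- A continuous function on a simplex is bounded. -/
lemma exists_bound_hull {θ : Pt d → ℝ} (hθ : ContinuousOn θ (hull K)) :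
    ∃ C, 0 ≤ C ∧ ∀ y ∈ hull K, |θ y| ≤ C := by
  obtain ⟨C, hC⟩ := (isCompact_hull K).exists_bound_of_continuousOn hθ
  exact ⟨max C 0, le_max_right _ _, fun y hy => (hC y hy).trans (le_max_left _ _)⟩

omit [DecidableEq (Pt d)] in
lemma memLp_mul_continuousOn {θ : Pt d → ℝ} {S : Set (Pt d)} (hS : MeasurableSet S)
    (hSK : S ⊆ hull K) (hθ : ContinuousOn θ (hull K)) {μ : Measure (Pt d)}
    (hw : MemLp w 2 (μ.restrict S)) : MemLp (fun y => θ y * w y) 2 (μ.restrict S) := by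
  obtain ⟨C, hC0, hC⟩ := exists_bound_hull hθ
  refine hw.of_le_mul (c := C) (((hθ.mono hSK).aestronglyMeasurable hS).mul hw.1) ?_
  rw [ae_restrict_iff' hS]
  refine Eventually.of_forall fun y hy => ?_
  rw [norm_mul]
  gcongr
  exact hC y (hSK hy)

/-- In the coordinates of `liftFace` the strip lies in `0 < t < ε`, and the integrand does not
depend on `t`. There is only an inequality because the segment above a point close to the rim of the
face may leave the element before height `ε`. -/
lemma IsSimplex.strip_integral_le (h : IsSimplex K) (hd : 1 ≤ d) (hp : p ∈ K) {g : Pt d → ℝ≥0∞}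
    (hg : Measurable g) (ε : ℝ) :
    ∫⁻ y in strip K p ε, g (faceProj K p y) ≤
      ENNReal.ofReal ‖baryGrad K p‖⁻¹ * (ENNReal.ofReal ε *
        ∫⁻ x in hull (K.erase p), g x ∂(surf d)) := by
  have := h.isFiniteMeasure_surf hd hp
  have hmp := h.measurePreserving_liftFace hd hp
  have hgm : Measurable fun y => g (faceProj K p y) := hg.comp (measurable_faceProj K p)
  have hs := measurableSet_strip K p ε
  have e1 : ∫⁻ y in strip K p ε, g (faceProj K p y)
      = ∫⁻ y in elt K, (strip K p ε).indicator (fun y => g (faceProj K p y)) y := by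
    rw [lintegral_indicator hs, Measure.restrict_restrict hs,
      inter_eq_left.2 (strip_subset K p ε)]
  rw [e1, ← hmp.lintegral_comp (hgm.indicator hs), Measure.restrict_smul, lintegral_smul_measure,
    smul_eq_mul]
  gcongr
  have hm2 : MeasurableSet (Ioo 0 ε ×ˢ (univ : Set (Pt d))) := measurableSet_Ioo.prod .univ
  calc ∫⁻ q in liftFace K p ⁻¹' elt K,
        (strip K p ε).indicator (fun y => g (faceProj K p y)) (liftFace K p q)
          ∂(volume.prod ((surf d).restrict (hull (K.erase p))))
      ≤ ∫⁻ q, (strip K p ε).indicator (fun y => g (faceProj K p y)) (liftFace K p q)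
          ∂(volume.prod ((surf d).restrict (hull (K.erase p)))) := setLIntegral_le_lintegral _ _
    _ = ∫⁻ s : ℝ, ∫⁻ x in hull (K.erase p),
          (strip K p ε).indicator (fun y => g (faceProj K p y)) (liftFace K p (s, x)) ∂(surf d) :=
        lintegral_prod _ ((hgm.indicator hs).comp (measurable_liftFace K p)).aemeasurable
    _ ≤ ∫⁻ s : ℝ, (Ioo 0 ε).indicator
          (fun _ => ∫⁻ x in hull (K.erase p), g x ∂(surf d)) s := by
        refine lintegral_mono fun s => ?_
        by_cases hsε : s ∈ Ioo 0 ε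
        · rw [indicator_of_mem hsε]
          refine setLIntegral_mono' (measurableSet_hull _) fun x hx => ?_
          have hx0 := h.hull_erase_subset hp hx
          refine (indicator_le_self _ _ _).trans_eq ?_
          rw [h.faceProj_liftFace hd hp hx0]
        · rw [indicator_of_notMem hsε]
          refine le_of_eq ?_
          rw [setLIntegral_congr_fun (g := fun _ => 0) (measurableSet_hull _) fun x hx => ?_]
          · simp
          · have hx0 := h.hull_erase_subset hp hx
            refine indicator_of_notMem (fun hmem => hsε ?_) _
            have h1 := hmem.1
            rw [h.elt_eq] at h1
            have h2 := h1 p hp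
            have h3 := hmem.2
            rw [h.bary_liftFace hd hp hx0] at h2 h3
            exact ⟨h2, h3⟩
    _ = _ := by
        rw [lintegral_indicator measurableSet_Ioo, setLIntegral_const]
        simp [mul_comm]

lemma IsSimplex.strip_integral_le' (h : IsSimplex K) (hd : 1 ≤ d) (hp : p ∈ K) {g : Pt d → ℝ≥0∞}
    (hg : AEMeasurable g ((surf d).restrict (hull (K.erase p)))) (ε : ℝ) :
    ∫⁻ y in strip K p ε, g (faceProj K p y) ≤
      ENNReal.ofReal ‖baryGrad K p‖⁻¹ * (ENNReal.ofReal ε *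
        ∫⁻ x in hull (K.erase p), g x ∂(surf d)) := by
  have h1 := (h.quasiMeasurePreserving_faceProj hd hp).ae_eq_comp hg.ae_eq_mk
  rw [lintegral_congr_ae hg.ae_eq_mk]
  refine le_trans (le_of_eq ?_) (h.strip_integral_le hd hp hg.measurable_mk ε)
  exact lintegral_congr_ae (ae_restrict_of_ae_restrict_of_subset (strip_subset K p ε) h1)

lemma norm_sub_faceProj (K : Finset (Pt d)) (p y : Pt d) :
    ‖y - faceProj K p y‖ = |bary K p y| * ‖apexDir K p‖ := by
  rw [faceProj, sub_sub_cancel, norm_smul, Real.norm_eq_abs]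

/-- With `π` the projection, write `θ w - (θ a) ∘ π = θ (w - a ∘ π) + (θ - θ ∘ π) (a ∘ π)`. The
first term is controlled by the bound of `θ`; the second is small by uniform continuity, as `y` and
`π y` are at distance at most `ε * ‖apexDir K p‖` in the strip. -/
lemma HasFaceTrace.mul_continuous (h : IsSimplex K) (hd : 1 ≤ d) (hp : p ∈ K) {θ : Pt d → ℝ}
    (hθ : ContinuousOn θ (hull K)) (ht : HasFaceTrace K p w a) :
    HasFaceTrace K p (fun y => θ y * w y) (fun x => θ x * a x) := by
  have hE : hull (K.erase p) ⊆ hull K := hull_mono (K.erase_subset p)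
  refine ⟨memLp_mul_continuousOn (isOpen_elt K).measurableSet (elt_subset_hull K) hθ ht.memLp_elt,
    memLp_mul_continuousOn (measurableSet_hull _) hE hθ ht.memLp, ?_, ?_⟩
  · obtain ⟨C, hC0, hC⟩ := exists_bound_hull hθ
    filter_upwards [ht.value, ae_restrict_mem (measurableSet_hull (K.erase p))] with x hx hxe
    refine hx.mul_continuous (isOpen_elt K).measurableSet (h.fat (hE hxe)) (C := C) ?_
      (fun y hy => hC y (elt_subset_hull K hy)) ht.memLp_elt.1
    exact (hθ x (hE hxe)).mono (insert_subset (hE hxe) (elt_subset_hull K))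
  · obtain ⟨C, hC0, hC⟩ := exists_bound_hull hθ
    have hac := ht.aestronglyMeasurable_comp h hd hp
    -- the part with the variation of `θ`
    have key : Tendsto (fun ε : ℝ => ENNReal.ofReal ε⁻¹ * ∫⁻ y in HDG.strip K p ε,
        ‖(θ y - θ (faceProj K p y)) * a (faceProj K p y)‖ₑ ^ 2) (𝓝[>] 0) (𝓝 0) := by
      set I := ENNReal.ofReal ‖baryGrad K p‖⁻¹ * ∫⁻ x in hull (K.erase p), ‖a x‖ₑ ^ 2 ∂(surf d)
      have hI : I ≠ ⊤ := by
        refine ENNReal.mul_ne_top ENNReal.ofReal_ne_top ?_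
        have := (MemLp.eLpNorm_lt_top ht.memLp)
        rw [eLpNorm_lt_top_iff_lintegral_rpow_enorm_lt_top (by norm_num) (by norm_num)] at this
        simpa using this.ne
      have huc := (isCompact_hull K).uniformContinuousOn_of_continuous hθ
      rw [Metric.uniformContinuousOn_iff] at huc
      have hlim : Tendsto (fun δ : ℝ => ENNReal.ofReal (δ ^ 2) * I) (𝓝[>] 0) (𝓝 0) := by
        have : Tendsto (fun δ : ℝ => ENNReal.ofReal (δ ^ 2)) (𝓝 0) (𝓝 0) := by
          have : Continuous fun δ : ℝ => ENNReal.ofReal (δ ^ 2) :=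
            ENNReal.continuous_ofReal.comp (continuous_pow 2)
          simpa using this.tendsto 0
        simpa using (ENNReal.Tendsto.mul_const this (Or.inr hI)).mono_left nhdsWithin_le_nhds
      rw [ENNReal.tendsto_nhds_zero]
      intro η hη
      obtain ⟨δ, hδη, hδ⟩ := (((ENNReal.tendsto_nhds_zero.1 hlim) η hη).and
        self_mem_nhdsWithin).exists
      obtain ⟨ρ, hρ, hρθ⟩ := huc δ hδ
      have hpos : 0 < ρ / (‖apexDir K p‖ + 1) := by positivity
      filter_upwards [Ioo_mem_nhdsGT hpos] with ε hε
      refine le_trans ?_ hδη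
      calc _ ≤ ENNReal.ofReal ε⁻¹ * ∫⁻ y in HDG.strip K p ε,
            ENNReal.ofReal (δ ^ 2) * ‖a (faceProj K p y)‖ₑ ^ 2 := by
            refine mul_le_mul' le_rfl ?_
            refine setLIntegral_mono' (measurableSet_strip K p ε) fun y hy => ?_
            rw [enorm_mul, mul_pow]
            gcongr
            rw [← ofReal_norm_sq]
            gcongr
            have hyK := elt_subset_hull K hy.1
            refine (hρθ y hyK _ (hE (h.faceProj_mem hd hp hyK)) ?_).le
            rw [dist_eq_norm, norm_sub_faceProj]
            have hb0 : 0 ≤ bary K p y := by rw [h.hull_eq] at hyK; exact hyK p hp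
            rw [abs_of_nonneg hb0]
            have h1 := hy.2
            have h2 := hε.2
            rw [lt_div_iff₀ (by positivity)] at h2
            have h3 := norm_nonneg (apexDir K p)
            nlinarith [hε.1]
        _ = ENNReal.ofReal ε⁻¹ * (ENNReal.ofReal (δ ^ 2) *
              ∫⁻ y in HDG.strip K p ε, ‖a (faceProj K p y)‖ₑ ^ 2) := by
            rw [lintegral_const_mul' _ _ ENNReal.ofReal_ne_top]
        _ ≤ ENNReal.ofReal ε⁻¹ * (ENNReal.ofReal (δ ^ 2) * (ENNReal.ofReal ‖baryGrad K p‖⁻¹ *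
              (ENNReal.ofReal ε * ∫⁻ x in hull (K.erase p), ‖a x‖ₑ ^ 2 ∂(surf d)))) := by
            gcongr
            exact h.strip_integral_le' hd hp (g := fun x => ‖a x‖ₑ ^ 2)
              (ht.memLp.1.enorm.pow_const 2) ε
        _ = (ENNReal.ofReal ε⁻¹ * ENNReal.ofReal ε) * (ENNReal.ofReal (δ ^ 2) * I) := by ring
        _ = _ := by
            rw [← ENNReal.ofReal_mul (inv_nonneg.2 hε.1.le), inv_mul_cancel₀ hε.1.ne']; simp
    have h3 := (ENNReal.Tendsto.const_mul (a := 2 * ENNReal.ofReal (C ^ 2)) ht.strip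
      (Or.inr (ENNReal.mul_ne_top (by simp) ENNReal.ofReal_ne_top))).add
      (ENNReal.Tendsto.const_mul (a := 2) key (by simp))
    simp only [mul_zero, add_zero] at h3
    refine tendsto_of_tendsto_of_tendsto_of_le_of_le tendsto_const_nhds h3 (fun _ => bot_le)
      fun ε => ?_
    have hm : AEMeasurable (fun y => ‖w y - a (faceProj K p y)‖ₑ ^ 2)
        (volume.restrict (HDG.strip K p ε)) :=
      (((ht.memLp_elt.1.sub hac).mono_set (strip_subset K p ε)).enorm.pow_const 2)
    have h4 : ∫⁻ y in HDG.strip K p ε,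
          ‖θ y * w y - θ (faceProj K p y) * a (faceProj K p y)‖ₑ ^ 2 ≤
        2 * ENNReal.ofReal (C ^ 2) *
            (∫⁻ y in HDG.strip K p ε, ‖w y - a (faceProj K p y)‖ₑ ^ 2) +
          2 * ∫⁻ y in HDG.strip K p ε,
            ‖(θ y - θ (faceProj K p y)) * a (faceProj K p y)‖ₑ ^ 2 := by
      rw [← lintegral_const_mul'' _ hm, ← lintegral_const_mul' _ _ (by simp),
        ← lintegral_add_left' (hm.const_mul _)]
      refine setLIntegral_mono' (measurableSet_strip K p ε) fun y hy => ?_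
      have e : θ y * w y - θ (faceProj K p y) * a (faceProj K p y)
          = θ y * (w y - a (faceProj K p y))
            + (θ y - θ (faceProj K p y)) * a (faceProj K p y) := by ring
      rw [e]
      refine (enorm_add_sq_le _ _).trans ?_
      gcongr ?_ + _
      rw [mul_assoc, enorm_mul, mul_pow]
      gcongr
      rw [← ofReal_norm_sq]
      gcongr
      exact hC y (elt_subset_hull K hy.1)
    exact (mul_le_mul' le_rfl h4).trans_eq (by ring)

end

section

variable {d : ℕ}

/-! ### The trace theorem -/

variable {K : Finset (Pt d)} {p : Pt d} {v w a b : Pt d → ℝ} {t : ℝ}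

/-- The inner integral of the Slobodeckij seminorm. -/
def slobInner (U : Set (Pt d)) (t : ℝ) (w : Pt d → ℝ) (y : Pt d) : ℝ≥0∞ :=
  ∫⁻ z in U, ENNReal.ofReal (|w y - w z| ^ 2 / ‖y - z‖ ^ ((d : ℝ) + 2 * t))

lemma measurable_slobInner (hw : Measurable w) (U : Set (Pt d)) :
    Measurable (slobInner U t w) :=
  (measurable_slob_kernel (t := t) hw).lintegral_prod_right'

/-- The Slobodeckij seminorm with a singular weight at the boundary point `x`. -/
def slobWeighted (U : Set (Pt d)) (t : ℝ) (w : Pt d → ℝ) (x : Pt d) : ℝ≥0∞ :=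
  ∫⁻ y in U, ENNReal.ofReal (dist x y ^ (-((d : ℝ) - 1 - (t - 1 / 2)))) * slobInner U t w y

lemma measurable_dist_rpow (m : ℝ) :
    Measurable fun q : Pt d × Pt d => ENNReal.ofReal (dist q.1 q.2 ^ m) :=
  ENNReal.measurable_ofReal.comp (Measurable.pow_const (by fun_prop) _)

lemma measurable_slobWeighted (hw : Measurable w) (U : Set (Pt d)) :
    Measurable (slobWeighted U t w) := by
  have : Measurable fun q : Pt d × Pt d =>
      ENNReal.ofReal (dist q.1 q.2 ^ (-((d : ℝ) - 1 - (t - 1 / 2)))) * slobInner U t w q.2 :=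
    (measurable_dist_rpow _).mul ((measurable_slobInner hw U).comp measurable_snd)
  exact this.lintegral_prod_right'

lemma le_of_ofReal_mul_le {c a b : ℝ} (hc : 0 < c) {X Y Z : ℝ≥0∞}
    (h : ENNReal.ofReal c * X ≤ 2 * (ENNReal.ofReal a * Y) + 2 * (ENNReal.ofReal b * Z)) :
    X ≤ ENNReal.ofReal (c⁻¹ * (2 * a)) * Y + ENNReal.ofReal (c⁻¹ * (2 * b)) * Z := by
  have hne0 : ENNReal.ofReal c ≠ 0 := by simpa using hc
  have e2 : (2 : ℝ≥0∞) = ENNReal.ofReal 2 := by simp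
  have hi : (0 : ℝ) ≤ c⁻¹ := by positivity
  calc X = (ENNReal.ofReal c)⁻¹ * (ENNReal.ofReal c * X) := by
        rw [← mul_assoc, ENNReal.inv_mul_cancel hne0 ENNReal.ofReal_ne_top, one_mul]
    _ ≤ _ := mul_le_mul' le_rfl h
    _ = _ := by
        rw [← ENNReal.ofReal_inv_of_pos hc, e2, ENNReal.ofReal_mul hi, ENNReal.ofReal_mul hi,
          ENNReal.ofReal_mul (by norm_num), ENNReal.ofReal_mul (by norm_num)]
        ring

lemma lintegral_ball_le_slobInner {U : Set (Pt d)} (ht : 0 < t) {y : Pt d}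
    {r : ℝ} (hr : 0 < r) {S : Set (Pt d)} (hSU : S ⊆ U) (hS : MeasurableSet S)
    (hSr : ∀ z ∈ S, dist y z ≤ 2 * r) :
    ∫⁻ z in S, ‖w y - w z‖ₑ ^ 2 ≤
      ENNReal.ofReal ((2 * r) ^ ((d : ℝ) + 2 * t)) * slobInner U t w y := by
  rw [slobInner, ← lintegral_const_mul' _ _ ENNReal.ofReal_ne_top]
  refine le_trans ?_ (lintegral_mono_set hSU)
  refine setLIntegral_mono' hS fun z hz => ?_
  rw [← ENNReal.ofReal_mul (by positivity), ← ofReal_norm_sq, Real.norm_eq_abs]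
  refine ENNReal.ofReal_le_ofReal ?_
  rcases eq_or_ne y z with rfl | hne
  · simp
  · have hpos : 0 < ‖y - z‖ := norm_pos_iff.2 (sub_ne_zero.2 hne)
    have h1 : ‖y - z‖ ^ ((d : ℝ) + 2 * t) ≤ (2 * r) ^ ((d : ℝ) + 2 * t) :=
      Real.rpow_le_rpow hpos.le (by rw [← dist_eq_norm]; exact hSr z hz) (by positivity)
    rw [mul_div_assoc', le_div_iff₀ (by positivity), mul_comm]
    gcongr

/-- For `y`, `z` in `B(x, r)` both `2r / |y - z|` and `r / |x - y|` are at least one, so the powers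
`d + 2t` and `d - 1 - (t - 1/2)` of them can be inserted. These exponents add up to `2d + (t -
1/2)`: the size of the product of two balls and a decay of order `t - 1/2`. Since `x ∉ U`, the
distance `|x - y|` is positive. -/
lemma oscillation_le {U : Set (Pt d)} (hU : MeasurableSet U) (hd : 2 ≤ d) (ht0 : 1 / 2 < t)
    (ht1 : t < 1) {x : Pt d} (hx : x ∉ U) {r : ℝ} (hr : 0 < r) :
    ∫⁻ y in Metric.ball x r ∩ U, ∫⁻ z in Metric.ball x r ∩ U, ‖w y - w z‖ₑ ^ 2 ≤
      ENNReal.ofReal (2 ^ ((d : ℝ) + 2 * t) * (r ^ d * r ^ d * r ^ (t - 1 / 2))) *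
        slobWeighted U t w x := by
  have hd' : (2 : ℝ) ≤ d := by exact_mod_cast hd
  have hB : MeasurableSet (Metric.ball x r ∩ U) := Metric.isOpen_ball.measurableSet.inter hU
  calc _ ≤ ∫⁻ y in Metric.ball x r ∩ U, ENNReal.ofReal ((2 * r) ^ ((d : ℝ) + 2 * t)) *
        (ENNReal.ofReal (r ^ ((d : ℝ) - 1 - (t - 1 / 2))) *
          (ENNReal.ofReal (dist x y ^ (-((d : ℝ) - 1 - (t - 1 / 2)))) * slobInner U t w y)) := by
        refine setLIntegral_mono' hB fun y hy => ?_
        refine (lintegral_ball_le_slobInner (t := t) (by linarith) hr inter_subset_right hB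
          fun z hz => ?_).trans ?_
        · have h1 := Metric.mem_ball.1 hy.1
          have h2 := Metric.mem_ball'.1 hz.1
          linarith [dist_triangle y x z]
        · refine mul_le_mul' le_rfl ?_
          rw [← mul_assoc, ← ENNReal.ofReal_mul (by positivity)]
          refine le_mul_of_one_le_left (by positivity) ?_
          rw [ENNReal.one_le_ofReal]
          have hpos : 0 < dist x y := dist_pos.2 fun h => hx (h ▸ hy.2)
          rw [Real.rpow_neg hpos.le, ← div_eq_mul_inv, one_le_div (by positivity)]
          exact Real.rpow_le_rpow hpos.le (Metric.mem_ball'.1 hy.1).le (by linarith)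
    _ = ENNReal.ofReal ((2 * r) ^ ((d : ℝ) + 2 * t)) *
        (ENNReal.ofReal (r ^ ((d : ℝ) - 1 - (t - 1 / 2))) * ∫⁻ y in Metric.ball x r ∩ U,
          (ENNReal.ofReal (dist x y ^ (-((d : ℝ) - 1 - (t - 1 / 2)))) * slobInner U t w y)) := by
        rw [lintegral_const_mul' _ _ ENNReal.ofReal_ne_top,
          lintegral_const_mul' _ _ ENNReal.ofReal_ne_top]
    _ ≤ ENNReal.ofReal ((2 * r) ^ ((d : ℝ) + 2 * t)) *
        (ENNReal.ofReal (r ^ ((d : ℝ) - 1 - (t - 1 / 2))) * slobWeighted U t w x) := by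
        gcongr
        exact lintegral_mono_set inter_subset_right
    _ = _ := by
        rw [← mul_assoc, ← ENNReal.ofReal_mul (by positivity)]
        congr 2
        rw [Real.mul_rpow (by norm_num) hr.le, mul_assoc, ← Real.rpow_add hr,
          ← Real.rpow_natCast r d, ← Real.rpow_add hr, ← Real.rpow_add hr]
        congr 2; ring

/-- Existence of boundary values, with a rate of convergence. -/
lemma exists_trace_rate (hd : 2 ≤ d) {κ : ℝ} (hκ : 0 < κ) (ht0 : 1 / 2 < t) (ht1 : t < 1) :
    ∃ C : ℝ, 0 < C ∧ ∀ (K : Finset (Pt d)) (c : Pt d), IsSimplex K →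
      Metric.closedBall c (κ * size K) ⊆ hull K → ∀ w : Pt d → ℝ, Measurable w →
      MemLp w 2 (volume.restrict (elt K)) → ∀ x ∈ hull K, x ∉ elt K → ∀ r, 0 < r → r ≤ size K →
        ∫⁻ y in Metric.ball x r ∩ elt K, ‖w y - trace (elt K) w x‖ₑ ^ 2 ≤
          ENNReal.ofReal (C * (r ^ d * r ^ (t - 1 / 2))) * slobWeighted (elt K) t w x ∧
        (slobWeighted (elt K) t w x ≠ ⊤ →
          HasStrongValue (elt K) w x (trace (elt K) w x)) := by
  have hω := unitBallVol_pos d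
  set c₀ : ℝ := unitBallVol d * (κ / 2) ^ d with hc₀
  have hc₀p : 0 < c₀ := by positivity
  obtain ⟨C, hC, hmain⟩ := exists_value (d := d) (by omega) hc₀p (β := t - 1 / 2) (by linarith)
  refine ⟨C * 2 ^ ((d : ℝ) + 2 * t), by positivity, ?_⟩
  intro K c hK hc w hwm hw x hx hxe r hr hrK
  -- Nothing is claimed at points where the weighted seminorm is infinite; the right side of the
  -- estimate is then `⊤`.
  by_cases hG : slobWeighted (elt K) t w x = ⊤
  · rw [hG, ENNReal.mul_top (by rw [Ne, ENNReal.ofReal_eq_zero, not_le]; positivity)]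
    exact ⟨le_top, fun h => absurd rfl h⟩
  set M : ℝ := 2 ^ ((d : ℝ) + 2 * t) * (slobWeighted (elt K) t w x).toReal with hM
  have hM0 : 0 ≤ M := by positivity
  have hvol := fun r hr hrK => hK.volume_ball_inter_ge (by omega) hκ hc hx (r := r) hr hrK
  obtain ⟨a, ha⟩ := hmain (elt K) x (size K) M w (isOpen_elt K).measurableSet
    (hK.size_pos (by omega)) hM0 hvol (volume_elt_lt_top K).ne hw (fun r hr _ => by
      refine (oscillation_le (isOpen_elt K).measurableSet hd ht0 ht1 hxe hr).trans_eq ?_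
      rw [← ENNReal.ofReal_toReal hG, ← ENNReal.ofReal_mul (by positivity), hM]
      congr 1; ring)
  have hsv : HasStrongValue (elt K) w x a := by
    have hlim : Tendsto (fun r : ℝ => ENNReal.ofReal (c₀⁻¹ * (C * M) * r ^ (t - 1 / 2)))
        (𝓝[>] 0) (𝓝 0) := by
      have h1 : Tendsto (fun r : ℝ => r ^ (t - 1 / 2)) (𝓝[>] 0) (𝓝 0) := by
        have := (Real.continuousAt_rpow_const 0 (t - 1 / 2) (Or.inr (by linarith))).tendsto
        rw [Real.zero_rpow (by linarith)] at this
        exact this.mono_left nhdsWithin_le_nhds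
      have h2 := ENNReal.tendsto_ofReal (h1.const_mul (c₀⁻¹ * (C * M)))
      simpa using h2
    refine tendsto_of_tendsto_of_tendsto_of_le_of_le' tendsto_const_nhds hlim
      (Eventually.of_forall fun _ => bot_le) ?_
    filter_upwards [Ioc_mem_nhdsGT (hK.size_pos (by omega))] with r hr
    have hcr : 0 < c₀ * r ^ d := by have := hr.1; positivity
    calc _ ≤ (ENNReal.ofReal (c₀ * r ^ d))⁻¹ * ENNReal.ofReal (C * M * (r ^ d * r ^ (t - 1 / 2))) :=
          mul_le_mul' (ENNReal.inv_le_inv.2 (hvol r hr.1 hr.2)) (ha r hr.1 hr.2)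
      _ = _ := by
          rw [← ENNReal.ofReal_inv_of_pos hcr, ← ENNReal.ofReal_mul (by positivity)]
          congr 1
          have := hr.1
          field_simp
  have htr := hsv.trace_eq (hK.fat hx) (hw.integrable (by norm_num))
  rw [htr]
  refine ⟨(ha r hr hrK).trans_eq ?_, fun _ => hsv⟩
  rw [← ENNReal.ofReal_toReal hG, ← ENNReal.ofReal_mul (by positivity), hM]
  congr 1; ring

variable [DecidableEq (Pt d)]

/-- A constant in the estimate of the weighted seminorm. -/
def kernelConst (d : ℕ) (t : ℝ) : ℝ :=
  2 ^ ((d : ℝ) - 1 - (t - 1 / 2)) * (1 - 2 ^ (-(t - 1 / 2)))⁻¹ * surfBallConst d * 2 ^ (t - 1 / 2)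

omit [DecidableEq (Pt d)] in
lemma kernelConst_nonneg (d : ℕ) {t : ℝ} (ht0 : 1 / 2 < t) : 0 ≤ kernelConst d t := by
  have := one_sub_two_rpow_pos (β := t - 1 / 2) (by linarith)
  have := surfBallConst_nonneg d
  unfold kernelConst; positivity

/-- By Tonelli's theorem the singular kernel is integrated over the face first, for fixed `y` in the
element. -/
lemma IsSimplex.lintegral_face_weight_le (h : IsSimplex K) (hd : 2 ≤ d) (hp : p ∈ K) {β : ℝ}
    (hβ : 0 < β) (hβ1 : β < 1) {F : Pt d → ℝ≥0∞} (hF : Measurable F) :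
    ∫⁻ x in hull (K.erase p), (∫⁻ y in elt K,
      ENNReal.ofReal (dist x y ^ (-((d : ℝ) - 1 - β))) * F y) ∂(surf d) ≤
      ENNReal.ofReal (2 ^ ((d : ℝ) - 1 - β) * (1 - 2 ^ (-β))⁻¹ * surfBallConst d *
        (2 * size K) ^ β) * ∫⁻ y in elt K, F y := by
  have := h.isFiniteMeasure_surf (by omega) hp
  have hm : Measurable fun q : Pt d × Pt d =>
      ENNReal.ofReal (dist q.1 q.2 ^ (-((d : ℝ) - 1 - β))) * F q.2 :=
    (measurable_dist_rpow _).mul (hF.comp measurable_snd)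
  rw [lintegral_lintegral_swap hm.aemeasurable, ← lintegral_const_mul' _ _ ENNReal.ofReal_ne_top]
  refine setLIntegral_mono' (isOpen_elt K).measurableSet fun y hy => ?_
  have hm' : Measurable fun x : Pt d => ENNReal.ofReal (dist x y ^ (-((d : ℝ) - 1 - β))) :=
    ENNReal.measurable_ofReal.comp (Measurable.pow_const (by fun_prop) _)
  rw [lintegral_mul_const _ hm']
  exact mul_le_mul' (h.lintegral_kernel_face_le hd hp hy hβ (by linarith)) le_rfl

lemma IsSimplex.lintegral_slobWeighted_le (h : IsSimplex K) (hd : 2 ≤ d) (hp : p ∈ K)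
    (ht0 : 1 / 2 < t) (ht1 : t < 1) (hw : Measurable w) :
    ∫⁻ x in hull (K.erase p), slobWeighted (elt K) t w x ∂(surf d) ≤
      ENNReal.ofReal (kernelConst d t * size K ^ (t - 1 / 2)) * slobSq (elt K) t w := by
  have hK := h.size_pos (by omega)
  refine (h.lintegral_face_weight_le hd hp (β := t - 1 / 2) (by linarith) (by linarith)
    (measurable_slobInner hw (elt K))).trans_eq ?_
  rw [Real.mul_rpow (by norm_num) hK.le, kernelConst, ← mul_assoc]
  rfl

set_option maxHeartbeats 1000000 in
/-- The trace theorem for the space `H^t`, `1/2 < t < 1`, on a simplex, with the estimate in terms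
of the shape of the simplex, for measurable functions. -/
lemma trace_theorem_of_measurable (hd : 2 ≤ d) {κ : ℝ} (hκ : 0 < κ) (ht0 : 1 / 2 < t)
    (ht1 : t < 1) :
    ∃ C : ℝ, 0 < C ∧ ∀ (K : Finset (Pt d)) (c : Pt d), IsSimplex K →
      Metric.closedBall c (κ * size K) ⊆ hull K → ∀ p ∈ K, ∀ w : Pt d → ℝ, Measurable w →
      MemLp w 2 (volume.restrict (elt K)) → slobSq (elt K) t w ≠ ⊤ →
        HasFaceTrace K p w (trace (elt K) w) ∧
        ENNReal.ofReal (size K) *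
            ∫⁻ x in hull (K.erase p), ‖trace (elt K) w x‖ₑ ^ 2 ∂(surf d) ≤
          ENNReal.ofReal C * ((∫⁻ y in elt K, ‖w y‖ₑ ^ 2) +
            ENNReal.ofReal (size K ^ (2 * t)) * slobSq (elt K) t w) := by
  obtain ⟨C₁, hC₁, hrate⟩ := exists_trace_rate hd hκ ht0 ht1
  have hω := unitBallVol_pos d
  have hS := surfBallConst_nonneg d
  have hk := kernelConst_nonneg d ht0
  set c₀ : ℝ := unitBallVol d * (κ / 2) ^ d with hc₀
  have hc₀p : 0 < c₀ := by positivity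
  set A : ℝ := c₀⁻¹ * (2 * (surfBallConst d * 2 ^ (d - 1))) with hA
  set B : ℝ := c₀⁻¹ * (2 * C₁ * kernelConst d t) with hB
  refine ⟨A + B + 1, by positivity, ?_⟩
  intro K c hK hc p hp w hwm hw hslob
  have hKs := hK.size_pos (by omega : 1 ≤ d)
  have hfs := hK.isFiniteMeasure_surf (by omega : 1 ≤ d) hp
  have hE : hull (K.erase p) ⊆ hull K := hull_mono (K.erase_subset p)
  have hEe : ∀ x ∈ hull (K.erase p), x ∉ elt K := fun x hx => hK.notMem_elt_of_mem_hull_erase hp hx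
  have hGint := hK.lintegral_slobWeighted_le hd hp ht0 ht1 hwm
  set G := slobWeighted (elt K) t w with hG
  have hGm : Measurable G := measurable_slobWeighted hwm _
  have hGtop : ∫⁻ x in hull (K.erase p), G x ∂(surf d) ≠ ⊤ :=
    (hGint.trans_lt (ENNReal.mul_lt_top ENNReal.ofReal_lt_top hslob.lt_top)).ne
  have hvol := fun {x} (hx : x ∈ hull K) r hr hrK =>
    hK.volume_ball_inter_ge (by omega : 1 ≤ d) hκ hc hx (r := r) hr hrK
  have hstrong : ∀ᵐ x ∂(surf d).restrict (hull (K.erase p)),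
      HasStrongValue (elt K) w x (trace (elt K) w x) := by
    filter_upwards [ae_restrict_mem (measurableSet_hull (K.erase p)),
      ae_lt_top hGm hGtop] with x hx hGx
    exact (hrate K c hK hc w hwm hw x (hE hx) (hEe x hx) (size K) hKs le_rfl).2 hGx.ne
  have hwL2 : ∫⁻ y in elt K, ‖w y‖ₑ ^ 2 ≠ ⊤ := by
    have := hw.eLpNorm_lt_top
    rw [eLpNorm_lt_top_iff_lintegral_rpow_enorm_lt_top (by norm_num) (by norm_num)] at this
    simpa using this.ne
  -- the pointwise estimate of the trace
  have hpt : ∀ x ∈ hull (K.erase p), ‖trace (elt K) w x‖ₑ ^ 2 ≤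
      ENNReal.ofReal (c₀⁻¹ * 2 * (size K ^ d)⁻¹) * (∫⁻ y in elt K, ‖w y‖ₑ ^ 2) +
        ENNReal.ofReal (c₀⁻¹ * (2 * C₁) * size K ^ (t - 1 / 2)) * G x := by
    intro x hx
    have hV := hvol (hE hx) (size K) hKs le_rfl
    have hcr : 0 < c₀ * size K ^ d := by positivity
    have hr := (hrate K c hK hc w hwm hw x (hE hx) (hEe x hx) (size K) hKs le_rfl).1
    have h1 : ENNReal.ofReal (c₀ * size K ^ d) * ‖trace (elt K) w x‖ₑ ^ 2 ≤
        2 * (∫⁻ y in elt K, ‖w y‖ₑ ^ 2) +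
          2 * (ENNReal.ofReal (C₁ * (size K ^ d * size K ^ (t - 1 / 2))) * G x) := by
      calc _ ≤ volume (Metric.ball x (size K) ∩ elt K) * ‖trace (elt K) w x‖ₑ ^ 2 := by gcongr
        _ = ∫⁻ y in Metric.ball x (size K) ∩ elt K,
              ‖w y + (trace (elt K) w x - w y)‖ₑ ^ 2 := by
            have : ∀ y, w y + (trace (elt K) w x - w y) = trace (elt K) w x := fun y => by ring
            simp_rw [this]
            rw [setLIntegral_const, mul_comm]
        _ ≤ 2 * (∫⁻ y in Metric.ball x (size K) ∩ elt K, ‖w y‖ₑ ^ 2) +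
              2 * ∫⁻ y in Metric.ball x (size K) ∩ elt K, ‖trace (elt K) w x - w y‖ₑ ^ 2 :=
            lintegral_enorm_add_sq_le hwm.aestronglyMeasurable
        _ ≤ _ := by
            refine add_le_add (mul_le_mul' le_rfl (lintegral_mono_set inter_subset_right))
              (mul_le_mul' le_rfl (le_trans (le_of_eq ?_) hr))
            refine lintegral_congr fun y => ?_
            rw [← enorm_neg, neg_sub]
    refine (le_of_ofReal_mul_le (a := 1) hcr (by simpa using h1)).trans_eq ?_
    congr 3
    · field_simp
    · field_simp
  -- The pointwise estimate is integrated over the face. Its second term carries `size K ^ (t -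
  -- 1/2)`, the weighted seminorm contributes the same factor again, and with the leading `size K`
  -- this makes `size K ^ (2 * t)`.
  have hest : ENNReal.ofReal (size K) *
      ∫⁻ x in hull (K.erase p), ‖trace (elt K) w x‖ₑ ^ 2 ∂(surf d) ≤
        ENNReal.ofReal A * (∫⁻ y in elt K, ‖w y‖ₑ ^ 2) +
          ENNReal.ofReal B * (ENNReal.ofReal (size K ^ (2 * t)) * slobSq (elt K) t w) := by
    calc _ ≤ ENNReal.ofReal (size K) * ∫⁻ x in hull (K.erase p),
          (ENNReal.ofReal (c₀⁻¹ * 2 * (size K ^ d)⁻¹) * (∫⁻ y in elt K, ‖w y‖ₑ ^ 2) +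
          ENNReal.ofReal (c₀⁻¹ * (2 * C₁) * size K ^ (t - 1 / 2)) * G x) ∂(surf d) := by
          refine mul_le_mul' le_rfl ?_
          exact setLIntegral_mono' (measurableSet_hull _) hpt
      _ = ENNReal.ofReal (size K) * (ENNReal.ofReal (c₀⁻¹ * 2 * (size K ^ d)⁻¹) *
            (∫⁻ y in elt K, ‖w y‖ₑ ^ 2) * surf d (hull (K.erase p)) +
            ENNReal.ofReal (c₀⁻¹ * (2 * C₁) * size K ^ (t - 1 / 2)) *
              ∫⁻ x in hull (K.erase p), G x ∂(surf d)) := by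
          rw [lintegral_add_left measurable_const, setLIntegral_const,
            lintegral_const_mul _ hGm]
      _ ≤ ENNReal.ofReal (size K) * (ENNReal.ofReal (c₀⁻¹ * 2 * (size K ^ d)⁻¹) *
            (∫⁻ y in elt K, ‖w y‖ₑ ^ 2) *
              ENNReal.ofReal (surfBallConst d * (2 * size K) ^ (d - 1)) +
            ENNReal.ofReal (c₀⁻¹ * (2 * C₁) * size K ^ (t - 1 / 2)) *
              (ENNReal.ofReal (kernelConst d t * size K ^ (t - 1 / 2)) *
                slobSq (elt K) t w)) := by
          gcongr
          exact hK.surf_hull_le (by omega) hp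
      _ = (ENNReal.ofReal (size K) * ENNReal.ofReal (c₀⁻¹ * 2 * (size K ^ d)⁻¹) *
              ENNReal.ofReal (surfBallConst d * (2 * size K) ^ (d - 1))) *
              (∫⁻ y in elt K, ‖w y‖ₑ ^ 2) +
            (ENNReal.ofReal (size K) * ENNReal.ofReal (c₀⁻¹ * (2 * C₁) * size K ^ (t - 1 / 2)) *
              ENNReal.ofReal (kernelConst d t * size K ^ (t - 1 / 2))) *
                slobSq (elt K) t w := by ring
      _ = _ := by
          rw [← ENNReal.ofReal_mul hKs.le, ← ENNReal.ofReal_mul (by positivity),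
            ← ENNReal.ofReal_mul hKs.le, ← ENNReal.ofReal_mul (by positivity),
            ← mul_assoc (ENNReal.ofReal B), ← ENNReal.ofReal_mul (show 0 ≤ B by positivity)]
          congr 3
          · rw [hA]
            obtain ⟨m, rfl⟩ : ∃ m, d = m + 1 := ⟨d - 1, by omega⟩
            rw [add_tsub_cancel_right, mul_pow, pow_succ]
            field_simp
          · rw [hB]
            have : size K ^ (2 * t) = size K * size K ^ (t - 1 / 2) * size K ^ (t - 1 / 2) := by
              nth_rewrite 2 [← Real.rpow_one (size K)]
              rw [← Real.rpow_add hKs, ← Real.rpow_add hKs]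
              congr 1; ring
            rw [this]; ring
  have hmeas : AEStronglyMeasurable (trace (elt K) w) ((surf d).restrict (hull (K.erase p))) := by
    refine aestronglyMeasurable_trace (isOpen_elt K).measurableSet hw.1
      (hw.integrable (by norm_num)) ?_ (hstrong.mono fun x hx => ⟨_, hx⟩)
    filter_upwards [ae_restrict_mem (measurableSet_hull (K.erase p))] with x hx
    exact hK.fat (hE hx)
  have hL2 : ∫⁻ x in hull (K.erase p), ‖trace (elt K) w x‖ₑ ^ 2 ∂(surf d) ≠ ⊤ := by
    intro htop
    rw [htop, ENNReal.mul_top (by simpa using hKs)] at hest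
    refine absurd hest (not_le.2 (ENNReal.add_lt_top.2 ⟨?_, ?_⟩))
    · exact ENNReal.mul_lt_top ENNReal.ofReal_lt_top hwL2.lt_top
    · exact ENNReal.mul_lt_top ENNReal.ofReal_lt_top
        (ENNReal.mul_lt_top ENNReal.ofReal_lt_top hslob.lt_top)
  refine ⟨⟨hw, ⟨hmeas, ?_⟩, hstrong, ?_⟩, hest.trans ?_⟩
  · rw [eLpNorm_lt_top_iff_lintegral_rpow_enorm_lt_top (by norm_num) (by norm_num)]
    simpa using hL2.lt_top
  · -- convergence in the strip
    set L : ℝ := ‖apexDir K p‖ + 1 with hL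
    have hL0 : 0 < L := by positivity
    -- The value at `y` and the trace at its projection are both compared with `w z`, averaged over
    -- `z` in a ball of radius `L * ε` around the projection; `L` is chosen such that `y` lies in
    -- this ball.
    have hpw : ∀ ε : ℝ, 0 < ε → L * ε ≤ size K → ∀ y ∈ strip K p ε,
        ‖w y - trace (elt K) w (faceProj K p y)‖ₑ ^ 2 ≤
          ENNReal.ofReal (c₀⁻¹ * 2 * 2 ^ ((d : ℝ) + 2 * t) * (L * ε) ^ (2 * t)) *
              slobInner (elt K) t w y +
            ENNReal.ofReal (c₀⁻¹ * (2 * C₁) * (L * ε) ^ (t - 1 / 2)) * G (faceProj K p y) := by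
      intro ε hε hεK y hy
      set r := L * ε with hr
      have hr0 : 0 < r := by positivity
      have hyK := elt_subset_hull K hy.1
      set x := faceProj K p y with hx
      have hxe : x ∈ hull (K.erase p) := hK.faceProj_mem (by omega) hp hyK
      have hxy : dist x y < r := by
        rw [dist_comm, dist_eq_norm, hx, norm_sub_faceProj]
        have hb0 : 0 ≤ bary K p y := by rw [hK.hull_eq] at hyK; exact hyK p hp
        rw [abs_of_nonneg hb0]
        have h1 := hy.2
        have h3 := norm_nonneg (apexDir K p)
        nlinarith
      have hB : MeasurableSet (Metric.ball x r ∩ elt K) :=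
        Metric.isOpen_ball.measurableSet.inter (isOpen_elt K).measurableSet
      have hV := hvol (hE hxe) r hr0 hεK
      have hcr : 0 < c₀ * r ^ d := by positivity
      have hrr := (hrate K c hK hc w hwm hw x (hE hxe) (hEe x hxe) r hr0 hεK).1
      have h1 : ENNReal.ofReal (c₀ * r ^ d) * ‖w y - trace (elt K) w x‖ₑ ^ 2 ≤
          2 * (ENNReal.ofReal ((2 * r) ^ ((d : ℝ) + 2 * t)) * slobInner (elt K) t w y) +
            2 * (ENNReal.ofReal (C₁ * (r ^ d * r ^ (t - 1 / 2))) * G x) := by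
        calc _ ≤ volume (Metric.ball x r ∩ elt K) * ‖w y - trace (elt K) w x‖ₑ ^ 2 := by gcongr
          _ = ∫⁻ z in Metric.ball x r ∩ elt K,
                ‖(w y - w z) + (w z - trace (elt K) w x)‖ₑ ^ 2 := by
              simp_rw [sub_add_sub_cancel]
              rw [setLIntegral_const, mul_comm]
          _ ≤ 2 * (∫⁻ z in Metric.ball x r ∩ elt K, ‖w y - w z‖ₑ ^ 2) +
                2 * ∫⁻ z in Metric.ball x r ∩ elt K, ‖w z - trace (elt K) w x‖ₑ ^ 2 :=
              lintegral_enorm_add_sq_le (measurable_const.sub hwm).aestronglyMeasurable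
          _ ≤ _ := by
              refine add_le_add (mul_le_mul' le_rfl ?_) (mul_le_mul' le_rfl hrr)
              refine lintegral_ball_le_slobInner (t := t) (by linarith) hr0
                inter_subset_right hB fun z hz => ?_
              have h2 := Metric.mem_ball'.1 hz.1
              rw [dist_comm] at hxy
              linarith [dist_triangle y x z]
      refine (le_of_ofReal_mul_le hcr h1).trans_eq ?_
      congr 3
      · rw [Real.mul_rpow (by norm_num) hr0.le, Real.rpow_add hr0, Real.rpow_natCast]
        field_simp
      · field_simp
    set N : ℝ := ‖baryGrad K p‖⁻¹
    set I := ∫⁻ x in hull (K.erase p), G x ∂(surf d)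
    -- After division by `ε` the first term retains `ε ^ (2t - 1)`, while the second retains `ε ^ (t
    -- - 1/2)` because the strip itself contributes a factor `ε`. Both vanish in the limit exactly
    -- since `t > 1/2`.
    have hb1 : Tendsto (fun ε : ℝ => ENNReal.ofReal (c₀⁻¹ * 2 * 2 ^ ((d : ℝ) + 2 * t) *
        L ^ (2 * t) * ε ^ (2 * t - 1)) * slobSq (elt K) t w) (𝓝[>] 0) (𝓝 0) := by
      have h1 : Tendsto (fun ε : ℝ => ε ^ (2 * t - 1)) (𝓝[>] 0) (𝓝 0) := by
        have := (Real.continuousAt_rpow_const 0 (2 * t - 1) (Or.inr (by linarith))).tendsto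
        rw [Real.zero_rpow (by linarith)] at this
        exact this.mono_left nhdsWithin_le_nhds
      have h2 := ENNReal.tendsto_ofReal
        (h1.const_mul (c₀⁻¹ * 2 * 2 ^ ((d : ℝ) + 2 * t) * L ^ (2 * t)))
      have h3 := ENNReal.Tendsto.mul_const h2 (b := slobSq (elt K) t w) (Or.inr hslob)
      simpa using h3
    have hb2 : Tendsto (fun ε : ℝ => ENNReal.ofReal (c₀⁻¹ * (2 * C₁) * L ^ (t - 1 / 2) * N *
        ε ^ (t - 1 / 2)) * I) (𝓝[>] 0) (𝓝 0) := by
      have h1 : Tendsto (fun ε : ℝ => ε ^ (t - 1 / 2)) (𝓝[>] 0) (𝓝 0) := by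
        have := (Real.continuousAt_rpow_const 0 (t - 1 / 2) (Or.inr (by linarith))).tendsto
        rw [Real.zero_rpow (by linarith)] at this
        exact this.mono_left nhdsWithin_le_nhds
      have h2 := ENNReal.tendsto_ofReal
        (h1.const_mul (c₀⁻¹ * (2 * C₁) * L ^ (t - 1 / 2) * N))
      have h3 := ENNReal.Tendsto.mul_const h2 (b := I) (Or.inr hGtop)
      simpa using h3
    have hb := hb1.add hb2
    rw [add_zero] at hb
    refine tendsto_of_tendsto_of_tendsto_of_le_of_le' tendsto_const_nhds hb
      (Eventually.of_forall fun _ => bot_le) ?_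
    filter_upwards [Ioc_mem_nhdsGT (show 0 < size K / L by positivity)] with ε hε
    have hε0 := hε.1
    have hεK : L * ε ≤ size K := by
      have := hε.2; rw [le_div_iff₀ hL0] at this; linarith
    have hN : 0 ≤ N := by positivity
    calc _ ≤ ENNReal.ofReal ε⁻¹ * ∫⁻ y in strip K p ε,
          (ENNReal.ofReal (c₀⁻¹ * 2 * 2 ^ ((d : ℝ) + 2 * t) * (L * ε) ^ (2 * t)) *
              slobInner (elt K) t w y +
            ENNReal.ofReal (c₀⁻¹ * (2 * C₁) * (L * ε) ^ (t - 1 / 2)) * G (faceProj K p y)) :=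
          mul_le_mul' le_rfl (setLIntegral_mono' (measurableSet_strip K p ε)
            (hpw ε hε0 hεK))
      _ = ENNReal.ofReal ε⁻¹ *
          (ENNReal.ofReal (c₀⁻¹ * 2 * 2 ^ ((d : ℝ) + 2 * t) * (L * ε) ^ (2 * t)) *
              (∫⁻ y in strip K p ε, slobInner (elt K) t w y) +
            ENNReal.ofReal (c₀⁻¹ * (2 * C₁) * (L * ε) ^ (t - 1 / 2)) *
              ∫⁻ y in strip K p ε, G (faceProj K p y)) := by
          rw [lintegral_add_left ((measurable_slobInner hwm _).const_mul _),
            lintegral_const_mul' _ _ ENNReal.ofReal_ne_top,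
            lintegral_const_mul' _ _ ENNReal.ofReal_ne_top]
      _ ≤ ENNReal.ofReal ε⁻¹ *
          (ENNReal.ofReal (c₀⁻¹ * 2 * 2 ^ ((d : ℝ) + 2 * t) * (L * ε) ^ (2 * t)) *
              slobSq (elt K) t w +
            ENNReal.ofReal (c₀⁻¹ * (2 * C₁) * (L * ε) ^ (t - 1 / 2)) *
              (ENNReal.ofReal N * (ENNReal.ofReal ε * I))) := by
          gcongr
          · exact lintegral_mono_set (strip_subset K p ε)
          · exact hK.strip_integral_le (by omega) hp hGm ε
      _ = (ENNReal.ofReal ε⁻¹ *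
          ENNReal.ofReal (c₀⁻¹ * 2 * 2 ^ ((d : ℝ) + 2 * t) * (L * ε) ^ (2 * t))) *
              slobSq (elt K) t w +
            (ENNReal.ofReal ε⁻¹ * ENNReal.ofReal (c₀⁻¹ * (2 * C₁) * (L * ε) ^ (t - 1 / 2)) *
              ENNReal.ofReal N * ENNReal.ofReal ε) * I := by ring
      _ = _ := by
          have hi : (0 : ℝ) ≤ ε⁻¹ := by positivity
          rw [← ENNReal.ofReal_mul hi, ← ENNReal.ofReal_mul hi,
            ← ENNReal.ofReal_mul (by positivity), ← ENNReal.ofReal_mul (by positivity)]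
          congr 3
          · rw [Real.mul_rpow hL0.le hε0.le, Real.rpow_sub hε0, Real.rpow_one]
            field_simp
          · rw [Real.mul_rpow hL0.le hε0.le]
            field_simp
  · rw [mul_add]
    gcongr
    · linarith [show 0 ≤ B by positivity]
    · linarith [show 0 ≤ A by positivity]

/-- The trace theorem for the space `H^t`, `1/2 < t < 1`, on a simplex. -/
lemma trace_theorem (hd : 2 ≤ d) {κ : ℝ} (hκ : 0 < κ) (ht0 : 1 / 2 < t) (ht1 : t < 1) :
    ∃ C : ℝ, 0 < C ∧ ∀ (K : Finset (Pt d)) (c : Pt d), IsSimplex K →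
      Metric.closedBall c (κ * size K) ⊆ hull K → ∀ p ∈ K, ∀ w : Pt d → ℝ,
      MemLp w 2 (volume.restrict (elt K)) → slobSq (elt K) t w ≠ ⊤ →
        HasFaceTrace K p w (trace (elt K) w) ∧
        ENNReal.ofReal (size K) *
            ∫⁻ x in hull (K.erase p), ‖trace (elt K) w x‖ₑ ^ 2 ∂(surf d) ≤
          ENNReal.ofReal C * ((∫⁻ y in elt K, ‖w y‖ₑ ^ 2) +
            ENNReal.ofReal (size K ^ (2 * t)) * slobSq (elt K) t w) := by
  obtain ⟨C, hC, h⟩ := trace_theorem_of_measurable hd hκ ht0 ht1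
  refine ⟨C, hC, fun K c hK hc p hp w hw hslob => ?_⟩
  have hc' := hw.1.ae_eq_mk
  rw [slobSq_congr hc'] at hslob
  obtain ⟨h1, h2⟩ := h K c hK hc p hp _ hw.1.stronglyMeasurable_mk.measurable
    ((memLp_congr_ae hc').1 hw) hslob
  have h3 : trace (elt K) (hw.1.mk w) = trace (elt K) w :=
    funext fun x => (trace_congr hc' x).symm
  rw [h3] at h1 h2
  refine ⟨h1.congr hc'.symm, h2.trans_eq ?_⟩
  have h4 : (fun y => ‖hw.1.mk w y‖ₑ ^ 2) =ᵐ[volume.restrict (elt K)] fun y => ‖w y‖ₑ ^ 2 :=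
    hc'.mono fun y hy => by simp only [← hy]
  rw [slobSq_congr hc', lintegral_congr_ae h4]

end

section

variable {d : ℕ}

/-! ### Green's formula on a simplex -/

variable {K : Finset (Pt d)} {p : Pt d} {v w a b : Pt d → ℝ} {t : ℝ}

/-- A smooth cutoff function, vanishing for `t ≤ 1` and equal to one for `t ≥ 2`. -/
def cut (t : ℝ) : ℝ := Real.smoothTransition (t - 1)

lemma contDiff_cut : ContDiff ℝ ∞ cut :=
  Real.smoothTransition.contDiff.comp (contDiff_id.sub contDiff_const)

lemma cut_eq_zero {t : ℝ} (ht : t ≤ 1) : cut t = 0 :=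
  Real.smoothTransition.zero_of_nonpos (by linarith)

lemma cut_eq_one {t : ℝ} (ht : 2 ≤ t) : cut t = 1 :=
  Real.smoothTransition.one_of_one_le (by linarith)

lemma abs_cut_le_one (t : ℝ) : |cut t| ≤ 1 := by
  rw [cut, abs_of_nonneg (Real.smoothTransition.nonneg _)]
  exact Real.smoothTransition.le_one _

lemma continuous_deriv_cut : Continuous (deriv cut) :=
  contDiff_cut.continuous_deriv (by norm_num)

lemma deriv_cut_eq_zero_left {t : ℝ} (ht : t < 1) : deriv cut t = 0 := by
  have : cut =ᶠ[𝓝 t] fun _ => (0 : ℝ) := by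
    filter_upwards [Iio_mem_nhds ht] with s hs using cut_eq_zero (le_of_lt hs)
  rw [this.deriv_eq, deriv_const]

lemma deriv_cut_eq_zero_right {t : ℝ} (ht : 2 < t) : deriv cut t = 0 := by
  have : cut =ᶠ[𝓝 t] fun _ => (1 : ℝ) := by
    filter_upwards [Ioi_mem_nhds ht] with s hs using cut_eq_one (le_of_lt hs)
  rw [this.deriv_eq, deriv_const]

lemma hasCompactSupport_deriv_cut : HasCompactSupport (deriv cut) := by
  refine HasCompactSupport.intro (isCompact_Icc (a := (1 : ℝ)) (b := 2)) fun t ht => ?_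
  rw [mem_Icc, not_and_or, not_le, not_le] at ht
  exact ht.elim deriv_cut_eq_zero_left deriv_cut_eq_zero_right

lemma integrable_deriv_cut : Integrable (deriv cut) :=
  continuous_deriv_cut.integrable_of_hasCompactSupport hasCompactSupport_deriv_cut

lemma integral_deriv_cut : ∫ t, deriv cut t = 1 := by
  have h1 : ∫ t in (0 : ℝ)..3, deriv cut t = cut 3 - cut 0 :=
    intervalIntegral.integral_deriv_eq_sub
      (fun x _ => (contDiff_cut.differentiable (by norm_num)).differentiableAt)
      (continuous_deriv_cut.intervalIntegrable _ _)
  rw [cut_eq_one (by norm_num), cut_eq_zero (by norm_num),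
    intervalIntegral.integral_of_le (by norm_num), sub_zero] at h1
  rw [← h1, setIntegral_eq_integral_of_forall_compl_eq_zero]
  intro t ht
  rw [mem_Ioc, not_and_or, not_lt, not_le] at ht
  rcases ht with ht | ht
  · exact deriv_cut_eq_zero_left (by linarith)
  · exact deriv_cut_eq_zero_right (by linarith)

lemma exists_bound_deriv_cut : ∃ M, 0 ≤ M ∧ ∀ t, |deriv cut t| ≤ M := by
  obtain ⟨M, hM⟩ := hasCompactSupport_deriv_cut.exists_bound_of_continuous continuous_deriv_cut
  exact ⟨M, (norm_nonneg _).trans (hM 0), hM⟩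

variable [DecidableEq (Pt d)]

/-- A smooth weight concentrated in the layer of width `ε` along a face. -/
def layer (K : Finset (Pt d)) (p : Pt d) (ε : ℝ) (y : Pt d) : ℝ :=
  ε⁻¹ * deriv cut (bary K p y / ε) * ∏ j ∈ K.erase p, cut (bary K j y / ε)

lemma continuous_layer (K : Finset (Pt d)) (p : Pt d) (ε : ℝ) : Continuous (layer K p ε) := by
  unfold layer
  refine (continuous_const.mul (continuous_deriv_cut.comp
    ((continuous_bary p).div_const _))).mul (continuous_finsetProd _ fun j _ => ?_)
  exact contDiff_cut.continuous.comp ((continuous_bary j).div_const _)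

omit [DecidableEq (Pt d)] in
lemma abs_prod_cut_le (s : Finset (Pt d)) (g : Pt d → ℝ) : |∏ j ∈ s, cut (g j)| ≤ 1 := by
  rw [Finset.abs_prod]
  exact Finset.prod_le_one (fun _ _ => abs_nonneg _) fun _ _ => abs_cut_le_one _

/-- The derivative of `cut` lives on `[1, 2]`, which confines the coordinate of `p` to `[ε, 2ε]`;
the product of cutoffs forces the other coordinates above `ε`. The width `3 * ε` makes the upper
bound strict. -/
lemma IsSimplex.layer_eq_zero (h : IsSimplex K) {ε : ℝ} (hε : 0 < ε) {y : Pt d}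
    (hy : y ∉ strip K p (3 * ε)) : layer K p ε y = 0 := by
  by_contra hne
  apply hy
  have h1 : deriv cut (bary K p y / ε) ≠ 0 := fun h0 => hne (by simp [layer, h0])
  have h2 : ∀ j ∈ K.erase p, cut (bary K j y / ε) ≠ 0 := fun j hj h0 =>
    hne (by rw [layer, Finset.prod_eq_zero hj h0, mul_zero])
  have h3 : 1 ≤ bary K p y / ε := not_lt.1 fun h' => h1 (deriv_cut_eq_zero_left h')
  have h4 : bary K p y / ε ≤ 2 := not_lt.1 fun h' => h1 (deriv_cut_eq_zero_right h')
  rw [le_div_iff₀ hε] at h3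
  rw [div_le_iff₀ hε] at h4
  refine ⟨?_, by linarith⟩
  rw [h.elt_eq]
  intro j hj
  by_cases hjp : j = p
  · rw [hjp]; linarith
  · have := h2 j (Finset.mem_erase.2 ⟨hjp, hj⟩)
    have h5 : 1 < bary K j y / ε := not_le.1 fun h' => this (cut_eq_zero h')
    rw [lt_div_iff₀ hε] at h5
    linarith

lemma abs_layer_le {M : ℝ} (hM : ∀ t, |deriv cut t| ≤ M) {ε : ℝ} (hε : 0 < ε) (y : Pt d) :
    |layer K p ε y| ≤ ε⁻¹ * M := by
  have hM0 := (abs_nonneg _).trans (hM 0)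
  rw [layer, abs_mul, abs_mul, abs_of_pos (inv_pos.2 hε)]
  calc _ ≤ ε⁻¹ * M * 1 := by
        gcongr
        · exact hM _
        · exact abs_prod_cut_le _ _
    _ = _ := mul_one _

/-- Barycentric coordinates are at most `1`, so the strip of width `2` is the whole element and the
strip estimate applies. -/
lemma HasFaceTrace.memLp_comp (h : IsSimplex K) (hd : 1 ≤ d) (hp : p ∈ K)
    (ht : HasFaceTrace K p w a) :
    MemLp (fun y => a (faceProj K p y)) 2 (volume.restrict (elt K)) := by
  refine ⟨ht.aestronglyMeasurable_comp h hd hp, ?_⟩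
  have h1 := ht.memLp.2
  rw [eLpNorm_lt_top_iff_lintegral_rpow_enorm_lt_top (by norm_num) (by norm_num)] at h1 ⊢
  simp only [ENNReal.toReal_ofNat, ENNReal.rpow_ofNat] at h1 ⊢
  have h2 : elt K ⊆ HDG.strip K p 2 := fun y hy => ⟨hy, by
    rw [h.elt_eq] at hy
    have h3 : bary K p y ≤ ∑ j ∈ K, bary K j y :=
      Finset.single_le_sum (f := fun j => bary K j y) (fun j hj => (hy j hj).le) hp
    rw [h.sum_bary] at h3; linarith⟩
  refine (lintegral_mono_set h2).trans_lt ((h.strip_integral_le' hd hp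
    (g := fun x => ‖a x‖ₑ ^ 2) (ht.memLp.1.enorm.pow_const 2) 2).trans_lt ?_)
  exact ENNReal.mul_lt_top ENNReal.ofReal_lt_top (ENNReal.mul_lt_top ENNReal.ofReal_lt_top h1)

/-- The layer is at most `M / ε` and lives in a strip of volume of order `ε`. By Cauchy-Schwarz the
squared integral is at most a constant times `ε⁻¹` times the squared `L²` distance over the strip,
which tends to zero by the last clause of `HasFaceTrace`. -/
lemma HasFaceTrace.tendsto_layer_sub (h : IsSimplex K) (hd : 1 ≤ d) (hp : p ∈ K)
    (ht : HasFaceTrace K p w a) :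
    Tendsto (fun ε => ∫⁻ y in elt K, ‖layer K p ε y * (w y - a (faceProj K p y))‖ₑ)
      (𝓝[>] 0) (𝓝 0) := by
  obtain ⟨M, hM0, hM⟩ := exists_bound_deriv_cut
  set Z := fun y => w y - a (faceProj K p y) with hZ
  have hZm : MemLp Z 2 (volume.restrict (elt K)) := ht.memLp_elt.sub (ht.memLp_comp h hd hp)
  set S := ENNReal.ofReal ‖baryGrad K p‖⁻¹ * surf d (hull (K.erase p)) with hS
  have hStop : S ≠ ⊤ :=
    ENNReal.mul_ne_top ENNReal.ofReal_ne_top (h.surf_hull_lt_top hd hp).ne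
  have h3 : Tendsto (fun ε : ℝ => 3 * ε) (𝓝[>] 0) (𝓝[>] 0) := by
    refine tendsto_nhdsWithin_iff.2 ⟨?_, ?_⟩
    · have : Tendsto (fun ε : ℝ => 3 * ε) (𝓝 0) (𝓝 (3 * 0)) := tendsto_id.const_mul 3
      rw [mul_zero] at this
      exact this.mono_left nhdsWithin_le_nhds
    · filter_upwards [self_mem_nhdsWithin] with ε hε
      exact mul_pos (by norm_num : (0 : ℝ) < 3) (mem_Ioi.1 hε)
  have h4 := ENNReal.Tendsto.const_mul (a := ENNReal.ofReal (9 * M ^ 2) * S) (ht.strip.comp h3)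
    (Or.inr (ENNReal.mul_ne_top ENNReal.ofReal_ne_top hStop))
  rw [mul_zero] at h4
  have h5 := (ENNReal.continuous_rpow_const (y := (1 / 2 : ℝ))).tendsto 0 |>.comp h4
  rw [ENNReal.zero_rpow_of_pos (by norm_num)] at h5
  refine tendsto_of_tendsto_of_tendsto_of_le_of_le' tendsto_const_nhds h5
    (Eventually.of_forall fun _ => bot_le) ?_
  filter_upwards [self_mem_nhdsWithin] with ε hε
  have hε : 0 < ε := hε
  have hms := measurableSet_strip K p (3 * ε)
  have hZs : AEMeasurable (fun y => ‖Z y‖ₑ) (volume.restrict (HDG.strip K p (3 * ε))) :=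
    (hZm.1.mono_set (strip_subset K p _)).enorm
  have hvol : volume (HDG.strip K p (3 * ε)) ≤ ENNReal.ofReal (3 * ε) * S := by
    have := h.strip_integral_le hd hp (g := fun _ => 1) measurable_const (3 * ε)
    rw [setLIntegral_one, setLIntegral_one] at this
    refine this.trans_eq ?_
    rw [hS]; ring
  have e1 : ∫⁻ y in elt K, ‖layer K p ε y * Z y‖ₑ ≤
      ENNReal.ofReal (ε⁻¹ * M) * ∫⁻ y in HDG.strip K p (3 * ε), ‖Z y‖ₑ := by
    calc _ = ∫⁻ y in elt K, (HDG.strip K p (3 * ε)).indicator (fun y => ‖layer K p ε y * Z y‖ₑ) y := by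
          refine lintegral_congr fun y => ?_
          by_cases hy : y ∈ HDG.strip K p (3 * ε)
          · rw [indicator_of_mem hy]
          · rw [indicator_of_notMem hy, h.layer_eq_zero hε hy]; simp
      _ = ∫⁻ y in HDG.strip K p (3 * ε), ‖layer K p ε y * Z y‖ₑ := by
          rw [lintegral_indicator hms, Measure.restrict_restrict hms,
            inter_eq_left.2 (strip_subset K p _)]
      _ ≤ ∫⁻ y in HDG.strip K p (3 * ε), ENNReal.ofReal (ε⁻¹ * M) * ‖Z y‖ₑ := by
          refine lintegral_mono fun y => ?_
          simp only []
          rw [enorm_mul]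
          refine mul_le_mul' ?_ le_rfl
          rw [← ofReal_norm]
          exact ENNReal.ofReal_le_ofReal (abs_layer_le hM hε y)
      _ = _ := lintegral_const_mul' _ _ ENNReal.ofReal_ne_top
  have e2 : (∫⁻ y in elt K, ‖layer K p ε y * Z y‖ₑ) ^ 2 ≤
      ENNReal.ofReal (9 * M ^ 2) * S *
        (ENNReal.ofReal (3 * ε)⁻¹ * ∫⁻ y in HDG.strip K p (3 * ε), ‖Z y‖ₑ ^ 2) := by
    calc _ ≤ (ENNReal.ofReal (ε⁻¹ * M) * ∫⁻ y in HDG.strip K p (3 * ε), ‖Z y‖ₑ) ^ 2 := by gcongr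
      _ ≤ ENNReal.ofReal (ε⁻¹ * M) ^ 2 * ((ENNReal.ofReal (3 * ε) * S) *
            ∫⁻ y in HDG.strip K p (3 * ε), ‖Z y‖ₑ ^ 2) := by
          rw [mul_pow]
          refine mul_le_mul' le_rfl ((sq_lintegral_le _ hZs).trans (mul_le_mul' ?_ le_rfl))
          rwa [Measure.restrict_apply_univ]
      _ = (ENNReal.ofReal (ε⁻¹ * M) ^ 2 * ENNReal.ofReal (3 * ε)) * (S *
            ∫⁻ y in HDG.strip K p (3 * ε), ‖Z y‖ₑ ^ 2) := by ring
      _ = (ENNReal.ofReal (9 * M ^ 2) * ENNReal.ofReal (3 * ε)⁻¹) * (S *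
            ∫⁻ y in HDG.strip K p (3 * ε), ‖Z y‖ₑ ^ 2) := by
          congr 1
          rw [← ENNReal.ofReal_pow (by positivity), ← ENNReal.ofReal_mul (by positivity),
            ← ENNReal.ofReal_mul (by positivity)]
          congr 1
          field_simp
          norm_num
      _ = _ := by ring
  calc _ = ((∫⁻ y in elt K, ‖layer K p ε y * Z y‖ₑ) ^ 2) ^ (1 / 2 : ℝ) := by
        rw [← ENNReal.rpow_natCast, ← ENNReal.rpow_mul]; norm_num [hZ]
    _ ≤ _ := ENNReal.rpow_le_rpow e2 (by norm_num)

omit [DecidableEq (Pt d)] in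
lemma integrable_mul_of_continuous {θ : Pt d → ℝ} (hθ : Continuous θ)
    (hw : MemLp w 2 (volume.restrict (elt K))) :
    Integrable (fun y => θ y * w y) (volume.restrict (elt K)) :=
  (memLp_mul_continuousOn (isOpen_elt K).measurableSet (elt_subset_hull K)
    hθ.continuousOn hw).integrable (by norm_num)

lemma continuous_liftFace (K : Finset (Pt d)) (p : Pt d) : Continuous (liftFace K p) := by
  unfold liftFace; fun_prop

/-- Fubini's theorem in the coordinates of `liftFace`: the prefactor cancels the Jacobian, and the
extended trace is constant along the fibres. -/
lemma HasFaceTrace.integral_layer_comp (h : IsSimplex K) (hd : 1 ≤ d) (hp : p ∈ K)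
    (ht : HasFaceTrace K p w a) {ε : ℝ} (hε : 0 < ε) :
    ‖baryGrad K p‖ * ∫ y in elt K, layer K p ε y * a (faceProj K p y) =
      ∫ x in hull (K.erase p), (∫ s : ℝ, layer K p ε (liftFace K p (s, x))) * a x ∂(surf d) := by
  have hβ := norm_pos_iff.2 (h.baryGrad_ne_zero hd hp)
  have := h.isFiniteMeasure_surf hd hp
  have hmp := h.measurePreserving_liftFace hd hp
  set μ : Measure (ℝ × Pt d) := volume.prod ((surf d).restrict (hull (K.erase p))) with hμ
  set c : ℝ≥0∞ := ENNReal.ofReal ‖baryGrad K p‖⁻¹ with hc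
  have hc0 : c ≠ 0 := by simpa [hc] using hβ
  have hctop : c ≠ ⊤ := ENNReal.ofReal_ne_top
  set G : Pt d → ℝ := fun y => layer K p ε y * a (faceProj K p y) with hG
  have hGi : Integrable G (volume.restrict (elt K)) :=
    integrable_mul_of_continuous (continuous_layer K p ε) (ht.memLp_comp h hd hp)
  have hzero : ∀ z, z ∉ liftFace K p ⁻¹' elt K → G (liftFace K p z) = 0 := fun z hz => by
    rw [hG]
    simp only []
    rw [h.layer_eq_zero hε fun h' => hz h'.1, zero_mul]
  have hGc : Integrable (fun z => G (liftFace K p z)) (c • μ) := by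
    have h1 := hmp.integrable_comp_of_integrable hGi
    exact (integrableOn_iff_integrable_of_support_subset
      (fun z hz => by_contra fun h' => hz (hzero z h'))).1 h1
  have hGμ : Integrable (fun z => G (liftFace K p z)) μ := (integrable_smul_measure hc0 hctop).1 hGc
  have e1 : ∫ y in elt K, G y = ‖baryGrad K p‖⁻¹ * ∫ z, G (liftFace K p z) ∂μ := by
    conv_lhs => rw [← hmp.map_eq]
    rw [integral_map hmp.measurable.aemeasurable (by rw [hmp.map_eq]; exact hGi.1),
      setIntegral_eq_integral_of_forall_compl_eq_zero hzero, integral_smul_measure, hc,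
      ENNReal.toReal_ofReal (by positivity), smul_eq_mul]
  rw [e1, ← mul_assoc, mul_inv_cancel₀ hβ.ne', one_mul, integral_prod_symm _ hGμ]
  refine setIntegral_congr_fun (measurableSet_hull _) fun x hx => ?_
  have hx0 := h.hull_erase_subset hp hx
  simp only [hG]
  rw [← integral_mul_const]
  refine integral_congr_ae (Eventually.of_forall fun s => ?_)
  simp only []
  rw [h.faceProj_liftFace hd hp hx0]

lemma integral_scaled_deriv_cut {ε : ℝ} (hε : 0 < ε) : ∫ s, ε⁻¹ * deriv cut (s / ε) = 1 := by
  rw [integral_const_mul, Measure.integral_comp_div, abs_of_pos hε, integral_deriv_cut, smul_eq_mul,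
    mul_one, inv_mul_cancel₀ hε.ne']

/-- Along the fibre above a relatively interior point the layer is, for small `ε`, the approximate
identity `ε⁻¹ cut'(s / ε)` with integral one. Almost every point of the face is of this kind, so
dominated convergence handles the extension of the trace; the difference between `w` and this
extension is negligible in the layer. -/
lemma HasFaceTrace.tendsto_integral_layer (h : IsSimplex K) (hd : 2 ≤ d) (hp : p ∈ K)
    (ht : HasFaceTrace K p w a) :
    Tendsto (fun ε => ‖baryGrad K p‖ * ∫ y in elt K, layer K p ε y * w y) (𝓝[>] 0)
      (𝓝 (∫ x in hull (K.erase p), a x ∂(surf d))) := by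
  have hd1 : 1 ≤ d := by omega
  have hfin := h.isFiniteMeasure_surf hd1 hp
  have hwa := ht.memLp_comp h hd1 hp
  -- the limit for the extension of the trace
  have h1 : Tendsto (fun ε => ‖baryGrad K p‖ * ∫ y in elt K, layer K p ε y * a (faceProj K p y))
      (𝓝[>] 0) (𝓝 (∫ x in hull (K.erase p), a x ∂(surf d))) := by
    have hlim : Tendsto (fun ε => ∫ x in hull (K.erase p),
        (∫ s : ℝ, layer K p ε (liftFace K p (s, x))) * a x ∂(surf d)) (𝓝[>] 0)
        (𝓝 (∫ x in hull (K.erase p), a x ∂(surf d))) := by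
      refine tendsto_integral_filter_of_dominated_convergence
        (fun x => (∫ s, |deriv cut s|) * |a x|) ?_ ?_ ?_ ?_
      · refine Eventually.of_forall fun ε => AEStronglyMeasurable.mul ?_ ht.memLp.1
        exact (((continuous_layer K p ε).comp (continuous_liftFace K p)).stronglyMeasurable
          |>.integral_prod_left' (μ := volume)).aestronglyMeasurable
      · filter_upwards [self_mem_nhdsWithin] with ε hε
        have hε : 0 < ε := hε
        filter_upwards [ae_restrict_mem (measurableSet_hull _)] with x hx
        have hx0 := h.hull_erase_subset hp hx
        rw [norm_mul, Real.norm_eq_abs (a x)]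
        refine mul_le_mul_of_nonneg_right ?_ (abs_nonneg _)
        have hi : Integrable fun s : ℝ => ε⁻¹ * |deriv cut (s / ε)| :=
          (integrable_deriv_cut.abs.comp_div hε.ne').const_mul _
        refine (norm_integral_le_of_norm_le hi (Eventually.of_forall fun s => ?_)).trans_eq ?_
        · rw [layer, h.bary_liftFace hd1 hp hx0, Real.norm_eq_abs, abs_mul, abs_mul,
            abs_of_pos (inv_pos.2 hε)]
          exact mul_le_of_le_one_right (by positivity) (abs_prod_cut_le _ _)
        · rw [integral_const_mul, Measure.integral_comp_div (fun s => |deriv cut s|),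
            abs_of_pos hε, smul_eq_mul, ← mul_assoc, inv_mul_cancel₀ hε.ne', one_mul]
      · exact (ht.memLp.integrable (by norm_num)).abs.const_mul _
      · filter_upwards [ae_restrict_mem (measurableSet_hull _), h.ae_bary_pos hd hp] with x hx hpos
        have hx0 := h.hull_erase_subset hp hx
        obtain ⟨m, hm0, hm⟩ : ∃ m : ℝ, 0 < m ∧ ∀ j ∈ K.erase p, m ≤ bary K j x := by
          obtain ⟨q, hq⟩ := h.exists_mem_erase hd1 p
          obtain ⟨j₀, hj₀, hj₁⟩ := (K.erase p).exists_min_image (fun j => bary K j x) ⟨q, hq⟩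
          exact ⟨_, hpos j₀ hj₀, hj₁⟩
        refine tendsto_const_nhds.congr' ?_
        -- Where the derivative of `cut` is nonzero, `s ≤ 2ε`. Each other coordinate loses at most
        -- `s / d ≤ 2ε` from a value of at least `m ≥ 4ε`, so it stays at least `2ε` and its cutoff
        -- equals one.
        filter_upwards [Ioc_mem_nhdsGT (show 0 < m / 4 by positivity)] with ε hε
        have hε0 := hε.1
        have hεm := hε.2
        have e : ∀ s, layer K p ε (liftFace K p (s, x)) = ε⁻¹ * deriv cut (s / ε) := by
          intro s
          rw [layer, h.bary_liftFace hd1 hp hx0]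
          by_cases hs : 2 < s / ε
          · rw [deriv_cut_eq_zero_right hs]; simp
          · rw [not_lt, div_le_iff₀ hε0] at hs
            by_cases hs1 : s / ε < 1
            · rw [deriv_cut_eq_zero_left hs1]; simp
            rw [not_lt, le_div_iff₀ hε0] at hs1
            rw [Finset.prod_eq_one, mul_one]
            intro j hj
            apply cut_eq_one
            have hj' := Finset.mem_erase.1 hj
            rw [le_div_iff₀ hε0, liftFace, h.bary_add_apexDir hd1 hp hj'.2, if_neg hj'.1]
            have h2 := hm j hj
            have h3 : (d : ℝ)⁻¹ ≤ 1 := inv_le_one_of_one_le₀ (by exact_mod_cast hd1)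
            have h4 : (0 : ℝ) ≤ (d : ℝ)⁻¹ := by positivity
            simp only []
            nlinarith
        simp_rw [e]
        rw [integral_scaled_deriv_cut hε0, one_mul]
    refine hlim.congr' ?_
    filter_upwards [self_mem_nhdsWithin] with ε hε
    exact (ht.integral_layer_comp h hd1 hp hε).symm
  -- the difference tends to zero
  have h2 : Tendsto (fun ε => ‖baryGrad K p‖ *
      ∫ y in elt K, layer K p ε y * (w y - a (faceProj K p y))) (𝓝[>] 0) (𝓝 0) := by
    have h3 := (ENNReal.tendsto_toReal ENNReal.zero_ne_top).comp (ht.tendsto_layer_sub h hd1 hp)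
    have h4 := (squeeze_zero_norm (fun ε => ?_) h3 : Tendsto (fun ε =>
      ∫ y in elt K, layer K p ε y * (w y - a (faceProj K p y))) (𝓝[>] 0) (𝓝 0))
    · simpa using h4.const_mul ‖baryGrad K p‖
    · have := integrable_mul_of_continuous (continuous_layer K p ε) (ht.memLp_elt.sub hwa)
      refine (norm_integral_le_lintegral_norm _).trans_eq ?_
      simp only [Function.comp_apply, ofReal_norm]
  have h3 := h1.add h2
  rw [add_zero] at h3
  refine h3.congr fun ε => ?_
  have hi := integrable_mul_of_continuous (continuous_layer K p ε) (ht.memLp_elt.sub hwa)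
  simp only [Pi.sub_apply] at hi
  rw [← mul_add, ← integral_add (integrable_mul_of_continuous (continuous_layer K p ε) hwa) hi]
  congr 2
  ext y
  ring

/-- The cutoff function which vanishes near the boundary of the simplex. -/
def interiorCut (K : Finset (Pt d)) (ε : ℝ) (y : Pt d) : ℝ := ∏ j ∈ K, cut (bary K j y / ε)

omit [DecidableEq (Pt d)] in
lemma bary_eq_inner (K : Finset (Pt d)) (p : Pt d) :
    (bary K p : Pt d → ℝ) = fun x => bary K p 0 + innerSL ℝ (baryGrad K p) x := by
  ext x
  rw [innerSL_apply_apply, ← bary_add, zero_add]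

omit [DecidableEq (Pt d)] in
lemma contDiff_bary (p : Pt d) : ContDiff ℝ ∞ (bary K p) := by
  rw [bary_eq_inner]
  exact contDiff_const.add (innerSL ℝ (baryGrad K p)).contDiff

omit [DecidableEq (Pt d)] in
lemma hasFDerivAt_bary (K : Finset (Pt d)) (p x : Pt d) :
    HasFDerivAt (bary K p) (innerSL ℝ (baryGrad K p)) x := by
  rw [bary_eq_inner]
  exact (innerSL ℝ (baryGrad K p)).hasFDerivAt.const_add _

omit [DecidableEq (Pt d)] in
lemma contDiff_interiorCut (K : Finset (Pt d)) (ε : ℝ) : ContDiff ℝ ∞ (interiorCut K ε) :=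
  contDiff_prod fun _ _ => contDiff_cut.comp ((contDiff_bary _).div_const _)

/-- By the product rule, differentiating the cutoff of one coordinate gives the layer of the
opposite face. This is where boundary terms enter Green's formula. -/
lemma gradient_interiorCut (K : Finset (Pt d)) (ε : ℝ) (y a : Pt d) :
    fderiv ℝ (interiorCut K ε) y a = ∑ p ∈ K, layer K p ε y * inner ℝ (baryGrad K p) a := by
  have h1 : ∀ p, HasFDerivAt (fun y => cut (bary K p y / ε))
      (deriv cut (bary K p y / ε) • (ε⁻¹ • innerSL ℝ (baryGrad K p))) y := fun p => by
    have h2 : HasFDerivAt (fun y => bary K p y / ε) (ε⁻¹ • innerSL ℝ (baryGrad K p)) y := by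
      simp_rw [div_eq_mul_inv]
      exact (hasFDerivAt_bary K p y).mul_const _
    have h4 : HasDerivAt cut (deriv cut (bary K p y / ε)) (bary K p y / ε) :=
      (contDiff_cut.differentiable (by norm_num)).differentiableAt.hasDerivAt
    exact HasDerivAt.comp_hasFDerivAt (h₂ := cut) y h4 h2
  have h3 := (HasFDerivAt.finsetProd (u := K) fun p _ => h1 p).fderiv
  rw [show interiorCut K ε = fun y => ∏ p ∈ K, cut (bary K p y / ε) from rfl, h3]
  simp only [sum_apply, smul_apply, innerSL_apply_apply, smul_eq_mul, layer]
  exact Finset.sum_congr rfl fun p _ => by ring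

omit [DecidableEq (Pt d)] in
-- Since `cut` vanishes up to `1`, the product is supported where all coordinates are at least `ε`,
-- a compact subset of the open element.
lemma IsSimplex.isTestFun_interiorCut_mul (h : IsSimplex K) {ε : ℝ} (hε : 0 < ε)
    (hv : ContDiff ℝ ∞ v) : IsTestFun (elt K) (fun y => interiorCut K ε y * v y) := by
  have hcl : IsClosed {y | ∀ p ∈ K, ε ≤ bary K p y} := by
    rw [show {y | ∀ p ∈ K, ε ≤ bary K p y} = ⋂ p ∈ K, {y | ε ≤ bary K p y} by ext; simp]
    exact isClosed_biInter fun p _ => isClosed_le continuous_const (continuous_bary p)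
  have hsub : {y | ∀ p ∈ K, ε ≤ bary K p y} ⊆ elt K := fun y hy => by
    rw [h.elt_eq]; exact fun p hp => hε.trans_le (hy p hp)
  have hsupp : tsupport (fun y => interiorCut K ε y * v y) ⊆ {y | ∀ p ∈ K, ε ≤ bary K p y} := by
    refine closure_minimal (fun y hy => ?_) hcl
    intro p hp
    by_contra hlt
    apply hy
    simp only [interiorCut]
    have h0 : cut (bary K p y / ε) = 0 := cut_eq_zero ((div_le_one hε).2 (not_le.1 hlt).le)
    rw [Finset.prod_eq_zero hp h0, zero_mul]
  refine ⟨(contDiff_interiorCut K ε).mul hv, ?_, hsupp.trans hsub⟩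
  exact (isCompact_hull K).of_isClosed_subset (isClosed_tsupport _)
    ((hsupp.trans hsub).trans (elt_subset_hull K))

omit [DecidableEq (Pt d)] in
lemma IsSimplex.tendsto_interiorCut (h : IsSimplex K) {y : Pt d} (hy : y ∈ elt K) :
    ∀ᶠ ε in 𝓝[>] 0, interiorCut K ε y = 1 := by
  rw [h.elt_eq] at hy
  have : ∀ᶠ ε in 𝓝[>] (0 : ℝ), ∀ p ∈ K, 2 * ε ≤ bary K p y := by
    rw [K.eventually_all]
    intro p hp
    filter_upwards [Ioc_mem_nhdsGT (show 0 < bary K p y / 2 by have := hy p hp; positivity)]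
      with ε hε
    have := hε.2; linarith
  filter_upwards [this, self_mem_nhdsWithin] with ε h1 hε
  exact Finset.prod_eq_one fun p hp => cut_eq_one (by
    rw [le_div_iff₀ (mem_Ioi.1 hε)]; exact h1 p hp)

omit [DecidableEq (Pt d)] in
lemma IsSimplex.tendsto_integral_interiorCut (h : IsSimplex K) {g : Pt d → ℝ}
    (hg : Integrable g (volume.restrict (elt K))) :
    Tendsto (fun ε => ∫ y in elt K, interiorCut K ε y * g y) (𝓝[>] 0) (𝓝 (∫ y in elt K, g y)) := by
  refine tendsto_integral_filter_of_dominated_convergence (fun y => |g y|) ?_ ?_ hg.abs ?_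
  · exact Eventually.of_forall fun ε =>
      (contDiff_interiorCut K ε).continuous.aestronglyMeasurable.mul hg.1
  · refine Eventually.of_forall fun ε => Eventually.of_forall fun y => ?_
    rw [norm_mul, Real.norm_eq_abs, Real.norm_eq_abs]
    exact mul_le_of_le_one_left (abs_nonneg _) (abs_prod_cut_le _ _)
  · filter_upwards [ae_restrict_mem (isOpen_elt K).measurableSet] with y hy
    refine tendsto_const_nhds.congr' ?_
    filter_upwards [h.tendsto_interiorCut hy] with ε hε
    rw [hε, one_mul]

omit [DecidableEq (Pt d)] in
lemma integrable_inner_of_memLp {μ : Measure (Pt d)} {F G : Pt d → Pt d} (hF : MemLp F 2 μ)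
    (hG : MemLp G 2 μ) : Integrable (fun x => inner ℝ (F x) (G x)) μ := by
  refine (hF.norm.integrable_mul hG.norm).mono' (hF.1.inner hG.1) (Eventually.of_forall fun x => ?_)
  exact norm_inner_le_norm _ _

/-- Green's formula on a simplex, for vector fields whose normal components have boundary values in
the sense of `HasFaceTrace`. -/
theorem IsSimplex.green (h : IsSimplex K) (hd : 2 ≤ d) {F : Pt d → Pt d} {g : Pt d → ℝ}
    {q : Pt d → Pt d → ℝ} (hF : MemLp F 2 (volume.restrict (elt K)))
    (hg : MemLp g 2 (volume.restrict (elt K)))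
    (hdiv : ∀ φ, IsTestFun (elt K) φ →
      ∫ x in elt K, inner ℝ (F x) (gradient φ x) = ∫ x in elt K, g x * φ x)
    (hq : ∀ p ∈ K, HasFaceTrace K p (fun y => inner ℝ (F y) (outerNormal K (K.erase p))) (q p))
    (hv : ContDiff ℝ ∞ v) :
    ∫ x in elt K, inner ℝ (F x) (gradient v x) =
      (∫ x in elt K, g x * v x) + ∑ p ∈ K, ∫ x in hull (K.erase p), q p x * v x ∂(surf d) := by
  have hvg := memLp_of_continuous (continuous_gradient hv) (isBounded_elt K) 2
  have hFv : Integrable (fun x => inner ℝ (F x) (gradient v x)) (volume.restrict (elt K)) :=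
    integrable_inner_of_memLp hF hvg
  have hgv : Integrable (fun x => g x * v x) (volume.restrict (elt K)) := by
    simpa only [mul_comm] using integrable_mul_of_continuous hv.continuous hg
  have hqv : ∀ p ∈ K, HasFaceTrace K p
      (fun y => v y * inner ℝ (F y) (outerNormal K (K.erase p))) (fun x => v x * q p x) :=
    fun p hp => (hq p hp).mul_continuous h (by omega) hp hv.continuous.continuousOn
  have hlim1 := h.tendsto_integral_interiorCut hFv
  have hlim2 := h.tendsto_integral_interiorCut hgv
  have hlim3 : Tendsto (fun ε => ∑ p ∈ K, ‖baryGrad K p‖ * ∫ y in elt K, layer K p ε y *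
      (v y * inner ℝ (F y) (outerNormal K (K.erase p)))) (𝓝[>] 0)
      (𝓝 (∑ p ∈ K, ∫ x in hull (K.erase p), v x * q p x ∂(surf d))) :=
    tendsto_finsetSum _ fun p hp => (hqv p hp).tendsto_integral_layer h hd hp
  have hlim := hlim2.add hlim3
  -- The divergence identity is used with the test function `interiorCut K ε * v`. The gradient of
  -- the cutoff points along the inner normals, so its contribution is minus the layer integrals of
  -- the outer normal components.
  have key : ∀ᶠ ε in 𝓝[>] (0 : ℝ), (∫ y in elt K, interiorCut K ε y * (g y * v y)) +
      ∑ p ∈ K, ‖baryGrad K p‖ * ∫ y in elt K, layer K p ε y *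
        (v y * inner ℝ (F y) (outerNormal K (K.erase p))) =
      ∫ y in elt K, interiorCut K ε y * inner ℝ (F y) (gradient v y) := by
    filter_upwards [self_mem_nhdsWithin] with ε hε
    have h1 := hdiv _ (h.isTestFun_interiorCut_mul (mem_Ioi.1 hε) hv)
    have e : ∀ y, inner ℝ (F y) (gradient (fun y => interiorCut K ε y * v y) y) =
        interiorCut K ε y * inner ℝ (F y) (gradient v y) -
          ∑ p ∈ K, ‖baryGrad K p‖ * (layer K p ε y *
            (v y * inner ℝ (F y) (outerNormal K (K.erase p)))) := by
      intro y
      have hd1 := ((contDiff_interiorCut K ε).differentiable (by norm_num)).differentiableAt (x := y)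
      have hd2 := (hv.differentiable (by norm_num)).differentiableAt (x := y)
      rw [real_inner_comm, inner_gradient_eq, fderiv_fun_mul hd1 hd2]
      simp only [add_apply, smul_apply, smul_eq_mul]
      rw [gradient_interiorCut, ← inner_gradient_eq, real_inner_comm, sub_eq_add_neg,
        Finset.mul_sum, ← Finset.sum_neg_distrib]
      congr 1
      refine Finset.sum_congr rfl fun p hp => ?_
      conv_lhs => rw [h.baryGrad_eq (by omega) hp]
      rw [inner_neg_left, inner_smul_left, real_inner_comm]
      simp only [RCLike.conj_to_real]
      ring
    simp_rw [e] at h1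
    rw [integral_sub, integral_finsetSum] at h1
    · simp_rw [integral_const_mul] at h1
      rw [eq_comm, ← sub_eq_iff_eq_add, h1]
      refine integral_congr_ae (Eventually.of_forall fun y => ?_)
      simp only []; ring
    · exact fun p hp => (integrable_mul_of_continuous (continuous_layer K p ε)
        (hqv p hp).memLp_elt).const_mul _
    · refine hFv.bdd_mul (c := 1) (contDiff_interiorCut K ε).continuous.aestronglyMeasurable
        (Eventually.of_forall fun y => abs_prod_cut_le _ _)
    · exact integrable_finsetSum _ fun p hp => (integrable_mul_of_continuous
        (continuous_layer K p ε) (hqv p hp).memLp_elt).const_mul _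
  have := tendsto_nhds_unique (hlim.congr' key) hlim1
  rw [← this]
  simp_rw [mul_comm (v _)]

end

section

variable {d : ℕ}

/-! ### Combinatorics of a triangulation -/

variable {Ω Ω₁ Ω₂ : Set (Pt d)} {T : Triangulation Ω} {K K' e : Finset (Pt d)} {p q x : Pt d}

lemma Triangulation.mem_elements : K ∈ T.elements ↔ K ∈ T.faces ∧ K.card = d + 1 := by
  simp [Triangulation.elements]

lemma Triangulation.mem_edges : e ∈ T.edges ↔ e ∈ T.faces ∧ e.card = d := by
  simp [Triangulation.edges]

lemma Triangulation.mem_adjacent : K ∈ T.adjacent e ↔ K ∈ T.elements ∧ e ⊆ K := by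
  simp [Triangulation.adjacent]

lemma Triangulation.mem_interfaceEdges :
    e ∈ T.interfaceEdges Ω₁ Ω₂ ↔ e ∈ T.edges ∧ hull e ⊆ interface Ω₁ Ω₂ := by
  simp [Triangulation.interfaceEdges]

lemma Triangulation.isSimplex (hK : K ∈ T.elements) : IsSimplex K :=
  ⟨T.indep (T.mem_elements.1 hK).1, (T.mem_elements.1 hK).2⟩

lemma Triangulation.edgesOf_subset (hd : 1 ≤ d) (hK : K ∈ T.elements) : edgesOf K ⊆ T.edges := by
  intro e he
  rw [edgesOf, Finset.mem_powersetCard] at he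
  refine T.mem_edges.2 ⟨T.down_closed (T.mem_elements.1 hK).1 he.1 ?_, he.2⟩
  rw [← Finset.card_pos, he.2]; omega

lemma Triangulation.mem_edgesOf_of_adjacent (he : e ∈ T.edges) (hK : K ∈ T.adjacent e) :
    e ∈ edgesOf K :=
  Finset.mem_powersetCard.2 ⟨(T.mem_adjacent.1 hK).2, (T.mem_edges.1 he).2⟩

lemma Triangulation.adjacent_nonempty (he : e ∈ T.edges) : (T.adjacent e).Nonempty := by
  obtain ⟨K, hK, heK, hc⟩ := T.pure e (T.mem_edges.1 he).1
  exact ⟨K, T.mem_adjacent.2 ⟨T.mem_elements.2 ⟨hK, hc⟩, heK⟩⟩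

lemma Triangulation.sum_swap {M : Type*} [AddCommMonoid M] (hd : 1 ≤ d)
    (g : Finset (Pt d) → Finset (Pt d) → M) :
    ∑ K ∈ T.elements, ∑ e ∈ edgesOf K, g K e = ∑ e ∈ T.edges, ∑ K ∈ T.adjacent e, g K e := by
  refine Finset.sum_comm' fun K e => ?_
  constructor
  · rintro ⟨hK, he⟩
    exact ⟨T.mem_adjacent.2 ⟨hK, (Finset.mem_powersetCard.1 he).1⟩, T.edgesOf_subset hd hK he⟩
  · rintro ⟨hK, he⟩
    exact ⟨(T.mem_adjacent.1 hK).1, T.mem_edgesOf_of_adjacent he hK⟩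

lemma Triangulation.hull_subset_closure (hK : K ∈ T.faces) : hull K ⊆ closure Ω := by
  rw [← T.covers]
  exact Geometry.SimplicialComplex.convexHull_subset_space hK

lemma Triangulation.closure_eq : closure Ω = ⋃ K ∈ T.elements, hull K := by
  refine Subset.antisymm (fun x hx => ?_)
    (iUnion₂_subset fun K hK => T.hull_subset_closure (T.mem_elements.1 hK).1)
  rw [← T.covers, Geometry.SimplicialComplex.mem_space_iff] at hx
  obtain ⟨s, hs, hxs⟩ := hx
  obtain ⟨K, hK, hsK, hc⟩ := T.pure s hs
  exact mem_iUnion₂.2 ⟨K, T.mem_elements.2 ⟨hK, hc⟩, hull_mono hsK hxs⟩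

lemma IsSimplex.bary_eq_zero_of_mem (h : IsSimplex K) {s : Set (Pt d)} (hs : s ⊆ K) {j : Pt d}
    (hj : j ∈ K) (hjs : j ∉ s) (hx : x ∈ convexHull ℝ s) : bary K j x = 0 := by
  have h1 : convexHull ℝ s ⊆ {y | bary K j y = 0} := by
    refine convexHull_min (fun y hy => h.bary_ne hj (hs hy) fun hh => hjs (hh ▸ hy)) ?_
    exact (convex_singleton (0 : ℝ)).affine_preimage (bary K j)
  exact h1 hx

/-- In a conforming triangulation two simplices meet in the hull of their common vertices, so a
vertex that carries weight at a common point must be shared. Combinatorial facts about elements and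
edges are deduced from geometric ones through this. -/
lemma Triangulation.mem_of_bary_ne_zero (hK : K ∈ T.elements) (hK' : K' ∈ T.faces)
    (hx : x ∈ hull K) (hx' : x ∈ hull K') {j : Pt d} (hj : j ∈ K) (hjx : bary K j x ≠ 0) :
    j ∈ K' := by
  by_contra hn
  have h1 := T.inter_subset_convexHull (T.mem_elements.1 hK).1 hK' ⟨hx, hx'⟩
  exact hjx ((T.isSimplex hK).bary_eq_zero_of_mem inter_subset_left hj (fun h => hn h.2) h1)

lemma Triangulation.subset_of_mem_elt (hK : K ∈ T.elements) (hK' : K' ∈ T.faces)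
    (hx : x ∈ elt K) (hx' : x ∈ hull K') : K ⊆ K' := fun j hj => by
  refine T.mem_of_bary_ne_zero hK hK' (elt_subset_hull K hx) hx' hj ?_
  rw [(T.isSimplex hK).elt_eq] at hx
  exact (hx j hj).ne'

lemma Triangulation.eq_of_mem_elt (hK : K ∈ T.elements) (hK' : K' ∈ T.elements)
    (hx : x ∈ elt K) (hx' : x ∈ hull K') : K = K' :=
  Finset.eq_of_subset_of_card_le (T.subset_of_mem_elt hK (T.mem_elements.1 hK').1 hx hx')
    (by rw [(T.mem_elements.1 hK).2, (T.mem_elements.1 hK').2])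

lemma Triangulation.disjoint_elt (hK : K ∈ T.elements) (hK' : K' ∈ T.elements) (hne : K ≠ K') :
    Disjoint (elt K) (hull K') :=
  disjoint_left.2 fun _ hx hx' => hne (T.eq_of_mem_elt hK hK' hx hx')

lemma Triangulation.notMem_hull_of_mem_elt (hK : K ∈ T.elements) (he : e ∈ T.edges)
    (hx : x ∈ elt K) : x ∉ hull e := fun hx' => by
  have := Finset.card_le_card (T.subset_of_mem_elt hK (T.mem_edges.1 he).1 hx hx')
  rw [(T.mem_elements.1 hK).2, (T.mem_edges.1 he).2] at this
  omega

/-! #### Faces and their neighbourhoods -/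

variable [DecidableEq (Pt d)]

/-- The relative interior of the face of `K` opposite to `p`. -/
def innerFace (K : Finset (Pt d)) (p : Pt d) : Set (Pt d) :=
  {x | bary K p x = 0 ∧ ∀ j ∈ K.erase p, 0 < bary K j x}

lemma IsSimplex.innerFace_subset (h : IsSimplex K) (hp : p ∈ K) :
    innerFace K p ⊆ hull (K.erase p) := by
  rintro x ⟨h0, h1⟩
  rw [h.hull_erase hp, h.hull_eq]
  refine ⟨fun j hj => ?_, h0⟩
  by_cases hjp : j = p
  · rw [hjp, h0]
  · exact (h1 j (Finset.mem_erase.2 ⟨hjp, hj⟩)).le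

lemma IsSimplex.ae_mem_innerFace (h : IsSimplex K) (hd : 2 ≤ d) (hp : p ∈ K) :
    ∀ᵐ x ∂(surf d).restrict (hull (K.erase p)), x ∈ innerFace K p := by
  filter_upwards [h.ae_bary_pos hd hp, ae_restrict_mem (measurableSet_hull _)] with x h1 h2
  exact ⟨h.hull_erase_subset hp h2, h1⟩

lemma IsSimplex.nonempty_innerFace (h : IsSimplex K) (hd : 1 ≤ d) (hp : p ∈ K) :
    (innerFace K p).Nonempty := by
  obtain ⟨y, hy⟩ := h.nonempty_elt
  rw [h.elt_eq] at hy
  refine ⟨faceProj K p y, ?_, fun j hj => ?_⟩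
  · rw [h.bary_faceProj hd hp hp, if_pos rfl]
  · have hj' := Finset.mem_erase.1 hj
    rw [h.bary_faceProj hd hp hj'.2, if_neg hj'.1]
    have h1 := hy j hj'.2
    have h2 := hy p hp
    positivity

lemma IsSimplex.hull_erase_subset_closure_innerFace (h : IsSimplex K) (hd : 1 ≤ d) (hp : p ∈ K) :
    hull (K.erase p) ⊆ closure (innerFace K p) := by
  intro x hx
  obtain ⟨c, hc⟩ := h.nonempty_innerFace hd hp
  have hlim : Tendsto (fun t : ℝ => AffineMap.lineMap x c t) (𝓝[>] 0) (𝓝 x) := by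
    have : Tendsto (fun t : ℝ => AffineMap.lineMap x c t) (𝓝 0) (𝓝 (AffineMap.lineMap x c (0 : ℝ))) :=
      AffineMap.lineMap_continuous.tendsto _
    rw [AffineMap.lineMap_apply_zero] at this
    exact this.mono_left nhdsWithin_le_nhds
  refine mem_closure_of_tendsto hlim ?_
  filter_upwards [Ioc_mem_nhdsGT (zero_lt_one (α := ℝ))] with t ht
  rw [h.hull_erase hp, h.hull_eq] at hx
  have key : ∀ j, bary K j (AffineMap.lineMap x c t) = (1 - t) * bary K j x + t * bary K j c := by
    intro j
    rw [AffineMap.apply_lineMap, AffineMap.lineMap_apply_module]; rfl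
  refine ⟨by rw [key, hx.2, hc.1]; ring, fun j hj => ?_⟩
  rw [key]
  have h1 := hx.1 j (Finset.mem_erase.1 hj).2
  have h2 := hc.2 j hj
  have h3 := ht.1
  have h4 : 0 ≤ 1 - t := by linarith [ht.2]
  positivity

lemma IsSimplex.bary_eq_of_erase_eq (h : IsSimplex K) (h' : IsSimplex K')
    (he : K.erase p = K'.erase q) {j : Pt d} (hj : j ∈ K.erase p) (hx : bary K p x = 0) :
    bary K' j x = bary K j x := by
  have hj' : j ∈ K' := (Finset.mem_erase.1 (he ▸ hj)).2
  rw [h.affine_eq (bary K' j) x, Finset.sum_eq_single_of_mem j (Finset.mem_erase.1 hj).2]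
  · rw [h'.bary_self hj', mul_one]
  · intro i hi hij
    by_cases hip : i = p
    · rw [hip, hx, zero_mul]
    · have : i ∈ K'.erase q := he ▸ Finset.mem_erase.2 ⟨hip, hi⟩
      rw [h'.bary_ne hj' (Finset.mem_erase.1 this).2 hij.symm, mul_zero]

/-- Two affine functions vanishing at the vertices of a common face are proportional; evaluating at
the apex gives the factor. -/
lemma IsSimplex.bary_apex_eq (h : IsSimplex K) (h' : IsSimplex K') (hp : p ∈ K) (hq : q ∈ K')
    (he : K.erase p = K'.erase q) (x : Pt d) : bary K' q x = bary K' q p * bary K p x := by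
  rw [h.affine_eq (bary K' q) x, Finset.sum_eq_single_of_mem p hp, mul_comm]
  intro i hi hip
  have : i ∈ K'.erase q := he ▸ Finset.mem_erase.2 ⟨hip, hi⟩
  rw [Finset.mem_erase] at this
  rw [h'.bary_ne hq this.2 this.1.symm, mul_zero]

lemma IsSimplex.innerFace_eq (h : IsSimplex K) (h' : IsSimplex K') (hp : p ∈ K) (hq : q ∈ K')
    (he : K.erase p = K'.erase q) : innerFace K p ⊆ innerFace K' q := by
  rintro x ⟨h0, h1⟩
  refine ⟨by rw [h.bary_apex_eq h' hp hq he, h0, mul_zero], fun j hj => ?_⟩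
  rw [← he] at hj
  rw [h.bary_eq_of_erase_eq h' he hj h0]
  exact h1 j hj

/-- Two elements with a common face lie on different sides of it. -/
lemma Triangulation.bary_apex_neg (hd : 1 ≤ d) (hK : K ∈ T.elements) (hK' : K' ∈ T.elements)
    (hne : K ≠ K') (hp : p ∈ K) (hq : q ∈ K') (he : K.erase p = K'.erase q) :
    bary K' q p < 0 := by
  have h := T.isSimplex hK
  have h' := T.isSimplex hK'
  have hne0 : bary K' q p ≠ 0 := fun h0 => by
    have := h.bary_apex_eq h' hp hq he q
    rw [h'.bary_self hq, h0, zero_mul] at this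
    exact one_ne_zero this
  -- If both apices were on the same side, a small step from a relatively interior point of the face
  -- in the direction of the apex would enter both open elements, which are disjoint.
  by_contra hpos
  have hpos : 0 < bary K' q p := lt_of_le_of_ne (not_lt.1 hpos) hne0.symm
  obtain ⟨c, hc⟩ := h.nonempty_innerFace hd hp
  have hc' := h.innerFace_eq h' hp hq he hc
  have hev : ∀ᶠ t in 𝓝[>] (0 : ℝ), c + t • apexDir K p ∈ elt K ∧ c + t • apexDir K p ∈ elt K' := by
    have hcont : ∀ (L : Finset (Pt d)) (j : Pt d), 0 < bary L j c →
        ∀ᶠ t in 𝓝[>] (0 : ℝ), 0 < bary L j (c + t • apexDir K p) := by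
      intro L j hj
      have hc : Continuous fun t : ℝ => bary L j (c + t • apexDir K p) :=
        (continuous_bary j).comp (by fun_prop)
      have := hc.tendsto 0
      simp only [zero_smul, add_zero] at this
      exact (this.eventually_const_lt hj).filter_mono nhdsWithin_le_nhds
    have e1 : ∀ᶠ t in 𝓝[>] (0 : ℝ), ∀ j ∈ K.erase p, 0 < bary K j (c + t • apexDir K p) :=
      (Finset.eventually_all _).2 fun j hj => hcont K j (hc.2 j hj)
    have e2 : ∀ᶠ t in 𝓝[>] (0 : ℝ), ∀ j ∈ K'.erase q, 0 < bary K' j (c + t • apexDir K p) :=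
      (Finset.eventually_all _).2 fun j hj => hcont K' j (hc'.2 j hj)
    filter_upwards [e1, e2, self_mem_nhdsWithin] with t h1 h2 ht
    have h3 : bary K p (c + t • apexDir K p) = t := by
      rw [h.bary_add_apexDir hd hp hp, hc.1, if_pos rfl]; ring
    have ht : 0 < t := ht
    rw [h.elt_eq, h'.elt_eq]
    refine ⟨fun j hj => ?_, fun j hj => ?_⟩
    · by_cases hjp : j = p
      · rw [hjp, h3]; exact ht
      · exact h1 j (Finset.mem_erase.2 ⟨hjp, hj⟩)
    · by_cases hjp : j = q
      · rw [hjp, h.bary_apex_eq h' hp hq he, h3]; positivity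
      · exact h2 j (Finset.mem_erase.2 ⟨hjp, hj⟩)
  obtain ⟨t, h1, h2⟩ := hev.exists
  exact hne (T.eq_of_mem_elt hK hK' h1 (elt_subset_hull _ h2))

lemma Triangulation.exists_apex (he : e ∈ T.edges) (hK : K ∈ T.adjacent e) :
    ∃ p ∈ K, K.erase p = e :=
  (T.isSimplex (T.mem_adjacent.1 hK).1).mem_edgesOf.1 (T.mem_edgesOf_of_adjacent he hK)

/-- Three elements on one edge would lie pairwise on opposite sides of it. The proportionality
factors of their apex coordinates are all negative, yet one is the product of two others. -/
lemma Triangulation.adjacent_eq_pair (hd : 1 ≤ d) (he : e ∈ T.edges) (hK : K ∈ T.adjacent e)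
    (hK' : K' ∈ T.adjacent e) (hne : K ≠ K') : T.adjacent e = {K, K'} := by
  refine Finset.Subset.antisymm (fun L hL => ?_) (by
    intro L hL
    rw [Finset.mem_insert, Finset.mem_singleton] at hL
    rcases hL with rfl | rfl <;> assumption)
  by_contra hn
  rw [Finset.mem_insert, Finset.mem_singleton, not_or] at hn
  obtain ⟨p, hp, hpe⟩ := T.exists_apex he hK
  obtain ⟨q, hq, hqe⟩ := T.exists_apex he hK'
  obtain ⟨r, hr, hre⟩ := T.exists_apex he hL
  have hK := (T.mem_adjacent.1 hK).1
  have hK' := (T.mem_adjacent.1 hK').1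
  have hL := (T.mem_adjacent.1 hL).1
  have h1 := T.bary_apex_neg hd hK hK' hne hp hq (hpe.trans hqe.symm)
  have h2 := T.bary_apex_neg hd hL hK hn.1 hr hp (hre.trans hpe.symm)
  have h3 := T.bary_apex_neg hd hL hK' hn.2 hr hq (hre.trans hqe.symm)
  have h4 := (T.isSimplex hK).bary_apex_eq (T.isSimplex hK') hp hq (hpe.trans hqe.symm) r
  have := mul_pos_of_neg_of_neg h1 h2
  linarith

/-- The apex coordinates of the two elements are proportional with a negative factor, hence so are
their gradients, whose directions are the inner normals. -/
lemma Triangulation.outerNormal_neg (hd : 1 ≤ d) (hK : K ∈ T.elements) (hK' : K' ∈ T.elements)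
    (hne : K ≠ K') (hp : p ∈ K) (hq : q ∈ K') (he : K.erase p = K'.erase q) :
    outerNormal K' (K'.erase q) = -outerNormal K (K.erase p) := by
  have h := T.isSimplex hK
  have h' := T.isSimplex hK'
  have hneg := T.bary_apex_neg hd hK hK' hne hp hq he
  set κ := bary K' q p
  have hgrad : baryGrad K' q = κ • baryGrad K p := by
    refine ext_inner_right ℝ fun v => ?_
    have h1 := bary_sub K' q v 0
    have h2 := bary_sub K p v 0
    rw [sub_zero] at h1 h2
    rw [inner_smul_left, ← h1, ← h2, h.bary_apex_eq h' hp hq he, h.bary_apex_eq h' hp hq he 0]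
    simp only [RCLike.conj_to_real]; ring
  have hb := norm_pos_iff.2 (h.baryGrad_ne_zero hd hp)
  have e1 := h'.baryGrad_eq hd hq
  rw [hgrad, norm_smul, Real.norm_eq_abs, abs_of_neg hneg] at e1
  conv_lhs at e1 => rw [h.baryGrad_eq hd hp]
  rw [smul_neg, smul_smul, neg_inj, neg_mul, neg_smul] at e1
  have h3 : κ * ‖baryGrad K p‖ ≠ 0 := (mul_neg_of_neg_of_pos hneg hb).ne
  have e2 : (κ * ‖baryGrad K p‖) • outerNormal K' (K'.erase q) =
      (κ * ‖baryGrad K p‖) • (-outerNormal K (K.erase p)) := by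
    rw [smul_neg, e1, neg_neg]
  exact smul_right_injective _ h3 e2

/-- A neighbourhood of the relative interior of the common face of two elements. -/
def patch (K K' : Finset (Pt d)) (p : Pt d) : Set (Pt d) :=
  {x | ∀ j ∈ K.erase p, 0 < bary K j x ∧ 0 < bary K' j x}

lemma isOpen_patch (K K' : Finset (Pt d)) (p : Pt d) : IsOpen (patch K K' p) := by
  rw [show patch K K' p = ⋂ j ∈ K.erase p, {x | 0 < bary K j x} ∩ {x | 0 < bary K' j x} by
    ext; simp [patch]]
  exact isOpen_biInter_finset fun j _ => (isOpen_lt continuous_const (continuous_bary j)).inter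
    (isOpen_lt continuous_const (continuous_bary j))

lemma convex_patch (K K' : Finset (Pt d)) (p : Pt d) : Convex ℝ (patch K K' p) := by
  rw [show patch K K' p = ⋂ j ∈ K.erase p, bary K j ⁻¹' Ioi 0 ∩ bary K' j ⁻¹' Ioi 0 by
    ext; simp [patch]]
  exact convex_iInter₂ fun j _ => ((convex_Ioi (0 : ℝ)).affine_preimage (bary K j)).inter
    ((convex_Ioi (0 : ℝ)).affine_preimage (bary K' j))

lemma IsSimplex.innerFace_subset_patch (h : IsSimplex K) (h' : IsSimplex K') (hp : p ∈ K)
    (hq : q ∈ K') (he : K.erase p = K'.erase q) : innerFace K p ⊆ patch K K' p := fun _ hx j hj =>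
  ⟨hx.2 j hj, (h.innerFace_eq h' hp hq he hx).2 j (he ▸ hj)⟩

/-- The sign of the apex coordinate of `K` decides: positive in `K`, zero on the face, negative in
`K'`. All other coordinates are positive in the patch. -/
lemma Triangulation.patch_subset (hd : 1 ≤ d) (hK : K ∈ T.elements) (hK' : K' ∈ T.elements)
    (hne : K ≠ K') (hp : p ∈ K) (hq : q ∈ K') (he : K.erase p = K'.erase q) (hx : x ∈ patch K K' p) :
    x ∈ elt K ∨ x ∈ innerFace K p ∨ x ∈ elt K' := by
  have h := T.isSimplex hK
  have h' := T.isSimplex hK'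
  have hneg := T.bary_apex_neg hd hK hK' hne hp hq he
  rw [h.elt_eq, h'.elt_eq]
  rcases lt_trichotomy 0 (bary K p x) with h0 | h0 | h0
  · refine Or.inl fun j hj => ?_
    by_cases hjp : j = p
    · rw [hjp]; exact h0
    · exact (hx j (Finset.mem_erase.2 ⟨hjp, hj⟩)).1
  · exact Or.inr (Or.inl ⟨h0.symm, fun j hj => (hx j hj).1⟩)
  · refine Or.inr (Or.inr fun j hj => ?_)
    by_cases hjp : j = q
    · rw [hjp, h.bary_apex_eq h' hp hq he]; exact mul_pos_of_neg_of_neg hneg h0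
    · exact (hx j (he ▸ Finset.mem_erase.2 ⟨hjp, hj⟩)).2

lemma Triangulation.patch_subset_closure (hd : 1 ≤ d) (hK : K ∈ T.elements) (hK' : K' ∈ T.elements)
    (hne : K ≠ K') (hp : p ∈ K) (hq : q ∈ K') (he : K.erase p = K'.erase q) :
    patch K K' p ⊆ closure Ω := by
  intro x hx
  have hc : hull K ⊆ closure Ω := T.hull_subset_closure (T.mem_elements.1 hK).1
  rcases T.patch_subset hd hK hK' hne hp hq he hx with h1 | h1 | h1
  · exact hc (elt_subset_hull _ h1)
  · exact hc (hull_mono (K.erase_subset p) ((T.isSimplex hK).innerFace_subset hp h1))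
  · exact T.hull_subset_closure (T.mem_elements.1 hK').1 (elt_subset_hull _ h1)

/-- Near the relative interior of a face there are only the adjacent elements. -/
lemma Triangulation.eventually_adjacent (hK : K ∈ T.elements) (hp : p ∈ K)
    (hx : x ∈ innerFace K p) :
    ∀ᶠ y in 𝓝 x, y ∈ closure Ω → ∃ L ∈ T.adjacent (K.erase p), y ∈ hull L := by
  have h := T.isSimplex hK
  have hxK : x ∈ hull K := hull_mono (K.erase_subset p) (h.innerFace_subset hp hx)
  -- The finitely many closed elements that miss `x` also miss a neighbourhood of it. An element
  -- containing `x` must contain every vertex of the face, since all of them carry weight at `x`.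
  have h1 : ∀ᶠ y in 𝓝 x, ∀ L ∈ T.elements, x ∉ hull L → y ∉ hull L := by
    refine (Finset.eventually_all _).2 fun L _ => ?_
    by_cases hL : x ∈ hull L
    · exact Eventually.of_forall fun y h => absurd hL h
    · filter_upwards [(isCompact_hull L).isClosed.isOpen_compl.mem_nhds hL] with y hy _ using hy
  filter_upwards [h1] with y hy hyΩ
  rw [T.closure_eq] at hyΩ
  obtain ⟨L, hL, hyL⟩ := mem_iUnion₂.1 hyΩ
  refine ⟨L, T.mem_adjacent.2 ⟨hL, fun j hj => ?_⟩, hyL⟩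
  have hxL : x ∈ hull L := by_contra fun hn => hy L hL hn hyL
  exact T.mem_of_bary_ne_zero hK (T.mem_elements.1 hL).1 hxK hxL (Finset.mem_erase.1 hj).2
    (hx.2 j hj).ne'

/-! #### The edges on the boundary and on the interface -/

/-- At a relatively interior point of the face that belonged to `Ω`, a small step out of `K` across
the face would land in some adjacent element. If `K` is the only one, this is impossible. -/
lemma Triangulation.hull_subset_frontier (hd : 1 ≤ d) (hΩ : IsOpen Ω) (hK : K ∈ T.elements)
    (hp : p ∈ K) (huniq : ∀ L ∈ T.adjacent (K.erase p), L = K) :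
    hull (K.erase p) ⊆ frontier Ω := by
  have h := T.isSimplex hK
  refine (h.hull_erase_subset_closure_innerFace hd hp).trans
    (closure_minimal (fun x hx => ?_) isClosed_frontier)
  have hxK : x ∈ hull K := hull_mono (K.erase_subset p) (h.innerFace_subset hp hx)
  rw [hΩ.frontier_eq]
  refine ⟨T.hull_subset_closure (T.mem_elements.1 hK).1 hxK, fun hxΩ => ?_⟩
  have hlim : Tendsto (fun t : ℝ => x + t • apexDir K p) (𝓝[<] 0) (𝓝 x) := by
    have hc : Continuous fun t : ℝ => x + t • apexDir K p := by fun_prop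
    have := hc.tendsto 0
    simp only [zero_smul, add_zero] at this
    exact this.mono_left nhdsWithin_le_nhds
  obtain ⟨t, h1, h2, ht⟩ := ((hlim.eventually (T.eventually_adjacent hK hp hx)).and
    ((hlim.eventually (hΩ.mem_nhds hxΩ)).and self_mem_nhdsWithin)).exists
  obtain ⟨L, hL, hxL⟩ := h1 (subset_closure h2)
  rw [huniq L hL, h.hull_eq] at hxL
  have h3 := hxL p hp
  rw [h.bary_add_apexDir hd hp hp, hx.1, if_pos rfl] at h3
  have : t < 0 := ht
  linarith

variable (hgeo : IsInterfaceGeometry Ω Ω₁ Ω₂) (hfit : T.FitsInterface Ω₁ Ω₂)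

include hgeo

/-- An open subset of the closure lies in `Ω` because `Ω` is the interior of its closure; without
this, `Ω` could have a slit along the face. -/
lemma IsInterfaceGeometry.patch_subset (hd : 1 ≤ d) (hK : K ∈ T.elements) (hK' : K' ∈ T.elements)
    (hne : K ≠ K') (hp : p ∈ K) (hq : q ∈ K') (he : K.erase p = K'.erase q) :
    patch K K' p ⊆ Ω := by
  rw [← hgeo.whole.interior_closure]
  exact interior_maximal (T.patch_subset_closure hd hK hK' hne hp hq he) (isOpen_patch K K' p)

omit [DecidableEq (Pt d)] in
lemma IsInterfaceGeometry.elt_subset (hK : K ∈ T.elements) : elt K ⊆ Ω := by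
  rw [← hgeo.whole.interior_closure]
  exact interior_mono (T.hull_subset_closure (T.mem_elements.1 hK).1)

include hfit

omit [DecidableEq (Pt d)] hgeo in
lemma Triangulation.FitsInterface.disjoint_elt (hK : K ∈ T.elements) :
    Disjoint (elt K) (interface Ω₁ Ω₂) := by
  obtain ⟨S, hS, hΓ⟩ := hfit
  rw [hΓ]
  refine disjoint_left.2 fun x hx hx' => ?_
  obtain ⟨e, he, hxe⟩ := mem_iUnion₂.1 hx'
  exact T.notMem_hull_of_mem_elt hK (hS he) hx hxe

omit [DecidableEq (Pt d)] hfit in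
-- A convex set is connected, and off the interface `Ω` is the disjoint union of two open sets.
lemma IsInterfaceGeometry.subset_or_subset {U : Set (Pt d)} (hU : U ⊆ Ω) (hUc : Convex ℝ U)
    (hΓ : Disjoint U (interface Ω₁ Ω₂)) : U ⊆ Ω₁ ∨ U ⊆ Ω₂ := by
  refine hUc.isPreconnected.subset_or_subset hgeo.left.isOpen hgeo.right.isOpen hgeo.disjoint ?_
  rw [hgeo.union]
  exact fun x hx => ⟨hU hx, disjoint_left.1 hΓ hx⟩

omit [DecidableEq (Pt d)] in
lemma IsInterfaceGeometry.elt_subset_or (hK : K ∈ T.elements) : elt K ⊆ Ω₁ ∨ elt K ⊆ Ω₂ :=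
  hgeo.subset_or_subset (hgeo.elt_subset hK) (convex_elt K) (hfit.disjoint_elt hK)

omit [DecidableEq (Pt d)] in
-- `sigma` tests inclusion of the closed element in the closure of `Ω₁`. An element inside `Ω₂`
-- fails the test because `Ω₁` is the interior of its closure and is disjoint from `Ω₂`.
lemma IsInterfaceGeometry.sigma_eq (hK : K ∈ T.elements) :
    (elt K ⊆ Ω₁ ∧ sigma Ω₁ K = 1) ∨ (elt K ⊆ Ω₂ ∧ sigma Ω₁ K = -1) := by
  have h := T.isSimplex hK
  rcases hgeo.elt_subset_or hfit hK with h1 | h2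
  · refine Or.inl ⟨h1, if_pos ?_⟩
    rw [← h.closure_elt]; exact closure_mono h1
  · refine Or.inr ⟨h2, if_neg fun h3 => ?_⟩
    have h4 : elt K ⊆ Ω₁ := by
      rw [← hgeo.left.interior_closure]; exact interior_mono h3
    obtain ⟨x, hx⟩ := h.nonempty_elt
    exact disjoint_left.1 hgeo.disjoint (h4 hx) (h2 hx)

/-- On both sides of the interface there are adjacent elements. -/
lemma IsInterfaceGeometry.exists_adjacent (hK : K ∈ T.elements) (hp : p ∈ K)
    (hx : x ∈ innerFace K p) :
    (x ∈ closure Ω₁ → ∃ L ∈ T.adjacent (K.erase p), elt L ⊆ Ω₁) ∧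
      (x ∈ closure Ω₂ → ∃ L ∈ T.adjacent (K.erase p), elt L ⊆ Ω₂) := by
  have key : ∀ V : Set (Pt d), IsOpen V → V ⊆ Ω → x ∈ closure V →
      ∃ L ∈ T.adjacent (K.erase p), (V ∩ elt L).Nonempty := by
    intro V hV hVΩ hxV
    obtain ⟨y, hyV, hy⟩ := (mem_closure_iff_frequently.1 hxV).and_eventually
      (T.eventually_adjacent hK hp hx) |>.exists
    obtain ⟨L, hL, hyL⟩ := hy (subset_closure (hVΩ hyV))
    rw [← (T.isSimplex (T.mem_adjacent.1 hL).1).closure_elt] at hyL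
    exact ⟨L, hL, mem_closure_iff.1 hyL V hV hyV⟩
  have hsub : Ω₁ ∪ Ω₂ ⊆ Ω := hgeo.union ▸ sdiff_subset
  constructor
  · intro h1
    obtain ⟨L, hL, y, hy1, hy2⟩ := key Ω₁ hgeo.left.isOpen (subset_union_left.trans hsub) h1
    refine ⟨L, hL, (hgeo.elt_subset_or hfit (T.mem_adjacent.1 hL).1).resolve_right fun h => ?_⟩
    exact disjoint_left.1 hgeo.disjoint hy1 (h hy2)
  · intro h1
    obtain ⟨L, hL, y, hy1, hy2⟩ := key Ω₂ hgeo.right.isOpen (subset_union_right.trans hsub) h1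
    refine ⟨L, hL, (hgeo.elt_subset_or hfit (T.mem_adjacent.1 hL).1).resolve_left fun h => ?_⟩
    exact disjoint_left.1 hgeo.disjoint (h hy2) hy1

/-- A relatively interior point of an interface edge lies in the boundaries of both subdomains, so
adjacent elements are found on either side. In particular such an edge has two adjacent elements. -/
lemma IsInterfaceGeometry.exists_adjacent_pair (hd : 1 ≤ d) (he : e ∈ T.interfaceEdges Ω₁ Ω₂) :
    ∃ K ∈ T.adjacent e, ∃ L ∈ T.adjacent e, elt K ⊆ Ω₁ ∧ elt L ⊆ Ω₂ ∧ K ≠ L := by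
  rw [T.mem_interfaceEdges] at he
  obtain ⟨M, hM⟩ := T.adjacent_nonempty he.1
  obtain ⟨p, hp, rfl⟩ := T.exists_apex he.1 hM
  have hM' := (T.mem_adjacent.1 hM).1
  have h := T.isSimplex hM'
  obtain ⟨c, hc⟩ := h.nonempty_innerFace hd hp
  have hcΓ := he.2 (h.innerFace_subset hp hc)
  obtain ⟨K, hK, hK1⟩ := (hgeo.exists_adjacent hfit hM' hp hc).1 (frontier_subset_closure hcΓ.1)
  obtain ⟨L, hL, hL1⟩ := (hgeo.exists_adjacent hfit hM' hp hc).2 (frontier_subset_closure hcΓ.2)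
  refine ⟨K, hK, L, hL, hK1, hL1, ?_⟩
  rintro rfl
  obtain ⟨y, hy⟩ := (T.isSimplex (T.mem_adjacent.1 hK).1).nonempty_elt
  exact disjoint_left.1 hgeo.disjoint (hK1 hy) (hL1 hy)

omit hgeo in
/-- An edge not in the interface meets it only in its boundary. -/
lemma Triangulation.FitsInterface.disjoint_innerFace (hK : K ∈ T.elements) (hd : 1 ≤ d)
    (hp : p ∈ K) (he : K.erase p ∉ T.interfaceEdges Ω₁ Ω₂) :
    Disjoint (innerFace K p) (interface Ω₁ Ω₂) := by
  have h := T.isSimplex hK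
  have hed : K.erase p ∈ T.edges := T.edgesOf_subset hd hK (h.mem_edgesOf.2 ⟨p, hp, rfl⟩)
  obtain ⟨S, hS, hΓ⟩ := hfit
  refine disjoint_left.2 fun x hx hx' => he ?_
  rw [hΓ] at hx'
  obtain ⟨e', he', hxe⟩ := mem_iUnion₂.1 hx'
  have hxK : x ∈ hull K := hull_mono (K.erase_subset p) (h.innerFace_subset hp hx)
  have hsub : K.erase p ⊆ e' := fun j hj => T.mem_of_bary_ne_zero hK (T.mem_edges.1 (hS he')).1
    hxK hxe (Finset.mem_erase.1 hj).2 (hx.2 j hj).ne'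
  have heq := Finset.eq_of_subset_of_card_le hsub
    (by rw [(T.mem_edges.1 (hS he')).2, (T.mem_edges.1 hed).2])
  rw [T.mem_interfaceEdges]
  refine ⟨hed, ?_⟩
  rw [heq, hΓ]
  exact subset_biUnion_of_mem he'

end

section

variable {d : ℕ}

/-! ### Fractional Sobolev spaces -/

variable {U U' : Set (Pt d)} {v w : Pt d → ℝ} {s : ℝ} {K : Finset (Pt d)} {p : Pt d}

lemma h1SemiSq_eq (U : Set (Pt d)) (v : Pt d → ℝ) :
    h1SemiSq U v = ∫⁻ x in U, ‖weakGrad U v x‖ₑ ^ 2 := by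
  simp only [h1SemiSq, ofReal_norm_sq]

lemma lintegral_enorm_sq_lt_top {E : Type*} [NormedAddCommGroup E] {μ : Measure (Pt d)}
    {f : Pt d → E} (hf : MemLp f 2 μ) : ∫⁻ x, ‖f x‖ₑ ^ 2 ∂μ < ⊤ := by
  have := hf.2
  rw [eLpNorm_lt_top_iff_lintegral_rpow_enorm_lt_top (by norm_num) (by norm_num)] at this
  simpa using this

lemma MemH1.h1SemiSq_lt_top (h : MemH1 U v) : h1SemiSq U v < ⊤ := by
  rw [h1SemiSq_eq]; exact lintegral_enorm_sq_lt_top h.memLp_weakGrad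

lemma enorm_sq_eq_sum (x : Pt d) : ‖x‖ₑ ^ 2 = ∑ i, ‖x i‖ₑ ^ 2 := by
  rw [← ofReal_norm_sq, EuclideanSpace.norm_sq_eq, ENNReal.ofReal_sum_of_nonneg
    (fun _ _ => by positivity)]
  exact Finset.sum_congr rfl fun i _ => ofReal_norm_sq _

lemma memLp_coord {μ : Measure (Pt d)} {G : Pt d → Pt d} (hG : MemLp G 2 μ) (i : Fin d) :
    MemLp (fun x => G x i) 2 μ :=
  hG.of_le ((EuclideanSpace.proj (𝕜 := ℝ) i).continuous.comp_aestronglyMeasurable hG.1)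
    (Eventually.of_forall fun x => PiLp.norm_apply_le (G x) i)

lemma MemH1.memLp_weakPartial (h : MemH1 U v) (i : Fin d) :
    MemLp (weakPartial U i v) 2 (volume.restrict U) := memLp_coord h.memLp_weakGrad i

lemma MemH1.h1SemiSq_eq_sum (h : MemH1 U v) :
    h1SemiSq U v = ∑ i, ∫⁻ x in U, ‖weakPartial U i v x‖ₑ ^ 2 := by
  rw [h1SemiSq_eq, ← lintegral_finsetSum' _ fun i _ => (h.memLp_weakPartial i).1.enorm.pow_const 2]
  exact lintegral_congr fun x => enorm_sq_eq_sum _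

lemma fracSemiSq_one (U : Set (Pt d)) (v : Pt d → ℝ) :
    fracSemiSq U 1 v = ∑ i, h1SemiSq U (weakPartial U i v) := by simp [fracSemiSq]

lemma fracSemiSq_of_ne (hs : s ≠ 1) (U : Set (Pt d)) (v : Pt d → ℝ) :
    fracSemiSq U s v = ∑ i, slobSq U s (weakPartial U i v) := by
  rw [fracSemiSq, if_neg hs]; rfl

lemma weakPartial_mono (h : MemH1 U v) (hU' : IsOpen U') (hUU : U' ⊆ U) (i : Fin d) :
    weakPartial U' i v =ᵐ[volume.restrict U'] weakPartial U i v :=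
  (weakGrad_mono h hU' hUU).mono fun x hx => by simp only [weakPartial, hx]

lemma weakPartial_congr (hU : IsOpen U) (h : MemH1 U v) (hvw : v =ᵐ[volume.restrict U] w)
    (i : Fin d) : weakPartial U i w =ᵐ[volume.restrict U] weakPartial U i v :=
  (weakGrad_congr hU h hvw).mono fun x hx => by simp only [weakPartial, hx]

lemma weakPartial_sub (hU : IsOpen U) (hv : MemH1 U v) (hw : MemH1 U w) (i : Fin d) :
    weakPartial U i (v - w) =ᵐ[volume.restrict U] weakPartial U i v - weakPartial U i w :=
  (weakGrad_sub hU hv hw).mono fun x hx => by simp [weakPartial, hx]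

lemma h1SemiSq_congr (hU : IsOpen U) (h : MemH1 U v) (hvw : v =ᵐ[volume.restrict U] w) :
    h1SemiSq U w = h1SemiSq U v := by
  rw [h1SemiSq_eq, h1SemiSq_eq]
  exact lintegral_congr_ae ((weakGrad_congr hU h hvw).mono fun x hx => by simp only [hx])

lemma h1SemiSq_sub_le (hU : IsOpen U) (hv : MemH1 U v) (hw : MemH1 U w) :
    h1SemiSq U (v - w) ≤ 2 * h1SemiSq U v + 2 * h1SemiSq U w := by
  rw [(hv.sub hw).h1SemiSq_eq_sum, hv.h1SemiSq_eq_sum, hw.h1SemiSq_eq_sum, Finset.mul_sum,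
    Finset.mul_sum, ← Finset.sum_add_distrib]
  refine Finset.sum_le_sum fun i _ => ?_
  calc _ = ∫⁻ x in U, ‖weakPartial U i v x + -weakPartial U i w x‖ₑ ^ 2 :=
        lintegral_congr_ae ((weakPartial_sub hU hv hw i).mono fun x hx => by
          simp only [hx]; rw [Pi.sub_apply, sub_eq_add_neg])
    _ ≤ _ := (lintegral_enorm_add_sq_le (hv.memLp_weakPartial i).1).trans_eq (by simp)

lemma MemHfrac.mono (h : MemHfrac U s v) (hU' : IsOpen U') (hUU : U' ⊆ U) : MemHfrac U' s v := by
  have h1 : s = 1 → ∀ i, MemH1 U' (weakPartial U' i v) := fun hs i =>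
    ((h.2.1 hs i).mono hUU).congr (weakPartial_mono h.1 hU' hUU i).symm
  refine ⟨h.1.mono hUU, h1, ?_⟩
  by_cases hs : s = 1
  · have h2 := h1 hs
    subst hs
    rw [fracSemiSq_one]
    exact ENNReal.sum_lt_top.2 fun i _ => (h2 i).h1SemiSq_lt_top
  · have h2 := h.2.2
    rw [fracSemiSq_of_ne hs] at h2 ⊢
    refine lt_of_le_of_lt (Finset.sum_le_sum fun i _ => ?_) h2
    rw [slobSq_congr (weakPartial_mono h.1 hU' hUU i)]
    exact slobSq_mono hUU

lemma fracSemiSq_congr (hU : IsOpen U) (h : MemHfrac U s v) (hvw : v =ᵐ[volume.restrict U] w) :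
    fracSemiSq U s w = fracSemiSq U s v := by
  by_cases hs : s = 1
  · have h2 := h.2.1 hs
    subst hs
    rw [fracSemiSq_one, fracSemiSq_one]
    exact Finset.sum_congr rfl fun i _ =>
      h1SemiSq_congr hU (h2 i) (weakPartial_congr hU h.1 hvw i).symm
  · rw [fracSemiSq_of_ne hs, fracSemiSq_of_ne hs]
    exact Finset.sum_congr rfl fun i _ => slobSq_congr (weakPartial_congr hU h.1 hvw i)

lemma MemHfrac.congr (h : MemHfrac U s v) (hU : IsOpen U) (hvw : v =ᵐ[volume.restrict U] w) :
    MemHfrac U s w :=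
  ⟨h.1.congr hvw, fun hs i => (h.2.1 hs i).congr (weakPartial_congr hU h.1 hvw i).symm,
    (fracSemiSq_congr hU h hvw).trans_lt h.2.2⟩

lemma fracSemiSq_sub_le (hU : IsOpen U) (hv : MemHfrac U s v) (hw : MemHfrac U s w) :
    fracSemiSq U s (v - w) ≤ 2 * fracSemiSq U s v + 2 * fracSemiSq U s w := by
  by_cases hs : s = 1
  · have h1 := hv.2.1 hs
    have h2 := hw.2.1 hs
    subst hs
    simp only [fracSemiSq_one]
    rw [Finset.mul_sum, Finset.mul_sum, ← Finset.sum_add_distrib]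
    refine Finset.sum_le_sum fun i _ => ?_
    rw [h1SemiSq_congr hU ((h1 i).sub (h2 i)) (weakPartial_sub hU hv.1 hw.1 i).symm]
    exact h1SemiSq_sub_le hU (h1 i) (h2 i)
  · simp only [fracSemiSq_of_ne hs]
    rw [Finset.mul_sum, Finset.mul_sum, ← Finset.sum_add_distrib]
    refine Finset.sum_le_sum fun i _ => ?_
    rw [slobSq_congr (weakPartial_sub hU hv.1 hw.1 i)]
    exact slobSq_sub_le (hv.1.memLp_weakPartial i).1 (hw.1.memLp_weakPartial i).1

lemma MemHfrac.sub (hU : IsOpen U) (hv : MemHfrac U s v) (hw : MemHfrac U s w) :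
    MemHfrac U s (v - w) := by
  refine ⟨hv.1.sub hw.1, fun hs i => ((hv.2.1 hs i).sub (hw.2.1 hs i)).congr
    (weakPartial_sub hU hv.1 hw.1 i).symm, (fracSemiSq_sub_le hU hv hw).trans_lt ?_⟩
  exact ENNReal.add_lt_top.2 ⟨ENNReal.mul_lt_top (by simp) hv.2.2,
    ENNReal.mul_lt_top (by simp) hw.2.2⟩

/-- The exponent of the Slobodeckij space which is used for derivatives in `H^s`. -/
def slobExp (s : ℝ) : ℝ := if s = 1 then 3 / 4 else s

lemma half_lt_slobExp (hs : 1 / 2 < s) : 1 / 2 < slobExp s := by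
  unfold slobExp; split_ifs <;> linarith

lemma slobExp_lt_one (hs : s ≤ 1) : slobExp s < 1 := by
  unfold slobExp; split_ifs with h
  · norm_num
  · exact lt_of_le_of_ne hs h

lemma IsSimplex.slobSq_le (h : IsSimplex K) (hd : 2 ≤ d) {t : ℝ} (ht0 : 0 < t) (ht1 : t < 1)
    (hv : MemH1 (elt K) v) :
    slobSq (elt K) t v ≤
      ENNReal.ofReal (slobConst d t * size K ^ (2 - 2 * t)) * h1SemiSq (elt K) v := by
  rw [h1SemiSq_eq]
  exact slobSq_le_of_hasWeakGrad hd (isOpen_elt K) (convex_elt K) (h.size_pos (by omega))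
    (fun x hx y hy => dist_le_size (elt_subset_hull K hx) (elt_subset_hull K hy)) ht0 ht1 hv.1
    hv.hasWeakGrad

lemma IsSimplex.slobSq_lt_top (h : IsSimplex K) (hd : 2 ≤ d) {t : ℝ} (ht0 : 0 < t) (ht1 : t < 1)
    (hv : MemH1 (elt K) v) : slobSq (elt K) t v < ⊤ :=
  (h.slobSq_le hd ht0 ht1 hv).trans_lt
    (ENNReal.mul_lt_top ENNReal.ofReal_lt_top hv.h1SemiSq_lt_top)

/-- For `s = 1` the seminorm of order `3/4` of a derivative is bounded by its `H¹` seminorm times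
`size K ^ (1/2)`, and with the weight `size K ^ (3/2)` the correct power `size K ^ 2` appears. Thus
both cases scale alike, and later arguments need not distinguish them. -/
lemma IsSimplex.slobSq_weakPartial_le (h : IsSimplex K) (hd : 2 ≤ d) (hv : MemHfrac (elt K) s v) :
    ∑ i, ENNReal.ofReal (size K ^ (2 * slobExp s)) *
      slobSq (elt K) (slobExp s) (weakPartial (elt K) i v) ≤
      ENNReal.ofReal (slobConst d (3 / 4) + 1) *
        (ENNReal.ofReal (size K ^ (2 * s)) * fracSemiSq (elt K) s v) := by
  have hK := h.size_pos (by omega)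
  have hc := slobConst_pos d (t := 3 / 4) (by norm_num)
  by_cases hs : s = 1
  · have h1 := hv.2.1 hs
    subst hs
    rw [fracSemiSq_one, Finset.mul_sum, Finset.mul_sum]
    refine Finset.sum_le_sum fun i _ => ?_
    rw [slobExp, if_pos rfl]
    calc _ ≤ ENNReal.ofReal (size K ^ (2 * (3 / 4 : ℝ))) *
          (ENNReal.ofReal (slobConst d (3 / 4) * size K ^ (2 - 2 * (3 / 4 : ℝ))) *
            h1SemiSq (elt K) (weakPartial (elt K) i v)) :=
          mul_le_mul' le_rfl (h.slobSq_le hd (by norm_num) (by norm_num) (h1 i))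
      _ = ENNReal.ofReal (slobConst d (3 / 4)) * (ENNReal.ofReal (size K ^ (2 * (1 : ℝ))) *
            h1SemiSq (elt K) (weakPartial (elt K) i v)) := by
          rw [← mul_assoc, ← mul_assoc, ← ENNReal.ofReal_mul (by positivity),
            ← ENNReal.ofReal_mul hc.le]
          congr 2
          rw [mul_left_comm, ← Real.rpow_add hK]
          norm_num
      _ ≤ _ := by gcongr; linarith
  · rw [fracSemiSq_of_ne hs, ← Finset.mul_sum, slobExp, if_neg hs]
    refine le_mul_of_one_le_left (by positivity) ?_
    rw [ENNReal.one_le_ofReal]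
    linarith

lemma MemHfrac.slobSq_lt_top (h : IsSimplex K) (hd : 2 ≤ d) (hv : MemHfrac (elt K) s v)
    (i : Fin d) : slobSq (elt K) (slobExp s) (weakPartial (elt K) i v) < ⊤ := by
  have hK := h.size_pos (by omega)
  have h1 := (Finset.single_le_sum (f := fun i => ENNReal.ofReal (size K ^ (2 * slobExp s)) *
      slobSq (elt K) (slobExp s) (weakPartial (elt K) i v)) (fun _ _ => bot_le)
      (Finset.mem_univ i)).trans (h.slobSq_weakPartial_le hd hv)
  have h2 := h1.trans_lt (ENNReal.mul_lt_top ENNReal.ofReal_lt_top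
    (ENNReal.mul_lt_top ENNReal.ofReal_lt_top hv.2.2))
  by_contra hn
  rw [not_lt_top_iff.1 hn, ENNReal.mul_top (by rw [Ne, ENNReal.ofReal_eq_zero, not_le]; positivity)]
    at h2
  exact lt_irrefl _ h2

lemma weakPartial_of_contDiff (hv : ContDiff ℝ ∞ v) (hU : Bornology.IsBounded U) (hU' : IsOpen U)
    (i : Fin d) : weakPartial U i v =ᵐ[volume.restrict U] fun x => gradient v x i :=
  (weakGrad_of_contDiff hv hU hU').mono fun x hx => by simp only [weakPartial, hx]

lemma contDiff_gradient_coord (hv : ContDiff ℝ ∞ v) (i : Fin d) :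
    ContDiff ℝ ∞ fun x => gradient v x i := by
  have e : (fun x => gradient v x i) = fun x => fderiv ℝ v x (EuclideanSpace.single i 1) := by
    ext x
    rw [← inner_gradient_eq, EuclideanSpace.inner_single_right]
    simp
  rw [e]
  exact (hv.fderiv_right (m := ∞) (by simp)).clm_apply contDiff_const

lemma IsSimplex.memHfrac_of_contDiff (h : IsSimplex K) (hd : 2 ≤ d) (hv : ContDiff ℝ ∞ v)
    (hs0 : 0 < s) (hs1 : s ≤ 1) : MemHfrac (elt K) s v := by
  have h1 : ∀ i, MemH1 (elt K) (weakPartial (elt K) i v) := fun i =>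
    (memH1_of_contDiff (contDiff_gradient_coord hv i) (isBounded_elt K)).congr
      (weakPartial_of_contDiff hv (isBounded_elt K) (isOpen_elt K) i).symm
  refine ⟨memH1_of_contDiff hv (isBounded_elt K), fun _ => h1, ?_⟩
  by_cases hs : s = 1
  · rw [hs, fracSemiSq_one]
    exact ENNReal.sum_lt_top.2 fun i _ => (h1 i).h1SemiSq_lt_top
  · rw [fracSemiSq_of_ne hs]
    exact ENNReal.sum_lt_top.2 fun i _ => h.slobSq_lt_top hd hs0 (lt_of_le_of_ne hs1 hs) (h1 i)

/-! ### Traces of fluxes -/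

variable [DecidableEq (Pt d)]

lemma HasFaceTrace.sub (h : IsSimplex K) (hd : 1 ≤ d) (hp : p ∈ K) {a b : Pt d → ℝ}
    (h1 : HasFaceTrace K p v a) (h2 : HasFaceTrace K p w b) :
    HasFaceTrace K p (v - w) (a - b) := by
  have h3 := h1.add h hd hp (h2.mul_continuous h hd hp (θ := fun _ => -1) continuousOn_const)
  convert h3 using 1 <;> ext x <;> simp [sub_eq_add_neg]

lemma HasFaceTrace.zero (K : Finset (Pt d)) (p : Pt d) :
    HasFaceTrace K p (0 : Pt d → ℝ) 0 := by
  refine ⟨MemLp.zero, MemLp.zero, Eventually.of_forall fun x => ?_, ?_⟩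
  · simp [HasStrongValue]
  · simp

lemma HasFaceTrace.sum (h : IsSimplex K) (hd : 1 ≤ d) (hp : p ∈ K) {ι : Type*} (S : Finset ι)
    {f a : ι → Pt d → ℝ} (hf : ∀ i ∈ S, HasFaceTrace K p (f i) (a i)) :
    HasFaceTrace K p (∑ i ∈ S, f i) (∑ i ∈ S, a i) := by
  classical
  induction S using Finset.induction_on with
  | empty => simpa using HasFaceTrace.zero K p
  | insert i S hi ih =>
    rw [Finset.sum_insert hi, Finset.sum_insert hi]
    exact (hf i (Finset.mem_insert_self _ _)).add h hd hp
      (ih fun j hj => hf j (Finset.mem_insert_of_mem hj))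

lemma HasFaceTrace.trace (h : IsSimplex K) (hd : 1 ≤ d) (hp : p ∈ K) {a : Pt d → ℝ}
    (ht : HasFaceTrace K p v a) : HasFaceTrace K p v (trace (elt K) v) :=
  ht.congr_trace h hd hp (ht.trace_eq h).symm

/-- The assumptions on the coefficient in the closed simplex. -/
structure IsBoundedCoeff (K : Finset (Pt d)) (L : ℝ) (A : Pt d → Pt d →L[ℝ] Pt d) : Prop where
  exists_extension : ∃ A' : Pt d → Pt d →L[ℝ] Pt d, ContinuousOn A' (hull K) ∧ EqOn A' A (elt K) ∧
    ∀ x ∈ hull K, ‖A' x‖ ≤ L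

omit [DecidableEq (Pt d)] in
lemma enorm_sum_sq_le {ι : Type*} (S : Finset ι) (f : ι → ℝ) :
    ‖∑ i ∈ S, f i‖ₑ ^ 2 ≤ S.card * ∑ i ∈ S, ‖f i‖ₑ ^ 2 := by
  have h1 : ∀ i ∈ S, ‖f i‖ₑ ^ 2 = ENNReal.ofReal (f i ^ 2) := fun i _ => (ofReal_sq_eq_enorm _).symm
  rw [Finset.sum_congr rfl h1, ← ofReal_sq_eq_enorm,
    ← ENNReal.ofReal_sum_of_nonneg (fun _ _ => sq_nonneg _), ← ENNReal.ofReal_natCast,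
    ← ENNReal.ofReal_mul (by positivity)]
  exact ENNReal.ofReal_le_ofReal sq_sum_le_card_mul_sum_sq

/-- The trace of a flux on a face, with the estimate in terms of the shape of the simplex. -/
lemma exists_flux_bound (hd : 2 ≤ d) {κ L : ℝ} (hκ : 0 < κ) (hL : 0 < L) (hs0 : 1 / 2 < s)
    (hs1 : s ≤ 1) :
    ∃ C : ℝ, 0 < C ∧ ∀ (K : Finset (Pt d)) (c : Pt d), IsSimplex K →
      Metric.closedBall c (κ * size K) ⊆ hull K → ∀ p ∈ K, ∀ A, IsBoundedCoeff K L A →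
      ∀ v : Pt d → ℝ, MemHfrac (elt K) s v →
        HasFaceTrace K p (fun y => inner ℝ (A y (weakGrad (elt K) v y))
          (outerNormal K (K.erase p))) (flux A v K (K.erase p)) ∧
        ENNReal.ofReal (size K) *
            ∫⁻ x in hull (K.erase p), ‖flux A v K (K.erase p) x‖ₑ ^ 2 ∂(surf d) ≤
          ENNReal.ofReal C * (h1SemiSq (elt K) v +
            ENNReal.ofReal (size K ^ (2 * s)) * fracSemiSq (elt K) s v) := by
  obtain ⟨C, hC, h⟩ := trace_theorem hd hκ (half_lt_slobExp hs0) (slobExp_lt_one hs1)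
  have hc := slobConst_pos d (t := 3 / 4) (by norm_num)
  refine ⟨d * L ^ 2 * C * (slobConst d (3 / 4) + 1), by positivity, ?_⟩
  intro K c hK hball p hp A hA v hv
  obtain ⟨A', hA'c, hA'e, hA'b⟩ := hA
  have hd1 : 1 ≤ d := by omega
  set n := outerNormal K (K.erase p) with hn
  have hn1 : ‖n‖ = 1 := (hK.isOuterNormal hd1 hp).1
  -- The normal flux is a combination of the partial derivatives with coefficients `θ i` that are
  -- continuous on the closed element, so the trace theorem is needed for the partial derivatives
  -- only.
  set θ : Fin d → Pt d → ℝ := fun i y => inner ℝ (A' y (EuclideanSpace.single i 1)) n with hθ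
  have hθc : ∀ i, ContinuousOn (θ i) (hull K) := fun i =>
    (hA'c.clm_apply continuousOn_const).inner continuousOn_const
  have hθb : ∀ i, ∀ y ∈ hull K, |θ i y| ≤ L := fun i y hy => by
    calc |θ i y| ≤ ‖A' y (EuclideanSpace.single i 1)‖ * ‖n‖ := abs_real_inner_le_norm _ _
      _ ≤ (‖A' y‖ * ‖(EuclideanSpace.single i 1 : Pt d)‖) * ‖n‖ := by
          gcongr; exact (A' y).le_opNorm _
      _ ≤ L := by rw [hn1]; simpa using hA'b y hy
  set G := weakGrad (elt K) v with hG
  have htr := fun i => h K c hK hball p hp (weakPartial (elt K) i v) (hv.1.memLp_weakPartial i)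
    (hv.slobSq_lt_top hK hd i).ne
  have hsum : HasFaceTrace K p (∑ i, fun y => θ i y * weakPartial (elt K) i v y)
      (∑ i, fun x => θ i x * trace (elt K) (weakPartial (elt K) i v) x) :=
    HasFaceTrace.sum hK hd1 hp _ fun i _ => (htr i).1.mul_continuous hK hd1 hp (hθc i)
  have hae : (∑ i, fun y => θ i y * weakPartial (elt K) i v y) =ᵐ[volume.restrict (elt K)]
      fun y => inner ℝ (A y (G y)) n := by
    filter_upwards [ae_restrict_mem (isOpen_elt K).measurableSet] with y hy
    have e1 : G y = ∑ i, (G y i) • (EuclideanSpace.single i 1 : Pt d) := by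
      ext j
      simp [Finset.sum_apply, Pi.single_apply]
    conv_rhs => rw [← hA'e hy, e1, map_sum, sum_inner]
    rw [Finset.sum_apply]
    refine Finset.sum_congr rfl fun i _ => ?_
    rw [map_smul, inner_smul_left]
    simp only [RCLike.conj_to_real, hθ, weakPartial, hG]
    ring
  have hflux := hsum.congr hae
  have hfe := hflux.trace_eq hK
  refine ⟨hflux.trace hK hd1 hp, ?_⟩
  calc ENNReal.ofReal (size K) *
        ∫⁻ x in hull (K.erase p), ‖flux A v K (K.erase p) x‖ₑ ^ 2 ∂(surf d)
      ≤ ENNReal.ofReal (size K) * ∫⁻ x in hull (K.erase p), ENNReal.ofReal (d * L ^ 2) *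
          ∑ i, ‖trace (elt K) (weakPartial (elt K) i v) x‖ₑ ^ 2 ∂(surf d) := by
        refine mul_le_mul' le_rfl (lintegral_mono_ae ?_)
        filter_upwards [hfe, ae_restrict_mem (measurableSet_hull _)] with x hx hxe
        have hxe' := hull_mono (K.erase_subset p) hxe
        have hx' : flux A v K (K.erase p) x =
            ∑ i, θ i x * trace (elt K) (weakPartial (elt K) i v) x := by
          rw [flux, hx, Finset.sum_apply]
        rw [hx']
        refine (enorm_sum_sq_le _ _).trans ?_
        rw [Finset.card_univ, Fintype.card_fin, ENNReal.ofReal_mul (by positivity),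
          ENNReal.ofReal_natCast, mul_assoc, Finset.mul_sum (a := ENNReal.ofReal (L ^ 2))]
        refine mul_le_mul' le_rfl (Finset.sum_le_sum fun i _ => ?_)
        rw [enorm_mul, mul_pow]
        refine mul_le_mul' ?_ le_rfl
        rw [← ofReal_norm_sq, Real.norm_eq_abs]
        exact ENNReal.ofReal_le_ofReal (pow_le_pow_left₀ (abs_nonneg _) (hθb i x hxe') 2)
    _ = ENNReal.ofReal (d * L ^ 2) * ∑ i, ENNReal.ofReal (size K) *
          ∫⁻ x in hull (K.erase p), ‖trace (elt K) (weakPartial (elt K) i v) x‖ₑ ^ 2 ∂(surf d) := by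
        rw [lintegral_const_mul' _ _ ENNReal.ofReal_ne_top,
          lintegral_finsetSum' _ fun i _ => (htr i).1.memLp.1.enorm.pow_const 2, mul_left_comm,
          Finset.mul_sum]
    _ ≤ ENNReal.ofReal (d * L ^ 2) * ∑ i, ENNReal.ofReal C *
          ((∫⁻ y in elt K, ‖weakPartial (elt K) i v y‖ₑ ^ 2) +
            ENNReal.ofReal (size K ^ (2 * slobExp s)) *
              slobSq (elt K) (slobExp s) (weakPartial (elt K) i v)) := by
        exact mul_le_mul' le_rfl (Finset.sum_le_sum fun i _ => (htr i).2)
    _ = ENNReal.ofReal (d * L ^ 2 * C) * (h1SemiSq (elt K) v + ∑ i,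
            ENNReal.ofReal (size K ^ (2 * slobExp s)) *
              slobSq (elt K) (slobExp s) (weakPartial (elt K) i v)) := by
        rw [← Finset.mul_sum, Finset.sum_add_distrib, ← hv.1.h1SemiSq_eq_sum, ← mul_assoc,
          ← ENNReal.ofReal_mul (by positivity)]
    _ ≤ ENNReal.ofReal (d * L ^ 2 * C) * (ENNReal.ofReal (slobConst d (3 / 4) + 1) *
          h1SemiSq (elt K) v + ENNReal.ofReal (slobConst d (3 / 4) + 1) *
            (ENNReal.ofReal (size K ^ (2 * s)) * fracSemiSq (elt K) s v)) := by
        refine mul_le_mul' le_rfl (add_le_add ?_ (hK.slobSq_weakPartial_le hd hv))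
        refine le_mul_of_one_le_left (by positivity) ?_
        rw [ENNReal.one_le_ofReal]; linarith
    _ = _ := by
        rw [← mul_add, ← mul_assoc, ← ENNReal.ofReal_mul (by positivity)]

/-- The boundary values of functions in `H¹`. -/
lemma exists_trace_H1 (hd : 2 ≤ d) (h : IsSimplex K) {κ : ℝ} (hκ : 0 < κ) {c : Pt d}
    (hc : Metric.closedBall c (κ * size K) ⊆ hull K) (hp : p ∈ K) (hv : MemH1 (elt K) v) :
    HasFaceTrace K p v (trace (elt K) v) := by
  obtain ⟨C, hC, hT⟩ := trace_theorem (d := d) (t := 3 / 4) hd hκ (by norm_num) (by norm_num)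
  exact (hT K c h hc p hp v hv.1 (h.slobSq_lt_top hd (by norm_num) (by norm_num) hv).ne).1

end

section

variable {d : ℕ}

/-! ### The interface problem on the elements of the triangulation -/

/-- The standing assumptions: a regular solution of the interface problem, and a triangulation of
shape regularity `κ` which resolves the interface. -/
structure IsSetting {Ω : Set (Pt d)} (T : Triangulation Ω) (Ω₁ Ω₂ : Set (Pt d))
    (A : Pt d → Pt d →L[ℝ] Pt d) (f gD gN u : Pt d → ℝ) (lmin lmax s κ : ℝ) : Prop where
  dim : 2 ≤ d
  geo : IsInterfaceGeometry Ω Ω₁ Ω₂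
  coeff : IsCoefficient Ω Ω₁ Ω₂ lmin lmax A
  lmin_pos : 0 < lmin
  lmax_pos : 0 < lmax
  memLp_f : MemLp f 2 (volume.restrict Ω)
  memLp_gN : MemLp gN 2 ((surf d).restrict (interface Ω₁ Ω₂))
  sol : IsWeakSolution Ω Ω₁ Ω₂ A f gD gN u
  left : MemHfrac Ω₁ s u
  right : MemHfrac Ω₂ s u
  half_lt : 1 / 2 < s
  le_one : s ≤ 1
  fits : T.FitsInterface Ω₁ Ω₂
  κ_pos : 0 < κ
  ball : ∀ K ∈ T.elements, ∃ c, Metric.closedBall c (κ * size K) ⊆ hull K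

variable {Ω Ω₁ Ω₂ : Set (Pt d)} {T : Triangulation Ω} {A : Pt d → Pt d →L[ℝ] Pt d}
  {f gD gN u φ v : Pt d → ℝ} {lmin lmax s κ : ℝ} {K K' L e : Finset (Pt d)} {p q x : Pt d}

/-! #### The coefficient -/

/-- Positivity of the quadratic form at `ξ - lmax⁻¹ • B ξ`, combined with the upper bound at `ξ` and
at `B ξ`, gives `lmax⁻¹ ‖B ξ‖² ≤ lmax ‖ξ‖²`. No diagonalisation is required. -/
lemma norm_le_of_symm {B : Pt d →L[ℝ] Pt d} (hmax : 0 < lmax)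
    (hs : ∀ ξ ζ : Pt d, inner ℝ ξ (B ζ) = inner ℝ (B ξ) ζ) (h0 : ∀ ξ : Pt d, 0 ≤ inner ℝ ξ (B ξ))
    (h1 : ∀ ξ : Pt d, inner ℝ ξ (B ξ) ≤ lmax * ‖ξ‖ ^ 2) : ‖B‖ ≤ lmax := by
  refine B.opNorm_le_bound hmax.le fun ξ => ?_
  set η := B ξ with hη
  have h2 := h0 (ξ - lmax⁻¹ • η)
  have e : inner ℝ (ξ - lmax⁻¹ • η) (B (ξ - lmax⁻¹ • η)) =
      inner ℝ ξ (B ξ) - 2 * lmax⁻¹ * ‖η‖ ^ 2 + lmax⁻¹ ^ 2 * inner ℝ η (B η) := by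
    rw [map_sub, map_smul, inner_sub_left, inner_sub_right, inner_sub_right, inner_smul_left,
      inner_smul_right, inner_smul_left, inner_smul_right, hs ξ η, ← hη, real_inner_self_eq_norm_sq]
    simp only [RCLike.conj_to_real]
    ring
  rw [e] at h2
  have h3 := h1 ξ
  have h4 := mul_le_mul_of_nonneg_left (h1 η) (by positivity : 0 ≤ lmax⁻¹ ^ 2)
  have h5 : lmax⁻¹ ^ 2 * (lmax * ‖η‖ ^ 2) = lmax⁻¹ * ‖η‖ ^ 2 := by field_simp
  have h6 : lmax⁻¹ * ‖η‖ ^ 2 ≤ lmax * ‖ξ‖ ^ 2 := by linarith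
  have h7 : ‖η‖ ^ 2 ≤ (lmax * ‖ξ‖) ^ 2 := by
    calc ‖η‖ ^ 2 = lmax * (lmax⁻¹ * ‖η‖ ^ 2) := by field_simp
      _ ≤ lmax * (lmax * ‖ξ‖ ^ 2) := by gcongr
      _ = _ := by ring
  exact le_of_sq_le_sq h7 (by positivity)

lemma IsCoefficient.norm_le (h : IsCoefficient Ω Ω₁ Ω₂ lmin lmax A) (hmin : 0 < lmin)
    (hmax : 0 < lmax) (hx : x ∈ Ω) : ‖A x‖ ≤ lmax :=
  norm_le_of_symm hmax (h.symm x hx) (fun ξ => (by positivity : 0 ≤ lmin * ‖ξ‖ ^ 2).trans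
    (h.lower x hx ξ)) (h.upper x hx)

lemma IsSetting.elt_subset (h : IsSetting T Ω₁ Ω₂ A f gD gN u lmin lmax s κ)
    (hK : K ∈ T.elements) : elt K ⊆ Ω := h.geo.elt_subset hK

/-- The element lies on one side of the interface, where `A` extends continuously to the closure,
and the bound passes to the limit. The values of `A` itself on a face are irrelevant, since fluxes
are traces from within. -/
lemma IsSetting.isBoundedCoeff (h : IsSetting T Ω₁ Ω₂ A f gD gN u lmin lmax s κ)
    (hK : K ∈ T.elements) : IsBoundedCoeff K lmax A := by
  have key : ∀ V, elt K ⊆ V → IsRegularOn V A → IsBoundedCoeff K lmax A := by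
    rintro V hV ⟨-, A', hA', hA'e⟩
    have hcl := (T.isSimplex hK).closure_elt
    have hc : ContinuousOn A' (hull K) := hA'.mono (hcl ▸ closure_mono hV)
    refine ⟨A', hc, hA'e.mono hV, fun x hx => ?_⟩
    rw [← hcl] at hx hc
    refine le_on_closure (f := fun x => ‖A' x‖) (g := fun _ => lmax) (fun y hy => ?_) hc.norm
      continuousOn_const hx
    rw [hA'e (hV hy)]
    exact h.coeff.norm_le h.lmin_pos h.lmax_pos (h.elt_subset hK hy)
  rcases h.geo.elt_subset_or h.fits hK with h1 | h1
  · exact key Ω₁ h1 h.coeff.left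
  · exact key Ω₂ h1 h.coeff.right

lemma IsSetting.memHfrac (h : IsSetting T Ω₁ Ω₂ A f gD gN u lmin lmax s κ)
    (hK : K ∈ T.elements) : MemHfrac (elt K) s u := by
  rcases h.geo.elt_subset_or h.fits hK with h1 | h1
  · exact h.left.mono (isOpen_elt K) h1
  · exact h.right.mono (isOpen_elt K) h1

lemma IsBoundedCoeff.memLp_apply {C : ℝ} (hA : IsBoundedCoeff K C A) {G : Pt d → Pt d}
    (hG : MemLp G 2 (volume.restrict (elt K))) :
    MemLp (fun y => A y (G y)) 2 (volume.restrict (elt K)) := by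
  obtain ⟨A', hc, he, hb⟩ := hA
  have hm := (isOpen_elt K).measurableSet
  have hae : (fun y => A' y (G y)) =ᵐ[volume.restrict (elt K)] fun y => A y (G y) := by
    filter_upwards [ae_restrict_mem hm] with y hy
    rw [he hy]
  refine (memLp_congr_ae hae).1 ?_
  have h1 : AEStronglyMeasurable (fun y => A' y (G y)) (volume.restrict (elt K)) :=
    isBoundedBilinearMap_apply.continuous.comp_aestronglyMeasurable
      (((hc.mono (elt_subset_hull K)).aestronglyMeasurable hm).prodMk hG.1)
  refine hG.of_le_mul (c := C) h1 ?_
  filter_upwards [ae_restrict_mem hm] with y hy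
  exact ((A' y).le_opNorm _).trans
    (mul_le_mul_of_nonneg_right (hb y (elt_subset_hull K hy)) (norm_nonneg _))

/-! #### Integrals over unions of elements -/

/-- Open elements are disjoint, and they differ from the closed ones by null sets, because the
boundary of a convex set is null. -/
lemma Triangulation.setIntegral_eq_sum {V : Set (Pt d)} {S : Finset (Finset (Pt d))}
    (hS : S ⊆ T.elements) (hSV : ∀ K ∈ S, elt K ⊆ V) (hV : V ⊆ ⋃ K ∈ S, hull K) {H : Pt d → ℝ}
    (hH : ∀ K ∈ S, IntegrableOn H (elt K)) : ∫ x in V, H x = ∑ K ∈ S, ∫ x in elt K, H x := by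
  have h1 : (⋃ K ∈ S, elt K : Set (Pt d)) =ᵐ[volume] V := by
    refine ae_eq_set.2 ⟨?_, ?_⟩
    · rw [sdiff_eq_empty.2 (iUnion₂_subset hSV), measure_empty]
    · refine measure_mono_null (t := ⋃ K ∈ S, hull K \ elt K) (fun x hx => ?_)
        ((measure_biUnion_null_iff S.countable_toSet).2 fun K _ => volume_hull_diff_elt K)
      obtain ⟨K, hK, hxK⟩ := mem_iUnion₂.1 (hV hx.1)
      exact mem_iUnion₂.2 ⟨K, hK, hxK, fun hxe => hx.2 (mem_iUnion₂.2 ⟨K, hK, hxe⟩)⟩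
  rw [← setIntegral_congr_set h1]
  refine integral_biUnion_finset S (fun K _ => (isOpen_elt K).measurableSet) ?_ hH
  intro K hK K' hK' hne
  exact (T.disjoint_elt (hS hK) (hS hK') hne).mono_right (elt_subset_hull K')

lemma Triangulation.subset_iUnion {V : Set (Pt d)}
    (hV : IsOpen V) (hVΩ : V ⊆ Ω) {S : Finset (Finset (Pt d))}
    (hS : ∀ K ∈ T.elements, (V ∩ elt K).Nonempty → K ∈ S) : V ⊆ ⋃ K ∈ S, hull K := by
  intro x hx
  have h1 := subset_closure (hVΩ hx)
  rw [T.closure_eq] at h1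
  obtain ⟨K, hK, hxK⟩ := mem_iUnion₂.1 h1
  refine mem_iUnion₂.2 ⟨K, hS K hK ?_, hxK⟩
  rw [← (T.isSimplex hK).closure_elt] at hxK
  exact mem_closure_iff.1 hxK V hV hx

lemma IsSetting.setIntegral_eq_sum (h : IsSetting T Ω₁ Ω₂ A f gD gN u lmin lmax s κ)
    {H : Pt d → ℝ} (hH : IntegrableOn H Ω) :
    ∫ x in Ω, H x = ∑ K ∈ T.elements, ∫ x in elt K, H x :=
  T.setIntegral_eq_sum Finset.Subset.rfl (fun _ hK => h.elt_subset hK)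
    (T.subset_iUnion h.geo.whole.isOpen Subset.rfl fun _ hK _ => hK)
    fun _ hK => hH.mono_set (h.elt_subset hK)

/-! #### Test functions -/

lemma IsTestFun.memH10 (hφ : IsTestFun Ω φ) (hΩ : IsOpen Ω) (hb : Bornology.IsBounded Ω) :
    MemH10 Ω φ := by
  refine ⟨memH1_of_contDiff hφ.contDiff hb, fun _ => φ, fun _ => hφ, ?_, ?_⟩
  · simp
  · have h1 := weakGrad_of_contDiff hφ.contDiff hb hΩ
    have h2 : eLpNorm (weakGrad Ω φ - gradient φ) 2 (volume.restrict Ω) = 0 := by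
      rw [eLpNorm_congr_ae (g := 0) (h1.mono fun x hx => by simp [hx]), eLpNorm_zero]
    simp only [h2]
    exact tendsto_const_nhds

lemma trace_eq_of_eventuallyEq {U U' : Set (Pt d)} {v w : Pt d → ℝ} {x : Pt d} {r₀ : ℝ} (hr₀ : 0 < r₀)
    (hU : Metric.ball x r₀ ∩ U = Metric.ball x r₀ ∩ U')
    (hvw : ∀ y ∈ Metric.ball x r₀, v y = w y) (hm : MeasurableSet U) :
    trace U v x = trace U' w x := by
  unfold trace limUnder
  congr 1
  refine Filter.map_congr ?_
  filter_upwards [Ioc_mem_nhdsGT hr₀] with r hr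
  have hsub := Metric.ball_subset_ball (x := x) hr.2
  have e : Metric.ball x r ∩ U = Metric.ball x r ∩ U' := by
    rw [← inter_eq_left.2 hsub, inter_assoc, inter_assoc, hU]
  rw [← e]
  refine setAverage_congr_fun (Metric.isOpen_ball.measurableSet.inter hm)
    (Eventually.of_forall fun y hy => hvw y (hsub hy.1))

lemma HasStrongValue.of_continuous {U : Set (Pt d)} (hU : IsOpen U)
    (hb : Bornology.IsBounded U) (hx : x ∈ closure U) (hv : Continuous v) :
    Fat U x ∧ HasStrongValue U v x (v x) := by
  have hfat : Fat U x := by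
    intro r hr h0
    obtain ⟨y, hy, hxy⟩ := Metric.mem_closure_iff.1 hx r hr
    have h1 : (Metric.ball x r ∩ U).Nonempty := ⟨y, by rwa [Metric.mem_ball, dist_comm], hy⟩
    exact ((Metric.isOpen_ball.inter hU).measure_pos volume h1).ne' h0
  obtain ⟨C, hC⟩ := hb.isCompact_closure.exists_bound_of_continuousOn hv.continuousOn
  have h1 : HasStrongValue U (fun _ => 1) x 1 := by simp [HasStrongValue]
  have h2 := h1.mul_continuous hU.measurableSet hfat hv.continuousWithinAt
    (fun y hy => hC y (subset_closure hy)) aestronglyMeasurable_const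
  simp only [mul_one] at h2
  exact ⟨hfat, h2⟩

lemma trace_of_continuous {U : Set (Pt d)} (hU : IsOpen U) (hb : Bornology.IsBounded U)
    (hx : x ∈ closure U) (hv : Continuous v) : trace U v x = v x := by
  obtain ⟨h1, h2⟩ := HasStrongValue.of_continuous hU hb hx hv
  exact h2.trace_eq h1 (memLp_one_iff_integrable.1 (memLp_of_continuous hv hb 1))

/-- Off `Ω` the function vanishes near the point, so all small averages are zero, even if the ball
does not meet `Ω` at all. -/
lemma IsTestFun.trace_eq (hφ : IsTestFun Ω φ) (hΩ : IsOpen Ω) (hb : Bornology.IsBounded Ω)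
    (x : Pt d) : trace Ω φ x = φ x := by
  by_cases hx : x ∈ Ω
  · exact trace_of_continuous hΩ hb (subset_closure hx) hφ.contDiff.continuous
  · have hx' : x ∉ tsupport φ := fun h => hx (hφ.2.2 h)
    obtain ⟨r, hr, hball⟩ := Metric.isOpen_iff.1 (isClosed_tsupport φ).isOpen_compl x hx'
    have hz : ∀ y ∈ Metric.ball x r, φ y = (fun _ => 0 : Pt d → ℝ) y := fun y hy =>
      image_eq_zero_of_notMem_tsupport (hball hy)
    rw [hz x (Metric.mem_ball_self hr), trace_eq_of_eventuallyEq hr rfl hz hΩ.measurableSet]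
    simp only [trace, average_zero]
    exact tendsto_const_nhds.limUnder_eq

lemma Triangulation.isBounded (T : Triangulation Ω) :
    Bornology.IsBounded Ω := by
  refine Bornology.IsBounded.subset ?_ (subset_closure.trans T.closure_eq.subset)
  exact (Bornology.isBounded_biUnion_finset _).2 fun K _ => (isCompact_hull K).isBounded

open Classical in
lemma IsSetting.setIntegral_half (h : IsSetting T Ω₁ Ω₂ A f gD gN u lmin lmax s κ)
    (hφ : IsTestFun Ω φ) {V : Set (Pt d)} (hV : IsOpen V) (hVΩ : V ⊆ Ω) (hu : MemHfrac V s u)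
    (hsep : ∀ K ∈ T.elements, elt K ⊆ V ∨ Disjoint V (elt K)) :
    ∫ x in V, inner ℝ (A x (weakGrad V u x)) (weakGrad V φ x) =
      ∑ K ∈ T.elements.filter (fun K => elt K ⊆ V),
        ∫ x in elt K, inner ℝ (A x (weakGrad (elt K) u x)) (gradient φ x) := by
  have hae : ∀ K ∈ T.elements.filter (fun K => elt K ⊆ V),
      (fun x => inner ℝ (A x (weakGrad V u x)) (weakGrad V φ x)) =ᵐ[volume.restrict (elt K)]
        fun x => inner ℝ (A x (weakGrad (elt K) u x)) (gradient φ x) := by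
    intro K hK
    have hKV := (Finset.mem_filter.1 hK).2
    have h1 := weakGrad_mono hu.1 (isOpen_elt K) hKV
    have h2 := ae_restrict_of_ae_restrict_of_subset hKV
      (weakGrad_of_contDiff hφ.contDiff (T.isBounded.subset hVΩ) hV)
    filter_upwards [h1, h2] with x h1 h2
    rw [h1, h2]
  rw [T.setIntegral_eq_sum (Finset.filter_subset _ _) (fun K hK => (Finset.mem_filter.1 hK).2) ?_ ?_]
  · exact Finset.sum_congr rfl fun K hK => integral_congr_ae (hae K hK)
  · refine T.subset_iUnion hV hVΩ fun K hK hne => Finset.mem_filter.2 ⟨hK, ?_⟩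
    exact (hsep K hK).resolve_right fun hd => not_disjoint_iff_nonempty_inter.2 hne hd
  · intro K hK
    have hK' := (Finset.mem_filter.1 hK).1
    refine (integrable_congr (hae K hK)).2 (integrable_inner_of_memLp
      ((h.isBoundedCoeff hK').memLp_apply (h.memHfrac hK').1.memLp_weakGrad)
      (memLp_of_continuous (continuous_gradient hφ.contDiff) (isBounded_elt K) 2))

lemma IsSetting.aForm_eq_sum (h : IsSetting T Ω₁ Ω₂ A f gD gN u lmin lmax s κ)
    (hφ : IsTestFun Ω φ) : aForm Ω₁ Ω₂ A u φ =
      ∑ K ∈ T.elements, ∫ x in elt K, inner ℝ (A x (weakGrad (elt K) u x)) (gradient φ x) := by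
  classical
  have hsub : Ω₁ ∪ Ω₂ ⊆ Ω := h.geo.union ▸ sdiff_subset
  have hd := h.geo.disjoint
  rw [aForm, h.setIntegral_half hφ h.geo.left.isOpen (subset_union_left.trans hsub) h.left,
    h.setIntegral_half hφ h.geo.right.isOpen (subset_union_right.trans hsub) h.right,
    ← Finset.sum_filter_add_sum_filter_not T.elements (fun K => elt K ⊆ Ω₁)]
  · congr 1
    refine Finset.sum_congr (Finset.filter_congr fun K hK => ?_) fun _ _ => rfl
    constructor
    · intro h2 h1
      obtain ⟨y, hy⟩ := (T.isSimplex hK).nonempty_elt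
      exact disjoint_left.1 hd (h1 hy) (h2 hy)
    · exact (h.geo.elt_subset_or h.fits hK).resolve_left
  · intro K hK
    exact (h.geo.elt_subset_or h.fits hK).symm.imp_right fun h1 => (hd.mono_left h1)|>.symm
  · intro K hK
    exact (h.geo.elt_subset_or h.fits hK).imp_right fun h1 => hd.mono_right h1

lemma IsSetting.weak (h : IsSetting T Ω₁ Ω₂ A f gD gN u lmin lmax s κ) (hφ : IsTestFun Ω φ) :
    ∑ K ∈ T.elements, ∫ x in elt K, inner ℝ (A x (weakGrad (elt K) u x)) (gradient φ x) =
      (∑ K ∈ T.elements, ∫ x in elt K, f x * φ x) +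
        ∫ x in interface Ω₁ Ω₂, gN x * φ x ∂(surf d) := by
  have hΩ := h.geo.whole.isOpen
  rw [← h.aForm_eq_sum hφ, h.sol.weak φ (hφ.memH10 hΩ T.isBounded)]
  have hi : IntegrableOn (fun x => f x * φ x) Ω :=
    integrable_smul_of_memLp h.memLp_f (hφ.memLp 2 _)
  rw [h.setIntegral_eq_sum hi]
  simp_rw [hφ.trace_eq hΩ T.isBounded]

/-- The equation on an element. -/
lemma IsSetting.div_eq (h : IsSetting T Ω₁ Ω₂ A f gD gN u lmin lmax s κ) (hK : K ∈ T.elements)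
    (hφ : IsTestFun (elt K) φ) :
    ∫ x in elt K, inner ℝ (A x (weakGrad (elt K) u x)) (gradient φ x) =
      ∫ x in elt K, f x * φ x := by
  have h1 := h.weak (hφ.mono (h.elt_subset hK))
  have hz : ∀ L ∈ T.elements, L ≠ K → ∀ x ∈ elt L, x ∉ elt K := fun L hL hne x hx hx' =>
    disjoint_left.1 (T.disjoint_elt hL hK hne) hx (elt_subset_hull K hx')
  rw [Finset.sum_eq_single_of_mem K hK, Finset.sum_eq_single_of_mem K hK] at h1
  · refine h1.trans (add_eq_left.2 (setIntegral_eq_zero_of_forall_eq_zero fun x hx => ?_))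
    rw [hφ.eq_zero fun hx' => disjoint_left.1 (h.fits.disjoint_elt hK) hx' hx, mul_zero]
  · intro L hL hne
    refine setIntegral_eq_zero_of_forall_eq_zero fun x hx => ?_
    rw [hφ.eq_zero (hz L hL hne x hx), mul_zero]
  · intro L hL hne
    refine setIntegral_eq_zero_of_forall_eq_zero fun x hx => ?_
    rw [hφ.gradient_eq_zero (hz L hL hne x hx), inner_zero_right]

variable [DecidableEq (Pt d)]

lemma IsSetting.hasFaceTrace_flux (h : IsSetting T Ω₁ Ω₂ A f gD gN u lmin lmax s κ)
    (hK : K ∈ T.elements) (hp : p ∈ K) (hv : MemHfrac (elt K) s v) :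
    HasFaceTrace K p (fun y => inner ℝ (A y (weakGrad (elt K) v y))
      (outerNormal K (K.erase p))) (flux A v K (K.erase p)) := by
  obtain ⟨C, -, hC⟩ := exists_flux_bound h.dim h.κ_pos h.lmax_pos h.half_lt h.le_one
  obtain ⟨c, hc⟩ := h.ball K hK
  exact (hC K c (T.isSimplex hK) hc p hp A (h.isBoundedCoeff hK) v hv).1

lemma IsSetting.hasFaceTrace (h : IsSetting T Ω₁ Ω₂ A f gD gN u lmin lmax s κ)
    (hK : K ∈ T.elements) (hp : p ∈ K) (hv : MemH1 (elt K) v) :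
    HasFaceTrace K p v (trace (elt K) v) := by
  obtain ⟨c, hc⟩ := h.ball K hK
  exact exists_trace_H1 h.dim (T.isSimplex hK) h.κ_pos hc hp hv

/-- Green's formula for the solution on an element. -/
lemma IsSetting.green (h : IsSetting T Ω₁ Ω₂ A f gD gN u lmin lmax s κ) (hK : K ∈ T.elements)
    (hv : ContDiff ℝ ∞ v) :
    ∫ x in elt K, inner ℝ (A x (weakGrad (elt K) u x)) (gradient v x) =
      (∫ x in elt K, f x * v x) +
        ∑ e ∈ edgesOf K, ∫ x in hull e, flux A u K e x * v x ∂(surf d) := by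
  have hs := T.isSimplex hK
  rw [hs.sum_edgesOf]
  exact hs.green h.dim ((h.isBoundedCoeff hK).memLp_apply (h.memHfrac hK).1.memLp_weakGrad)
    (h.memLp_f.mono_measure (Measure.restrict_mono_set _ (h.elt_subset hK)))
    (fun φ hφ => h.div_eq hK hφ) (fun p hp => h.hasFaceTrace_flux hK hp (h.memHfrac hK)) hv

/-- Green's formula on each element turns the weak formulation into an identity in which the volume
terms with `f` cancel, leaving integrals over edges. -/
lemma IsSetting.sum_flux (h : IsSetting T Ω₁ Ω₂ A f gD gN u lmin lmax s κ) (hφ : IsTestFun Ω φ) :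
    ∑ e ∈ T.edges, ∑ K ∈ T.adjacent e, ∫ x in hull e, flux A u K e x * φ x ∂(surf d) =
      ∫ x in interface Ω₁ Ω₂, gN x * φ x ∂(surf d) := by
  have h1 := h.weak hφ
  rw [Finset.sum_congr rfl fun K hK => h.green hK hφ.contDiff, Finset.sum_add_distrib,
    T.sum_swap (by have := h.dim; omega)] at h1
  exact add_left_cancel h1

end

section

variable {d : ℕ}

/-! ### Jumps of the solution across edges -/

variable {Ω Ω₁ Ω₂ : Set (Pt d)} {T : Triangulation Ω} {A : Pt d → Pt d →L[ℝ] Pt d}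
  {f gD gN u φ v : Pt d → ℝ} {lmin lmax s κ : ℝ} {K K' L e : Finset (Pt d)} {p q x : Pt d}
  [DecidableEq (Pt d)]

lemma Triangulation.disjoint_patch_edge (hd : 1 ≤ d) (hK : K ∈ T.elements) (hK' : K' ∈ T.elements)
    (hne : K ≠ K') (hp : p ∈ K) (hq : q ∈ K') (he : K.erase p = K'.erase q)
    (hL : L ∈ T.edges) (hLe : L ≠ K.erase p) : Disjoint (patch K K' p) (hull L) := by
  refine disjoint_left.2 fun x hx hxL => ?_
  have h := T.isSimplex hK
  rcases T.patch_subset hd hK hK' hne hp hq he hx with h1 | h1 | h1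
  · exact T.notMem_hull_of_mem_elt hK hL h1 hxL
  · have hxK : x ∈ hull K := hull_mono (K.erase_subset p) (h.innerFace_subset hp h1)
    have hsub : K.erase p ⊆ L := fun j hj => T.mem_of_bary_ne_zero hK (T.mem_edges.1 hL).1 hxK hxL
      (Finset.mem_erase.1 hj).2 (h1.2 j hj).ne'
    refine hLe (Finset.eq_of_subset_of_card_le hsub ?_).symm
    rw [(T.mem_edges.1 hL).2, Finset.card_erase_of_mem hp, (T.mem_elements.1 hK).2]
    omega
  · exact T.notMem_hull_of_mem_elt hK' hL h1 hxL

/-- A function on a face with vanishing integrals against test functions near its relative interior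
is zero. -/
lemma IsSimplex.ae_eq_zero_of_patch (h : IsSimplex K) (h' : IsSimplex K') (hd : 2 ≤ d) (hp : p ∈ K)
    (hq : q ∈ K') (he : K.erase p = K'.erase q) {g : Pt d → ℝ}
    (hg : Integrable g ((surf d).restrict (hull (K.erase p))))
    (hz : ∀ φ, IsTestFun (patch K K' p) φ →
      ∫ x in hull (K.erase p), g x * φ x ∂(surf d) = 0) :
    g =ᵐ[(surf d).restrict (hull (K.erase p))] 0 := by
  have h1 := (isOpen_patch K K' p).ae_eq_zero_of_integral_contDiff_smul_eq_zero
    (hg.locallyIntegrable.locallyIntegrableOn _) (fun φ h1 h2 h3 => by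
      rw [← hz φ ⟨h1, h2, h3⟩]
      exact integral_congr_ae (Eventually.of_forall fun x => by simp [mul_comm]))
  filter_upwards [h1, h.ae_mem_innerFace hd hp] with x hx hx'
  exact hx (h.innerFace_subset_patch h' hp hq he hx')

omit [DecidableEq (Pt d)] in
lemma IsSetting.one_le (h : IsSetting T Ω₁ Ω₂ A f gD gN u lmin lmax s κ) : 1 ≤ d := by
  have := h.dim; omega

lemma IsSetting.isFiniteMeasure_surf (h : IsSetting T Ω₁ Ω₂ A f gD gN u lmin lmax s κ)
    (he : e ∈ T.edges) : IsFiniteMeasure ((surf d).restrict (hull e)) := by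
  obtain ⟨K, hK⟩ := T.adjacent_nonempty he
  obtain ⟨p, hp, rfl⟩ := T.exists_apex he hK
  exact (T.isSimplex (T.mem_adjacent.1 hK).1).isFiniteMeasure_surf h.one_le hp

lemma IsSetting.memLp_flux (h : IsSetting T Ω₁ Ω₂ A f gD gN u lmin lmax s κ)
    (hK : K ∈ T.elements) (he : e ∈ edgesOf K) (hv : MemHfrac (elt K) s v) :
    MemLp (flux A v K e) 2 ((surf d).restrict (hull e)) := by
  obtain ⟨p, hp, rfl⟩ := (T.isSimplex hK).mem_edgesOf.1 he
  exact (h.hasFaceTrace_flux hK hp hv).memLp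

lemma IsSetting.memLp_trace (h : IsSetting T Ω₁ Ω₂ A f gD gN u lmin lmax s κ)
    (hK : K ∈ T.elements) (he : e ∈ edgesOf K) (hv : MemH1 (elt K) v) :
    MemLp (trace (elt K) v) 2 ((surf d).restrict (hull e)) := by
  obtain ⟨p, hp, rfl⟩ := (T.isSimplex hK).mem_edgesOf.1 he
  exact (h.hasFaceTrace hK hp hv).memLp

/-- The jump of the flux of the solution. -/
lemma IsSetting.flux_jump (h : IsSetting T Ω₁ Ω₂ A f gD gN u lmin lmax s κ)
    (he : e ∈ T.edges) (hK : K ∈ T.adjacent e) (hK' : K' ∈ T.adjacent e) (hne : K ≠ K') :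
    (fun x => ∑ L ∈ T.adjacent e, flux A u L e x) =ᵐ[(surf d).restrict (hull e)]
      if e ∈ T.interfaceEdges Ω₁ Ω₂ then gN else 0 := by
  have hd := h.one_le
  have hfin := h.isFiniteMeasure_surf he
  have hfl : ∀ L ∈ T.adjacent e, MemLp (flux A u L e) 2 ((surf d).restrict (hull e)) :=
    fun L hL => h.memLp_flux (T.mem_adjacent.1 hL).1 (T.mem_edgesOf_of_adjacent he hL)
      (h.memHfrac (T.mem_adjacent.1 hL).1)
  set G : Pt d → ℝ := if e ∈ T.interfaceEdges Ω₁ Ω₂ then gN else 0 with hG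
  have hGm : MemLp G 2 ((surf d).restrict (hull e)) := by
    rw [hG]; split_ifs with hi
    · exact h.memLp_gN.mono_measure (Measure.restrict_mono_set _ (T.mem_interfaceEdges.1 hi).2)
    · exact MemLp.zero
  have hsum : MemLp (fun x => ∑ L ∈ T.adjacent e, flux A u L e x) 2
      ((surf d).restrict (hull e)) := memLp_finsetSum _ hfl
  obtain ⟨p, hp, hpe⟩ := T.exists_apex he hK
  obtain ⟨q, hq, hqe⟩ := T.exists_apex he hK'
  have hpq := hpe.trans hqe.symm
  have hKe := (T.mem_adjacent.1 hK).1
  have hKe' := (T.mem_adjacent.1 hK').1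
  have hpatch := h.geo.patch_subset hd hKe hKe' hne hp hq hpq
  -- For a test function supported in the patch all edges except `e` drop out. The patch meets the
  -- interface inside `e` if `e` belongs to it, and not at all otherwise, which explains the two
  -- cases of `G`.
  have hzero : (fun x => (∑ L ∈ T.adjacent e, flux A u L e x) - G x)
      =ᵐ[(surf d).restrict (hull e)] 0 := by
    rw [← hpe] at hsum hGm hfin ⊢
    refine (T.isSimplex hKe).ae_eq_zero_of_patch (T.isSimplex hKe') h.dim hp hq hpq
      ((hsum.sub hGm).integrable (by norm_num)) fun φ hφ => ?_
    rw [hpe] at hsum hGm hfin ⊢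
    have hφ2 : MemLp φ 2 ((surf d).restrict (hull e)) := by
      obtain ⟨C, hC⟩ := hφ.hasCompactSupport.exists_bound_of_continuous hφ.contDiff.continuous
      exact MemLp.of_bound hφ.contDiff.continuous.aestronglyMeasurable C (Eventually.of_forall hC)
    have h1 := h.sum_flux (hφ.mono hpatch)
    rw [Finset.sum_eq_single_of_mem e he] at h1
    · simp_rw [sub_mul, Finset.sum_mul]
      rw [integral_sub, integral_finsetSum, h1, sub_eq_zero]
      · rw [hG]; split_ifs with hi
        · refine (setIntegral_eq_of_subset_of_forall_sdiff_eq_zero ?_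
            (T.mem_interfaceEdges.1 hi).2 fun x hx => ?_)
          · exact (isClosed_frontier.inter isClosed_frontier).measurableSet
          · rw [hφ.eq_zero, mul_zero]
            intro hxp
            rcases T.patch_subset hd hKe hKe' hne hp hq hpq hxp with h2 | h2 | h2
            · exact disjoint_left.1 (h.fits.disjoint_elt hKe) h2 hx.1
            · exact hx.2 (hpe ▸ (T.isSimplex hKe).innerFace_subset hp h2)
            · exact disjoint_left.1 (h.fits.disjoint_elt hKe') h2 hx.1
        · simp only [Pi.zero_apply, zero_mul, integral_zero]
          refine setIntegral_eq_zero_of_forall_eq_zero fun x hx => ?_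
          rw [hφ.eq_zero, mul_zero]
          intro hxp
          rcases T.patch_subset hd hKe hKe' hne hp hq hpq hxp with h2 | h2 | h2
          · exact disjoint_left.1 (h.fits.disjoint_elt hKe) h2 hx
          · exact disjoint_left.1 (h.fits.disjoint_innerFace hKe hd hp (hpe ▸ hi)) h2 hx
          · exact disjoint_left.1 (h.fits.disjoint_elt hKe') h2 hx
      · exact fun L hL => integrable_smul_of_memLp (hfl L hL) hφ2
      · exact integrable_finsetSum _ fun L hL => integrable_smul_of_memLp (hfl L hL) hφ2
      · exact integrable_smul_of_memLp hGm hφ2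
    · intro e' he' hne'
      refine Finset.sum_eq_zero fun L _ => setIntegral_eq_zero_of_forall_eq_zero fun x hx => ?_
      rw [hφ.eq_zero, mul_zero]
      intro hxp
      exact disjoint_left.1 (T.disjoint_patch_edge hd hKe hKe' hne hp hq hpq he'
        (hpe ▸ hne')) hxp hx
  filter_upwards [hzero] with x hx
  exact sub_eq_zero.1 hx

/-- Green's formula for a function in `H¹` of an element. -/
lemma IsSetting.green_H1 (h : IsSetting T Ω₁ Ω₂ A f gD gN u lmin lmax s κ) (hK : K ∈ T.elements)
    (hv : MemH1 (elt K) v) (a : Pt d) (hφ : ContDiff ℝ ∞ φ) :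
    ∫ x in elt K, v x * inner ℝ a (gradient φ x) =
      -(∫ x in elt K, φ x * inner ℝ (weakGrad (elt K) v x) a) + ∑ p ∈ K,
        ∫ x in hull (K.erase p), inner ℝ a (outerNormal K (K.erase p)) * trace (elt K) v x * φ x
          ∂(surf d) := by
  have hs := T.isSimplex hK
  -- Green's formula for the field `v • a`, whose divergence is the directional derivative of `v`
  -- along `a`.
  have h1 := hs.green (v := φ) h.dim (F := fun x => v x • a)
    (g := fun x => -inner ℝ (weakGrad (elt K) v x) a)
    (q := fun p x => inner ℝ a (outerNormal K (K.erase p)) * trace (elt K) v x)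
    ?_ ?_ ?_ ?_ hφ
  · simp_rw [inner_smul_left] at h1
    simp only [RCLike.conj_to_real] at h1
    rw [h1, ← integral_neg]
    congr 2
    ext x; ring
  · exact (hv.1.norm.const_mul ‖a‖).of_le (hv.1.1.smul_const a)
      (Eventually.of_forall fun x => by simp [norm_smul, mul_comm])
  · exact (hv.memLp_weakGrad.norm.const_mul ‖a‖).of_le
      (hv.memLp_weakGrad.1.inner aestronglyMeasurable_const).neg
      (Eventually.of_forall fun x => by
        rw [norm_neg, norm_mul, norm_norm, norm_norm, mul_comm]
        exact norm_inner_le_norm _ _)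
  · intro ψ hψ
    have h2 := (hasWeakGrad_iff hv.1 hv.memLp_weakGrad).1 hv.hasWeakGrad ψ hψ a
    simp_rw [inner_smul_left]
    simp only [RCLike.conj_to_real]
    rw [← integral_neg] at h2
    calc _ = ∫ x in elt K, v x * inner ℝ (gradient ψ x) a :=
          integral_congr_ae (Eventually.of_forall fun x => by simp only [real_inner_comm])
      _ = _ := h2.trans (integral_congr_ae (Eventually.of_forall fun x => by ring))
  · intro p hp
    have h2 := (h.hasFaceTrace hK hp hv).mul_continuous hs h.one_le hp
      (θ := fun _ => inner ℝ a (outerNormal K (K.erase p))) continuousOn_const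
    convert h2 using 2 with y
    rw [inner_smul_left]
    simp only [RCLike.conj_to_real]
    ring

omit [DecidableEq (Pt d)] in
lemma integrable_mul_inner_of_memLp {μ : Measure (Pt d)} {G : Pt d → Pt d} (hv : MemLp v 2 μ)
    (hG : MemLp G 2 μ) (a : Pt d) : Integrable (fun x => v x * inner ℝ (G x) a) μ :=
  integrable_smul_of_memLp hv ((hG.norm.const_mul ‖a‖).of_le (hG.1.inner aestronglyMeasurable_const)
    (Eventually.of_forall fun x => by
      rw [norm_mul, norm_norm, norm_norm, mul_comm]
      exact norm_inner_le_norm _ _))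

lemma Triangulation.setIntegral_patch (hd : 1 ≤ d) (hK : K ∈ T.elements) (hK' : K' ∈ T.elements)
    (hne : K ≠ K') (hp : p ∈ K) (hq : q ∈ K') (he : K.erase p = K'.erase q) {g : Pt d → ℝ}
    (hg : IntegrableOn g (patch K K' p)) :
    ∫ x in patch K K' p, g x =
      (∫ x in patch K K' p ∩ elt K, g x) + ∫ x in patch K K' p ∩ elt K', g x := by
  have hs := T.isSimplex hK
  have hdis : Disjoint (patch K K' p ∩ elt K) (patch K K' p ∩ elt K') :=
    (T.disjoint_elt hK hK' hne).mono inter_subset_right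
      (inter_subset_right.trans interior_subset)
  rw [← setIntegral_union hdis ((isOpen_patch K K' p).inter (isOpen_elt K')).measurableSet (hg.mono_set inter_subset_left)
    (hg.mono_set inter_subset_left)]
  refine setIntegral_congr_set ?_
  have hnull : volume (frontier (hull K)) = 0 := (convex_convexHull ℝ _).addHaar_frontier volume
  filter_upwards [compl_mem_ae_iff.2 hnull] with x hx
  refine propext ⟨fun h1 => ?_, fun h1 => h1.elim And.left And.left⟩
  rcases T.patch_subset hd hK hK' hne hp hq he h1 with h2 | h2 | h2
  · exact Or.inl ⟨h1, h2⟩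
  · by_cases h3 : x ∈ elt K
    · exact Or.inl ⟨h1, h3⟩
    · exact absurd ⟨subset_closure (hull_mono (K.erase_subset p) (hs.innerFace_subset hp h2)), h3⟩ hx
  · exact Or.inr ⟨h1, h2⟩

/-- A function in `H¹` near the common face of two elements has the same trace from both sides. -/
lemma IsSetting.trace_eq_of_memH1 (h : IsSetting T Ω₁ Ω₂ A f gD gN u lmin lmax s κ)
    (hK : K ∈ T.elements) (hK' : K' ∈ T.elements) (hne : K ≠ K') (hp : p ∈ K) (hq : q ∈ K')
    (he : K.erase p = K'.erase q) (hv : MemH1 (elt K) v) (hv' : MemH1 (elt K') v)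
    (hvp : MemH1 (patch K K' p) v) :
    trace (elt K) v =ᵐ[(surf d).restrict (hull (K.erase p))] trace (elt K') v := by
  have hd := h.one_le
  have hs := T.isSimplex hK
  have hs' := T.isSimplex hK'
  set n := outerNormal K (K.erase p) with hn
  have hn' : outerNormal K' (K'.erase q) = -n := T.outerNormal_neg hd hK hK' hne hp hq he
  have hnn : inner ℝ n n = 1 := by
    rw [real_inner_self_eq_norm_sq, (hs.isOuterNormal hd hp).1]; norm_num
  have hfin := hs.isFiniteMeasure_surf hd hp
  have ht := (h.hasFaceTrace hK hp hv).memLp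
  have ht' : MemLp (trace (elt K') v) 2 ((surf d).restrict (hull (K.erase p))) :=
    he ▸ (h.hasFaceTrace hK' hq hv').memLp
  have hz := hs.ae_eq_zero_of_patch hs' h.dim hp hq he
    (g := fun x => trace (elt K) v x - trace (elt K') v x)
    ((ht.sub ht').integrable (by norm_num)) ?_
  · exact hz.mono fun x hx => sub_eq_zero.1 hx
  intro φ hφ
  have hφ2 : MemLp φ 2 ((surf d).restrict (hull (K.erase p))) := by
    obtain ⟨C, hC⟩ := hφ.hasCompactSupport.exists_bound_of_continuous hφ.contDiff.continuous
    exact MemLp.of_bound hφ.contDiff.continuous.aestronglyMeasurable C (Eventually.of_forall hC)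
  have hface : ∀ {L : Finset (Pt d)}, L ∈ T.elements → ∀ r ∈ L, L.erase r ≠ K.erase p →
      ∀ x ∈ hull (L.erase r), φ x = 0 := by
    intro L hL r hr hne' x hx
    refine hφ.eq_zero fun hxp => ?_
    exact disjoint_left.1 (T.disjoint_patch_edge hd hK hK' hne hp hq he
      (T.edgesOf_subset hd hL ((T.isSimplex hL).mem_edgesOf.2 ⟨r, hr, rfl⟩)) hne') hxp hx
  have hinj : ∀ {L : Finset (Pt d)} {r r' : Pt d}, r' ∈ L → r ≠ r' →
      L.erase r ≠ L.erase r' := fun {L r r'} hr' hne' heq => by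
    have h1 : r' ∈ L.erase r := Finset.mem_erase.2 ⟨hne'.symm, hr'⟩
    rw [heq] at h1
    exact (Finset.mem_erase.1 h1).1 rfl
  -- Green's formula in the direction `n` from both sides: the volume terms add up to the defining
  -- identity of the weak gradient on the patch and cancel. The outer normals are opposite, so the
  -- face terms leave the difference of the traces.
  have g1 := h.green_H1 hK hv n hφ.contDiff
  have g2 := h.green_H1 hK' hv' n hφ.contDiff
  rw [Finset.sum_eq_single_of_mem p hp fun r hr hrp => setIntegral_eq_zero_of_forall_eq_zero
    fun x hx => by rw [hface hK r hr (hinj hp hrp) x hx, mul_zero]] at g1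
  rw [Finset.sum_eq_single_of_mem q hq fun r hr hrq => setIntegral_eq_zero_of_forall_eq_zero
    fun x hx => by rw [hface hK' r hr (he ▸ hinj hq hrq) x hx, mul_zero], ← he] at g2
  rw [← he] at hn'
  have key : ∀ {L : Finset (Pt d)}, MemH1 (elt L) v →
      (∫ x in elt L, v x * inner ℝ n (gradient φ x)) + (∫ x in elt L,
        φ x * inner ℝ (weakGrad (elt L) v x) n) = (∫ x in patch K K' p ∩ elt L,
        (v x * inner ℝ (gradient φ x) n + φ x * inner ℝ (weakGrad (patch K K' p) v x) n)) := by
    intro L hL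
    have hE : IsOpen (elt L) := isOpen_interior
    have hO : IsOpen (patch K K' p ∩ elt L) := (isOpen_patch K K' p).inter isOpen_interior
    rw [setIntegral_eq_of_subset_of_forall_sdiff_eq_zero (f := fun x => v x * inner ℝ n (gradient φ x))
        hE.measurableSet (inter_subset_right (s := patch K K' p)) fun x hx => by
          rw [hφ.gradient_eq_zero fun hxp => hx.2 ⟨hxp, hx.1⟩, inner_zero_right, mul_zero],
      setIntegral_eq_of_subset_of_forall_sdiff_eq_zero
        (f := fun x => φ x * inner ℝ (weakGrad (elt L) v x) n)
        hE.measurableSet (inter_subset_right (s := patch K K' p)) fun x hx => by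
          rw [hφ.eq_zero fun hxp => hx.2 ⟨hxp, hx.1⟩, zero_mul], ← integral_add]
    · refine integral_congr_ae ?_
      filter_upwards [weakGrad_mono hL hO inter_subset_right,
        weakGrad_mono hvp hO inter_subset_left] with x h1 h2
      rw [← h1, h2, real_inner_comm n (gradient φ x)]
    · have h1 := (hL.mono (inter_subset_right (s := patch K K' p))).1
      simp_rw [real_inner_comm _ n]
      exact integrable_mul_inner_of_memLp h1 (hφ.memLp_gradient 2 _) n
    · have h1 := (hL.memLp_weakGrad.mono_measure (Measure.restrict_mono_set volume
        (inter_subset_right (s := patch K K' p))))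
      exact (integrable_mul_inner_of_memLp (hφ.memLp 2 _) h1 n)
  have hi1 := integrable_mul_inner_of_memLp hvp.1 (hφ.memLp_gradient 2 _) n
  have hi2 := integrable_mul_inner_of_memLp (hφ.memLp 2 _) hvp.memLp_weakGrad n
  have hsplit := T.setIntegral_patch hd hK hK' hne hp hq he (hi1.add hi2)
  simp only [Pi.add_apply] at hsplit
  rw [integral_add hi1 hi2, (hasWeakGrad_iff hvp.1 hvp.memLp_weakGrad).1 hvp.hasWeakGrad φ hφ n,
    neg_add_cancel, ← key hv, ← key hv', g1, g2, hn', inner_neg_right, hnn] at hsplit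
  have hsub : ∫ x in hull (K.erase p), (trace (elt K) v x - trace (elt K') v x) * φ x ∂(surf d) =
      (∫ x in hull (K.erase p), trace (elt K) v x * φ x ∂(surf d)) -
        ∫ x in hull (K.erase p), trace (elt K') v x * φ x ∂(surf d) := by
    simp_rw [sub_mul]
    exact integral_sub (integrable_smul_of_memLp ht hφ2) (integrable_smul_of_memLp ht' hφ2)
  rw [hsub]
  simp only [one_mul, neg_mul, integral_neg] at hsplit
  linarith

/-- Within the patch, `V` and the open element coincide: the face and the opposite element are
excluded. Small balls around the point therefore produce the same averages. -/
lemma IsSetting.trace_half_eq (h : IsSetting T Ω₁ Ω₂ A f gD gN u lmin lmax s κ)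
    (hK : K ∈ T.elements) (hK' : K' ∈ T.elements) (hne : K ≠ K') (hp : p ∈ K) (hq : q ∈ K')
    (he : K.erase p = K'.erase q) {V W : Set (Pt d)} (hV : IsOpen V) (hKV : elt K ⊆ V)
    (hKW : elt K' ⊆ W) (hVW : Disjoint V W) (hVe : Disjoint V (hull (K.erase p)))
    (hx : x ∈ innerFace K p) : trace V u x = trace (elt K) u x := by
  have hxp := (T.isSimplex hK).innerFace_subset_patch (T.isSimplex hK') hp hq he hx
  obtain ⟨r, hr, hr'⟩ := Metric.isOpen_iff.1 (isOpen_patch K K' p) x hxp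
  refine trace_eq_of_eventuallyEq hr ?_ (fun _ _ => rfl) hV.measurableSet
  refine Subset.antisymm (fun y hy => ⟨hy.1, ?_⟩) (inter_subset_inter_right _ hKV)
  rcases T.patch_subset h.one_le hK hK' hne hp hq he (hr' hy.1) with h1 | h1 | h1
  · exact h1
  · exact absurd ((T.isSimplex hK).innerFace_subset hp h1) (disjoint_left.1 hVe hy.2)
  · exact absurd (hKW h1) (disjoint_left.1 hVW hy.2)

omit [DecidableEq (Pt d)] in
lemma IsSetting.sigma_left (h : IsSetting T Ω₁ Ω₂ A f gD gN u lmin lmax s κ)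
    (hK : K ∈ T.elements) (hsub : elt K ⊆ Ω₁) : sigma Ω₁ K = 1 := by
  rcases h.geo.sigma_eq h.fits hK with h1 | h1
  · exact h1.2
  · obtain ⟨x, hx⟩ := (T.isSimplex hK).nonempty_elt
    exact absurd (h1.1 hx) (disjoint_left.1 h.geo.disjoint (hsub hx))

omit [DecidableEq (Pt d)] in
lemma IsSetting.sigma_right (h : IsSetting T Ω₁ Ω₂ A f gD gN u lmin lmax s κ)
    (hK : K ∈ T.elements) (hsub : elt K ⊆ Ω₂) : sigma Ω₁ K = -1 := by
  rcases h.geo.sigma_eq h.fits hK with h1 | h1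
  · obtain ⟨x, hx⟩ := (T.isSimplex hK).nonempty_elt
    exact absurd (hsub hx) (disjoint_left.1 h.geo.disjoint (h1.1 hx))
  · exact h1.2

/-- The solution jumps by `g_D` across an edge in the interface. -/
lemma IsSetting.trace_sub_interface (h : IsSetting T Ω₁ Ω₂ A f gD gN u lmin lmax s κ)
    (he : e ∈ T.interfaceEdges Ω₁ Ω₂) (hK : K ∈ T.adjacent e) (hL : L ∈ T.adjacent e)
    (hKΩ : elt K ⊆ Ω₁) (hLΩ : elt L ⊆ Ω₂) (hne : K ≠ L) :
    ∀ᵐ x ∂(surf d).restrict (hull e), trace (elt K) u x - trace (elt L) u x = gD x := by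
  have he' := (T.mem_interfaceEdges.1 he)
  obtain ⟨p, hp, rfl⟩ := T.exists_apex he'.1 hK
  obtain ⟨q, hq, hqe⟩ := T.exists_apex he'.1 hL
  have hK' := (T.mem_adjacent.1 hK).1
  have hL' := (T.mem_adjacent.1 hL).1
  have hd1 : Disjoint Ω₁ (hull (K.erase p)) := by
    refine disjoint_left.2 fun x hx hx' => ?_
    exact disjoint_left.1 (disjoint_iff_inter_eq_empty.2 (IsOpen.inter_frontier_eq h.geo.left.isOpen)) hx
      (he'.2 hx').1
  have hd2 : Disjoint Ω₂ (hull (L.erase q)) := by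
    rw [hqe]
    refine disjoint_left.2 fun x hx hx' => ?_
    exact disjoint_left.1 (disjoint_iff_inter_eq_empty.2 (IsOpen.inter_frontier_eq h.geo.right.isOpen)) hx
      (he'.2 hx').2
  have hj := h.sol.jump.filter_mono (ae_mono (Measure.restrict_mono_set (surf d) he'.2))
  filter_upwards [hj, (T.isSimplex hK').ae_mem_innerFace h.dim hp] with x hx hxi
  rw [h.trace_half_eq hK' hL' hne hp hq hqe.symm h.geo.left.isOpen hKΩ hLΩ h.geo.disjoint hd1 hxi,
    h.trace_half_eq hL' hK' hne.symm hq hp hqe h.geo.right.isOpen hLΩ hKΩ h.geo.disjoint.symm hd2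
      ((T.isSimplex hK').innerFace_eq (T.isSimplex hL') hp hq hqe.symm hxi)] at hx
  exact hx

/-- The solution has no jump across an interior edge outside of the interface. -/
lemma IsSetting.trace_eq_of_notMem (h : IsSetting T Ω₁ Ω₂ A f gD gN u lmin lmax s κ)
    (he : e ∈ T.edges) (hei : e ∉ T.interfaceEdges Ω₁ Ω₂) (hK : K ∈ T.adjacent e)
    (hK' : K' ∈ T.adjacent e) (hne : K ≠ K') :
    trace (elt K) u =ᵐ[(surf d).restrict (hull e)] trace (elt K') u := by
  obtain ⟨p, hp, rfl⟩ := T.exists_apex he hK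
  obtain ⟨q, hq, hqe⟩ := T.exists_apex he hK'
  have hKe := (T.mem_adjacent.1 hK).1
  have hKe' := (T.mem_adjacent.1 hK').1
  refine h.trace_eq_of_memH1 hKe hKe' hne hp hq hqe.symm (h.memHfrac hKe).1 (h.memHfrac hKe').1 ?_
  have hdis : Disjoint (patch K K' p) (interface Ω₁ Ω₂) := by
    refine disjoint_left.2 fun x hx hx' => ?_
    rcases T.patch_subset h.one_le hKe hKe' hne hp hq hqe.symm hx with h2 | h2 | h2
    · exact disjoint_left.1 (h.fits.disjoint_elt hKe) h2 hx'
    · exact disjoint_left.1 (h.fits.disjoint_innerFace hKe h.one_le hp hei) h2 hx'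
    · exact disjoint_left.1 (h.fits.disjoint_elt hKe') h2 hx'
  rcases h.geo.subset_or_subset (h.geo.patch_subset h.one_le hKe hKe' hne hp hq hqe.symm)
    (convex_patch K K' p) hdis with h1 | h1
  · exact h.left.1.mono h1
  · exact h.right.1.mono h1

omit [DecidableEq (Pt d)] in
lemma hatTrace_singleton (hK : T.adjacent e = {K}) : hatTrace T v e = trace (elt K) v := by
  ext x; simp [hatTrace, hK]

lemma hatTrace_pair (hne : K ≠ L) (hK : T.adjacent e = {K, L}) :
    hatTrace T v e = fun x => 1 / 2 * (trace (elt K) v x + trace (elt L) v x) := by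
  ext x; simp [hatTrace, hK, Finset.card_pair hne, Finset.sum_pair hne]

/-- The jump `u - û` of the solution. -/
lemma IsSetting.hjump_eq (h : IsSetting T Ω₁ Ω₂ A f gD gN u lmin lmax s κ)
    (he : e ∈ T.edges) (hK : K ∈ T.adjacent e) :
    hjump (u, hatTrace T u) K e =ᵐ[(surf d).restrict (hull e)]
      if e ∈ T.interfaceEdges Ω₁ Ω₂ then fun x => sigma Ω₁ K / 2 * gD x else 0 := by
  have hd := h.one_le
  split_ifs with hi
  · obtain ⟨K₁, h₁, K₂, h₂, hs₁, hs₂, hne⟩ := h.geo.exists_adjacent_pair h.fits hd hi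
    have hpair := T.adjacent_eq_pair hd he h₁ h₂ hne
    rw [hpair, Finset.mem_insert, Finset.mem_singleton] at hK
    rcases hK with rfl | rfl
    · filter_upwards [h.trace_sub_interface hi h₁ h₂ hs₁ hs₂ hne] with x hx
      simp only [hjump, hatTrace_pair hne hpair, h.sigma_left (T.mem_adjacent.1 h₁).1 hs₁, ← hx]
      ring
    · filter_upwards [h.trace_sub_interface hi h₁ h₂ hs₁ hs₂ hne] with x hx
      simp only [hjump, hatTrace_pair hne hpair, h.sigma_right (T.mem_adjacent.1 h₂).1 hs₂, ← hx]
      ring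
  · by_cases hL : ∃ L ∈ T.adjacent e, L ≠ K
    · obtain ⟨L, hL, hne⟩ := hL
      filter_upwards [h.trace_eq_of_notMem he hi hK hL hne.symm] with x hx
      simp only [hjump, hatTrace_pair hne.symm (T.adjacent_eq_pair hd he hK hL hne.symm), ← hx,
        Pi.zero_apply]
      ring
    · push Not at hL
      have hsing : T.adjacent e = {K} := Finset.eq_singleton_iff_unique_mem.2 ⟨hK, hL⟩
      exact Eventually.of_forall fun x => by simp [hjump, hatTrace_singleton hsing]

end

section

variable {d : ℕ}

/-! ### Galerkin orthogonality -/

/-- Pairs for which the terms of the method are defined. -/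
structure IsRegularPair {Ω : Set (Pt d)} (T : Triangulation Ω) (s : ℝ) (w : HPair d) : Prop where
  memHfrac : ∀ K ∈ T.elements, MemHfrac (elt K) s w.1
  memLp_hjump : ∀ K ∈ T.elements, ∀ e ∈ edgesOf K,
    MemLp (hjump w K e) 2 ((surf d).restrict (hull e))

variable {Ω Ω₁ Ω₂ : Set (Pt d)} {T : Triangulation Ω} {A : Pt d → Pt d →L[ℝ] Pt d}
  {f gD gN u φ v : Pt d → ℝ} {lmin lmax s κ : ℝ} {K K' L e : Finset (Pt d)} {p q x : Pt d}
  {w z z' : HPair d} {k l : ℕ} {η : Finset (Pt d) → ℝ}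

lemma contDiff_eval (p : MvPolynomial (Fin d) ℝ) :
    ContDiff ℝ ∞ fun x : Pt d => MvPolynomial.eval (⇑x) p := by
  induction p using MvPolynomial.induction_on with
  | C a => simpa using contDiff_const
  | add p q hp hq => simpa using hp.add hq
  | mul_X p i hp =>
    have h1 : ContDiff ℝ ∞ fun x : Pt d => x i := (EuclideanSpace.proj (𝕜 := ℝ) i).contDiff
    simpa using hp.mul h1

lemma memLp_of_isPolyAE (hfin : IsFiniteMeasure ((surf d).restrict (hull e)))
    (hv : IsPolyAE ((surf d).restrict (hull e)) l v) :
    MemLp v 2 ((surf d).restrict (hull e)) := by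
  obtain ⟨p, -, hp⟩ := hv
  refine (memLp_congr_ae hp).2 ?_
  have hc := (contDiff_eval p).continuous
  obtain ⟨C, hC⟩ := (isCompact_hull e).exists_bound_of_continuousOn hc.continuousOn
  refine MemLp.of_bound hc.aestronglyMeasurable C ?_
  filter_upwards [ae_restrict_mem (isCompact_hull e).isClosed.measurableSet] with x hx
  exact hC x hx

/-- The trace of a function which agrees with a polynomial on an element. -/
lemma trace_of_ae_eq_eval (h : IsSimplex K) {P : MvPolynomial (Fin d) ℝ}
    (hv : v =ᵐ[volume.restrict (elt K)] fun x => MvPolynomial.eval (⇑x) P) (hx : x ∈ hull K) :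
    trace (elt K) v x = MvPolynomial.eval (⇑x) P := by
  rw [trace_congr hv]
  exact trace_of_continuous (isOpen_elt K) (isBounded_elt K) (h.closure_elt.symm ▸ hx)
    (contDiff_eval P).continuous

lemma integrable_mul_of_memLp {μ : Measure (Pt d)} {g h : Pt d → ℝ} (hg : MemLp g 2 μ)
    (hh : MemLp h 2 μ) : Integrable (fun x => g x * h x) μ := integrable_smul_of_memLp hg hh

variable [DecidableEq (Pt d)]

lemma IsSetting.isRegularPair_discrete (h : IsSetting T Ω₁ Ω₂ A f gD gN u lmin lmax s κ)
    (hw : w ∈ discreteSpace T k l) : IsRegularPair T s w := by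
  have hreg : ∀ K ∈ T.elements, MemHfrac (elt K) s w.1 := fun K hK => by
    obtain ⟨P, -, hP⟩ := hw.1 K hK
    exact ((T.isSimplex hK).memHfrac_of_contDiff h.dim (contDiff_eval P)
      (by linarith [h.half_lt]) h.le_one).congr (isOpen_elt K) hP.symm
  refine ⟨hreg, fun K hK e he => ?_⟩
  have heT := T.edgesOf_subset h.one_le hK he
  exact (h.memLp_trace hK he (hreg K hK).1).sub
    (memLp_of_isPolyAE (h.isFiniteMeasure_surf heT) (hw.2.1 e heT))

lemma IsSetting.isRegularPair_solution (h : IsSetting T Ω₁ Ω₂ A f gD gN u lmin lmax s κ) :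
    IsRegularPair T s (u, hatTrace T u) := by
  refine ⟨fun K hK => h.memHfrac hK, fun K hK e he => ?_⟩
  have heT := T.edgesOf_subset h.one_le hK he
  have h1 : MemLp (fun x => ∑ L ∈ T.adjacent e, trace (elt L) u x) 2
      ((surf d).restrict (hull e)) := memLp_finsetSum _ fun L hL =>
    h.memLp_trace (T.mem_adjacent.1 hL).1 (T.mem_edgesOf_of_adjacent heT hL)
      (h.memHfrac (T.mem_adjacent.1 hL).1).1
  exact (h.memLp_trace hK he (h.memHfrac hK).1).sub (h1.const_mul ((T.adjacent e).card : ℝ)⁻¹)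

/-- `trace` is a `limUnder` and need not be additive at points without a limit; additivity holds
almost everywhere through `HasFaceTrace`. -/
lemma IsSetting.hjump_sub (h : IsSetting T Ω₁ Ω₂ A f gD gN u lmin lmax s κ)
    (hw : IsRegularPair T s w) (hz : IsRegularPair T s z) (hK : K ∈ T.elements)
    (he : e ∈ edgesOf K) :
    hjump (w - z) K e =ᵐ[(surf d).restrict (hull e)] hjump w K e - hjump z K e := by
  have hs := T.isSimplex hK
  obtain ⟨p, hp, rfl⟩ := hs.mem_edgesOf.1 he
  have h1 := ((h.hasFaceTrace hK hp (hw.memHfrac K hK).1).sub hs h.one_le hp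
    (h.hasFaceTrace hK hp (hz.memHfrac K hK).1)).trace_eq hs
  filter_upwards [h1] with x hx
  simp only [hjump, Prod.fst_sub, hx, Pi.sub_apply, Prod.snd_sub]
  ring

lemma IsSetting.flux_sub (h : IsSetting T Ω₁ Ω₂ A f gD gN u lmin lmax s κ)
    (hw : IsRegularPair T s w) (hz : IsRegularPair T s z) (hK : K ∈ T.elements)
    (he : e ∈ edgesOf K) :
    flux A (w - z).1 K e =ᵐ[(surf d).restrict (hull e)] flux A w.1 K e - flux A z.1 K e := by
  have hs := T.isSimplex hK
  obtain ⟨p, hp, rfl⟩ := hs.mem_edgesOf.1 he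
  refine (((h.hasFaceTrace_flux hK hp (hw.memHfrac K hK)).sub hs h.one_le hp
    (h.hasFaceTrace_flux hK hp (hz.memHfrac K hK))).congr ?_).trace_eq hs
  filter_upwards [weakGrad_sub (isOpen_elt K) (hw.memHfrac K hK).1 (hz.memHfrac K hK).1] with x hx
  rw [Prod.fst_sub, hx]
  simp [inner_sub_left]

lemma IsRegularPair.sub (h : IsSetting T Ω₁ Ω₂ A f gD gN u lmin lmax s κ)
    (hw : IsRegularPair T s w) (hz : IsRegularPair T s z) : IsRegularPair T s (w - z) :=
  ⟨fun K hK => (hw.memHfrac K hK).sub (isOpen_elt K) (hz.memHfrac K hK), fun K hK e he =>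
    (memLp_congr_ae (h.hjump_sub hw hz hK he)).2
      ((hw.memLp_hjump K hK e he).sub (hz.memLp_hjump K hK e he))⟩

/-- The integral is additive only on integrable functions; regularity of the pairs makes every
product in the form integrable. -/
lemma IsSetting.bh_sub_left (h : IsSetting T Ω₁ Ω₂ A f gD gN u lmin lmax s κ)
    (hw : IsRegularPair T s w) (hz : IsRegularPair T s z) (hz' : IsRegularPair T s z') :
    Bh T A η (w - z) z' = Bh T A η w z' - Bh T A η z z' := by
  have e1 : ∀ K ∈ T.elements,
      ∫ x in elt K, inner ℝ (A x (weakGrad (elt K) (w - z).1 x)) (weakGrad (elt K) z'.1 x) =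
      (∫ x in elt K, inner ℝ (A x (weakGrad (elt K) w.1 x)) (weakGrad (elt K) z'.1 x)) -
        ∫ x in elt K, inner ℝ (A x (weakGrad (elt K) z.1 x)) (weakGrad (elt K) z'.1 x) := by
    intro K hK
    have hw' := (hw.memHfrac K hK).1
    have hz1 := (hz.memHfrac K hK).1
    have hz2 := (hz'.memHfrac K hK).1.memLp_weakGrad
    rw [← integral_sub]
    · refine integral_congr_ae ((weakGrad_sub (isOpen_elt K) hw' hz1).mono fun x hx => ?_)
      simp only [Prod.fst_sub, hx, Pi.sub_apply, map_sub, inner_sub_left]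
    · exact integrable_inner_of_memLp ((h.isBoundedCoeff hK).memLp_apply hw'.memLp_weakGrad) hz2
    · exact integrable_inner_of_memLp ((h.isBoundedCoeff hK).memLp_apply hz1.memLp_weakGrad) hz2
  have e2 : ∀ K ∈ T.elements, ∀ e ∈ edgesOf K,
      ∫ x in hull e, flux A (w - z).1 K e x * hjump z' K e x ∂(surf d) =
      (∫ x in hull e, flux A w.1 K e x * hjump z' K e x ∂(surf d)) -
        ∫ x in hull e, flux A z.1 K e x * hjump z' K e x ∂(surf d) := by
    intro K hK e he
    rw [← integral_sub]
    · refine integral_congr_ae ((h.flux_sub hw hz hK he).mono fun x hx => ?_)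
      simp only [hx, Pi.sub_apply, sub_mul]
    · exact integrable_mul_of_memLp (h.memLp_flux hK he (hw.memHfrac K hK))
        (hz'.memLp_hjump K hK e he)
    · exact integrable_mul_of_memLp (h.memLp_flux hK he (hz.memHfrac K hK))
        (hz'.memLp_hjump K hK e he)
  have e3 : ∀ K ∈ T.elements, ∀ e ∈ edgesOf K,
      ∫ x in hull e, flux A z'.1 K e x * hjump (w - z) K e x ∂(surf d) =
      (∫ x in hull e, flux A z'.1 K e x * hjump w K e x ∂(surf d)) -
        ∫ x in hull e, flux A z'.1 K e x * hjump z K e x ∂(surf d) := by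
    intro K hK e he
    rw [← integral_sub]
    · refine integral_congr_ae ((h.hjump_sub hw hz hK he).mono fun x hx => ?_)
      simp only [hx, Pi.sub_apply, mul_sub]
    · exact integrable_mul_of_memLp (h.memLp_flux hK he (hz'.memHfrac K hK))
        (hw.memLp_hjump K hK e he)
    · exact integrable_mul_of_memLp (h.memLp_flux hK he (hz'.memHfrac K hK))
        (hz.memLp_hjump K hK e he)
  have e4 : ∀ K ∈ T.elements, ∀ e ∈ edgesOf K,
      ∫ x in hull e, η e / size e * hjump (w - z) K e x * hjump z' K e x ∂(surf d) =
      (∫ x in hull e, η e / size e * hjump w K e x * hjump z' K e x ∂(surf d)) -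
        ∫ x in hull e, η e / size e * hjump z K e x * hjump z' K e x ∂(surf d) := by
    intro K hK e he
    rw [← integral_sub]
    · refine integral_congr_ae ((h.hjump_sub hw hz hK he).mono fun x hx => ?_)
      simp only [hx, Pi.sub_apply, mul_sub, sub_mul]
    · exact integrable_mul_of_memLp ((hw.memLp_hjump K hK e he).const_mul _)
        (hz'.memLp_hjump K hK e he)
    · exact integrable_mul_of_memLp ((hz.memLp_hjump K hK e he).const_mul _)
        (hz'.memLp_hjump K hK e he)
  unfold Bh
  rw [Finset.sum_congr rfl e1,
    Finset.sum_congr rfl fun K hK => Finset.sum_congr rfl (e2 K hK),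
    Finset.sum_congr rfl fun K hK => Finset.sum_congr rfl (e3 K hK),
    Finset.sum_congr rfl fun K hK => Finset.sum_congr rfl (e4 K hK)]
  simp only [Finset.sum_sub_distrib]
  ring

/-- The sum of the fluxes of the solution, tested with an edge function of the discrete space. -/
lemma IsSetting.sum_flux_hat (h : IsSetting T Ω₁ Ω₂ A f gD gN u lmin lmax s κ)
    (hw : w ∈ discreteSpace T k l) :
    ∑ K ∈ T.elements, ∑ e ∈ edgesOf K, ∫ x in hull e, flux A u K e x * w.2 e x ∂(surf d) =
      ∑ e ∈ T.interfaceEdges Ω₁ Ω₂, ∫ x in hull e, gN x * w.2 e x ∂(surf d) := by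
  rw [T.sum_swap h.one_le]
  have hsub : T.interfaceEdges Ω₁ Ω₂ ⊆ T.edges := fun e he => (T.mem_interfaceEdges.1 he).1
  rw [← Finset.sum_filter_add_sum_filter_not T.edges (· ∈ T.interfaceEdges Ω₁ Ω₂),
    Finset.filter_mem_eq_inter, Finset.inter_eq_right.2 hsub]
  have key : ∀ e ∈ T.edges, ∑ K ∈ T.adjacent e, ∫ x in hull e, flux A u K e x * w.2 e x ∂(surf d) =
      if e ∈ T.interfaceEdges Ω₁ Ω₂ then ∫ x in hull e, gN x * w.2 e x ∂(surf d) else 0 := by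
    intro e he
    have hfin := h.isFiniteMeasure_surf he
    have hw2 := memLp_of_isPolyAE hfin (hw.2.1 e he)
    obtain ⟨K, hK⟩ := T.adjacent_nonempty he
    have hKe := (T.mem_adjacent.1 hK).1
    by_cases hL : ∃ L ∈ T.adjacent e, L ≠ K
    · obtain ⟨L, hL, hne⟩ := hL
      rw [← integral_finsetSum _ fun M hM => integrable_mul_of_memLp
        (h.memLp_flux (T.mem_adjacent.1 hM).1 (T.mem_edgesOf_of_adjacent he hM)
          (h.memHfrac (T.mem_adjacent.1 hM).1)) hw2]
      have hj := h.flux_jump he hK hL hne.symm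
      simp_rw [← Finset.sum_mul]
      rw [integral_congr_ae (g := fun x => (if e ∈ T.interfaceEdges Ω₁ Ω₂ then gN else 0) x *
        w.2 e x) (hj.mono fun x hx => by simp only [hx])]
      split_ifs <;> simp
    -- An edge with a single adjacent element lies in the boundary of `Ω`, where the edge function
    -- vanishes. It cannot belong to the interface, since interface edges have two adjacent
    -- elements.
    · push Not at hL
      obtain ⟨p, hp, rfl⟩ := T.exists_apex he hK
      have hz := hw.2.2 _ he (T.hull_subset_frontier h.one_le h.geo.whole.isOpen hKe hp hL)
      rw [if_neg]
      · refine Finset.sum_eq_zero fun M _ => ?_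
        rw [integral_congr_ae (g := fun _ => (0 : ℝ)) (hz.mono fun x hx => by simp [hx])]
        simp
      · intro hi
        obtain ⟨K₁, h₁, K₂, h₂, -, -, hne⟩ := h.geo.exists_adjacent_pair h.fits h.one_le hi
        exact hne ((hL _ h₁).trans (hL _ h₂).symm)
  rw [Finset.sum_congr rfl fun e he => (key e (hsub he)).trans (if_pos he),
    Finset.sum_eq_zero fun e he => (key e (Finset.mem_filter.1 he).1).trans
      (if_neg (Finset.mem_filter.1 he).2), add_zero]

/-- Sums over the edges of functions which only see the jump of the solution. -/
lemma IsSetting.sum_hjump (h : IsSetting T Ω₁ Ω₂ A f gD gN u lmin lmax s κ)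
    (F : Finset (Pt d) → Finset (Pt d) → Pt d → ℝ) :
    ∑ K ∈ T.elements, ∑ e ∈ edgesOf K,
        ∫ x in hull e, F K e x * hjump (u, hatTrace T u) K e x ∂(surf d) =
      ∑ e ∈ T.interfaceEdges Ω₁ Ω₂, ∑ K ∈ T.adjacent e,
        ∫ x in hull e, F K e x * (sigma Ω₁ K / 2 * gD x) ∂(surf d) := by
  rw [T.sum_swap h.one_le]
  have hsub : T.interfaceEdges Ω₁ Ω₂ ⊆ T.edges := fun e he => (T.mem_interfaceEdges.1 he).1
  rw [← Finset.sum_subset hsub]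
  · refine Finset.sum_congr rfl fun e he => Finset.sum_congr rfl fun K hK => ?_
    have h1 := h.hjump_eq (hsub he) hK
    rw [if_pos he] at h1
    exact integral_congr_ae (h1.mono fun x hx => by simp only [hx])
  · intro e he hei
    refine Finset.sum_eq_zero fun K hK => ?_
    have h1 := h.hjump_eq he hK
    rw [if_neg hei] at h1
    rw [integral_congr_ae (g := fun _ => (0 : ℝ)) (h1.mono fun x hx => by simp [hx])]
    simp

/-- Consistency of the method. -/
lemma IsSetting.bh_solution (h : IsSetting T Ω₁ Ω₂ A f gD gN u lmin lmax s κ)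
    (hw : w ∈ discreteSpace T k l) :
    Bh T A η (u, hatTrace T u) w = Lh T Ω₁ Ω₂ A f gD gN η w := by
  have hreg := h.isRegularPair_discrete hw
  -- Green's formula with the polynomial that represents `w` on `K`; on the edges that polynomial is
  -- split into the jump and the edge function.
  have e1 : ∀ K ∈ T.elements,
      (∫ x in elt K, inner ℝ (A x (weakGrad (elt K) u x)) (weakGrad (elt K) w.1 x)) =
      (∫ x in elt K, f x * w.1 x) + ((∑ e ∈ edgesOf K,
        ∫ x in hull e, flux A u K e x * hjump w K e x ∂(surf d)) +
        ∑ e ∈ edgesOf K, ∫ x in hull e, flux A u K e x * w.2 e x ∂(surf d)) := by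
    intro K hK
    have hs := T.isSimplex hK
    obtain ⟨P, -, hP⟩ := hw.1 K hK
    have hc := contDiff_eval P
    have hg : weakGrad (elt K) w.1 =ᵐ[volume.restrict (elt K)]
        gradient fun x : Pt d => MvPolynomial.eval (⇑x) P :=
      (weakGrad_congr (isOpen_elt K) (memH1_of_contDiff hc (isBounded_elt K)) hP.symm).trans
        (weakGrad_of_contDiff hc (isBounded_elt K) (isOpen_elt K))
    have e0 : ∫ x in elt K, inner ℝ (A x (weakGrad (elt K) u x)) (weakGrad (elt K) w.1 x) =
        ∫ x in elt K, inner ℝ (A x (weakGrad (elt K) u x))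
          (gradient (fun x : Pt d => MvPolynomial.eval (⇑x) P) x) :=
      integral_congr_ae (hg.mono fun x hx => by simp only [hx])
    rw [e0, h.green hK hc, ← Finset.sum_add_distrib]
    congr 1
    · exact integral_congr_ae (hP.mono fun x hx => by simp only [hx])
    · refine Finset.sum_congr rfl fun e he => ?_
      have heT := T.edgesOf_subset h.one_le hK he
      have hfin := h.isFiniteMeasure_surf heT
      have hfl := h.memLp_flux hK he (h.memHfrac hK)
      rw [← integral_add (integrable_mul_of_memLp hfl (hreg.memLp_hjump K hK e he))
        (integrable_mul_of_memLp hfl (memLp_of_isPolyAE hfin (hw.2.1 e heT)))]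
      refine setIntegral_congr_fun (isCompact_hull e).isClosed.measurableSet fun x hx => ?_
      have hxK : x ∈ hull K := hull_mono (Finset.mem_powersetCard.1 he).1 hx
      simp only [hjump, trace_of_ae_eq_eval hs hP hxK]
      ring
  -- The flux terms with the jump of `w` now cancel. The edge functions collect the fluxes into
  -- `gN`, and the last two sums see only the jump of the solution, which is `sigma / 2 * gD` on the
  -- interface.
  unfold Bh Lh
  rw [Finset.sum_congr rfl e1, Finset.sum_add_distrib, Finset.sum_add_distrib, h.sum_flux_hat hw,
    h.sum_hjump (fun K e x => flux A w.1 K e x)]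
  have e4 := h.sum_hjump (fun K e x => η e / size e * hjump w K e x)
  have e7 : ∑ K ∈ T.elements, ∑ e ∈ edgesOf K,
      ∫ x in hull e, η e / size e * hjump (u, hatTrace T u) K e x * hjump w K e x ∂(surf d) =
      ∑ K ∈ T.elements, ∑ e ∈ edgesOf K,
      ∫ x in hull e, η e / size e * hjump w K e x * hjump (u, hatTrace T u) K e x ∂(surf d) :=
    Finset.sum_congr rfl fun K _ => Finset.sum_congr rfl fun e _ =>
      integral_congr_ae (Eventually.of_forall fun x => by ring)
  have e5 : ∑ e ∈ T.interfaceEdges Ω₁ Ω₂, ∑ K ∈ T.adjacent e,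
      ∫ x in hull e, flux A w.1 K e x * (sigma Ω₁ K / 2 * gD x) ∂(surf d) =
      ∑ e ∈ T.interfaceEdges Ω₁ Ω₂, ∑ K ∈ T.adjacent e,
        ∫ x in hull e, gD x * (1 / 2 * (sigma Ω₁ K * flux A w.1 K e x)) ∂(surf d) :=
    Finset.sum_congr rfl fun e _ => Finset.sum_congr rfl fun K _ =>
      integral_congr_ae (Eventually.of_forall fun x => by ring)
  have e6 : ∑ e ∈ T.interfaceEdges Ω₁ Ω₂, ∑ K ∈ T.adjacent e,
      ∫ x in hull e, η e / size e * hjump w K e x * (sigma Ω₁ K / 2 * gD x) ∂(surf d) =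
      ∑ e ∈ T.interfaceEdges Ω₁ Ω₂, ∑ K ∈ T.adjacent e,
        ∫ x in hull e, sigma Ω₁ K / 2 * (η e / size e) * gD x * hjump w K e x ∂(surf d) :=
    Finset.sum_congr rfl fun e _ => Finset.sum_congr rfl fun K _ =>
      integral_congr_ae (Eventually.of_forall fun x => by ring)
  rw [e7, e4, e5, e6]
  ring

/-- Galerkin orthogonality. -/
theorem IsSetting.galerkin (h : IsSetting T Ω₁ Ω₂ A f gD gN u lmin lmax s κ)
    (hz : IsHDGSolution T Ω₁ Ω₂ k l A f gD gN η z) (hw : w ∈ discreteSpace T k l) :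
    Bh T A η ((u, hatTrace T u) - z) w = 0 := by
  rw [h.bh_sub_left h.isRegularPair_solution (h.isRegularPair_discrete hz.1)
    (h.isRegularPair_discrete hw), h.bh_solution hw, hz.2 w hw, sub_self]

end

section

variable {d : ℕ}

/-! ### Inverse inequalities for polynomials -/

/-- The map `g` factors through the range of `f`, and linear maps on a finite-dimensional space are
bounded. This serves as equivalence of norms for polynomials of bounded degree. -/
lemma exists_norm_le_of_ker_le {V E F : Type*} [AddCommGroup V] [Module ℝ V]
    [FiniteDimensional ℝ V] [NormedAddCommGroup E] [NormedSpace ℝ E] [NormedAddCommGroup F]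
    [NormedSpace ℝ F] (f : V →ₗ[ℝ] E) (g : V →ₗ[ℝ] F) (hfg : LinearMap.ker f ≤ LinearMap.ker g) :
    ∃ C : ℝ, 0 < C ∧ ∀ v, ‖g v‖ ≤ C * ‖f v‖ := by
  set r : V →ₗ[ℝ] LinearMap.range f := f.rangeRestrict
  have hr : Function.Surjective r := f.surjective_rangeRestrict
  obtain ⟨σ, hσ⟩ := r.exists_rightInverse_of_surjective (LinearMap.range_eq_top.2 hr)
  set G := LinearMap.toContinuousLinearMap (g ∘ₗ σ)
  refine ⟨‖G‖ + 1, by positivity, fun v => ?_⟩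
  have h1 : g v = G (r v) := by
    have h2 : v - σ (r v) ∈ LinearMap.ker f := by
      rw [LinearMap.mem_ker, map_sub, sub_eq_zero]
      have := LinearMap.congr_fun hσ (r v)
      exact (congrArg Subtype.val this).symm
    have h3 := LinearMap.mem_ker.1 (hfg h2)
    rw [map_sub, sub_eq_zero] at h3
    exact h3
  rw [h1]
  refine (G.le_opNorm _).trans (mul_le_mul_of_nonneg_right (by linarith) (norm_nonneg _))

variable {k : ℕ} {U : Set (Pt d)} {P : MvPolynomial (Fin d) ℝ} {K : Finset (Pt d)}

/-- A polynomial as an element of `L²(U)`. -/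
def evalLp (hU : Bornology.IsBounded U) :
    MvPolynomial (Fin d) ℝ →ₗ[ℝ] Lp ℝ 2 (volume.restrict U) where
  toFun P := (memLp_of_continuous (contDiff_eval P).continuous hU 2).toLp _
  map_add' P Q := by
    rw [← MemLp.toLp_add]
    exact MemLp.toLp_congr _ _ (Eventually.of_forall fun x => by simp)
  map_smul' a P := by
    rw [RingHom.id_apply, ← MemLp.toLp_const_smul]
    exact MemLp.toLp_congr _ _ (Eventually.of_forall fun x => by simp [MvPolynomial.smul_eval])

lemma norm_evalLp_sq (hU : Bornology.IsBounded U) :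
    ENNReal.ofReal (‖evalLp hU P‖ ^ 2) =
      ∫⁻ x in U, ‖MvPolynomial.eval (⇑x) P‖ₑ ^ 2 := by
  rw [ENNReal.ofReal_pow (norm_nonneg _), ofReal_norm, Lp.enorm_def,
    show eLpNorm (⇑(evalLp hU P)) 2 (volume.restrict U) =
      eLpNorm (fun x : Pt d => MvPolynomial.eval (⇑x) P) 2 (volume.restrict U) from
      eLpNorm_congr_ae (MemLp.coeFn_toLp (memLp_of_continuous (contDiff_eval P).continuous hU 2)),
    eLpNorm_eq_lintegral_rpow_enorm_toReal (by norm_num) (by norm_num), ← ENNReal.rpow_natCast,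
    ← ENNReal.rpow_mul]
  norm_num

/-- A polynomial is continuous, so it vanishes on the whole ball; the ball contains a box, and a
polynomial vanishing on a product of infinite sets is zero. -/
lemma eq_zero_of_evalLp_eq_zero {r : ℝ} (hr : 0 < r)
    (h : evalLp (Metric.isBounded_ball (x := (0 : Pt d)) (r := r)) P = 0) : P = 0 := by
  have hc := (contDiff_eval P).continuous
  have h1 : (fun x : Pt d => MvPolynomial.eval (⇑x) P) =ᵐ[volume.restrict (Metric.ball 0 r)] 0 := by
    have h2 := (Lp.eq_zero_iff_ae_eq_zero).1 h
    exact (MemLp.coeFn_toLp (memLp_of_continuous hc Metric.isBounded_ball 2)).symm.trans h2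
  have h3 : EqOn (fun x : Pt d => MvPolynomial.eval (⇑x) P) 0 (Metric.ball 0 r) :=
    Measure.eqOn_open_of_ae_eq h1 Metric.isOpen_ball hc.continuousOn continuousOn_const
  obtain ⟨δ, hδ, hδ'⟩ : ∃ δ > 0, ∀ x : Fin d → ℝ, (∀ i, x i ∈ Ioo (-δ) δ) →
      WithLp.toLp 2 x ∈ Metric.ball (0 : Pt d) r := by
    have hcont : Continuous fun x : Fin d → ℝ => (WithLp.toLp 2 x : Pt d) :=
      PiLp.continuous_toLp 2 _
    have hmem : (fun x : Fin d → ℝ => (WithLp.toLp 2 x : Pt d)) ⁻¹' Metric.ball 0 r ∈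
        𝓝 (0 : Fin d → ℝ) :=
      hcont.continuousAt.preimage_mem_nhds (Metric.ball_mem_nhds _ hr)
    obtain ⟨δ, hδ, hsub⟩ := Metric.mem_nhds_iff.1 hmem
    refine ⟨δ, hδ, fun x hx => hsub ?_⟩
    rw [mem_ball_zero_iff, pi_norm_lt_iff hδ]
    exact fun i => abs_lt.2 (hx i)
  refine MvPolynomial.funext_set (fun _ => Ioo (-δ) δ) (fun _ => Ioo_infinite (by linarith))
    fun x hx => ?_
  simpa using h3 (hδ' x fun i => hx i (mem_univ i))

lemma gradient_eval (P : MvPolynomial (Fin d) ℝ) (x : Pt d) (i : Fin d) :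
    gradient (fun y : Pt d => MvPolynomial.eval (⇑y) P) x i =
      MvPolynomial.eval (⇑x) (MvPolynomial.pderiv i P) := by
  have e : ∀ v : Pt d → ℝ, gradient v x i = fderiv ℝ v x (EuclideanSpace.single i 1) := fun v => by
    rw [← inner_gradient_eq, EuclideanSpace.inner_single_right]
    simp
  rw [e]
  have hd : ∀ Q : MvPolynomial (Fin d) ℝ,
      DifferentiableAt ℝ (fun y : Pt d => MvPolynomial.eval (⇑y) Q) x := fun Q =>
    ((contDiff_eval Q).differentiable (by simp)).differentiableAt
  have hX : ∀ j : Fin d, HasFDerivAt (fun y : Pt d => y j) (EuclideanSpace.proj (𝕜 := ℝ) j) x :=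
    fun j => (EuclideanSpace.proj (𝕜 := ℝ) j).hasFDerivAt
  induction P using MvPolynomial.induction_on with
  | C a => simp
  | add p q hp hq =>
    simp only [map_add] at *
    rw [fderiv_fun_add (hd p) (hd q), add_apply, hp, hq]
  | mul_X p j hp =>
    simp only [map_mul, MvPolynomial.eval_X, Derivation.leibniz, smul_eq_mul, map_add,
      MvPolynomial.pderiv_X] at *
    rw [fderiv_fun_mul (hd p) (hX j).differentiableAt, add_apply, smul_apply, smul_apply, hp,
      (hX j).fderiv]
    by_cases hij : i = j
    · subst hij; simp
    · simp [Ne.symm hij]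

/-- The composition of a polynomial with `y ↦ c + h y`. -/
def rescale (c : Pt d) (h : ℝ) (P : MvPolynomial (Fin d) ℝ) : MvPolynomial (Fin d) ℝ :=
  MvPolynomial.bind₁ (fun i => MvPolynomial.C (c i) + MvPolynomial.C h * MvPolynomial.X i) P

lemma eval_rescale (c : Pt d) (h : ℝ) (P : MvPolynomial (Fin d) ℝ) (y : Pt d) :
    MvPolynomial.eval (⇑y) (rescale c h P) = MvPolynomial.eval (⇑(c + h • y)) P := by
  rw [rescale, MvPolynomial.eval, MvPolynomial.eval₂Hom_bind₁]
  congr 2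
  ext i
  simp

lemma totalDegree_rescale_le (c : Pt d) (h : ℝ) (P : MvPolynomial (Fin d) ℝ) :
    (rescale c h P).totalDegree ≤ P.totalDegree := by
  rw [rescale, P.as_sum, map_sum, ← P.as_sum]
  refine MvPolynomial.totalDegree_finsetSum_le fun m hm => ?_
  rw [MvPolynomial.bind₁_monomial]
  refine (MvPolynomial.totalDegree_mul _ _).trans ?_
  rw [MvPolynomial.totalDegree_C, zero_add]
  refine (MvPolynomial.totalDegree_finsetProd _ _).trans ?_
  refine le_trans (Finset.sum_le_sum fun i _ => ?_) (MvPolynomial.le_totalDegree hm)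
  refine (MvPolynomial.totalDegree_pow _ _).trans ?_
  refine (Nat.mul_le_mul_left _ ?_).trans_eq (mul_one _)
  refine (MvPolynomial.totalDegree_add _ _).trans (max_le (by simp) ?_)
  refine (MvPolynomial.totalDegree_mul _ _).trans ?_
  simp

lemma eval_pderiv_rescale (c : Pt d) (h : ℝ) (P : MvPolynomial (Fin d) ℝ) (y : Pt d) (i : Fin d) :
    MvPolynomial.eval (⇑y) (MvPolynomial.pderiv i (rescale c h P)) =
      h * MvPolynomial.eval (⇑(c + h • y)) (MvPolynomial.pderiv i P) := by
  have e : ∀ (v : Pt d → ℝ) x, gradient v x i = fderiv ℝ v x (EuclideanSpace.single i 1) :=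
    fun v x => by
      rw [← inner_gradient_eq, EuclideanSpace.inner_single_right]
      simp
  rw [← gradient_eval, ← gradient_eval, e, e]
  simp_rw [eval_rescale]
  have h1 : HasFDerivAt (fun y : Pt d => c + h • y) (h • ContinuousLinearMap.id ℝ (Pt d)) y :=
    ((hasFDerivAt_id y).const_smul h).const_add c
  have h2 := ((contDiff_eval P).differentiable (by simp) (c + h • y)).hasFDerivAt.comp y h1
  rw [show (fun y : Pt d => MvPolynomial.eval (⇑(c + h • y)) P) =
    (fun y : Pt d => MvPolynomial.eval (⇑y) P) ∘ fun y => c + h • y from rfl, h2.fderiv]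
  simp

lemma lintegral_ball_rescale (c : Pt d) {h : ℝ} (hh : 0 < h) (r : ℝ) (F : Pt d → ℝ≥0∞) :
    ∫⁻ x in Metric.ball c (h * r), F x =
      ENNReal.ofReal (h ^ d) * ∫⁻ y in Metric.ball 0 r, F (c + h • y) := by
  have h1 : (fun y : Pt d => c + h • y) '' Metric.ball 0 r = Metric.ball c (h * r) := by
    ext x
    simp only [mem_image, mem_ball_iff_norm, sub_zero]
    constructor
    · rintro ⟨y, hy, rfl⟩
      rw [add_sub_cancel_left, norm_smul, Real.norm_of_nonneg hh.le]
      exact mul_lt_mul_of_pos_left hy hh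
    · intro hx
      refine ⟨h⁻¹ • (x - c), ?_, by rw [smul_inv_smul₀ hh.ne']; abel⟩
      rw [norm_smul, norm_inv, Real.norm_of_nonneg hh.le, inv_mul_lt_iff₀ hh]
      exact hx
  have h2 : ∀ y ∈ Metric.ball (0 : Pt d) r, HasFDerivWithinAt (fun y : Pt d => c + h • y)
      (h • ContinuousLinearMap.id ℝ (Pt d)) (Metric.ball 0 r) y := fun y _ =>
    (((hasFDerivAt_id y).const_smul h).const_add c).hasFDerivWithinAt
  have hinj : InjOn (fun y : Pt d => c + h • y) (Metric.ball 0 r) := fun x _ y _ hxy =>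
    smul_right_injective _ hh.ne' (add_left_cancel hxy)
  have hdet : |(h • ContinuousLinearMap.id ℝ (Pt d)).det| = h ^ d := by
    simp [ContinuousLinearMap.det, abs_of_pos hh]
  rw [← h1, lintegral_image_eq_lintegral_abs_det_fderiv_mul volume measurableSet_ball h2 hinj, hdet,
    lintegral_const_mul' _ _ ENNReal.ofReal_ne_top]

/-- The inverse inequality. -/
lemma exists_inverse_inequality (d k : ℕ) {κ : ℝ} (hκ : 0 < κ) :
    ∃ C : ℝ, 0 < C ∧ ∀ (K : Finset (Pt d)) (c : Pt d), IsSimplex K → 1 ≤ d →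
      Metric.closedBall c (κ * size K) ⊆ hull K → ∀ P : MvPolynomial (Fin d) ℝ,
      P.totalDegree ≤ k → ∀ i, ENNReal.ofReal (size K ^ 2) *
        ∫⁻ x in elt K, ‖MvPolynomial.eval (⇑x) (MvPolynomial.pderiv i P)‖ₑ ^ 2 ≤
        ENNReal.ofReal C * ∫⁻ x in elt K, ‖MvPolynomial.eval (⇑x) P‖ₑ ^ 2 := by
  set V := MvPolynomial.restrictTotalDegree (Fin d) ℝ k
  have hb : ∀ r : ℝ, Bornology.IsBounded (Metric.ball (0 : Pt d) r) := fun r =>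
    Metric.isBounded_ball
  -- After translation and scaling by `size K`, every admissible element lies between the balls of
  -- radius `κ` and `2`. A norm comparison on these two fixed balls replaces the reference simplex
  -- and gives a constant independent of the element.
  have h1 : ∀ i, ∃ C : ℝ, 0 < C ∧ ∀ v : V, ‖evalLp (hb 2) (MvPolynomial.pderiv i v.1)‖ ≤
      C * ‖evalLp (hb κ) v.1‖ := fun i =>
    exists_norm_le_of_ker_le ((evalLp (hb κ)) ∘ₗ V.subtype)
      ((evalLp (hb 2)) ∘ₗ (MvPolynomial.pderiv i).toLinearMap ∘ₗ V.subtype) (by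
        intro v hv
        have h2 : v.1 = 0 := eq_zero_of_evalLp_eq_zero hκ hv
        simp [h2])
  choose C hC0 hC using h1
  refine ⟨∑ i, C i ^ 2 + 1, by positivity, fun K c hK hd hc P hP i => ?_⟩
  have hs := hK.size_pos hd
  set h := size K
  have hmem : rescale c h P ∈ V := (MvPolynomial.mem_restrictTotalDegree _ _ _).2
    ((totalDegree_rescale_le c h P).trans hP)
  have hcK : c ∈ hull K := hc (Metric.mem_closedBall_self (by positivity))
  have hsub1 : elt K ⊆ Metric.ball c (h * 2) := fun x hx => by
    have := dist_le_size (elt_subset_hull K hx) hcK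
    rw [Metric.mem_ball]; linarith
  have hsub2 : Metric.ball c (h * κ) ⊆ elt K := by
    rw [mul_comm]
    exact interior_maximal (Metric.ball_subset_closedBall.trans hc) Metric.isOpen_ball
  have key : ∫⁻ y in Metric.ball (0 : Pt d) 2,
        ‖MvPolynomial.eval (⇑y) (MvPolynomial.pderiv i (rescale c h P))‖ₑ ^ 2 ≤
      ENNReal.ofReal (C i ^ 2) *
        ∫⁻ y in Metric.ball (0 : Pt d) κ, ‖MvPolynomial.eval (⇑y) (rescale c h P)‖ₑ ^ 2 := by
    rw [← norm_evalLp_sq (hb 2), ← norm_evalLp_sq (hb κ), ← ENNReal.ofReal_mul (by positivity),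
      ← mul_pow]
    exact ENNReal.ofReal_le_ofReal (pow_le_pow_left₀ (norm_nonneg _) (hC i ⟨_, hmem⟩) 2)
  simp_rw [eval_pderiv_rescale, eval_rescale, enorm_mul, mul_pow] at key
  rw [lintegral_const_mul' _ _ (by simp)] at key
  have hh : ‖h‖ₑ ^ 2 = ENNReal.ofReal (h ^ 2) := (ofReal_sq_eq_enorm _).symm
  rw [hh] at key
  calc _ ≤ ENNReal.ofReal (h ^ 2) * ∫⁻ x in Metric.ball c (h * 2),
        ‖MvPolynomial.eval (⇑x) (MvPolynomial.pderiv i P)‖ₑ ^ 2 :=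
        mul_le_mul' le_rfl (lintegral_mono_set hsub1)
    _ = ENNReal.ofReal (h ^ d) * (ENNReal.ofReal (h ^ 2) * ∫⁻ y in Metric.ball (0 : Pt d) 2,
        ‖MvPolynomial.eval (⇑(c + h • y)) (MvPolynomial.pderiv i P)‖ₑ ^ 2) := by
        rw [lintegral_ball_rescale c hs, mul_left_comm]
    _ ≤ ENNReal.ofReal (h ^ d) * (ENNReal.ofReal (C i ^ 2) * ∫⁻ y in Metric.ball (0 : Pt d) κ,
        ‖MvPolynomial.eval (⇑(c + h • y)) P‖ₑ ^ 2) := mul_le_mul' le_rfl key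
    _ = ENNReal.ofReal (C i ^ 2) * ∫⁻ x in Metric.ball c (h * κ),
        ‖MvPolynomial.eval (⇑x) P‖ₑ ^ 2 := by
        rw [lintegral_ball_rescale c hs, mul_left_comm]
    _ ≤ _ := by
        refine mul_le_mul' (ENNReal.ofReal_le_ofReal ?_) (lintegral_mono_set hsub2)
        have := Finset.single_le_sum (f := fun i => C i ^ 2) (fun _ _ => sq_nonneg _)
          (Finset.mem_univ i)
        linarith

lemma totalDegree_pderiv_le (P : MvPolynomial (Fin d) ℝ) (i : Fin d) :
    (MvPolynomial.pderiv i P).totalDegree ≤ P.totalDegree := by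
  conv_lhs => rw [P.as_sum, map_sum]
  refine MvPolynomial.totalDegree_finsetSum_le fun m hm => ?_
  rw [MvPolynomial.pderiv_monomial]
  refine (MvPolynomial.totalDegree_monomial_le _ _).trans
    (le_trans ?_ (MvPolynomial.le_totalDegree hm))
  rw [Finsupp.sum_fintype _ _ (fun _ => rfl), Finsupp.sum_fintype _ _ (fun _ => rfl)]
  exact Finset.sum_le_sum fun j _ => by simp

variable {s : ℝ} {v : Pt d → ℝ}

lemma weakPartial_of_ae_eq_eval (hv : v =ᵐ[volume.restrict (elt K)]
    fun x => MvPolynomial.eval (⇑x) P) (i : Fin d) :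
    weakPartial (elt K) i v =ᵐ[volume.restrict (elt K)]
      fun x => MvPolynomial.eval (⇑x) (MvPolynomial.pderiv i P) := by
  have hc := contDiff_eval P
  refine (weakPartial_congr (isOpen_elt K) (memH1_of_contDiff hc (isBounded_elt K)) hv.symm i).trans
    ((weakPartial_of_contDiff hc (isBounded_elt K) (isOpen_elt K) i).trans ?_)
  exact Eventually.of_forall fun x => gradient_eval P x i

lemma IsPolyAE.weakPartial (hv : IsPolyAE (volume.restrict (elt K)) k v) (i : Fin d) :
    IsPolyAE (volume.restrict (elt K)) k (weakPartial (elt K) i v) := by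
  obtain ⟨P, hP, hv⟩ := hv
  exact ⟨_, (totalDegree_pderiv_le P i).trans hP, weakPartial_of_ae_eq_eval hv i⟩

lemma IsPolyAE.memH1 (hv : IsPolyAE (volume.restrict (elt K)) k v) : MemH1 (elt K) v := by
  obtain ⟨P, hP, hv⟩ := hv
  exact (memH1_of_contDiff (contDiff_eval P) (isBounded_elt K)).congr hv.symm

lemma IsPolyAE.memHfrac (hK : IsSimplex K) (hd : 2 ≤ d) (hs0 : 0 < s) (hs1 : s ≤ 1)
    (hv : IsPolyAE (volume.restrict (elt K)) k v) : MemHfrac (elt K) s v := by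
  obtain ⟨P, hP, hv⟩ := hv
  exact (hK.memHfrac_of_contDiff hd (contDiff_eval P) hs0 hs1).congr (isOpen_elt K) hv.symm

lemma exists_h1SemiSq_le (d k : ℕ) {κ : ℝ} (hκ : 0 < κ) :
    ∃ C : ℝ, 0 < C ∧ ∀ (K : Finset (Pt d)) (c : Pt d), IsSimplex K → 1 ≤ d →
      Metric.closedBall c (κ * size K) ⊆ hull K → ∀ v : Pt d → ℝ,
      IsPolyAE (volume.restrict (elt K)) k v →
      ENNReal.ofReal (size K ^ 2) * h1SemiSq (elt K) v ≤
        ENNReal.ofReal C * ∫⁻ x in elt K, ‖v x‖ₑ ^ 2 := by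
  obtain ⟨C, hC0, hC⟩ := exists_inverse_inequality d k hκ
  -- The factor `d + 1` instead of `d` keeps the constant positive before `1 ≤ d` is available.
  refine ⟨(d + 1) * C, by positivity, fun K c hK hd hc v hv => ?_⟩
  obtain ⟨P, hP, hvP⟩ := id hv
  rw [hv.memH1.h1SemiSq_eq_sum, Finset.mul_sum,
    lintegral_congr_ae (g := fun x : Pt d => ‖MvPolynomial.eval (⇑x) P‖ₑ ^ 2)
      (hvP.mono fun x hx => by simp only [hx])]
  calc _ ≤ ∑ i : Fin d, ENNReal.ofReal C * ∫⁻ x in elt K, ‖MvPolynomial.eval (⇑x) P‖ₑ ^ 2 := by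
        refine Finset.sum_le_sum fun i _ => ?_
        rw [lintegral_congr_ae (g := fun x : Pt d => ‖MvPolynomial.eval (⇑x)
          (MvPolynomial.pderiv i P)‖ₑ ^ 2)
          ((weakPartial_of_ae_eq_eval hvP i).mono fun x hx => by simp only [hx])]
        exact hC K c hK hd hc P hP i
    _ = ENNReal.ofReal (d * C) * ∫⁻ x in elt K, ‖MvPolynomial.eval (⇑x) P‖ₑ ^ 2 := by
        rw [Finset.sum_const, Finset.card_univ, Fintype.card_fin, nsmul_eq_mul, ← mul_assoc,
          ENNReal.ofReal_mul (by positivity), ENNReal.ofReal_natCast]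
    _ ≤ _ := mul_le_mul' (ENNReal.ofReal_le_ofReal (by nlinarith)) le_rfl

/-- The inverse inequality for the broken seminorm of order `1 + s`. -/
lemma exists_fracSemiSq_le (hd : 2 ≤ d) (k : ℕ) {κ : ℝ} (hκ : 0 < κ) (hs0 : 0 < s) (hs1 : s ≤ 1) :
    ∃ C : ℝ, 0 < C ∧ ∀ (K : Finset (Pt d)) (c : Pt d), IsSimplex K →
      Metric.closedBall c (κ * size K) ⊆ hull K → ∀ v : Pt d → ℝ,
      IsPolyAE (volume.restrict (elt K)) k v →
      ENNReal.ofReal (size K ^ (2 * s)) * fracSemiSq (elt K) s v ≤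
        ENNReal.ofReal C * h1SemiSq (elt K) v := by
  obtain ⟨C, hC0, hC⟩ := exists_h1SemiSq_le d k hκ
  by_cases hs : s = 1
  · refine ⟨C, hC0, fun K c hK hc v hv => ?_⟩
    have hsz := hK.size_pos (by omega)
    rw [hs, fracSemiSq_one, hv.memH1.h1SemiSq_eq_sum, Finset.mul_sum, Finset.mul_sum]
    refine Finset.sum_le_sum fun i _ => ?_
    have := hC K c hK (by omega) hc _ (hv.weakPartial i)
    rwa [mul_one, Real.rpow_two]
  · have hs1' : s < 1 := lt_of_le_of_ne hs1 hs
    have hc0 := slobConst_pos d hs1'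
    refine ⟨slobConst d s * C, by positivity, fun K c hK hc v hv => ?_⟩
    have hsz := hK.size_pos (by omega)
    rw [fracSemiSq_of_ne hs, hv.memH1.h1SemiSq_eq_sum, Finset.mul_sum, Finset.mul_sum]
    refine Finset.sum_le_sum fun i _ => ?_
    calc _ ≤ ENNReal.ofReal (size K ^ (2 * s)) *
          (ENNReal.ofReal (slobConst d s * size K ^ (2 - 2 * s)) *
            h1SemiSq (elt K) (weakPartial (elt K) i v)) :=
          mul_le_mul' le_rfl (hK.slobSq_le hd hs0 hs1' (hv.weakPartial i).memH1)
      _ = ENNReal.ofReal (slobConst d s) * (ENNReal.ofReal (size K ^ 2) *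
            h1SemiSq (elt K) (weakPartial (elt K) i v)) := by
          rw [← mul_assoc, ← mul_assoc, ← ENNReal.ofReal_mul (by positivity),
            ← ENNReal.ofReal_mul hc0.le]
          congr 2
          rw [mul_left_comm, ← Real.rpow_add hsz, ← Real.rpow_two]
          norm_num
      _ ≤ ENNReal.ofReal (slobConst d s) * (ENNReal.ofReal C *
            ∫⁻ x in elt K, ‖weakPartial (elt K) i v x‖ₑ ^ 2) :=
          mul_le_mul' le_rfl (hC K c hK (by omega) hc _ (hv.weakPartial i))
      _ = _ := by rw [← mul_assoc, ← ENNReal.ofReal_mul hc0.le]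

/-- The flux of a polynomial is bounded by its gradient. -/
lemma exists_flux_poly_bound [DecidableEq (Pt d)] (hd : 2 ≤ d) (k : ℕ) {κ L : ℝ} (hκ : 0 < κ)
    (hL : 0 < L) :
    ∃ C : ℝ, 0 < C ∧ ∀ (K : Finset (Pt d)) (c : Pt d), IsSimplex K →
      Metric.closedBall c (κ * size K) ⊆ hull K → ∀ p ∈ K, ∀ A, IsBoundedCoeff K L A →
      ∀ v : Pt d → ℝ, IsPolyAE (volume.restrict (elt K)) k v →
        ENNReal.ofReal (size K) *
            ∫⁻ x in hull (K.erase p), ‖flux A v K (K.erase p) x‖ₑ ^ 2 ∂(surf d) ≤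
          ENNReal.ofReal C * h1SemiSq (elt K) v := by
  -- A polynomial has every order of smoothness, so the fixed order `3/4` is used. The resulting
  -- constant, and with it the threshold for the penalty, does not depend on `s`.
  obtain ⟨C, hC0, hC⟩ := exists_flux_bound (s := 3 / 4) hd hκ hL (by norm_num) (by norm_num)
  obtain ⟨C', hC0', hC'⟩ := exists_fracSemiSq_le (s := 3 / 4) hd k hκ (by norm_num) (by norm_num)
  refine ⟨C * (1 + C'), by positivity, fun K c hK hc p hp A hA v hv => ?_⟩
  refine ((hC K c hK hc p hp A hA v (hv.memHfrac hK hd (by norm_num) (by norm_num))).2).trans ?_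
  rw [ENNReal.ofReal_mul hC0.le, mul_assoc, ENNReal.ofReal_add (by norm_num) hC0'.le, add_mul,
    ENNReal.ofReal_one, one_mul]
  exact mul_le_mul' le_rfl (add_le_add le_rfl (hC' K c hK hc v hv))

end

section

variable {d : ℕ}

/-! ### Stability of the method -/

/-- Young's inequality `F G ≤ t G² + F² / (4t)`. The free parameter decides which factor is to be
absorbed. -/
lemma abs_integral_le_of_abs_le_mul {μ : Measure (Pt d)} {φ F G : Pt d → ℝ}
    (hφ : ∀ᵐ x ∂μ, |φ x| ≤ F x * G x) (hF : Integrable (fun x => F x ^ 2) μ)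
    (hG : Integrable (fun x => G x ^ 2) μ) {t : ℝ} (ht : 0 < t) :
    |∫ x, φ x ∂μ| ≤ t * (∫ x, G x ^ 2 ∂μ) + (4 * t)⁻¹ * ∫ x, F x ^ 2 ∂μ := by
  rw [← integral_const_mul, ← integral_const_mul, ← integral_add (hG.const_mul _) (hF.const_mul _)]
  rw [← Real.norm_eq_abs]
  refine norm_integral_le_of_norm_le ((hG.const_mul t).add (hF.const_mul (4 * t)⁻¹))
    (hφ.mono fun x hx => ?_)
  refine hx.trans ?_
  have h1 : t * G x ^ 2 + (4 * t)⁻¹ * F x ^ 2 - F x * G x = (4 * t)⁻¹ * (2 * t * G x - F x) ^ 2 := by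
    field_simp; ring
  have h2 : 0 ≤ (4 * t)⁻¹ * (2 * t * G x - F x) ^ 2 := by positivity
  linarith

/-- The squared `L²` norm of the gradient on an element. -/
def gradSq (K : Finset (Pt d)) (v : Pt d → ℝ) : ℝ := ∫ x in elt K, ‖weakGrad (elt K) v x‖ ^ 2

/-- The scaled squared seminorm of order `1 + s` on an element. -/
def fracSq (s : ℝ) (K : Finset (Pt d)) (v : Pt d → ℝ) : ℝ :=
  size K ^ (2 * s) * (fracSemiSq (elt K) s v).toReal

/-- The penalty terms on the boundary of an element. -/
def jumpSq (η : Finset (Pt d) → ℝ) (w : HPair d) (K : Finset (Pt d)) : ℝ :=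
  ∑ e ∈ edgesOf K, ∫ x in hull e, η e / size e * hjump w K e x ^ 2 ∂(surf d)

/-- The contribution of an element to `B_h`. -/
def localForm (A : Pt d → Pt d →L[ℝ] Pt d) (η : Finset (Pt d) → ℝ) (w v : HPair d)
    (K : Finset (Pt d)) : ℝ :=
  (∫ x in elt K, inner ℝ (A x (weakGrad (elt K) w.1 x)) (weakGrad (elt K) v.1 x))
    - (∑ e ∈ edgesOf K, ∫ x in hull e, flux A w.1 K e x * hjump v K e x ∂(surf d))
    - (∑ e ∈ edgesOf K, ∫ x in hull e, flux A v.1 K e x * hjump w K e x ∂(surf d))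
    + ∑ e ∈ edgesOf K, ∫ x in hull e, η e / size e * hjump w K e x * hjump v K e x ∂(surf d)

variable {Ω Ω₁ Ω₂ : Set (Pt d)} {T : Triangulation Ω} {A : Pt d → Pt d →L[ℝ] Pt d}
  {f gD gN u v : Pt d → ℝ} {lmin lmax s κ ηmin : ℝ} {K e : Finset (Pt d)} {p x : Pt d}
  {w z : HPair d} {k l : ℕ} {η : Finset (Pt d) → ℝ} {U : Set (Pt d)}

lemma bh_eq_sum_localForm (T : Triangulation Ω) (A : Pt d → Pt d →L[ℝ] Pt d)
    (η : Finset (Pt d) → ℝ) (w v : HPair d) :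
    Bh T A η w v = ∑ K ∈ T.elements, localForm A η w v K := by
  simp only [Bh, localForm, Finset.sum_add_distrib, Finset.sum_sub_distrib]

lemma MemH1.ofReal_gradSq (hv : MemH1 (elt K) v) :
    ENNReal.ofReal (gradSq K v) = h1SemiSq (elt K) v :=
  ofReal_integral_eq_lintegral_ofReal hv.memLp_weakGrad.integrable_norm_pow'
    (Eventually.of_forall fun _ => by positivity)

lemma gradSq_nonneg (K : Finset (Pt d)) (v : Pt d → ℝ) : 0 ≤ gradSq K v :=
  integral_nonneg fun _ => by positivity

lemma size_nonneg (K : Finset (Pt d)) : 0 ≤ size K := Metric.diam_nonneg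

lemma fracSq_nonneg (s : ℝ) (K : Finset (Pt d)) (v : Pt d → ℝ) : 0 ≤ fracSq s K v :=
  mul_nonneg (Real.rpow_nonneg (size_nonneg K) _) ENNReal.toReal_nonneg

lemma MemHfrac.ofReal_fracSq (hv : MemHfrac (elt K) s v) :
    ENNReal.ofReal (fracSq s K v) =
      ENNReal.ofReal (size K ^ (2 * s)) * fracSemiSq (elt K) s v := by
  rw [fracSq, ENNReal.ofReal_mul (Real.rpow_nonneg (size_nonneg K) _),
    ENNReal.ofReal_toReal hv.2.2.ne]

lemma ofReal_integral_sq {μ : Measure (Pt d)} {g : Pt d → ℝ} (hg : MemLp g 2 μ) :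
    ENNReal.ofReal (∫ x, g x ^ 2 ∂μ) = ∫⁻ x, ENNReal.ofReal (g x ^ 2) ∂μ :=
  ofReal_integral_eq_lintegral_ofReal hg.integrable_sq (Eventually.of_forall fun _ => sq_nonneg _)

variable [DecidableEq (Pt d)]

/-- The estimates for the fluxes and the seminorms on which the stability of the method rests. -/
structure HasFluxBounds (T : Triangulation Ω) (A : Pt d → Pt d →L[ℝ] Pt d) (s : ℝ) (k : ℕ)
    (C₁ C₂ C₃ : ℝ) : Prop where
  poly : ∀ K ∈ T.elements, ∀ v, IsPolyAE (volume.restrict (elt K)) k v → ∀ e ∈ edgesOf K,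
    size K * ∫ x in hull e, flux A v K e x ^ 2 ∂(surf d) ≤ C₁ * gradSq K v
  smooth : ∀ K ∈ T.elements, ∀ v, MemHfrac (elt K) s v → ∀ e ∈ edgesOf K,
    size K * ∫ x in hull e, flux A v K e x ^ 2 ∂(surf d) ≤ C₂ * (gradSq K v + fracSq s K v)
  frac : ∀ K ∈ T.elements, ∀ v, IsPolyAE (volume.restrict (elt K)) k v →
    fracSq s K v ≤ C₃ * gradSq K v

/-- The order of the quantifiers matters: `C₁` fixes the threshold for the penalty and is chosen
before `s`, whereas `C₂` and `C₃` may depend on `s`. -/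
lemma exists_hasFluxBounds (hd : 2 ≤ d) (k : ℕ) (hκ : 0 < κ) (hmax : 0 < lmax) :
    ∃ C₁ : ℝ, 0 < C₁ ∧ ∀ s, 1 / 2 < s → s ≤ 1 → ∃ C₂ C₃ : ℝ, 0 < C₂ ∧ 0 < C₃ ∧
      ∀ (Ω Ω₁ Ω₂ : Set (Pt d)) (T : Triangulation Ω) (A : Pt d → Pt d →L[ℝ] Pt d)
        (f gD gN u : Pt d → ℝ) (lmin : ℝ), IsSetting T Ω₁ Ω₂ A f gD gN u lmin lmax s κ →
        HasFluxBounds T A s k C₁ C₂ C₃ := by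
  obtain ⟨C₁, h10, h1⟩ := exists_flux_poly_bound hd k hκ hmax
  refine ⟨C₁, h10, fun s hs0 hs1 => ?_⟩
  obtain ⟨C₂, h20, h2⟩ := exists_flux_bound hd hκ hmax hs0 hs1
  obtain ⟨C₃, h30, h3⟩ := exists_fracSemiSq_le (s := s) hd k hκ (by linarith) hs1
  refine ⟨C₂, C₃, h20, h30, fun Ω Ω₁ Ω₂ T A f gD gN u lmin h => ⟨?_, ?_, ?_⟩⟩
  · intro K hK v hv e he
    have hs := T.isSimplex hK
    obtain ⟨c, hc⟩ := h.ball K hK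
    have hfl := h.memLp_flux hK he (hv.memHfrac hs hd (by linarith) hs1)
    obtain ⟨p, hp, rfl⟩ := hs.mem_edgesOf.1 he
    have := h1 K c hs hc p hp A (h.isBoundedCoeff hK) v hv
    simp_rw [← ofReal_sq_eq_enorm] at this
    rwa [← ofReal_integral_sq hfl, ← hv.memH1.ofReal_gradSq, ← ENNReal.ofReal_mul (size_nonneg K),
      ← ENNReal.ofReal_mul h10.le, ENNReal.ofReal_le_ofReal_iff
        (mul_nonneg h10.le (gradSq_nonneg _ _))] at this
  · intro K hK v hv e he
    have hs := T.isSimplex hK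
    obtain ⟨c, hc⟩ := h.ball K hK
    have hfl := h.memLp_flux hK he hv
    obtain ⟨p, hp, rfl⟩ := hs.mem_edgesOf.1 he
    have := (h2 K c hs hc p hp A (h.isBoundedCoeff hK) v hv).2
    simp_rw [← ofReal_sq_eq_enorm] at this
    have hnn : 0 ≤ gradSq K v + fracSq s K v :=
      add_nonneg (gradSq_nonneg _ _) (fracSq_nonneg _ _ _)
    rwa [← ofReal_integral_sq hfl, ← hv.1.ofReal_gradSq, ← hv.ofReal_fracSq,
      ← ENNReal.ofReal_mul (size_nonneg K), ← ENNReal.ofReal_add (gradSq_nonneg _ _)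
        (fracSq_nonneg _ _ _), ← ENNReal.ofReal_mul h20.le, ENNReal.ofReal_le_ofReal_iff
        (mul_nonneg h20.le hnn)] at this
  · intro K hK v hv
    have hs := T.isSimplex hK
    obtain ⟨c, hc⟩ := h.ball K hK
    have := h3 K c hs hc v hv
    rwa [← hv.memH1.ofReal_gradSq, ← (hv.memHfrac hs hd (by linarith) hs1).ofReal_fracSq,
      ← ENNReal.ofReal_mul h30.le, ENNReal.ofReal_le_ofReal_iff
        (mul_nonneg h30.le (gradSq_nonneg _ _))] at this

/-- The assumptions on the penalty parameters. -/
def IsPenalty (T : Triangulation Ω) (η : Finset (Pt d) → ℝ) (ηmin : ℝ) : Prop :=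
  0 < ηmin ∧ ∀ e ∈ T.edges, ηmin ≤ η e

omit [DecidableEq (Pt d)] in
lemma IsPenalty.div_le (hη : IsPenalty T η ηmin) (hd : 2 ≤ d) (hK : K ∈ T.elements)
    (he : e ∈ edgesOf K) : 0 < size e ∧ 0 ≤ η e / size e ∧ ηmin / size K ≤ η e / size e := by
  have he' := Finset.mem_powersetCard.1 he
  have hse : 0 < size e := size_pos_of_one_lt_card (by omega)
  have hη1 := hη.2 e (T.edgesOf_subset (by omega) hK he)
  have hη0 := hη.1
  refine ⟨hse, div_nonneg (by linarith) hse.le, ?_⟩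
  exact div_le_div₀ (by linarith) hη1 hse (size_mono he'.1)

omit [DecidableEq (Pt d)] in
lemma IsPenalty.jumpSq_nonneg (hη : IsPenalty T η ηmin) (hd : 2 ≤ d) (hK : K ∈ T.elements)
    (w : HPair d) : 0 ≤ jumpSq η w K :=
  Finset.sum_nonneg fun _ he => integral_nonneg fun _ =>
    mul_nonneg (hη.div_le hd hK he).2.1 (sq_nonneg _)

/-- Products of fluxes and jumps. -/
lemma IsSetting.abs_sum_flux_hjump_le (h : IsSetting T Ω₁ Ω₂ A f gD gN u lmin lmax s κ)
    (hη : IsPenalty T η ηmin) (hK : K ∈ T.elements) (hz : IsRegularPair T s z)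
    (hw : IsRegularPair T s w) {M : ℝ} (hM : ∀ e ∈ edgesOf K,
      size K * ∫ x in hull e, flux A z.1 K e x ^ 2 ∂(surf d) ≤ M) {t : ℝ} (ht : 0 < t) :
    |∑ e ∈ edgesOf K, ∫ x in hull e, flux A z.1 K e x * hjump w K e x ∂(surf d)| ≤
      t * jumpSq η w K + (4 * (t * ηmin))⁻¹ * ((d + 1) * M) := by
  have hs := T.isSimplex hK
  have hsK := hs.size_pos h.one_le
  have hη0 := hη.1
  have key : ∀ e ∈ edgesOf K,
      |∫ x in hull e, flux A z.1 K e x * hjump w K e x ∂(surf d)| ≤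
        t * (∫ x in hull e, η e / size e * hjump w K e x ^ 2 ∂(surf d)) +
          (4 * (t * ηmin))⁻¹ * M := by
    intro e he
    have hfl := h.memLp_flux hK he (hz.memHfrac K hK)
    have hj := hw.memLp_hjump K hK e he
    -- This Young parameter converts the squared jump into `t` times the penalty term, as `ηmin /
    -- h_K ≤ η_e / h_e`. The complementary factor contains precisely the `size K` of the flux bound.
    have hτ : 0 < t * ηmin / size K := by positivity
    have h1 := abs_integral_le_of_abs_le_mul (φ := fun x => flux A z.1 K e x * hjump w K e x)
      (F := fun x => |flux A z.1 K e x|) (G := fun x => |hjump w K e x|)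
      (Eventually.of_forall fun x => (abs_mul _ _).le)
      (by simpa only [sq_abs] using hfl.integrable_sq)
      (by simpa only [sq_abs] using hj.integrable_sq) hτ
    simp only [sq_abs] at h1
    have h2 : 0 ≤ ∫ x in hull e, hjump w K e x ^ 2 ∂(surf d) := integral_nonneg fun _ => sq_nonneg _
    refine h1.trans (add_le_add ?_ ?_)
    · rw [integral_const_mul, mul_div_assoc, mul_assoc]
      exact mul_le_mul_of_nonneg_left (mul_le_mul_of_nonneg_right (hη.div_le h.dim hK he).2.2 h2)
        ht.le
    · have e1 : (4 * (t * ηmin / size K))⁻¹ = (4 * (t * ηmin))⁻¹ * size K := by field_simp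
      rw [e1, mul_assoc]
      exact mul_le_mul_of_nonneg_left (hM e he) (by positivity)
  refine (Finset.abs_sum_le_sum_abs _ _).trans ((Finset.sum_le_sum key).trans_eq ?_)
  rw [Finset.sum_add_distrib, ← Finset.mul_sum, Finset.sum_const, hs.card_edgesOf, nsmul_eq_mul,
    jumpSq]
  push_cast
  ring

omit [DecidableEq (Pt d)] in
lemma IsSetting.integral_form_ge (h : IsSetting T Ω₁ Ω₂ A f gD gN u lmin lmax s κ)
    (hK : K ∈ T.elements) (hw : MemH1 (elt K) v) :
    lmin * gradSq K v ≤
      ∫ x in elt K, inner ℝ (A x (weakGrad (elt K) v x)) (weakGrad (elt K) v x) := by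
  rw [gradSq, ← integral_const_mul]
  refine setIntegral_mono_on (hw.memLp_weakGrad.integrable_norm_pow'.const_mul _)
    (integrable_inner_of_memLp ((h.isBoundedCoeff hK).memLp_apply hw.memLp_weakGrad)
      hw.memLp_weakGrad) (isOpen_elt K).measurableSet fun x hx => ?_
  rw [real_inner_comm]
  exact h.coeff.lower x (h.elt_subset hK hx) _

omit [DecidableEq (Pt d)] in
lemma IsSetting.abs_integral_form_le (h : IsSetting T Ω₁ Ω₂ A f gD gN u lmin lmax s κ)
    (hK : K ∈ T.elements) {v' : Pt d → ℝ} (hv : MemH1 (elt K) v) (hv' : MemH1 (elt K) v')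
    {t : ℝ} (ht : 0 < t) :
    |∫ x in elt K, inner ℝ (A x (weakGrad (elt K) v x)) (weakGrad (elt K) v' x)| ≤
      t * gradSq K v' + (4 * t)⁻¹ * (lmax ^ 2 * gradSq K v) := by
  have h1 := abs_integral_le_of_abs_le_mul (μ := volume.restrict (elt K))
    (φ := fun x => inner ℝ (A x (weakGrad (elt K) v x)) (weakGrad (elt K) v' x))
    (F := fun x => lmax * ‖weakGrad (elt K) v x‖) (G := fun x => ‖weakGrad (elt K) v' x‖)
    ?_ ?_ hv'.memLp_weakGrad.integrable_norm_pow' ht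
  · simp_rw [mul_pow] at h1
    rwa [integral_const_mul] at h1
  · filter_upwards [ae_restrict_mem (isOpen_elt K).measurableSet] with x hx
    refine (abs_real_inner_le_norm _ _).trans (mul_le_mul_of_nonneg_right ?_ (norm_nonneg _))
    exact ((A x).le_opNorm _).trans (mul_le_mul_of_nonneg_right
      (h.coeff.norm_le h.lmin_pos h.lmax_pos (h.elt_subset hK hx)) (norm_nonneg _))
  · simp_rw [mul_pow]
    exact hv.memLp_weakGrad.integrable_norm_pow'.const_mul _

omit [DecidableEq (Pt d)] in
lemma IsSetting.abs_sum_penalty_le (h : IsSetting T Ω₁ Ω₂ A f gD gN u lmin lmax s κ)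
    (hη : IsPenalty T η ηmin) (hK : K ∈ T.elements) (hz : IsRegularPair T s z)
    (hw : IsRegularPair T s w) {t : ℝ} (ht : 0 < t) :
    |∑ e ∈ edgesOf K, ∫ x in hull e, η e / size e * hjump z K e x * hjump w K e x ∂(surf d)| ≤
      t * jumpSq η w K + (4 * t)⁻¹ * jumpSq η z K := by
  rw [jumpSq, jumpSq, Finset.mul_sum, Finset.mul_sum, ← Finset.sum_add_distrib]
  refine (Finset.abs_sum_le_sum_abs _ _).trans (Finset.sum_le_sum fun e he => ?_)
  have hj := hw.memLp_hjump K hK e he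
  have hj' := hz.memLp_hjump K hK e he
  have hnn := (hη.div_le h.dim hK he).2.1
  have h1 := abs_integral_le_of_abs_le_mul (φ := fun x => hjump z K e x * hjump w K e x)
    (F := fun x => |hjump z K e x|) (G := fun x => |hjump w K e x|)
    (Eventually.of_forall fun x => (abs_mul _ _).le)
    (by simpa only [sq_abs] using hj'.integrable_sq)
    (by simpa only [sq_abs] using hj.integrable_sq) ht
  simp only [sq_abs] at h1
  simp_rw [mul_assoc]
  rw [integral_const_mul, integral_const_mul, integral_const_mul, abs_mul, abs_of_nonneg hnn]
  refine (mul_le_mul_of_nonneg_left h1 hnn).trans_eq ?_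
  ring

/-- Coercivity on an element. -/
lemma IsSetting.localForm_ge (h : IsSetting T Ω₁ Ω₂ A f gD gN u lmin lmax s κ)
    (hη : IsPenalty T η ηmin) {C₁ C₂ C₃ : ℝ} (hC : HasFluxBounds T A s k C₁ C₂ C₃)
    (hηC : 4 * (d + 1) * C₁ / lmin ≤ ηmin) (hw : w ∈ discreteSpace T k l) (hK : K ∈ T.elements) :
    lmin / 2 * gradSq K w.1 + 1 / 2 * jumpSq η w K ≤ localForm A η w w K := by
  have hreg := h.isRegularPair_discrete hw
  have hmin := h.lmin_pos
  have h1 := h.integral_form_ge hK (hreg.memHfrac K hK).1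
  -- The flux term occurs twice in the form. With `t = 1/4` the two copies use up half of the jump
  -- term and, by the size of the penalty, half of `lmin * gradSq`.
  have h2 := (le_abs_self _).trans (h.abs_sum_flux_hjump_le hη hK hreg hreg
    (hC.poly K hK _ (hw.1 K hK)) (t := 1 / 4) (by norm_num))
  have h3 : (4 * (1 / 4 * ηmin))⁻¹ * ((d + 1) * (C₁ * gradSq K w.1)) ≤
      lmin / 4 * gradSq K w.1 := by
    have h4 : (4 * (1 / 4 * ηmin))⁻¹ * ((d + 1) * (C₁ * gradSq K w.1)) =
      ((d + 1) * C₁ / ηmin) * gradSq K w.1 := by field_simp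
    rw [h4]
    refine mul_le_mul_of_nonneg_right ?_ (gradSq_nonneg _ _)
    rw [div_le_iff₀ hη.1]
    rw [div_le_iff₀ hmin] at hηC
    linarith
  have h5 : ∑ e ∈ edgesOf K,
      ∫ x in hull e, η e / size e * hjump w K e x * hjump w K e x ∂(surf d) = jumpSq η w K :=
    Finset.sum_congr rfl fun e _ => integral_congr_ae (Eventually.of_forall fun x => by ring)
  rw [localForm, h5]
  linarith

/-- Continuity on an element. -/
lemma IsSetting.localForm_le (h : IsSetting T Ω₁ Ω₂ A f gD gN u lmin lmax s κ)
    (hη : IsPenalty T η ηmin) {C₁ C₂ C₃ : ℝ} (hC0 : 0 < C₁) (hC0' : 0 < C₂)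
    (hC : HasFluxBounds T A s k C₁ C₂ C₃)
    (hz : IsRegularPair T s z) (hw : w ∈ discreteSpace T k l) (hK : K ∈ T.elements) {t : ℝ}
    (ht : 0 < t) :
    localForm A η z w K ≤ 2 * t * (gradSq K w.1 + jumpSq η w K) +
      ((4 * t)⁻¹ * (lmax ^ 2 + 1) + (4 * (t * ηmin))⁻¹ * ((d + 1) * (C₁ + C₂))) *
        (gradSq K z.1 + fracSq s K z.1 + jumpSq η z K) := by
  have hreg := h.isRegularPair_discrete hw
  have hη0 := hη.1
  have hpos : 0 < (4 * (t * ηmin))⁻¹ * ((d + 1) * C₁) := by positivity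
  -- Chosen such that the flux of the discrete argument costs exactly `t * gradSq K w.1`; the
  -- remaining `τ * jumpSq η z K` goes to the other argument.
  set τ := (4 * (t * ηmin))⁻¹ * ((d + 1) * C₁) with hτ
  have h1 := (le_abs_self _).trans
    (h.abs_integral_form_le hK (hz.memHfrac K hK).1 (hreg.memHfrac K hK).1 ht)
  have h2 := (neg_le_abs _).trans (h.abs_sum_flux_hjump_le hη hK hz hreg
    (hC.smooth K hK _ (hz.memHfrac K hK)) ht)
  have h3 := (neg_le_abs _).trans (h.abs_sum_flux_hjump_le hη hK hreg hz
    (hC.poly K hK _ (hw.1 K hK)) hpos)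
  have h4 := (le_abs_self _).trans (h.abs_sum_penalty_le hη hK hz hreg ht)
  have e1 : (4 * (τ * ηmin))⁻¹ * ((d + 1) * (C₁ * gradSq K w.1)) = t * gradSq K w.1 := by
    rw [hτ]; field_simp
  rw [e1] at h3
  have ha := gradSq_nonneg K z.1
  have hb := fracSq_nonneg s K z.1
  have hj := hη.jumpSq_nonneg h.dim hK z
  have e2 : ((4 * t)⁻¹ * (lmax ^ 2 + 1) + (4 * (t * ηmin))⁻¹ * ((d + 1) * (C₁ + C₂))) =
      (4 * t)⁻¹ * lmax ^ 2 + (4 * t)⁻¹ + τ + (4 * (t * ηmin))⁻¹ * ((d + 1) * C₂) := by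
    rw [hτ]; ring
  have p1 : 0 ≤ (4 * t)⁻¹ * lmax ^ 2 := by positivity
  have p2 : 0 ≤ (4 * t)⁻¹ := by positivity
  have p3 : 0 ≤ (4 * (t * ηmin))⁻¹ * ((d + 1) * C₂) := by positivity
  rw [e2, localForm]
  have q1 := mul_nonneg p1 hb
  have q2 := mul_nonneg p1 hj
  have q3 := mul_nonneg p2 ha
  have q4 := mul_nonneg p2 hb
  have q5 := mul_nonneg hpos.le ha
  have q6 := mul_nonneg hpos.le hb
  have q7 := mul_nonneg p3 hj
  clear_value τ
  generalize (4 * t)⁻¹ = r at *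
  generalize (4 * (t * ηmin))⁻¹ = r' at *
  linarith

/-! ### The mesh-dependent norm and quasi-optimality -/

/-- The square of `‖·‖_{1+s,h}`. -/
def energy {Ω : Set (Pt d)} (T : Triangulation Ω) (η : Finset (Pt d) → ℝ) (s : ℝ) (w : HPair d) :
    ℝ :=
  ∑ K ∈ T.elements, (gradSq K w.1 + fracSq s K w.1 + jumpSq η w K)

omit [DecidableEq (Pt d)] in
lemma IsPenalty.hdgNorm_eq (hη : IsPenalty T η ηmin) (hd : 2 ≤ d) (hw : IsRegularPair T s w) :
    hdgNorm T η s w = ENNReal.ofReal (energy T η s w) ^ (1 / 2 : ℝ) := by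
  have e1 : ∀ K ∈ T.elements, ENNReal.ofReal (jumpSq η w K) =
      ∑ e ∈ edgesOf K, ENNReal.ofReal (η e / size e) *
        ∫⁻ x in hull e, ENNReal.ofReal (hjump w K e x ^ 2) ∂(surf d) := by
    intro K hK
    rw [jumpSq, ENNReal.ofReal_sum_of_nonneg fun e he => integral_nonneg fun _ =>
      mul_nonneg (hη.div_le hd hK he).2.1 (sq_nonneg _)]
    refine Finset.sum_congr rfl fun e he => ?_
    rw [integral_const_mul, ENNReal.ofReal_mul (hη.div_le hd hK he).2.1,
      ofReal_integral_sq (hw.memLp_hjump K hK e he)]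
  rw [hdgNorm, energy, ENNReal.ofReal_sum_of_nonneg fun _ hK => add_nonneg
    (add_nonneg (gradSq_nonneg _ _) (fracSq_nonneg _ _ _)) (hη.jumpSq_nonneg hd hK w),
    ← Finset.sum_add_distrib, ← Finset.sum_add_distrib]
  congr 1
  refine Finset.sum_congr rfl fun K hK => ?_
  rw [ENNReal.ofReal_add (add_nonneg (gradSq_nonneg _ _) (fracSq_nonneg _ _ _))
    (hη.jumpSq_nonneg hd hK w), ENNReal.ofReal_add (gradSq_nonneg _ _) (fracSq_nonneg _ _ _),
    (hw.memHfrac K hK).1.ofReal_gradSq, (hw.memHfrac K hK).ofReal_fracSq, e1 K hK]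

omit [DecidableEq (Pt d)] in
lemma le_of_ofReal_le_two_mul_add {a b c : ℝ} (hb : 0 ≤ b) (hc : 0 ≤ c)
    (h : ENNReal.ofReal a ≤ 2 * ENNReal.ofReal b + 2 * ENNReal.ofReal c) : a ≤ 2 * b + 2 * c := by
  have e : (2 : ℝ≥0∞) = ENNReal.ofReal 2 := by simp
  rwa [e, ← ENNReal.ofReal_mul (by norm_num), ← ENNReal.ofReal_mul (by norm_num),
    ← ENNReal.ofReal_add (by positivity) (by positivity),
    ENNReal.ofReal_le_ofReal_iff (by positivity)] at h

lemma IsSetting.energy_sub_le (h : IsSetting T Ω₁ Ω₂ A f gD gN u lmin lmax s κ)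
    (hη : IsPenalty T η ηmin) (hw : IsRegularPair T s w) (hz : IsRegularPair T s z) :
    energy T η s (w - z) ≤ 2 * energy T η s w + 2 * energy T η s z := by
  rw [energy, energy, energy, Finset.mul_sum, Finset.mul_sum, ← Finset.sum_add_distrib]
  refine Finset.sum_le_sum fun K hK => ?_
  have hw' := hw.memHfrac K hK
  have hz' := hz.memHfrac K hK
  have h1 : gradSq K (w - z).1 ≤ 2 * gradSq K w.1 + 2 * gradSq K z.1 := by
    refine le_of_ofReal_le_two_mul_add (gradSq_nonneg _ _) (gradSq_nonneg _ _) ?_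
    rw [Prod.fst_sub, (hw'.1.sub hz'.1).ofReal_gradSq, hw'.1.ofReal_gradSq, hz'.1.ofReal_gradSq]
    exact h1SemiSq_sub_le (isOpen_elt K) hw'.1 hz'.1
  have h2 : fracSq s K (w - z).1 ≤ 2 * fracSq s K w.1 + 2 * fracSq s K z.1 := by
    refine le_of_ofReal_le_two_mul_add (fracSq_nonneg _ _ _) (fracSq_nonneg _ _ _) ?_
    rw [Prod.fst_sub, (hw'.sub (isOpen_elt K) hz').ofReal_fracSq, hw'.ofReal_fracSq,
      hz'.ofReal_fracSq, mul_left_comm, mul_left_comm 2, ← mul_add]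
    exact mul_le_mul' le_rfl (fracSemiSq_sub_le (isOpen_elt K) hw' hz')
  have h3 : jumpSq η (w - z) K ≤ 2 * jumpSq η w K + 2 * jumpSq η z K := by
    rw [jumpSq, jumpSq, jumpSq, Finset.mul_sum, Finset.mul_sum, ← Finset.sum_add_distrib]
    refine Finset.sum_le_sum fun e he => ?_
    have j1 := (hw.memLp_hjump K hK e he).integrable_sq
    have j2 := (hz.memLp_hjump K hK e he).integrable_sq
    rw [integral_const_mul, integral_const_mul, integral_const_mul, mul_left_comm,
      mul_left_comm (2 : ℝ), ← mul_add]
    refine mul_le_mul_of_nonneg_left ?_ (hη.div_le h.dim hK he).2.1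
    rw [← integral_const_mul, ← integral_const_mul,
      ← integral_add (j1.const_mul _) (j2.const_mul _)]
    refine integral_mono_ae ((hw.sub h hz).memLp_hjump K hK e he).integrable_sq
      ((j1.const_mul _).add (j2.const_mul _)) ?_
    filter_upwards [h.hjump_sub hw hz hK he] with x hx
    simp only [hx, Pi.sub_apply]
    nlinarith [sq_nonneg (hjump w K e x + hjump z K e x)]
  linarith

omit [DecidableEq (Pt d)] in
lemma IsPolyAE.sub {μ : Measure (Pt d)} {v v' : Pt d → ℝ} (hv : IsPolyAE μ k v)
    (hv' : IsPolyAE μ k v') : IsPolyAE μ k (v - v') := by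
  obtain ⟨P, hP, hv⟩ := hv
  obtain ⟨Q, hQ, hv'⟩ := hv'
  refine ⟨P - Q, (MvPolynomial.totalDegree_sub P Q).trans (max_le hP hQ), ?_⟩
  filter_upwards [hv, hv'] with x h1 h2
  simp [h1, h2]

omit [DecidableEq (Pt d)] in
lemma sub_mem_discreteSpace (hw : w ∈ discreteSpace T k l) (hz : z ∈ discreteSpace T k l) :
    w - z ∈ discreteSpace T k l := by
  refine ⟨fun K hK => (hw.1 K hK).sub (hz.1 K hK), fun e he => (hw.2.1 e he).sub (hz.2.1 e he),
    fun e he hf => ?_⟩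
  filter_upwards [hw.2.2 e he hf, hz.2.2 e he hf] with x h1 h2
  simp [h1, h2]

/-- Quasi-optimality, for the squared norms. -/
theorem IsSetting.energy_le (h : IsSetting T Ω₁ Ω₂ A f gD gN u lmin lmax s κ)
    (hη : IsPenalty T η ηmin) {C₁ C₂ C₃ c₀ : ℝ} (hC0 : 0 < C₁) (hC0' : 0 < C₂) (hC0'' : 0 < C₃)
    (hC : HasFluxBounds T A s k C₁ C₂ C₃) (hηC : 4 * (d + 1) * C₁ / lmin ≤ ηmin)
    (hc₀ : 0 < c₀) (hc₁ : c₀ ≤ lmin / 2) (hc₂ : c₀ ≤ 1 / 2) {uh vh : HPair d}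
    (huh : IsHDGSolution T Ω₁ Ω₂ k l A f gD gN η uh) (hvh : vh ∈ discreteSpace T k l) :
    energy T η s ((u, hatTrace T u) - uh) ≤ (2 + 4 * (1 + C₃) * (((4 * (c₀ / 4))⁻¹ * (lmax ^ 2 + 1) +
      (4 * (c₀ / 4 * ηmin))⁻¹ * ((d + 1) * (C₁ + C₂))) / c₀)) *
        energy T η s ((u, hatTrace T u) - vh) := by
  set U : HPair d := (u, hatTrace T u)
  set M := (4 * (c₀ / 4))⁻¹ * (lmax ^ 2 + 1) +
      (4 * (c₀ / 4 * ηmin))⁻¹ * ((d + 1) * (C₁ + C₂)) with hM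
  have hw : uh - vh ∈ discreteSpace T k l := sub_mem_discreteSpace huh.1 hvh
  set w := uh - vh
  have hwr := h.isRegularPair_discrete hw
  have hz : IsRegularPair T s (U - vh) :=
    h.isRegularPair_solution.sub h (h.isRegularPair_discrete hvh)
  set z := U - vh
  have hzw : U - uh = z - w := (sub_sub_sub_cancel_right U uh vh).symm
  have hgal := h.galerkin huh hw
  have hsub : Bh T A η (z - w) w = 0 := by rw [← hzw]; exact hgal
  rw [h.bh_sub_left hz hwr hwr, sub_eq_zero] at hsub
  set D := ∑ K ∈ T.elements, (gradSq K w.1 + jumpSq η w K) with hD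
  have h1 : c₀ * D ≤ Bh T A η w w := by
    rw [bh_eq_sum_localForm, hD, Finset.mul_sum]
    refine Finset.sum_le_sum fun K hK => le_trans ?_ (h.localForm_ge hη hC hηC hw hK)
    have a1 := mul_le_mul_of_nonneg_right hc₁ (gradSq_nonneg K w.1)
    have a2 := mul_le_mul_of_nonneg_right hc₂ (hη.jumpSq_nonneg h.dim hK w)
    linarith
  -- Continuity with `t = c₀ / 4`: the term in `D` is half of the coercivity bound and is absorbed,
  -- which is why the next estimate has a factor `2`.
  have h2 : Bh T A η z w ≤ 2 * (c₀ / 4) * D + M * energy T η s z := by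
    rw [bh_eq_sum_localForm, hD, energy, Finset.mul_sum, Finset.mul_sum, ← Finset.sum_add_distrib]
    exact Finset.sum_le_sum fun K hK =>
      h.localForm_le hη hC0 hC0' hC hz hw hK (by positivity)
  have h3 : D ≤ 2 * (M / c₀) * energy T η s z := by
    rw [hsub] at h2
    have : c₀ * D ≤ 2 * M * energy T η s z := by linarith
    rw [← mul_le_mul_iff_right₀ hc₀]
    refine this.trans_eq ?_
    field_simp
  -- Coercivity does not see the fractional seminorm; for the discrete `w` the inverse inequality
  -- recovers it from the gradient.
  have h4 : energy T η s w ≤ (1 + C₃) * D := by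
    rw [energy, hD, Finset.mul_sum]
    refine Finset.sum_le_sum fun K hK => ?_
    have a1 := hC.frac K hK _ (hw.1 K hK)
    have a2 := mul_nonneg hC0''.le (hη.jumpSq_nonneg h.dim hK w)
    linarith
  have h5 := h.energy_sub_le hη hz hwr
  have h6 : (1 + C₃) * D ≤ (1 + C₃) * (2 * (M / c₀) * energy T η s z) :=
    mul_le_mul_of_nonneg_left h3 (by positivity)
  rw [hzw]
  linarith

omit [DecidableEq (Pt d)] in
lemma le_mul_biInf {F : HPair d → ℝ≥0∞} {a : ℝ≥0∞} {c : ℝ} (hc : 0 < c)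
    {S : Set (HPair d)} (h : ∀ v ∈ S, a ≤ ENNReal.ofReal c * F v) :
    a ≤ ENNReal.ofReal c * ⨅ v ∈ S, F v := by
  have hc' : ENNReal.ofReal c ≠ 0 := by simpa using hc
  rw [mul_comm, ← ENNReal.div_le_iff hc' ENNReal.ofReal_ne_top]
  refine le_iInf₂ fun v hv => ?_
  rw [ENNReal.div_le_iff hc' ENNReal.ofReal_ne_top, mul_comm]
  exact h v hv

end

end HDG

end

/-! ### Choice of the constants -/

theorem theorem1 (d : ℕ) (hd : d = 2 ∨ d = 3) (k : ℕ) (hk : 1 ≤ k) (ν₁ lmin lmax : ℝ)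
    (hlmin : 0 < lmin) (hlmax : 0 < lmax) :
    ∃ ηstar : ℝ, 0 < ηstar ∧
      ∀ ηmin : ℝ, 0 < ηmin → ∀ s : ℝ, 1 / 2 < s → s ≤ 1 →
        ∃ C : ℝ, 0 < C ∧
          ∀ (Ω Ω₁ Ω₂ : Set (HDG.Pt d)) (A : HDG.Pt d → HDG.Pt d →L[ℝ] HDG.Pt d)
            (f gD gN u : HDG.Pt d → ℝ) (T : HDG.Triangulation Ω)
            (η : Finset (HDG.Pt d) → ℝ) (l : ℕ) (uh : HDG.HPair d),
            HDG.IsInterfaceGeometry Ω Ω₁ Ω₂ →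
            HDG.IsCoefficient Ω Ω₁ Ω₂ lmin lmax A →
            MemLp f 2 (volume.restrict Ω) →
            MemLp gD 2 ((HDG.surf d).restrict (HDG.interface Ω₁ Ω₂)) →
            MemLp gN 2 ((HDG.surf d).restrict (HDG.interface Ω₁ Ω₂)) →
            HDG.IsWeakSolution Ω Ω₁ Ω₂ A f gD gN u →
            HDG.MemHfrac Ω₁ s u → HDG.MemHfrac Ω₂ s u →
            T.ShapeRegular ν₁ → T.FitsInterface Ω₁ Ω₂ →
            (∀ e ∈ T.edges, ηmin ≤ η e) →
            1 ≤ l →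
            HDG.IsHDGSolution T Ω₁ Ω₂ k l A f gD gN η uh →
            (∀ vh ∈ HDG.discreteSpace T k l,
              HDG.Bh T A η ((u, HDG.hatTrace T u) - uh) vh = 0) ∧
            (ηstar ≤ ηmin →
              HDG.hdgNorm T η s ((u, HDG.hatTrace T u) - uh) < ⊤ ∧
              HDG.hdgNorm T η s ((u, HDG.hatTrace T u) - uh) ≤
                ENNReal.ofReal C * ⨅ vh ∈ HDG.discreteSpace T k l,
                  HDG.hdgNorm T η s ((u, HDG.hatTrace T u) - vh)) := by
  classical
  have hd2 : 2 ≤ d := by omega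
  -- The maximum keeps the radius factor `(4 * ν ^ 2)⁻¹` positive for every real `ν₁`; shape
  -- regularity with `ν₁` implies it with `ν`.
  set ν := max ν₁ 1
  have hν : 0 < ν := lt_max_of_lt_right one_pos
  have hκ : 0 < (4 * ν ^ 2)⁻¹ := by positivity
  obtain ⟨C₁, h1, hC₁⟩ := HDG.exists_hasFluxBounds hd2 k hκ hlmax
  refine ⟨4 * (d + 1) * C₁ / lmin, by positivity, fun ηmin hηmin s hs0 hs1 => ?_⟩
  obtain ⟨C₂, C₃, h2, h3, hC⟩ := hC₁ s hs0 hs1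
  set c₀ := min (lmin / 2) (1 / 2) with hc₀
  have hc : 0 < c₀ := lt_min (by positivity) (by norm_num)
  set M := 2 + 4 * (1 + C₃) * (((4 * (c₀ / 4))⁻¹ * (lmax ^ 2 + 1) +
    (4 * (c₀ / 4 * ηmin))⁻¹ * ((d + 1) * (C₁ + C₂))) / c₀) with hM
  have hM0 : 0 < M := by positivity
  -- `M` bounds the ratio of the squared norms.
  refine ⟨√M, Real.sqrt_pos.2 hM0, ?_⟩
  intro Ω Ω₁ Ω₂ A f gD gN u T η l uh hgeo hA hf _ hgN hu hu1 hu2 hT hfit hη _ huh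
  have h : HDG.IsSetting T Ω₁ Ω₂ A f gD gN u lmin lmax s (4 * ν ^ 2)⁻¹ :=
    ⟨hd2, hgeo, hA, hlmin, hlmax, hf, hgN, hu, hu1, hu2, hs0, hs1, hfit, hκ, fun K hK =>
      ((T.isSimplex hK).exists_closedBall_subset hd2 fun e he =>
        (hT K hK e he).trans (le_max_left _ _)).2⟩
  have hpen : HDG.IsPenalty T η ηmin := ⟨hηmin, hη⟩
  have hUr := h.isRegularPair_solution
  refine ⟨fun vh hvh => h.galerkin huh hvh, fun hηstar => ⟨?_, ?_⟩⟩
  · rw [hpen.hdgNorm_eq hd2 (hUr.sub h (h.isRegularPair_discrete huh.1))]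
    exact ENNReal.rpow_lt_top_of_nonneg (by norm_num) ENNReal.ofReal_ne_top
  · refine HDG.le_mul_biInf (Real.sqrt_pos.2 hM0) fun vh hvh => ?_
    rw [hpen.hdgNorm_eq hd2 (hUr.sub h (h.isRegularPair_discrete huh.1)),
      hpen.hdgNorm_eq hd2 (hUr.sub h (h.isRegularPair_discrete hvh)), Real.sqrt_eq_rpow,
      ← ENNReal.ofReal_rpow_of_pos hM0, ← ENNReal.mul_rpow_of_nonneg _ _ (by norm_num),
      ← ENNReal.ofReal_mul hM0.le]
    refine ENNReal.rpow_le_rpow (ENNReal.ofReal_le_ofReal ?_) (by norm_num)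
    exact h.energy_le hpen h1 h2 h3 (hC Ω Ω₁ Ω₂ T A f gD gN u lmin h) hηstar hc
      (min_le_left _ _) (min_le_right _ _) huh hvh
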